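/- **Setting.** Let $K$ be a strongly invertible knot with an intravergent diagram: a knot diagram in the plane with $N=2\overline N+1$ crossings that is invariant under the rotation $\tau$ by $180^\circ$ around one of its crossings (the *central* crossing, which lies on the axis). Fix any orientation of $K$ and let $N_-$ be its number of negative crossings. The $0$- and $1$-resolutions of the central crossing are invariant under $\tau$, and their quotients by $\tau$ are annular knot diagrams $\overline K_0$, $\overline K_1$ with the same $\overline N$ crossings, which differ by moving one point across the axis. Fix any orientation of the quotient knot, let $\overline N_-$ be its number of negative crossings, and put $\Delta=N_--2\overline N_-$. For a finite set $S$, let $(1\to0)^S$ be the poset category $\{0,1\}^S$ with one morphism $v\to w$ whenever $v\ge w$, and let $\mathscr B$ be the Burnside 2-category (finite sets, finite correspondences $A\xleftarrow{s}X\xrightarrow{t}B$ composed by fibre product, bijections of correspondences). Isomorphisms of 2-functors to $\mathscr B$ consist of bijections of the sets and of the correspondences, compatible with $s$, $t$ and the composition 2-morphisms. **Khovanov Burnside functor.** A Khovanov generator at $v\in\{0,1\}^N$ is a labelling by $1$ or $X$ of the circles of the complete resolution at $v$; its quantum grading is $N-3N_-+|v|+\#\{X\}-\#\{1\}$. $F^{\mathscr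 B}_j(K)\colon(1\to0)^N\to\mathscr B$ sends $v$ to the set of generators at $v$ of quantum grading $j$. For an edge $v\to w$ the set $s^{-1}(x)\cap t^{-1}(y)$ has one element if $y$ occurs in the image of $x$ under the saddle map of the Frobenius algebra $\mathbb Z[X]/(X^2)$ ($1\mapsto 1\otimes X+X\otimes 1$, $X\mapsto X\otimes X$) and is empty otherwise. The 2-morphism of a 2-dimensional face is the unique possible one, except for ladybug faces, where it is the ladybug matching (made with the right pair). For general $v\ge w$ the correspondence is the composite along any sequence of edges, composites along different sequences being identified by the 2-morphisms of the faces. The rotation $\tau$ acts on crossings, generators and correspondences. The fixed point functor $(F^{\mathscr B}_j(K))^\tau$ consists of the $\tau$-fixed elements of the sets and correspondences over the $\tau$-fixed subcategory of the cube, which is identified with $(1\to0)^{\overline N+1}$, one direction for each $\tau$-orbit of crossings; the last direction is that of the central crossing. **Annular Burnside functor of the pair.** For a labelled resolution of an annular diagram, the annular grading is the winding number around the axis, with circles labelled $1$ oriented counterclockwise and circles labelled $X$ clockwise. $\mathit{AF}^{\mathscr B}_{\overline\jmath,k}(\overline K_1,\overline K_0)\colon(1\to 0)^{\overline N+1}\to\mathscr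 B$ sends $v=(v_1,\dots,v_{\overline N+1})$ to the set of Khovanov generators of $\overline K_{v_{\overline N+1}}$ over $(v_1,\dots,v_{\overline N})$ of quantum grading $\overline\jmath$ (computed with $\overline N$, $\overline N_-$ and $|(v_1,\dots,v_{\overline N})|$) and annular grading $k-v_{\overline N+1}$. In the first $\overline N$ directions, $s^{-1}(x)\cap t^{-1}(y)$ has one element if $y$ occurs in the image of $x$ under the saddle map and $x$, $y$ have the same annular grading, and is empty otherwise. In the last direction the same holds with the saddle map replaced by the axis-moving map $f^+$, which adds an essential circle labelled $1$ next to the axis and merges it, by the (winding number preserving) annular merge map, into the circle through the moving point. The 2-morphisms of faces are the unique possible ones, or the ladybug matching for ladybugs, and general correspondences are composites along sequences of edges, as before. **Lemma 4.2.** For every integer $j$, $F^{\mathscr B}_j(K)$ is a 2-functor $(1\to 0)^N\to\mathscr B$ and all $\mathit{AF}^{\mathscr B}_{\overline\jmath,k}(\overline K_1,\overline K_0)$ are 2-functors $(1\to0)^{\overline N+1}\to\mathscr B$ (in particular, the composition maps of correspondences are bijections), and the fixed point functor is isomorphic, as a 2-functor from $(1\to0)^{\overline N+1}$ to $\mathscr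 B$, to a disjoint union of annular Burnside functors: $$(F^{\mathscr B}_j(K))^\tau\;\cong\coprod_{\substack{\overline\jmath,k\in\mathbb Z\\ 2\overline\jmath+k=j-1+3\Delta}}\mathit{AF}^{\mathscr B}_{\overline\jmath,k}(\overline K_1,\overline K_0).$$ -/

import Mathlib

namespace Khovanov

/-! ### Two-functors from a poset to the Burnside 2-category

The Burnside 2-category has finite sets as objects, finite correspondences `A ← X → B` as
1-morphisms (composed by fibre products) and bijections of correspondences as 2-morphisms.
A correspondence is presented by its fibres `X(a, b) = s⁻¹(a) ∩ t⁻¹(b)`. -/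

/-- The data of a functor `F` from a poset `P` (one morphism `v → w` whenever `w ≤ v`) to the
Burnside 2-category: `F(v)` is the fibre of `vert` over `v`, the correspondence `F(v → w)` has
the fibres `Hom x y` for `x ∈ F(v)`, `y ∈ F(w)`, and `comp` gives the comparison maps
`F(v → w) ∘ F(u → v) → F(u → w)`. That the comparison maps are bijections, that everything is
finite and that `F(v → v)` is the identity correspondence is `IsTwoFunctor` below. -/
structure BurnsideDiagram (P : Type) [PartialOrder P] where
  Gen : Type
  vert : Gen → P
  Hom : Gen → Gen → Type
  le_of_hom : ∀ {x y : Gen}, Hom x y → vert y ≤ vert x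
  id : ∀ x : Gen, Hom x x
  comp : ∀ {x y z : Gen}, Hom x y → Hom y z → Hom x z
  id_comp : ∀ {x y : Gen} (f : Hom x y), comp (id x) f = f
  comp_id : ∀ {x y : Gen} (f : Hom x y), comp f (id y) = f
  assoc : ∀ {x y z w : Gen} (f : Hom x y) (g : Hom y z) (h : Hom z w),
    comp (comp f g) h = comp f (comp g h)

namespace BurnsideDiagram

variable {P : Type} [PartialOrder P]

/-- An element of one of the correspondences, together with its source and its target. -/
def Arrow (F : BurnsideDiagram P) : Type := Σ x : F.Gen, Σ y : F.Gen, F.Hom x y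

def arrow (F : BurnsideDiagram P) {x y : F.Gen} (f : F.Hom x y) : F.Arrow := ⟨x, y, f⟩

/-- The data form a (strictly unitary) 2-functor to the Burnside 2-category: the sets and the
correspondences are finite, `F(v → v)` is the identity correspondence, and for `w ≤ v ≤ u` the
comparison map `F(v → w) ∘ F(u → v) → F(u → w)` is a bijection. -/
def IsTwoFunctor (F : BurnsideDiagram P) : Prop :=
  (∀ v : P, Finite {x : F.Gen // F.vert x = v}) ∧
  (∀ x y : F.Gen, Finite (F.Hom x y)) ∧
  (∀ (x y : F.Gen) (f : F.Hom x y), F.vert x = F.vert y → F.arrow f = F.arrow (F.id x)) ∧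
  (∀ (x z : F.Gen) (f : F.Hom x z) (v : P), F.vert z ≤ v → v ≤ F.vert x →
    ∃! p : (Σ y : {y : F.Gen // F.vert y = v}, F.Hom x y.1 × F.Hom y.1 z),
      F.comp p.2.1 p.2.2 = f)

/-- An isomorphism of functors to the Burnside 2-category: bijections of the sets and of the
correspondences, compatible with sources, targets, identities and the composition 2-morphisms. -/
structure Iso (F G : BurnsideDiagram P) where
  gen : F.Gen ≃ G.Gen
  vert_gen : ∀ x : F.Gen, G.vert (gen x) = F.vert x
  hom : ∀ {x y : F.Gen}, F.Hom x y ≃ G.Hom (gen x) (gen y)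
  hom_id : ∀ x : F.Gen, hom (F.id x) = G.id (gen x)
  hom_comp : ∀ {x y z : F.Gen} (f : F.Hom x y) (g : F.Hom y z),
    hom (F.comp f g) = G.comp (hom f) (hom g)

/-- An external `ℤ/2`-action on `F` covering the action of the involution `t` on `P`. -/
structure ExternalInvolution (F : BurnsideDiagram P) (t : P ≃o P) where
  gen : F.Gen → F.Gen
  gen_gen : ∀ x : F.Gen, gen (gen x) = x
  vert_gen : ∀ x : F.Gen, F.vert (gen x) = t (F.vert x)
  hom : ∀ {x y : F.Gen}, F.Hom x y → F.Hom (gen x) (gen y)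
  hom_hom : ∀ {x y : F.Gen} (f : F.Hom x y), F.arrow (hom (hom f)) = F.arrow f
  hom_id : ∀ x : F.Gen, hom (F.id x) = F.id (gen x)
  hom_comp : ∀ {x y z : F.Gen} (f : F.Hom x y) (g : F.Hom y z),
    hom (F.comp f g) = F.comp (hom f) (hom g)

theorem arrow_comp_eq (F : BurnsideDiagram P) {x y z x' y' z' : F.Gen}
    {f : F.Hom x y} {g : F.Hom y z} {f' : F.Hom x' y'} {g' : F.Hom y' z'}
    (hf : F.arrow f' = F.arrow f) (hg : F.arrow g' = F.arrow g) :
    F.arrow (F.comp f' g') = F.arrow (F.comp f g) := by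
  unfold arrow at *
  cases hf
  cases hg
  rfl

theorem arrow_id_eq (F : BurnsideDiagram P) {x x' : F.Gen} (h : x' = x) :
    F.arrow (F.id x') = F.arrow (F.id x) := by
  subst h
  rfl

/-- The fixed point functor: it is defined on the fixed subposet and consists of the fixed
elements of the sets and of the correspondences. -/
def ExternalInvolution.fixed {F : BurnsideDiagram P} {t : P ≃o P}
    (T : F.ExternalInvolution t) : BurnsideDiagram {v : P // t v = v} where
  Gen := {x : F.Gen // T.gen x = x}
  vert x := ⟨F.vert x.1, by rw [← T.vert_gen, x.2]⟩
  Hom x y := {f : F.Hom x.1 y.1 // F.arrow (T.hom f) = F.arrow f}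
  le_of_hom f := F.le_of_hom f.1
  id x := ⟨F.id x.1, by rw [T.hom_id]; exact F.arrow_id_eq x.2⟩
  comp f g := ⟨F.comp f.1 g.1, by rw [T.hom_comp]; exact F.arrow_comp_eq f.2 g.2⟩
  id_comp f := Subtype.ext (F.id_comp f.1)
  comp_id f := Subtype.ext (F.comp_id f.1)
  assoc f g h := Subtype.ext (F.assoc f.1 g.1 h.1)

/-- Transport of a functor along an isomorphism of posets. -/
def reindex {Q : Type} [PartialOrder Q] (F : BurnsideDiagram P) (e : P ≃o Q) :
    BurnsideDiagram Q where
  Gen := F.Gen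
  vert x := e (F.vert x)
  Hom := F.Hom
  le_of_hom f := e.monotone (F.le_of_hom f)
  id := F.id
  comp := F.comp
  id_comp := F.id_comp
  comp_id := F.comp_id
  assoc := F.assoc

/-- The correspondences of a disjoint union. -/
inductive CoprodHom {I : Type} (F : I → BurnsideDiagram P) :
    (Σ i, (F i).Gen) → (Σ i, (F i).Gen) → Type
  | mk {i : I} {x y : (F i).Gen} (f : (F i).Hom x y) : CoprodHom F ⟨i, x⟩ ⟨i, y⟩

def CoprodHom.comp {I : Type} {F : I → BurnsideDiagram P} :
    ∀ {x y z : Σ i, (F i).Gen}, CoprodHom F x y → CoprodHom F y z → CoprodHom F x z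
  | _, _, _, .mk f, .mk g => .mk ((F _).comp f g)

/-- The disjoint union of functors: disjoint unions of the sets and of the correspondences. -/
def coprod {I : Type} (F : I → BurnsideDiagram P) : BurnsideDiagram P where
  Gen := Σ i, (F i).Gen
  vert x := (F x.1).vert x.2
  Hom := CoprodHom F
  le_of_hom := by rintro _ _ ⟨f⟩; exact (F _).le_of_hom f
  id x := .mk ((F x.1).id x.2)
  comp := CoprodHom.comp
  id_comp := by rintro _ _ ⟨f⟩; exact congrArg CoprodHom.mk ((F _).id_comp f)
  comp_id := by rintro _ _ ⟨f⟩; exact congrArg CoprodHom.mk ((F _).comp_id f)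
  assoc := by rintro _ _ _ _ ⟨f⟩ ⟨g⟩ ⟨h⟩; exact congrArg CoprodHom.mk ((F _).assoc f g h)

end BurnsideDiagram

/-! ### Cube-shaped functors given by vertices, edges and 2-dimensional faces -/

/-- Vertices, edges and faces of a functor `(1 → 0)^ι → 𝓑`, all of whose edge correspondences have
fibres with at most one element: `Step i x y` says that `s⁻¹(x) ∩ t⁻¹(y)` is non-empty for the edge
from `vert x` to `vert y` in direction `i`, and `Face i j x y y' z` says that the 2-morphism of the
face in the directions `i`, `j` takes `x → y → z` (first `i`, then `j`) to `x → y' → z` (first `j`,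
then `i`). -/
structure CubeData (ι : Type) where
  Gen : Type
  vert : Gen → ι → Bool
  Step : ι → Gen → Gen → Prop
  vert_of_step : ∀ {i : ι} {x y : Gen}, Step i x y →
    vert x i = true ∧ vert y i = false ∧ ∀ k, k ≠ i → vert y k = vert x k
  Face : ι → ι → Gen → Gen → Gen → Gen → Prop

namespace CubeData

variable {ι : Type} (A : CubeData ι)

/-- Elements of the composite of the edge correspondences along a sequence of edges. -/
inductive Path : A.Gen → A.Gen → Type
  | nil (x : A.Gen) : Path x x
  | cons {x y z : A.Gen} (i : ι) (h : A.Step i x y) (p : Path y z) : Path x z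

variable {A}

def Path.append : ∀ {x y z : A.Gen}, A.Path x y → A.Path y z → A.Path x z
  | _, _, _, .nil _, q => q
  | _, _, _, .cons i h p, q => .cons i h (p.append q)

/-- Two elements of composites along sequences of edges are related if one 2-dimensional face
takes one to the other. -/
inductive FaceRel : ∀ {x y : A.Gen}, A.Path x y → A.Path x y → Prop
  | face {x y y' z w : A.Gen} {i j : ι} (h₁ : A.Step i x y) (h₂ : A.Step j y z)
      (k₁ : A.Step j x y') (k₂ : A.Step i y' z) (hf : A.Face i j x y y' z) (p : A.Path z w) :
      FaceRel (.cons i h₁ (.cons j h₂ p)) (.cons j k₁ (.cons i k₂ p))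
  | cons {x y z : A.Gen} {i : ι} (h : A.Step i x y) {p q : A.Path y z} (hpq : FaceRel p q) :
      FaceRel (.cons i h p) (.cons i h q)

theorem FaceRel.append_right {x y z : A.Gen} {p p' : A.Path x y} (h : FaceRel p p')
    (q : A.Path y z) : FaceRel (p.append q) (p'.append q) := by
  induction h with
  | face h₁ h₂ k₁ k₂ hf p => exact FaceRel.face h₁ h₂ k₁ k₂ hf (p.append q)
  | cons h _ ih => exact FaceRel.cons h (ih q)

theorem FaceRel.append_left {x y z : A.Gen} (p : A.Path x y) {q q' : A.Path y z}
    (h : FaceRel q q') : FaceRel (p.append q) (p.append q') := by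
  induction p with
  | nil => exact h
  | cons i k p ih => exact FaceRel.cons k (ih h)

theorem Path.append_nil {x y : A.Gen} (p : A.Path x y) : p.append (.nil y) = p := by
  induction p with
  | nil => rfl
  | cons i h p ih => exact congrArg (Path.cons i h) ih

theorem Path.append_assoc {x y z w : A.Gen} (p : A.Path x y) (q : A.Path y z) (r : A.Path z w) :
    (p.append q).append r = p.append (q.append r) := by
  induction p with
  | nil => rfl
  | cons i h p ih => exact congrArg (Path.cons i h) (ih q)

theorem vert_le_of_step {i : ι} {x y : A.Gen} (h : A.Step i x y) : A.vert y ≤ A.vert x := by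
  obtain ⟨_, h₂, h₃⟩ := A.vert_of_step h
  intro k
  by_cases hk : k = i
  · subst hk; rw [h₂]; exact Bool.false_le _
  · rw [h₃ k hk]

theorem Path.vert_le {x y : A.Gen} (p : A.Path x y) : A.vert y ≤ A.vert x := by
  induction p with
  | nil => exact le_rfl
  | cons i h p ih => exact ih.trans (vert_le_of_step h)

variable (A) in
/-- The functor determined by vertices, edges and faces: `F(v → w)` is obtained from the
composites of the edge correspondences along all sequences of edges from `v` to `w` by identifying
elements which correspond to each other under the 2-morphisms of the faces. -/
def toDiagram : BurnsideDiagram (ι → Bool) where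
  Gen := A.Gen
  vert := A.vert
  Hom x y := Quot (@FaceRel ι A x y)
  le_of_hom f := Quot.ind (β := fun _ => _) (fun p => p.vert_le) f
  id x := Quot.mk _ (.nil x)
  comp f g := Quot.map₂ Path.append (fun p _ _ h => FaceRel.append_left p h)
    (fun _ _ q h => FaceRel.append_right h q) f g
  id_comp := by rintro _ _ ⟨p⟩; rfl
  comp_id := by rintro _ _ ⟨p⟩; exact congrArg (Quot.mk _) p.append_nil
  assoc := by rintro _ _ _ _ ⟨p⟩ ⟨q⟩ ⟨r⟩; exact congrArg (Quot.mk _) (p.append_assoc q r)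

/-- An involution of the vertices, edges and faces, covering the involution `s` of the set of
directions of the cube. -/
structure Involution (A : CubeData ι) (s : Equiv.Perm ι) where
  gen : A.Gen → A.Gen
  gen_gen : ∀ x, gen (gen x) = x
  vert_gen : ∀ x, A.vert (gen x) = A.vert x ∘ s
  step : ∀ {i x y}, A.Step i x y → A.Step (s i) (gen x) (gen y)
  face : ∀ {i j x y y' z}, A.Face i j x y y' z →
    A.Face (s i) (s j) (gen x) (gen y) (gen y') (gen z)

namespace Involution

variable {s : Equiv.Perm ι} (T : A.Involution s)

def path : ∀ {x y : A.Gen}, A.Path x y → A.Path (T.gen x) (T.gen y)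
  | _, _, .nil x => .nil (T.gen x)
  | _, _, .cons i h p => .cons (s i) (T.step h) (path p)

theorem path_append {x y z : A.Gen} (p : A.Path x y) (q : A.Path y z) :
    T.path (p.append q) = (T.path p).append (T.path q) := by
  induction p with
  | nil => rfl
  | cons i h p ih => exact congrArg (Path.cons (s i) (T.step h)) (ih q)

theorem path_rel {x y : A.Gen} {p q : A.Path x y} (h : FaceRel p q) :
    FaceRel (T.path p) (T.path q) := by
  induction h with
  | face h₁ h₂ k₁ k₂ hf p =>
    exact FaceRel.face (T.step h₁) (T.step h₂) (T.step k₁) (T.step k₂) (T.face hf) (T.path p)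
  | cons h _ ih => exact FaceRel.cons (T.step h) ih

theorem cons_eq {x y z x' y' z' : A.Gen} {i i' : ι} {h : A.Step i x y} {h' : A.Step i' x' y'}
    {p : A.Path y z} {p' : A.Path y' z'} (hx : x' = x) (hi : i' = i)
    (hp : (⟨y', z', p'⟩ : Σ a, Σ b, A.Path a b) = ⟨y, z, p⟩) :
    (⟨x', z', .cons i' h' p'⟩ : Σ a, Σ b, A.Path a b) = ⟨x, z, .cons i h p⟩ := by
  subst hx hi
  cases hp
  rfl

theorem path_path (hs : ∀ i, s (s i) = i) {x y : A.Gen} (p : A.Path x y) :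
    (⟨_, _, T.path (T.path p)⟩ : Σ a, Σ b, A.Path a b) = ⟨x, y, p⟩ := by
  induction p with
  | nil x =>
    change (⟨_, _, Path.nil (T.gen (T.gen x))⟩ : Σ a, Σ b, A.Path a b) = ⟨x, x, Path.nil x⟩
    rw [T.gen_gen]
  | cons i h p ih => exact cons_eq (T.gen_gen _) (hs i) ih

end Involution

/-- Precomposition with an involution of the set of directions. -/
def cubeIso (s : Equiv.Perm ι) (hs : ∀ i, s (s i) = i) : (ι → Bool) ≃o (ι → Bool) where
  toFun v := v ∘ s
  invFun v := v ∘ s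
  left_inv v := by funext i; simp [hs]
  right_inv v := by funext i; simp [hs]
  map_rel_iff' := by
    intro v w
    refine ⟨fun h i => ?_, fun h i => h (s i)⟩
    have := h (s i)
    simpa [hs] using this

/-- The induced external action on the functor. -/
def Involution.toExternal {s : Equiv.Perm ι} (T : A.Involution s) (hs : ∀ i, s (s i) = i) :
    A.toDiagram.ExternalInvolution (cubeIso s hs) where
  gen := T.gen
  gen_gen := T.gen_gen
  vert_gen := T.vert_gen
  hom f := Quot.map T.path (fun _ _ h => T.path_rel h) f
  hom_hom := by
    rintro x y ⟨p⟩
    exact congrArg (fun a : (Σ a, Σ b, A.Path a b) =>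
      (⟨a.1, a.2.1, Quot.mk _ a.2.2⟩ : A.toDiagram.Arrow)) (T.path_path hs p)
  hom_id _ := rfl
  hom_comp := by rintro _ _ _ ⟨p⟩ ⟨q⟩; exact congrArg (Quot.mk _) (T.path_append p q)

end CubeData

/-! ### Diagrams on the sphere, resolutions and Khovanov generators -/

/-- A link diagram as a combinatorial map. The darts are the half-edges; `rot` is the next dart
counterclockwise around the vertex and `edge` is the other half of the edge. A vertex is a crossing
(four darts, alternately belonging to the over- and the understrand) or a point in the interior of
an arc of the link (two darts, of which one is called `isOver`). -/
structure LinkDiagram where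
  Dart : Type
  finite_dart : Finite Dart
  rot : Equiv.Perm Dart
  edge : Equiv.Perm Dart
  isOver : Dart → Bool
  edge_edge : ∀ h, edge (edge h) = h
  edge_ne : ∀ h, edge h ≠ h
  rot_four : ∀ h, rot (rot (rot (rot h))) = h
  isOver_rot : ∀ h, isOver (rot h) = !isOver h

/-- The labels of circles: the basis `1`, `X` of `ℤ[X]/(X²)`. -/
inductive Label
  | one
  | X

/-- The product of two basis elements of `ℤ[X]/(X²)`, `none` meaning zero. -/
def Label.mul : Label → Label → Option Label
  | .one, b => some b
  | .X, .one => some .X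
  | .X, .X => none

/-- The basis elements occurring in the coproduct: `1 ↦ 1 ⊗ X + X ⊗ 1`, `X ↦ X ⊗ X`. -/
def Label.comul : Label → List (Label × Label)
  | .one => [(.one, .X), (.X, .one)]
  | .X => [(.X, .X)]

namespace LinkDiagram

variable (D : LinkDiagram)

def Vertex : Type := Quot (fun a b : D.Dart => b = D.rot a)

def Edge : Type := Quot (fun a b : D.Dart => b = D.edge a)

/-- The regions: one goes along the boundary of the region to the left of a dart (pointing away from
its vertex), keeping the region on the left. -/
def Region : Type := Quot (fun a b : D.Dart => b = D.rot.symm (D.edge a))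

def vtx (h : D.Dart) : D.Vertex := Quot.mk _ h

/-- The region to the left of a dart, between `h` and `rot h`. -/
def left (h : D.Dart) : D.Region := Quot.mk _ h

def IsCrossing (c : D.Vertex) : Prop := ∀ h, D.vtx h = c → D.rot (D.rot h) ≠ h

/-- An orientation of the link; `out h` means that the strand leaves the vertex along `h`. -/
structure Orientation where
  out : D.Dart → Bool
  out_edge : ∀ h, out (D.edge h) = !out h
  out_crossing : ∀ h, D.rot (D.rot h) ≠ h → out (D.rot (D.rot h)) = !out h
  out_point : ∀ h, D.rot (D.rot h) = h → out (D.rot h) = !out h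

/-- The number of negative crossings: those where turning counterclockwise from the outgoing end of
the overstrand one meets the incoming end of the understrand first. -/
noncomputable def numNeg (o : D.Orientation) : ℕ :=
  Nat.card {c : D.Vertex // D.IsCrossing c ∧
    ∃ h, D.vtx h = c ∧ D.isOver h = true ∧ o.out h = true ∧ o.out (D.rot h) = false}

/-- A vertex of the cube of resolutions (`false` is `0`, `true` is `1`). -/
abbrev State : Type := D.Vertex → Bool

/-- The dart joined to `h` in the resolution: the `0`-resolution joins an end of the understrand to
the next end of the overstrand counterclockwise, the `1`-resolution joins an end of the overstrand
to the next end of the understrand counterclockwise. At a two-valent vertex the two darts are joined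
in both cases. -/
def smooth (v : D.State) (h : D.Dart) : D.Dart :=
  if D.isOver h = v (D.vtx h) then D.rot h else D.rot.symm h

/-- The circles of the complete resolution at `v`. -/
def Circle (v : D.State) : Type :=
  Quot (fun a b : D.Dart => b = D.edge a ∨ b = D.smooth v a)

/-- The circle through a dart. -/
def circ (v : D.State) (h : D.Dart) : D.Circle v := Quot.mk _ h

/-- A Khovanov generator: a vertex of the cube and a labelling of the circles of the resolution,
given as a labelling of the darts which is constant along circles. -/
@[ext] structure KhGen where
  state : D.State
  label : D.Dart → Label
  label_edge : ∀ h, label (D.edge h) = label h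
  label_smooth : ∀ h, label (D.smooth state h) = label h

noncomputable def numCrossings : ℕ := Nat.card {c : D.Vertex // D.IsCrossing c}

/-- `|v|`, over the crossings. -/
noncomputable def weight (v : D.State) : ℕ :=
  Nat.card {c : D.Vertex // D.IsCrossing c ∧ v c = true}

/-- The number of circles with a given label. -/
noncomputable def numLabel (x : D.KhGen) (l : Label) : ℕ :=
  Nat.card {C : D.Circle x.state // ∃ h, D.circ x.state h = C ∧ x.label h = l}

/-- The quantum grading. -/
noncomputable def quantum (o : D.Orientation) (x : D.KhGen) : ℤ :=
  (D.numCrossings : ℤ) - 3 * D.numNeg o + D.weight x.state + D.numLabel x .X - D.numLabel x .one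

/-- `D.Drop c v w`: there is an edge of the cube from `v` to `w` in the direction `c`. -/
def Drop (c : D.Vertex) (v w : D.State) : Prop :=
  v c = true ∧ w c = false ∧ ∀ k, k ≠ c → w k = v k

/-- `y` occurs in the image of `x` under the map that the Frobenius algebra `ℤ[X]/(X²)` associates
to the saddle at the crossing `c`: the circles away from `c` keep their labels, and the circles at
`c` are merged or split. -/
def Saddle (c : D.Vertex) (x y : D.KhGen) : Prop :=
  D.Drop c x.state y.state ∧
  (∀ h, (∀ a, D.vtx a = c → D.circ x.state a ≠ D.circ x.state h) → y.label h = x.label h) ∧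
  ∃ a, D.vtx a = c ∧
    ((D.circ x.state a ≠ D.circ x.state (D.rot (D.rot a)) ∧
      D.circ y.state a = D.circ y.state (D.rot (D.rot a)) ∧
      Label.mul (x.label a) (x.label (D.rot (D.rot a))) = some (y.label a)) ∨
     (D.circ x.state a = D.circ x.state (D.rot (D.rot a)) ∧
      D.circ y.state a ≠ D.circ y.state (D.rot (D.rot a)) ∧
      (y.label a, y.label (D.rot (D.rot a))) ∈ Label.comul (x.label a)))

/-- The face from `u` down to `w` in the directions of the crossings `i`, `j` is a ladybug: a single
circle of the resolution at `w` meets `i` and `j`, and the surgery arcs of `i` and `j` have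
alternating ends on it, so that surgery along both arcs gives a single circle again. -/
def IsLadybug (i j : D.Vertex) (u w : D.State) : Prop :=
  D.IsCrossing i ∧ D.IsCrossing j ∧
  ∀ a b, (D.vtx a = i ∨ D.vtx a = j) → (D.vtx b = i ∨ D.vtx b = j) →
    D.circ u a = D.circ u b ∧ D.circ w a = D.circ w b

/-- The 2-morphism of a face. In a ladybug there are two intermediate generators on each side. They
are matched by the ladybug matching made with the right pair: of the four segments into which the
ends of the two surgery arcs cut the circle at `w`, the right pair are those reached by a right turn
from the surgery arcs. These are the two segments which start at an end of the understrand of one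
crossing and finish at an end of the understrand of the other one. The intermediate circles
containing the same segment of the right pair correspond to each other. For all other faces there is
at most one intermediate generator on each side. -/
def FaceMatch (i j : D.Vertex) (x y y' z : D.KhGen) : Prop :=
  D.IsLadybug i j x.state z.state →
    ∀ h, D.vtx h = i → D.isOver h = false → y.label h = y'.label h

/-- The vertices, edges and faces of the Khovanov Burnside functor in quantum grading `j`. -/
noncomputable def khovanovData (o : D.Orientation) (j : ℤ) : CubeData D.Vertex where
  Gen := {x : D.KhGen // D.quantum o x = j}
  vert x := x.1.state
  Step c x y := D.Saddle c x.1 y.1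
  vert_of_step h := h.1
  Face a b x y y' z := D.FaceMatch a b x.1 y.1 y'.1 z.1

/-- The Khovanov Burnside functor in quantum grading `j`. -/
noncomputable def khovanov (o : D.Orientation) (j : ℤ) : BurnsideDiagram (D.Vertex → Bool) :=
  (D.khovanovData o j).toDiagram

end LinkDiagram

/-! ### Annular diagrams and the axis-moving map -/

/-- A diagram with a distinguished point of the link (the only two-valent vertex), adjacent to the
axis, and a region containing infinity. It encodes a pair of annular diagrams `L₁`, `L₀`, which
differ by moving the point across the axis: the region of the axis of `L_ε` is given by `IsAxisRegion ε`. -/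
structure AxisDiagram extends LinkDiagram where
  point : toLinkDiagram.Vertex
  point_iff : ∀ h, rot (rot h) = h ↔ toLinkDiagram.vtx h = point
  outer : toLinkDiagram.Region

namespace AxisDiagram

variable (L : AxisDiagram)

/-- `r` is the region containing the axis of `L_ε`: at the point, it is to the left of the dart `h`
with `isOver h` for `ε = 0`, and to the left of the other dart for `ε = 1`. -/
def IsAxisRegion (ε : Bool) (r : L.Region) : Prop :=
  ∃ h, L.vtx h = L.point ∧ L.isOver h = !ε ∧ L.left h = r

/-- The circle `C` of the resolution at `v` is essential, i.e. separates the axis (for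
`ε = v point`) from infinity: it is the boundary of a set of regions which contains exactly one of
the two. -/
def IsEssential (v : L.State) (C : L.Circle v) : Prop :=
  ∃ inside : L.Region → Prop,
    (∀ h, ¬(inside (L.left h) ↔ inside (L.left (L.edge h))) ↔ L.circ v h = C) ∧
    ∃ r, L.IsAxisRegion (v L.point) r ∧ ¬(inside r ↔ inside L.outer)

/-- The number of essential circles with a given label. -/
noncomputable def numEssential (x : L.KhGen) (l : Label) : ℕ :=
  Nat.card {C : L.Circle x.state // L.IsEssential x.state C ∧
    ∃ h, L.circ x.state h = C ∧ x.label h = l}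

/-- The annular grading of a generator of `L_ε`, `ε = x.state point`: the winding number around the
axis, with circles labelled `1` oriented counterclockwise and circles labelled `X` clockwise. -/
noncomputable def winding (x : L.KhGen) : ℤ :=
  (L.numEssential x .one : ℤ) - L.numEssential x .X

/-- The annular grading on the pair, where the generators of `L₁` are shifted up by one. -/
noncomputable def annular (x : L.KhGen) : ℤ :=
  L.winding x + if x.state L.point = true then 1 else 0

/-- `y` occurs in `f⁺(x)`, where `f⁺` adds an essential circle labelled `1` next to the axis and
then merges it, by the annular merge map, into the circle through the point. The annular merge map
is the part of the merge map that preserves the winding number, and adding the circle labelled `1`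
has raised the winding number by one. -/
def AxisMove (x y : L.KhGen) : Prop :=
  L.Drop L.point x.state y.state ∧
  (∀ h, (∀ a, L.vtx a = L.point → L.circ x.state a ≠ L.circ x.state h) →
    y.label h = x.label h) ∧
  (∀ a, L.vtx a = L.point → Label.mul .one (x.label a) = some (y.label a)) ∧
  L.winding y = L.winding x + 1

/-- The vertices, edges and faces of the annular Burnside functor of the pair `(L₁, L₀)` in
(quantum, annular) bigrading `(j, k)`. In the directions of the crossings the edges are the parts of
the Khovanov maps of `L₁`, `L₀` that preserve the annular grading, and in the last direction, that
of the point, they are given by `f⁺`. -/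
noncomputable def annularData (o : L.Orientation) (j k : ℤ) : CubeData L.Vertex where
  Gen := {x : L.KhGen // L.quantum o x = j ∧ L.annular x = k}
  vert x := x.1.state
  Step c x y := (c ≠ L.point ∧ L.Saddle c x.1 y.1 ∧ L.winding x.1 = L.winding y.1) ∨
    (c = L.point ∧ L.AxisMove x.1 y.1)
  vert_of_step := by
    rintro c x y (⟨_, h, _⟩ | ⟨rfl, h⟩)
    · exact h.1
    · exact h.1
  Face a b x y y' z := L.FaceMatch a b x.1 y.1 y'.1 z.1

/-- The annular Burnside functor of the pair `(L₁, L₀)` in bigrading `(j, k)`. -/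
noncomputable def annularPair (o : L.Orientation) (j k : ℤ) :
    BurnsideDiagram (L.Vertex → Bool) :=
  (L.annularData o j k).toDiagram

end AxisDiagram

/-! ### Intravergent diagrams and their quotients -/

/-- An intravergent diagram of a strongly invertible knot: a knot diagram in the plane which is
invariant under the rotation `tau` of the plane by 180 degrees around one of its crossings, the
`center`. The rotation fixes no point of the plane except for the center; the only cells of the
sphere that it maps to themselves are the center and the region `outer` containing infinity. -/
structure IntravergentDiagram extends LinkDiagram where
  four_valent : ∀ h, rot (rot h) ≠ h
  /-- The link is a knot. -/
  knot : Subsingleton (Quot (fun a b : Dart => b = edge a ∨ b = rot (rot a)))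
  /-- The connected combinatorial map has the Euler characteristic of the sphere. -/
  planar : Nat.card toLinkDiagram.Vertex + Nat.card toLinkDiagram.Region =
    Nat.card toLinkDiagram.Edge + 2
  tau : Dart → Dart
  tau_tau : ∀ h, tau (tau h) = h
  tau_rot : ∀ h, tau (rot h) = rot (tau h)
  tau_edge : ∀ h, tau (edge h) = edge (tau h)
  isOver_tau : ∀ h, isOver (tau h) = isOver h
  center : toLinkDiagram.Vertex
  tau_center : ∀ h, toLinkDiagram.vtx h = center → tau h = rot (rot h)
  center_of_tau : ∀ h, toLinkDiagram.vtx (tau h) = toLinkDiagram.vtx h →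
    toLinkDiagram.vtx h = center
  tau_ne : ∀ h, tau h ≠ h
  tau_ne_edge : ∀ h, tau h ≠ edge h
  outer : toLinkDiagram.Region
  outer_iff : ∀ h, toLinkDiagram.left (tau h) = toLinkDiagram.left h ↔
    toLinkDiagram.left h = outer

namespace IntravergentDiagram

variable (K : IntravergentDiagram)

theorem tau_rot_symm (h : K.Dart) : K.tau (K.rot.symm h) = K.rot.symm (K.tau h) := by
  rw [Equiv.eq_symm_apply, ← K.tau_rot, Equiv.apply_symm_apply]

/-- The action of the rotation on the crossings. -/
def tauVertex : Equiv.Perm K.Vertex where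
  toFun := Quot.map K.tau (by rintro a _ rfl; exact K.tau_rot a)
  invFun := Quot.map K.tau (by rintro a _ rfl; exact K.tau_rot a)
  left_inv := by rintro ⟨a⟩; exact congrArg (Quot.mk _) (K.tau_tau a)
  right_inv := by rintro ⟨a⟩; exact congrArg (Quot.mk _) (K.tau_tau a)

theorem tauVertex_vtx (h : K.Dart) : K.tauVertex (K.vtx h) = K.vtx (K.tau h) := rfl

theorem tauVertex_tauVertex (c : K.Vertex) : K.tauVertex (K.tauVertex c) = c :=
  K.tauVertex.left_inv c

theorem quot_tau_eq {a b : K.Dart}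
    (h : Quot.mk (fun a b : K.Dart => b = K.tau a) a = Quot.mk _ b) : b = a ∨ b = K.tau a := by
  have key : ∀ q : Quot (fun a b : K.Dart => b = K.tau a), q = Quot.mk _ b →
      Quot.lift (fun c => b = c ∨ b = K.tau c)
        (by rintro c _ rfl; simp only [K.tau_tau]; exact propext or_comm) q := by
    rintro _ rfl
    exact Or.inl rfl
  exact key _ h

/-- The diagram of the quotient of `K`. Its crossings are the pairs of crossings of `K` exchanged by
the rotation, and the center becomes a two-valent vertex: the two darts at the center which belong
to the same strand are identified. -/
def quotientDiagram : LinkDiagram where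
  Dart := Quot (fun a b : K.Dart => b = K.tau a)
  finite_dart := by
    have := K.finite_dart
    exact Finite.of_surjective _ Quot.mk_surjective
  rot :=
    { toFun := Quot.map K.rot (by rintro a _ rfl; exact (K.tau_rot a).symm)
      invFun := Quot.map K.rot.symm (by rintro a _ rfl; exact (K.tau_rot_symm a).symm)
      left_inv := by rintro ⟨a⟩; exact congrArg (Quot.mk _) (K.rot.symm_apply_apply a)
      right_inv := by rintro ⟨a⟩; exact congrArg (Quot.mk _) (K.rot.apply_symm_apply a) }
  edge :=
    { toFun := Quot.map K.edge (by rintro a _ rfl; exact (K.tau_edge a).symm)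
      invFun := Quot.map K.edge (by rintro a _ rfl; exact (K.tau_edge a).symm)
      left_inv := by rintro ⟨a⟩; exact congrArg (Quot.mk _) (K.edge_edge a)
      right_inv := by rintro ⟨a⟩; exact congrArg (Quot.mk _) (K.edge_edge a) }
  isOver := Quot.lift K.isOver (by rintro a _ rfl; exact (K.isOver_tau a).symm)
  edge_edge := by rintro ⟨a⟩; exact congrArg (Quot.mk _) (K.edge_edge a)
  edge_ne := by
    rintro ⟨a⟩ h
    rcases K.quot_tau_eq h with h | h
    · exact K.edge_ne a h.symm
    · apply K.tau_ne_edge (K.edge a)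
      rw [K.edge_edge, ← h]
  rot_four := by rintro ⟨a⟩; exact congrArg (Quot.mk _) (K.rot_four a)
  isOver_rot := by rintro ⟨a⟩; exact K.isOver_rot a

/-- The image of a dart in the quotient. -/
def projDart (h : K.Dart) : K.quotientDiagram.Dart := Quot.mk _ h

theorem projDart_tau (h : K.Dart) : K.projDart (K.tau h) = K.projDart h :=
  (Quot.sound (r := fun a b : K.Dart => b = K.tau a) rfl).symm

/-- The image of a vertex in the quotient. -/
def projVertex : K.Vertex → K.quotientDiagram.Vertex :=
  Quot.map K.projDart (by rintro a _ rfl; rfl)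

/-- The image of a region in the quotient. -/
def projRegion : K.Region → K.quotientDiagram.Region :=
  Quot.map K.projDart (by rintro a _ rfl; rfl)

theorem projVertex_tau (c : K.Vertex) : K.projVertex (K.tauVertex c) = K.projVertex c := by
  obtain ⟨a⟩ := c
  exact congrArg (Quot.mk _) (K.projDart_tau a)

/-- A function on the vertices which is invariant under the rotation descends to the quotient. -/
def descend {α : Type} (f : K.Vertex → α) (hf : ∀ c, f (K.tauVertex c) = f c) :
    K.quotientDiagram.Vertex → α :=
  Quot.lift (Quot.lift (fun h : K.Dart => f (K.vtx h)) (by rintro a _ rfl; exact (hf _).symm))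
    (by
      rintro ⟨a⟩ _ rfl
      have h : K.vtx a = K.vtx (K.rot a) := Quot.sound rfl
      exact congrArg f h)

theorem descend_projVertex {α : Type} (f : K.Vertex → α) (hf : ∀ c, f (K.tauVertex c) = f c)
    (c : K.Vertex) : K.descend f hf (K.projVertex c) = f c := by
  obtain ⟨a⟩ := c
  rfl

theorem projVertex_surjective : Function.Surjective K.projVertex := by
  rintro ⟨⟨a⟩⟩
  exact ⟨K.vtx a, rfl⟩

theorem vtx_rot (h : K.Dart) : K.vtx (K.rot h) = K.vtx h :=
  (Quot.sound (r := fun a b : K.Dart => b = K.rot a) rfl).symm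

theorem tauVertex_center : K.tauVertex K.center = K.center := by
  obtain ⟨a, ha⟩ : ∃ a, K.vtx a = K.center := Quot.exists_rep K.center
  rw [← ha, tauVertex_vtx, K.tau_center a ha, vtx_rot, vtx_rot]

theorem eq_center_of_projVertex {c : K.Vertex} (h : K.projVertex c = K.projVertex K.center) :
    c = K.center := by
  have hf : ∀ c, (fun c => c = K.center) (K.tauVertex c) = (fun c => c = K.center) c := by
    intro c
    refine propext ⟨fun h => ?_, fun h => ?_⟩
    · have := congrArg K.tauVertex h
      rwa [tauVertex_tauVertex, tauVertex_center] at this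
    · change K.tauVertex c = K.center
      rw [show c = K.center from h, tauVertex_center]
  have h₁ := K.descend_projVertex (fun c => c = K.center) hf c
  rw [h, K.descend_projVertex] at h₁
  exact h₁.mp rfl

/-- The quotient of an intravergent diagram; the distinguished point is the image of the center.
Pushing the point off the axis as in the `ε`-resolution of the center gives the annular quotient
knots: for a dart `h` of the center with `isOver h = ε`, the `ε`-resolution joins `h` to `rot h`,
and the axis is to the left of `rot h`. -/
def quotient : AxisDiagram where
  toLinkDiagram := K.quotientDiagram
  point := K.projVertex K.center
  point_iff := by
    rintro ⟨a⟩
    constructor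
    · intro h
      rcases K.quot_tau_eq h with h | h
      · exact absurd h.symm (K.four_valent a)
      · have h₁ : K.tau a = K.rot (K.rot a) := by
          conv_lhs => rw [h]
          exact K.tau_tau _
        have h₂ : K.vtx a = K.center := by
          apply K.center_of_tau
          rw [h₁, vtx_rot, vtx_rot]
        exact congrArg K.projVertex h₂
    · intro h
      have h₁ : K.vtx a = K.center := K.eq_center_of_projVertex h
      change K.projDart (K.rot (K.rot a)) = K.projDart a
      rw [← K.tau_center a h₁, projDart_tau]
  outer := K.projRegion K.outer

/-- `Δ = N₋ - 2 N̄₋`. -/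
noncomputable def shift (o : K.Orientation) (o' : K.quotient.Orientation) : ℤ :=
  (K.numNeg o : ℤ) - 2 * K.quotient.numNeg o'

/-- The cube `(1 → 0)^{N̄+1}` of the quotient (one direction for each crossing and one for the
distinguished point) is the fixed subposet of the cube of `K`. -/
def fixedCube : {v : K.Vertex → Bool //
      CubeData.cubeIso K.tauVertex K.tauVertex_tauVertex v = v} ≃o (K.quotient.Vertex → Bool) where
  toFun v := K.descend v.1 (fun c => congrFun v.2 c)
  invFun w := ⟨w ∘ K.projVertex, by funext c; exact congrArg w (K.projVertex_tau c)⟩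
  left_inv v := by
    apply Subtype.ext
    funext c
    exact K.descend_projVertex v.1 (fun c => congrFun v.2 c) c
  right_inv w := by
    funext c
    obtain ⟨c, rfl⟩ := K.projVertex_surjective c
    exact K.descend_projVertex _ _ c
  map_rel_iff' := by
    intro v w
    constructor
    · rintro h ⟨a⟩
      exact h (K.projVertex (K.vtx a))
    · intro h c
      obtain ⟨⟨a⟩, rfl⟩ := K.projVertex_surjective c
      exact h (K.vtx a)

/-! ### The action of the rotation on the Khovanov Burnside functor -/

theorem rot_tau (h : K.Dart) : K.rot (K.tau h) = K.tau (K.rot h) := (K.tau_rot h).symm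

theorem edge_tau (h : K.Dart) : K.edge (K.tau h) = K.tau (K.edge h) := (K.tau_edge h).symm

theorem smooth_tau (v : K.State) (h : K.Dart) :
    K.smooth v (K.tau h) = K.tau (K.smooth (v ∘ K.tauVertex) h) := by
  unfold LinkDiagram.smooth
  rw [K.isOver_tau, ← K.tauVertex_vtx]
  simp only [Function.comp_apply]
  split
  · exact K.rot_tau h
  · exact (K.tau_rot_symm h).symm

theorem state_tau_tau (v : K.State) : (v ∘ K.tauVertex) ∘ K.tauVertex = v := by
  funext c
  simp [tauVertex_tauVertex]

theorem circ_tau {v : K.State} {a b : K.Dart} (h : K.circ (v ∘ K.tauVertex) a =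
    K.circ (v ∘ K.tauVertex) b) : K.circ v (K.tau a) = K.circ v (K.tau b) := by
  have key : ∀ C : K.Circle (v ∘ K.tauVertex), ∀ D, C = D →
      Quot.map (rb := fun a b : K.Dart => b = K.edge a ∨ b = K.smooth v a) K.tau (by
        rintro a b (rfl | rfl)
        · exact Or.inl (K.tau_edge a)
        · exact Or.inr (K.smooth_tau v a).symm) C = Quot.map K.tau (by
        rintro a b (rfl | rfl)
        · exact Or.inl (K.tau_edge a)
        · exact Or.inr (K.smooth_tau v a).symm) D := by
    rintro C _ rfl
    rfl
  exact key _ _ h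

theorem circ_tau_iff (v : K.State) (a b : K.Dart) :
    K.circ (v ∘ K.tauVertex) a = K.circ (v ∘ K.tauVertex) b ↔
      K.circ v (K.tau a) = K.circ v (K.tau b) := by
  refine ⟨K.circ_tau, fun h => ?_⟩
  have h₁ : K.circ ((v ∘ K.tauVertex) ∘ K.tauVertex) (K.tau a) =
      K.circ ((v ∘ K.tauVertex) ∘ K.tauVertex) (K.tau b) := by
    rw [state_tau_tau]; exact h
  have h₂ := K.circ_tau h₁
  rwa [K.tau_tau, K.tau_tau] at h₂

/-- The action of the rotation on the Khovanov generators. -/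
def tauGen (x : K.KhGen) : K.KhGen where
  state := x.state ∘ K.tauVertex
  label := x.label ∘ K.tau
  label_edge h := by simp only [Function.comp_apply, K.tau_edge, x.label_edge]
  label_smooth h := by
    simp only [Function.comp_apply]
    rw [← K.smooth_tau, x.label_smooth]

theorem tauGen_tauGen (x : K.KhGen) : K.tauGen (K.tauGen x) = x := by
  apply LinkDiagram.KhGen.ext
  · exact K.state_tau_tau x.state
  · funext h
    simp [tauGen, K.tau_tau]

theorem isCrossing (c : K.Vertex) : K.IsCrossing c := fun h _ => K.four_valent h

theorem weight_tau (v : K.State) : K.weight (v ∘ K.tauVertex) = K.weight v := by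
  refine Nat.card_congr (K.tauVertex.subtypeEquiv fun c => ?_)
  simp [K.isCrossing]

/-- The circles of a resolution and of its image under the rotation. -/
def circleEquiv (v : K.State) : K.Circle (v ∘ K.tauVertex) ≃ K.Circle v where
  toFun := Quot.map K.tau (by
    rintro a b (rfl | rfl)
    · exact Or.inl (K.tau_edge a)
    · exact Or.inr (K.smooth_tau v a).symm)
  invFun := Quot.map K.tau (by
    rintro a b (rfl | rfl)
    · exact Or.inl (K.tau_edge a)
    · refine Or.inr ?_
      rw [K.smooth_tau, state_tau_tau])
  left_inv := by rintro ⟨a⟩; exact congrArg (Quot.mk _) (K.tau_tau a)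
  right_inv := by rintro ⟨a⟩; exact congrArg (Quot.mk _) (K.tau_tau a)

theorem numLabel_tau (x : K.KhGen) (l : Label) : K.numLabel (K.tauGen x) l = K.numLabel x l := by
  refine Nat.card_congr ((K.circleEquiv x.state).subtypeEquiv fun C => ?_)
  constructor
  · rintro ⟨h, rfl, h₂⟩
    exact ⟨K.tau h, rfl, h₂⟩
  · rintro ⟨h, h₁, h₂⟩
    refine ⟨K.tau h, ?_, ?_⟩
    · apply (K.circleEquiv x.state).injective
      rw [← h₁]
      exact congrArg (Quot.mk _) (K.tau_tau h)
    · change x.label (K.tau (K.tau h)) = l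
      rw [K.tau_tau, h₂]

theorem quantum_tau (o : K.Orientation) (x : K.KhGen) :
    K.quantum o (K.tauGen x) = K.quantum o x := by
  unfold LinkDiagram.quantum
  rw [K.numLabel_tau, K.numLabel_tau]
  change _ + (K.weight (x.state ∘ K.tauVertex) : ℤ) + _ - _ = _
  rw [K.weight_tau]

theorem tauVertex_eq_iff (a c : K.Vertex) : a = K.tauVertex c ↔ K.tauVertex a = c := by
  constructor
  · rintro rfl; exact K.tauVertex_tauVertex c
  · rintro rfl; exact (K.tauVertex_tauVertex a).symm

theorem saddle_tau {c : K.Vertex} {x y : K.KhGen} (h : K.Saddle c x y) :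
    K.Saddle (K.tauVertex c) (K.tauGen x) (K.tauGen y) := by
  obtain ⟨⟨h₁, h₂, h₃⟩, h₄, a, ha, h₅⟩ := h
  refine ⟨⟨?_, ?_, ?_⟩, ?_, K.tau a, ?_, ?_⟩
  · change x.state (K.tauVertex (K.tauVertex c)) = true
    rw [tauVertex_tauVertex, h₁]
  · change y.state (K.tauVertex (K.tauVertex c)) = false
    rw [tauVertex_tauVertex, h₂]
  · intro k hk
    exact h₃ _ fun h => hk ((K.tauVertex_eq_iff _ _).2 h)
  · intro h hh
    refine h₄ (K.tau h) fun b hb he => ?_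
    refine hh (K.tau b) ?_ ?_
    · rw [← K.tauVertex_vtx, hb]
    · refine (K.circ_tau_iff x.state _ _).2 ?_
      rw [K.tau_tau]
      exact he
  · rw [← K.tauVertex_vtx, ha]
  · have e : ∀ (z : K.KhGen), (K.circ (K.tauGen z).state (K.tau a) =
        K.circ (K.tauGen z).state (K.rot (K.rot (K.tau a)))) ↔
        (K.circ z.state a = K.circ z.state (K.rot (K.rot a))) := by
      intro z
      refine (K.circ_tau_iff z.state _ _).trans ?_
      rw [K.rot_tau, K.rot_tau, K.tau_tau, K.tau_tau]
    have l : ∀ (z : K.KhGen) b, (K.tauGen z).label (K.tau b) = z.label b := by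
      intro z b
      change z.label (K.tau (K.tau b)) = _
      rw [K.tau_tau]
    simp only [ne_eq, e]
    rw [K.rot_tau, K.rot_tau]
    simp only [l]
    exact h₅

theorem faceMatch_tau {i j : K.Vertex} {x y y' z : K.KhGen} (h : K.FaceMatch i j x y y' z) :
    K.FaceMatch (K.tauVertex i) (K.tauVertex j) (K.tauGen x) (K.tauGen y) (K.tauGen y')
      (K.tauGen z) := by
  rintro ⟨-, -, h₁⟩ a ha ho
  refine h ⟨K.isCrossing i, K.isCrossing j, fun b c hb hc => ?_⟩ (K.tau a) ?_ ?_
  · have t : ∀ b, (K.vtx b = i ∨ K.vtx b = j) →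
        (K.vtx (K.tau b) = K.tauVertex i ∨ K.vtx (K.tau b) = K.tauVertex j) := by
      rintro b (rfl | rfl)
      · exact Or.inl rfl
      · exact Or.inr rfl
    obtain ⟨h₂, h₃⟩ := h₁ (K.tau b) (K.tau c) (t b hb) (t c hc)
    have h₄ := (K.circ_tau_iff x.state _ _).1 h₂
    have h₅ := (K.circ_tau_iff z.state _ _).1 h₃
    rw [K.tau_tau, K.tau_tau] at h₄ h₅
    exact ⟨h₄, h₅⟩
  · rw [← K.tauVertex_vtx, ha, tauVertex_tauVertex]
  · rw [K.isOver_tau, ho]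

/-- The action of the rotation on the vertices, edges and faces. -/
noncomputable def tauData (o : K.Orientation) (j : ℤ) :
    (K.khovanovData o j).Involution K.tauVertex where
  gen x := ⟨K.tauGen x.1, (K.quantum_tau o x.1).trans x.2⟩
  gen_gen x := Subtype.ext (K.tauGen_tauGen x.1)
  vert_gen _ := rfl
  step h := K.saddle_tau h
  face h := K.faceMatch_tau h

/-- The external `ℤ/2`-action on the Khovanov Burnside functor given by the rotation. -/
noncomputable def tauAction (o : K.Orientation) (j : ℤ) :
    (K.khovanov o j).ExternalInvolution
      (CubeData.cubeIso K.tauVertex K.tauVertex_tauVertex) :=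
  (K.tauData o j).toExternal K.tauVertex_tauVertex

/-- The fixed point functor, on the cube of the quotient. -/
noncomputable def fixedPointFunctor (o : K.Orientation) (j : ℤ) :
    BurnsideDiagram (K.quotient.Vertex → Bool) :=
  (K.tauAction o j).fixed.reindex K.fixedCube

end IntravergentDiagram

end Khovanov

/-! All functors in the statement are generated by sets, edge correspondences and matchings on
square faces, so the theorem reduces to checks in dimensions one, two and three.

**Coherence.** If the face matchings are bijective, symmetric and satisfy the hexagon relation on
3-dimensional faces, then a sequence of edges can be sorted by insertion and the sorted sequence
depends only on its class (`Coherent.insert_insert_aux`, `Coherent.sort_eq_of_mk_eq`). Ordering the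
directions so that those which fall before a given vertex come first, one reads off the unique
factorization through that vertex (`Coherent.isTwoFunctor`).

**The Khovanov functor.** Circles are treated as a partition of the darts. A checkerboard colouring
makes them the cycles of a permutation, and a change of resolution multiplies this permutation by a
transposition, so that it merges two cycles or splits one. Labels become numbers, `0` for `1` and
`1` for `X`: a merge adds them, a split produces two labels whose sum is larger by one. Existence
and uniqueness of the other side of a face are then combinatorics of labelled partitions
(`Pants.exists_swap`, `Pants.lady_of_ne`), and only ladybugs leave a choice. Planarity enters
through the fact that the crossings of a ladybug have opposite colours
(`IsPlanar.separatesLadybugs`). It makes the ladybug matching symmetric, and it leaves, among any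
three crossings, two that never form a ladybug, from which the hexagon relation follows. Planarity
is used in the form that cycles modulo 2 bound, which is a rank count with Euler's formula
(`IsPlanar.exists_boundary`).

**The fixed points.** They form a 2-functor because the factorization of a fixed element through a
fixed vertex is unique, hence itself fixed. To identify this functor with a disjoint union of
annular ones it is enough to compare sets, edges and faces (`Presentation.nonempty_iso`).

*Sets.* Fixed generators are pulled back from the quotient. A circle of the quotient is essential
exactly when its preimage is connected (`isEssential_iff`), so counting circles and crossings in
pairs gives the relation between the gradings (`quantum_liftGen`).

*Edges.* An edge away from the center is a pair of saddles at a crossing and its image under the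
rotation. Essential circles correspond to blocks preserved by the rotation, and going through the
possible types shows that a middle generator exists exactly when the quotient saddle preserves the
winding number (`exists_middle_iff`). A saddle at the center merges two exchanged circles labelled
`1` or splits an invariant circle labelled `X`. In both cases no label changes and the winding
number rises by one: this is the axis move (`saddle_center_iff`).

*Faces.* A face of the quotient becomes four faces upstairs. If their matchings did not induce the
ladybug matching of the quotient, a short case analysis of the circles would give a contradiction
(`saddle_faces_absurd`).

The annular data are never shown to be coherent directly: each annular functor is a summand of the
fixed point functor for a suitable quantum grading, and summands of 2-functors are 2-functors. -/

namespace Khovanov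
-- Coherent cube data: sorting sequences of edges
namespace CubeData
variable {ι : Type} {A : CubeData ι}

/-- The conditions under which vertices, edges and faces determine a functor: the 2-morphisms of
the faces are bijections, inverse to each other for the two orders of the directions, and they
satisfy the hexagon relation for every 3-dimensional face. -/
structure Coherent (A : CubeData ι) : Prop where
  finite_index : Finite ι
  finite_gen : Finite A.Gen
  face_exists : ∀ {i j x y z}, A.Step i x y → A.Step j y z →
    ∃ y', A.Step j x y' ∧ A.Step i y' z ∧ A.Face i j x y y' z
  face_unique : ∀ {i j x y z y₁ y₂}, A.Step i x y → A.Step j y z →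
    A.Step j x y₁ → A.Step i y₁ z → A.Face i j x y y₁ z →
    A.Step j x y₂ → A.Step i y₂ z → A.Face i j x y y₂ z → y₁ = y₂
  face_symm : ∀ {i j x y y' z}, A.Step i x y → A.Step j y z → A.Step j x y' → A.Step i y' z →
    A.Face i j x y y' z → A.Face j i x y' y z
  hexagon : ∀ {i j k x y z w y' s t s' t'}, A.Step i x y → A.Step j y z → A.Step k z w →
    A.Step j x y' → A.Step i y' z → A.Face i j x y y' z →
    A.Step k y s → A.Step j s w → A.Face j k y z s w →
    A.Step k x t → A.Step i t s → A.Face i k x y t s →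
    A.Step k y' s' → A.Step i s' w → A.Face i k y' z s' w →
    A.Step k x t' → A.Step j t' s' → A.Face j k x y' t' s' →
    t = t' ∧ A.Face i j t s s' w

theorem eq_false_of_le_false {b : Bool} (h : b ≤ false) : b = false := by
  cases b
  · rfl
  · exact absurd h (by decide)

theorem ne_of_steps {i j : ι} {x y z : A.Gen} (h : A.Step i x y) (k : A.Step j y z) : i ≠ j := by
  rintro rfl
  have h₁ := (A.vert_of_step h).2.1
  rw [(A.vert_of_step k).1] at h₁
  exact absurd h₁ (by decide)

namespace Path

/-- The sequence of directions of a sequence of edges. -/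
def dirs : ∀ {x y : A.Gen}, A.Path x y → List ι
  | _, _, .nil _ => []
  | _, _, .cons i _ p => i :: p.dirs

theorem dirs_append {x y z : A.Gen} (p : A.Path x y) (q : A.Path y z) :
    (p.append q).dirs = p.dirs ++ q.dirs := by
  induction p with
  | nil => rfl
  | cons i h p ih => exact congrArg (i :: ·) (ih q)

/-- Coordinates only ever fall from `true` to `false`, so the set of directions is determined by the
two end vertices. -/
theorem mem_dirs {x y : A.Gen} (p : A.Path x y) (c : ι) :
    c ∈ p.dirs ↔ A.vert x c = true ∧ A.vert y c = false := by
  induction p with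
  | nil x =>
    simp only [dirs, List.not_mem_nil, false_iff, not_and]
    intro h; rw [h]; decide
  | @cons x y z i h p ih =>
    obtain ⟨h₁, h₂, h₃⟩ := A.vert_of_step h
    have hle : A.vert z i = false := by
      have := p.vert_le i
      rw [h₂] at this
      exact eq_false_of_le_false this
    simp only [dirs, List.mem_cons, ih]
    by_cases hc : c = i
    · subst hc; simp [h₁, hle]
    · simp [hc, h₃ c hc]

/-- The entries of a sequence of edges. -/
def entries : ∀ {x y : A.Gen}, A.Path x y → List (ι × A.Gen)
  | _, _, .nil _ => []
  | _, _, @Path.cons _ _ _ y _ i _ p => (i, y) :: p.entries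

theorem entries_injective {x y : A.Gen} (p q : A.Path x y) (h : p.entries = q.entries) :
    p = q := by
  induction p with
  | nil x =>
    cases q with
    | nil => rfl
    | cons i k q => simp [entries] at h
  | @cons x y z i k p ih =>
    cases q with
    | nil => simp [entries] at h
    | cons j l q =>
      simp only [entries, List.cons.injEq, Prod.mk.injEq] at h
      obtain ⟨⟨rfl, rfl⟩, h⟩ := h
      rw [ih q h]

theorem dirs_nodup {x y : A.Gen} (p : A.Path x y) : p.dirs.Nodup := by
  induction p with
  | nil => exact List.nodup_nil
  | cons i h p ih =>
    refine List.nodup_cons.2 ⟨fun hi => ?_, ih⟩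
    have h₁ := ((p.mem_dirs i).1 hi).1
    rw [(A.vert_of_step h).2.1] at h₁
    exact absurd h₁ (by decide)

theorem length_entries {x y : A.Gen} (p : A.Path x y) : p.entries.length = p.dirs.length := by
  induction p with
  | nil => rfl
  | cons i h p ih => simp [entries, dirs, ih]

/-- No direction occurs twice in a sequence of edges, so its length is bounded by the number of
directions. -/
theorem finite [Finite ι] [Finite A.Gen] (x y : A.Gen) : Finite (A.Path x y) := by
  have := Fintype.ofFinite ι
  have hf : {l : List (ι × A.Gen) | l.length ≤ Fintype.card ι}.Finite :=
    List.finite_length_le _ _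
  have := hf.to_subtype
  refine Finite.of_injective
    (fun p : A.Path x y => (⟨p.entries, ?_⟩ : {l : List (ι × A.Gen) | l.length ≤ Fintype.card ι}))
    (fun p q h => entries_injective p q (congrArg Subtype.val h))
  rw [Set.mem_ofPred_eq, length_entries]
  exact p.dirs_nodup.length_le_card

/-- Vertices fall strictly along a sequence of edges, so a sequence meets each vertex of the cube at
most once. This is the uniqueness part of factorization, for sequences instead of classes. -/
theorem append_cancel {x z y y' : A.Gen} (p : A.Path x y) (q : A.Path y z) (p' : A.Path x y')
    (q' : A.Path y' z) (hv : A.vert y = A.vert y') (h : p.append q = p'.append q') :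
    (⟨y, p, q⟩ : Σ y, A.Path x y × A.Path y z) = ⟨y', p', q'⟩ := by
  induction p with
  | nil x =>
    cases p' with
    | nil => cases h; rfl
    | cons i k p' =>
      have h₁ := congrFun hv i
      rw [(A.vert_of_step k).1] at h₁
      have h₂ := p'.vert_le i
      rw [(A.vert_of_step k).2.1, ← h₁] at h₂
      exact absurd (eq_false_of_le_false h₂) (by decide)
  | @cons x a y i k p ih =>
    cases p' with
    | nil =>
      have h₁ := congrFun hv i
      rw [(A.vert_of_step k).1] at h₁
      have h₂ := p.vert_le i
      rw [(A.vert_of_step k).2.1, h₁] at h₂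
      exact absurd (eq_false_of_le_false h₂) (by decide)
    | @cons _ b _ j l p' =>
      change Path.cons i k (p.append q) = Path.cons j l (p'.append q') at h
      injection h with h₁ h₂ h₃ h₄ h₅
      subst h₂ h₄
      have := ih q p' hv (eq_of_heq h₅)
      cases this
      rfl

/-- A sequence of edges whose directions between `x` and `v` come first passes through `v`. -/
theorem exists_split {x z : A.Gen} (p : A.Path x z) (v : ι → Bool) (hz : A.vert z ≤ v)
    (hx : v ≤ A.vert x) (hp : p.dirs.Pairwise fun i j => v i = true → v j = true) :
    ∃ (y : A.Gen) (p₁ : A.Path x y) (p₂ : A.Path y z), A.vert y = v ∧ p = p₁.append p₂ := by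
  induction p with
  | nil x => exact ⟨x, .nil x, .nil x, le_antisymm hz hx, rfl⟩
  | @cons x y z i h p ih =>
    obtain ⟨h₁, h₂, h₃⟩ := A.vert_of_step h
    simp only [dirs, List.pairwise_cons] at hp
    cases hv : v i with
    | false =>
      obtain ⟨a, p₁, p₂, ha, rfl⟩ := ih hz (fun c => by
        by_cases hc : c = i
        · subst hc; rw [hv]; exact Bool.false_le _
        · rw [h₃ c hc]; exact hx c) hp.2
      exact ⟨a, .cons i h p₁, p₂, ha, rfl⟩
    | true =>
      refine ⟨x, .nil x, .cons i h p, ?_, rfl⟩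
      refine le_antisymm (fun c => ?_) hx
      cases hc : v c with
      | true => exact Bool.le_true _
      | false =>
        have hzc : A.vert z c = false := by
          have := hz c
          rw [hc] at this
          exact eq_false_of_le_false this
        cases hxc : A.vert x c with
        | false => exact le_rfl
        | true =>
          exfalso
          have hci : c ≠ i := by rintro rfl; rw [hv] at hc; exact absurd hc (by decide)
          have := hp.1 c ((p.mem_dirs c).2 ⟨by rw [h₃ c hci, hxc], hzc⟩) hv
          rw [hc] at this
          exact absurd this (by decide)

end Path

theorem mk_cons {i : ι} {x y z : A.Gen} (h : A.Step i x y) {p q : A.Path y z}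
    (e : (Quot.mk _ p : Quot (@FaceRel ι A y z)) = Quot.mk _ q) :
    (Quot.mk _ (.cons i h p) : Quot (@FaceRel ι A x z)) = Quot.mk _ (.cons i h q) :=
  congrArg (Quot.map (Path.cons i h) fun _ _ r => FaceRel.cons h r) e

namespace Coherent

variable (hA : A.Coherent) (r : ι → ℕ)

/-- Move an edge to its place in a sorted sequence of edges, by means of the 2-morphisms of the
faces. -/
noncomputable def insert (hA : A.Coherent) (r : ι → ℕ) :
    ∀ {y z : A.Gen} (_ : A.Path y z) {x : A.Gen} (i : ι) (_ : A.Step i x y), A.Path x z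
  | _, _, .nil _, _, i, h => .cons i h (.nil _)
  | _, _, .cons j k p, _, i, h =>
    open Classical in
    if r i < r j then .cons i h (.cons j k p)
    else .cons j (hA.face_exists h k).choose_spec.1
      (insert hA r p i (hA.face_exists h k).choose_spec.2.1)

theorem insert_lt {i j : ι} {x y y₁ z : A.Gen} (h : A.Step i x y) (k : A.Step j y y₁)
    (p : A.Path y₁ z) (hr : r i < r j) :
    hA.insert r (.cons j k p) i h = .cons i h (.cons j k p) := by
  rw [insert, if_pos hr]

/-- `insert` takes its face from a choice in `face_exists`. By `face_unique` the choice is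
immaterial, and any face at hand may be used to compute it. -/
theorem insert_swap {i j : ι} {x y y' y₁ z : A.Gen} (h : A.Step i x y) (k : A.Step j y y₁)
    (p : A.Path y₁ z) (hr : ¬ r i < r j) (k₁ : A.Step j x y') (k₂ : A.Step i y' y₁)
    (hf : A.Face i j x y y' y₁) :
    hA.insert r (.cons j k p) i h = .cons j k₁ (hA.insert r p i k₂) := by
  rw [insert, if_neg hr]
  have hs := (hA.face_exists h k).choose_spec
  obtain rfl := hA.face_unique h k hs.1 hs.2.1 hs.2.2 k₁ k₂ hf
  rfl

/-- The one place where the hexagon relation is needed. If both edges have to move past the first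
edge of the sequence, the two sides of the equation go around a 3-dimensional face in the two
possible ways. The hexagon says that they begin with the same edge and leave a pair of chains
related by a face, to which the induction applies. -/
theorem insert_insert_aux {z w : A.Gen} (q : A.Path z w) :
    ∀ {i j : ι} {x y y' : A.Gen} (h₁ : A.Step i x y) (h₂ : A.Step j y z) (k₁ : A.Step j x y')
      (k₂ : A.Step i y' z) (_ : A.Face i j x y y' z) (_ : r i < r j),
    hA.insert r (hA.insert r q j h₂) i h₁ = hA.insert r (hA.insert r q i k₂) j k₁ := by
  induction q with
  | nil z =>
    intro i j x y y' h₁ h₂ k₁ k₂ hf hr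
    rw [insert, insert_lt hA r _ _ _ hr, insert,
      insert_swap hA r _ _ _ hr.not_gt h₁ h₂ (hA.face_symm h₁ h₂ k₁ k₂ hf), insert]
  | @cons z z₁ w k h₃ q ih =>
    intro i j x y y' h₁ h₂ k₁ k₂ hf hr
    by_cases hik : r i < r k
    · rw [insert_lt hA r k₂ h₃ q hik,
        insert_swap hA r _ _ _ hr.not_gt h₁ h₂ (hA.face_symm h₁ h₂ k₁ k₂ hf)]
      by_cases hjk : r j < r k
      · rw [insert_lt hA r _ _ _ hjk, insert_lt hA r _ _ _ hr]
      · obtain ⟨s, g₁, g₂, hs⟩ := hA.face_exists h₂ h₃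
        rw [insert_swap hA r _ _ _ hjk g₁ g₂ hs, insert_lt hA r _ _ _ hik]
    · have hjk : ¬ r j < r k := fun h => hik (hr.trans h)
      obtain ⟨s, g₁, g₂, hs⟩ := hA.face_exists h₂ h₃
      obtain ⟨t, g₃, g₄, ht⟩ := hA.face_exists h₁ g₁
      obtain ⟨s', l₁, l₂, hs'⟩ := hA.face_exists k₂ h₃
      obtain ⟨t', l₃, l₄, ht'⟩ := hA.face_exists k₁ l₁
      obtain ⟨rfl, hf'⟩ := hA.hexagon h₁ h₂ h₃ k₁ k₂ hf g₁ g₂ hs g₃ g₄ ht l₁ l₂ hs' l₃ l₄ ht'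
      rw [insert_swap hA r _ _ _ hjk g₁ g₂ hs, insert_swap hA r _ _ _ hik g₃ g₄ ht,
        insert_swap hA r _ _ _ hik l₁ l₂ hs', insert_swap hA r _ _ _ hjk l₃ l₄ ht',
        ih g₄ g₂ l₄ l₂ hf' hr]

/-- The sorted sequence of edges obtained by means of the 2-morphisms of the faces. -/
noncomputable def sort (hA : A.Coherent) (r : ι → ℕ) : ∀ {x y : A.Gen}, A.Path x y → A.Path x y
  | _, _, .nil x => .nil x
  | _, _, .cons i h p => hA.insert r (sort hA r p) i h

theorem sort_eq_of_faceRel (hr : Function.Injective r) {x y : A.Gen} {p q : A.Path x y}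
    (h : FaceRel p q) : hA.sort r p = hA.sort r q := by
  induction h with
  | face h₁ h₂ k₁ k₂ hf p =>
    simp only [sort]
    rcases lt_trichotomy (r _) (r _) with h | h | h
    · exact hA.insert_insert_aux r _ h₁ h₂ k₁ k₂ hf h
    · exact absurd (hr h) (ne_of_steps h₁ h₂)
    · exact (hA.insert_insert_aux r _ k₁ k₂ h₁ h₂ (hA.face_symm h₁ h₂ k₁ k₂ hf) h).symm
  | cons h _ ih => simp only [sort, ih]

/-- Together with `mk_sort` and `sort_of_sorted` this makes the sorted sequences a normal form for
the elements of the functor. -/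
theorem sort_eq_of_mk_eq (hr : Function.Injective r) {x y : A.Gen} {p q : A.Path x y}
    (h : (Quot.mk _ p : Quot (@FaceRel ι A x y)) = Quot.mk _ q) : hA.sort r p = hA.sort r q :=
  congrArg (Quot.lift (hA.sort r) fun _ _ e => hA.sort_eq_of_faceRel r hr e) h

theorem mk_insert {y z : A.Gen} (q : A.Path y z) : ∀ {x : A.Gen} (i : ι) (h : A.Step i x y),
    (Quot.mk _ (hA.insert r q i h) : Quot (@FaceRel ι A x z)) = Quot.mk _ (.cons i h q) := by
  induction q with
  | nil => intro x i h; rfl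
  | cons j k p ih =>
    intro x i h
    by_cases hr : r i < r j
    · rw [insert_lt hA r _ _ _ hr]
    · obtain ⟨s, g₁, g₂, hs⟩ := hA.face_exists h k
      rw [insert_swap hA r _ _ _ hr g₁ g₂ hs, mk_cons g₁ (ih i g₂)]
      exact (Quot.sound (FaceRel.face h k g₁ g₂ hs p)).symm

theorem mk_sort {x y : A.Gen} (p : A.Path x y) :
    (Quot.mk _ (hA.sort r p) : Quot (@FaceRel ι A x y)) = Quot.mk _ p := by
  induction p with
  | nil => rfl
  | cons i h p ih =>
    rw [sort, mk_insert]
    exact mk_cons h ih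

theorem dirs_insert {y z : A.Gen} (q : A.Path y z) : ∀ {x : A.Gen} (i : ι) (h : A.Step i x y),
    (hA.insert r q i h).dirs.Perm (i :: q.dirs) := by
  induction q with
  | nil => intro x i h; rfl
  | cons j k p ih =>
    intro x i h
    by_cases hr : r i < r j
    · rw [insert_lt hA r _ _ _ hr]; rfl
    · obtain ⟨s, g₁, g₂, hs⟩ := hA.face_exists h k
      rw [insert_swap hA r _ _ _ hr g₁ g₂ hs]
      exact ((ih i g₂).cons j).trans (List.Perm.swap i j p.dirs)

theorem sorted_insert (hr : Function.Injective r) {y z : A.Gen} (q : A.Path y z)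
    (hq : q.dirs.Pairwise (r · < r ·)) : ∀ {x : A.Gen} (i : ι) (h : A.Step i x y),
    (hA.insert r q i h).dirs.Pairwise (r · < r ·) := by
  induction q with
  | nil => intro x i h; exact List.pairwise_singleton _ _
  | cons j k p ih =>
    intro x i h
    simp only [Path.dirs, List.pairwise_cons] at hq
    by_cases hij : r i < r j
    · rw [insert_lt hA r _ _ _ hij]
      simp only [Path.dirs, List.pairwise_cons, List.mem_cons]
      refine ⟨?_, hq⟩
      rintro a (rfl | ha)
      · exact hij
      · exact hij.trans (hq.1 a ha)
    · obtain ⟨s, g₁, g₂, hs⟩ := hA.face_exists h k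
      rw [insert_swap hA r _ _ _ hij g₁ g₂ hs]
      simp only [Path.dirs, List.pairwise_cons]
      refine ⟨fun a ha => ?_, ih hq.2 i g₂⟩
      rcases List.mem_cons.1 ((hA.dirs_insert r p i g₂).mem_iff.1 ha) with rfl | ha
      · exact lt_of_le_of_ne (not_lt.1 hij) fun e => ne_of_steps h k (hr e).symm
      · exact hq.1 a ha

theorem sorted_sort (hr : Function.Injective r) {x y : A.Gen} (p : A.Path x y) :
    (hA.sort r p).dirs.Pairwise (r · < r ·) := by
  induction p with
  | nil => exact List.Pairwise.nil
  | cons i h p ih => exact hA.sorted_insert r hr _ ih i h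

theorem sort_of_sorted {x y : A.Gen} (p : A.Path x y) (hp : p.dirs.Pairwise (r · < r ·)) :
    hA.sort r p = p := by
  induction p with
  | nil => rfl
  | cons i h p ih =>
    simp only [Path.dirs, List.pairwise_cons] at hp
    rw [sort, ih hp.2]
    cases p with
    | nil => rfl
    | cons j k p => exact hA.insert_lt r _ _ _ (hp.1 j (List.mem_cons_self ..))

theorem exists_rank (hA : A.Coherent) (v : ι → Bool) : ∃ r : ι → ℕ, Function.Injective r ∧
    ∀ i j, v i = false → v j = true → r i < r j := by
  have := hA.finite_index
  obtain ⟨n, ⟨e⟩⟩ := Finite.exists_equiv_fin ι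
  -- An enumeration of the directions by numbers below `n`, in which the directions with `v c =
  -- true` are shifted behind all the others.
  refine ⟨fun c => e c + if v c = true then n else 0, fun a b h => ?_, fun i j hi hj => ?_⟩
  · have ha := (e a).2
    have hb := (e b).2
    apply e.injective
    apply Fin.ext
    simp only at h
    split at h <;> split at h <;> omega
  · have ha := (e i).2
    simp only [hi, hj]
    simp
    omega

theorem sorted_append {v : ι → Bool} (hv : ∀ i j, v i = false → v j = true → r i < r j)
    {x y z : A.Gen} (hy : A.vert y = v) (p : A.Path x y) (q : A.Path y z)
    (hp : p.dirs.Pairwise (r · < r ·)) (hq : q.dirs.Pairwise (r · < r ·)) :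
    (p.append q).dirs.Pairwise (r · < r ·) := by
  rw [Path.dirs_append, List.pairwise_append]
  refine ⟨hp, hq, fun a ha b hb => hv a b ?_ ?_⟩
  · rw [← hy]; exact ((p.mem_dirs a).1 ha).2
  · rw [← hy]; exact ((q.mem_dirs b).1 hb).1

/-- Directions are ranked so that those where `v` is `false` come first. The sorted representative
then passes through `v`, which gives existence. If two factorizations have sorted parts, their
concatenations are sorted and hence equal as sequences, and `append_cancel` separates the parts. -/
theorem exists_unique_split (hA : A.Coherent) {x z : A.Gen} (f : Quot (@FaceRel ι A x z))
    (v : ι → Bool) (hz : A.vert z ≤ v) (hx : v ≤ A.vert x) :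
    ∃! p : (Σ y : {y : A.Gen // A.vert y = v},
      Quot (@FaceRel ι A x y.1) × Quot (@FaceRel ι A y.1 z)),
      A.toDiagram.comp (x := x) (y := p.1.1) (z := z) p.2.1 p.2.2 = f := by
  induction f using Quot.ind with | _ p
  obtain ⟨r, hr, hv⟩ := hA.exists_rank v
  obtain ⟨y, p₁, p₂, hy, hp⟩ := (hA.sort r p).exists_split v hz hx
    ((hA.sorted_sort r hr p).imp fun {a b} hab ha => by
      cases hb : v b with
      | true => rfl
      | false => exact absurd (hv b a hb ha) hab.not_gt)
  refine ⟨⟨⟨y, hy⟩, Quot.mk _ p₁, Quot.mk _ p₂⟩, ?_, ?_⟩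
  · change Quot.mk _ (p₁.append p₂) = _
    rw [← hp]
    exact hA.mk_sort r p
  · rintro ⟨⟨y', hy'⟩, ⟨q₁⟩, ⟨q₂⟩⟩ hq
    change Quot.mk _ (q₁.append q₂) = Quot.mk _ p at hq
    have hs := hA.sorted_sort r hr p
    have e₁ : (Quot.mk _ ((hA.sort r q₁).append (hA.sort r q₂)) : Quot (@FaceRel ι A x z)) =
        Quot.mk _ (p₁.append p₂) := by
      rw [← hp, hA.mk_sort r p, ← hq]
      exact congrArg₂ (fun a b => A.toDiagram.comp (x := x) (y := y') (z := z) a b)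
        (hA.mk_sort r q₁) (hA.mk_sort r q₂)
    have e₂ := hA.sort_eq_of_mk_eq r hr e₁
    rw [hA.sort_of_sorted r _ (sorted_append r hv hy' _ _ (hA.sorted_sort r hr q₁)
      (hA.sorted_sort r hr q₂)), ← hp, hA.sort_of_sorted r _ hs, hp] at e₂
    have e₃ := Path.append_cancel _ _ _ _ (hy'.trans hy.symm) e₂
    have e₄ : (Quot.mk _ q₁ : Quot (@FaceRel ι A x y')) = Quot.mk _ (hA.sort r q₁) :=
      (hA.mk_sort r q₁).symm
    have e₅ : (Quot.mk _ q₂ : Quot (@FaceRel ι A y' z)) = Quot.mk _ (hA.sort r q₂) :=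
      (hA.mk_sort r q₂).symm
    rw [e₄, e₅]
    cases e₃
    rfl

/-- Coherent data define a functor to the Burnside 2-category. -/
theorem isTwoFunctor (hA : A.Coherent) : A.toDiagram.IsTwoFunctor := by
  have := hA.finite_index
  have := hA.finite_gen
  refine ⟨fun v => Subtype.finite (α := A.Gen), fun x y => ?_, ?_,
    fun x z f v hz hx => hA.exists_unique_split f v hz hx⟩
  · have := Path.finite x y (A := A)
    exact Finite.of_surjective _ (Quot.mk_surjective (r := @FaceRel ι A x y))
  · rintro x y ⟨p⟩ hv
    cases p with
    | nil => rfl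
    | cons i h p =>
      have h₁ : A.vert _ i = A.vert _ i := congrFun hv i
      have h₂ := p.vert_le i
      rw [← h₁, (A.vert_of_step h).1, (A.vert_of_step h).2.1] at h₂
      exact absurd (eq_false_of_le_false h₂) (by decide)

end Coherent
end CubeData
-- Inheritance of the 2-functor property
namespace BurnsideDiagram
variable {P : Type} [PartialOrder P]

theorem IsTwoFunctor.exists_factor {F : BurnsideDiagram P} (hF : F.IsTwoFunctor) {x z : F.Gen}
    (f : F.Hom x z) {v : P} (hz : F.vert z ≤ v) (hx : v ≤ F.vert x) :
    ∃ (y : F.Gen) (g : F.Hom x y) (h : F.Hom y z), F.vert y = v ∧ F.comp g h = f := by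
  obtain ⟨⟨⟨y, hy⟩, g, h⟩, hp, -⟩ := hF.2.2.2 x z f v hz hx
  exact ⟨y, g, h, hy, hp⟩

theorem IsTwoFunctor.factor_unique {F : BurnsideDiagram P} (hF : F.IsTwoFunctor)
    {x y y' z : F.Gen} {g : F.Hom x y} {h : F.Hom y z} {g' : F.Hom x y'} {h' : F.Hom y' z}
    (hv : F.vert y = F.vert y') (e : F.comp g h = F.comp g' h') :
    (⟨y, g, h⟩ : Σ y, F.Hom x y × F.Hom y z) = ⟨y', g', h'⟩ := by
  obtain ⟨p, -, hp⟩ := hF.2.2.2 x z (F.comp g h) (F.vert y) (F.le_of_hom h) (F.le_of_hom g)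
  have h₁ := hp ⟨⟨y, rfl⟩, g, h⟩ rfl
  have h₂ := hp ⟨⟨y', hv.symm⟩, g', h'⟩ e.symm
  exact congrArg (fun p : (Σ y₁ : {y₁ : F.Gen // F.vert y₁ = F.vert y},
    F.Hom x y₁.1 × F.Hom y₁.1 z) => (⟨p.1.1, p.2⟩ : Σ y, F.Hom x y × F.Hom y z))
    (h₁.trans h₂.symm)

/-- Bijectivity of the comparison maps is split into surjectivity and injectivity. The latter is
stated without the subtype of elements over `v`, which makes it easy to transport. -/
theorem IsTwoFunctor.of_factor {F : BurnsideDiagram P}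
    (h₁ : ∀ v : P, Finite {x : F.Gen // F.vert x = v}) (h₂ : ∀ x y : F.Gen, Finite (F.Hom x y))
    (h₃ : ∀ (x y : F.Gen) (f : F.Hom x y), F.vert x = F.vert y → F.arrow f = F.arrow (F.id x))
    (h₄ : ∀ (x z : F.Gen) (f : F.Hom x z) (v : P), F.vert z ≤ v → v ≤ F.vert x →
      ∃ (y : F.Gen) (g : F.Hom x y) (h : F.Hom y z), F.vert y = v ∧ F.comp g h = f)
    (h₅ : ∀ (x y y' z : F.Gen) (g : F.Hom x y) (h : F.Hom y z) (g' : F.Hom x y')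
      (h' : F.Hom y' z), F.vert y = F.vert y' → F.comp g h = F.comp g' h' →
      (⟨y, g, h⟩ : Σ y, F.Hom x y × F.Hom y z) = ⟨y', g', h'⟩) : F.IsTwoFunctor := by
  refine ⟨h₁, h₂, h₃, fun x z f v hz hx => ?_⟩
  obtain ⟨y, g, h, hy, hf⟩ := h₄ x z f v hz hx
  refine ⟨⟨⟨y, hy⟩, g, h⟩, hf, ?_⟩
  rintro ⟨⟨y', hy'⟩, g', h'⟩ e
  have e₁ := h₅ _ _ _ _ g' h' g h (hy'.trans hy.symm) (e.trans hf.symm)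
  simp only at g' h' e
  cases e₁
  rfl

theorem arrow_inj {F : BurnsideDiagram P} {x y : F.Gen} {f g : F.Hom x y}
    (h : F.arrow f = F.arrow g) : f = g := by
  unfold arrow at h
  cases h
  rfl

/-- A version for elements whose sources and targets are not syntactically equal, such as an element
and its image under an involution. -/
theorem IsTwoFunctor.arrow_factor_unique {F : BurnsideDiagram P} (hF : F.IsTwoFunctor)
    {x y z x' y' z' : F.Gen} {g : F.Hom x y} {h : F.Hom y z} {g' : F.Hom x' y'}
    {h' : F.Hom y' z'} (hv : F.vert y = F.vert y')
    (e : F.arrow (F.comp g h) = F.arrow (F.comp g' h')) :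
    y = y' ∧ F.arrow g = F.arrow g' ∧ F.arrow h = F.arrow h' := by
  obtain rfl : x = x' := congrArg (fun a : F.Arrow => a.1) e
  obtain rfl : z = z' := congrArg (fun a : F.Arrow => a.2.1) e
  have := hF.factor_unique hv (arrow_inj e)
  cases this
  exact ⟨rfl, rfl, rfl⟩

/-- The involution carries a factorization of a fixed element through a fixed vertex to another
factorization of the same element through the same vertex. By uniqueness it is the same one, so both
factors and the middle element are fixed. -/
theorem ExternalInvolution.isTwoFunctor_fixed {F : BurnsideDiagram P} {t : P ≃o P}
    (T : F.ExternalInvolution t) (hF : F.IsTwoFunctor) : T.fixed.IsTwoFunctor := by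
  refine IsTwoFunctor.of_factor ?_ ?_ ?_ ?_ ?_
  · rintro ⟨v, hv⟩
    have := hF.1 v
    refine Finite.of_injective
      (fun x : {x : T.fixed.Gen // T.fixed.vert x = ⟨v, hv⟩} =>
        (⟨x.1.1, congrArg Subtype.val x.2⟩ : {x : F.Gen // F.vert x = v})) fun x y h => ?_
    have h₁ := congrArg Subtype.val h
    exact Subtype.ext (Subtype.ext h₁)
  · intro x y
    have := hF.2.1 x.1 y.1
    exact Subtype.finite (α := F.Hom x.1 y.1)
  · rintro ⟨x, hx⟩ ⟨y, hy⟩ ⟨f, hf⟩ hv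
    have e := hF.2.2.1 x y f (congrArg Subtype.val hv)
    obtain rfl : x = y := (congrArg (fun a : F.Arrow => a.2.1) e).symm
    obtain rfl := arrow_inj e
    rfl
  · rintro ⟨x, hx⟩ ⟨z, hz⟩ ⟨f, hf⟩ ⟨v, hv⟩ h₁ h₂
    obtain ⟨y, g, h, hy, rfl⟩ := hF.exists_factor f h₁ h₂
    rw [T.hom_comp] at hf
    obtain ⟨hy', hg, hh⟩ := hF.arrow_factor_unique (by rw [T.vert_gen, hy, hv]) hf
    exact ⟨⟨y, hy'⟩, ⟨g, hg⟩, ⟨h, hh⟩, Subtype.ext hy, rfl⟩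
  · rintro ⟨x, hx⟩ ⟨y, hy⟩ ⟨y', hy'⟩ ⟨z, hz⟩ ⟨g, hg⟩ ⟨h, hh⟩ ⟨g', hg'⟩ ⟨h', hh'⟩ hv e
    have := hF.factor_unique (congrArg Subtype.val hv) (congrArg Subtype.val e)
    simp only at g h g' h' this
    cases this
    rfl

theorem IsTwoFunctor.reindex {Q : Type} [PartialOrder Q] {F : BurnsideDiagram P}
    (hF : F.IsTwoFunctor) (e : P ≃o Q) : (F.reindex e).IsTwoFunctor := by
  refine IsTwoFunctor.of_factor (fun v => ?_) hF.2.1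
    (fun x y f hv => hF.2.2.1 x y f (e.injective hv)) (fun x z f v hz hx => ?_)
    (fun x y y' z g h g' h' hv => hF.factor_unique (e.injective hv))
  · have := hF.1 (e.symm v)
    refine Finite.of_injective
      (fun x : {x : (F.reindex e).Gen // (F.reindex e).vert x = v} =>
        (⟨x.1, (e.symm_apply_eq.2 x.2.symm).symm⟩ : {x : F.Gen // F.vert x = e.symm v})) ?_
    intro x y h
    have h₁ := congrArg Subtype.val h
    exact Subtype.ext h₁
  · obtain ⟨y, g, h, hy, hf⟩ := hF.exists_factor f (v := e.symm v)
      ((OrderIso.le_symm_apply e).2 hz) ((OrderIso.symm_apply_le e).2 hx)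
    exact ⟨y, g, h, (e.symm_apply_eq.1 hy.symm).symm, hf⟩

theorem IsTwoFunctor.of_iso {F G : BurnsideDiagram P} (hF : F.IsTwoFunctor) (e : F.Iso G) :
    G.IsTwoFunctor := by
  refine IsTwoFunctor.of_factor (fun v => ?_) ?_ ?_ ?_ ?_
  · have := hF.1 v
    refine Finite.of_injective (fun x : {x : G.Gen // G.vert x = v} =>
      (⟨e.gen.symm x.1, by rw [← e.vert_gen, Equiv.apply_symm_apply, x.2]⟩ :
        {x : F.Gen // F.vert x = v})) ?_
    exact fun x y h => Subtype.ext (e.gen.symm.injective (congrArg Subtype.val h))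
  · intro x y
    obtain ⟨x, rfl⟩ := e.gen.surjective x
    obtain ⟨y, rfl⟩ := e.gen.surjective y
    have := hF.2.1 x y
    exact Finite.of_equiv _ e.hom
  · intro x y f hv
    obtain ⟨x, rfl⟩ := e.gen.surjective x
    obtain ⟨y, rfl⟩ := e.gen.surjective y
    obtain ⟨f, rfl⟩ := e.hom.surjective f
    have h := hF.2.2.1 x y f (by rw [← e.vert_gen, hv, e.vert_gen])
    obtain rfl : x = y := (congrArg (fun a : F.Arrow => a.2.1) h).symm
    obtain rfl := arrow_inj h
    rw [e.hom_id]
  · intro x z f v hz hx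
    obtain ⟨x, rfl⟩ := e.gen.surjective x
    obtain ⟨z, rfl⟩ := e.gen.surjective z
    obtain ⟨f, rfl⟩ := e.hom.surjective f
    rw [e.vert_gen] at hz hx
    obtain ⟨y, g, h, hy, rfl⟩ := hF.exists_factor f hz hx
    exact ⟨e.gen y, e.hom g, e.hom h, by rw [e.vert_gen, hy], (e.hom_comp g h).symm⟩
  · intro x y y' z g h g' h' hv he
    obtain ⟨x, rfl⟩ := e.gen.surjective x
    obtain ⟨y, rfl⟩ := e.gen.surjective y
    obtain ⟨y', rfl⟩ := e.gen.surjective y'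
    obtain ⟨z, rfl⟩ := e.gen.surjective z
    obtain ⟨g, rfl⟩ := e.hom.surjective g
    obtain ⟨h, rfl⟩ := e.hom.surjective h
    obtain ⟨g', rfl⟩ := e.hom.surjective g'
    obtain ⟨h', rfl⟩ := e.hom.surjective h'
    rw [← e.hom_comp, ← e.hom_comp] at he
    have := hF.factor_unique (by rw [← e.vert_gen, hv, e.vert_gen]) (e.hom.injective he)
    cases this
    rfl

/-- The bijections of the correspondences are indexed by elements of `F`, so their inverses have to
be transported along `gen (gen.symm X) = X`. By `key₂` the transport becomes invisible when elements
are compared as arrows. -/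
theorem Iso.exists_symm {F G : BurnsideDiagram P} (e : F.Iso G) : Nonempty (G.Iso F) := by
  have key : ∀ {X Y : G.Gen}, Function.Bijective
      (fun f : F.Hom (e.gen.symm X) (e.gen.symm Y) =>
        (cast (by rw [Equiv.apply_symm_apply, Equiv.apply_symm_apply]) (e.hom f) : G.Hom X Y)) := by
    intro X Y
    exact (cast_bijective _).comp e.hom.bijective
  let hom : ∀ {X Y : G.Gen}, G.Hom X Y ≃ F.Hom (e.gen.symm X) (e.gen.symm Y) :=
    fun {X Y} => (Equiv.ofBijective _ key).symm
  have key₂ : ∀ {x y : F.Gen} (X Y : G.Gen) (hX : X = e.gen x) (hY : Y = e.gen y)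
      (f : F.Hom x y), F.arrow (hom (X := X) (Y := Y) (hX ▸ hY ▸ e.hom f)) = F.arrow f := by
    rintro x y _ _ rfl rfl f
    have hx : e.gen.symm (e.gen x) = x := e.gen.symm_apply_apply x
    have hy : e.gen.symm (e.gen y) = y := e.gen.symm_apply_apply y
    have : hom (X := e.gen x) (Y := e.gen y) (e.hom f) = cast (by rw [hx, hy]) f := by
      rw [Equiv.symm_apply_eq]
      change e.hom f = cast _ (e.hom (cast _ f))
      generalize_proofs p₁ p₂
      revert p₁ p₂
      rw [hx, hy]
      intro p₁ p₂
      rfl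
    change F.arrow (hom (X := e.gen x) (Y := e.gen y) (e.hom f)) = _
    rw [this]
    generalize_proofs p₁
    revert p₁
    rw [hx, hy]
    intro p₁
    rfl
  refine ⟨⟨e.gen.symm, fun X => by rw [← e.vert_gen, Equiv.apply_symm_apply], hom, ?_, ?_⟩⟩
  · intro X
    obtain ⟨x, rfl⟩ := e.gen.surjective X
    apply arrow_inj
    have := key₂ (e.gen x) (e.gen x) rfl rfl (F.id x)
    simp only [e.hom_id] at this
    rw [this]
    exact F.arrow_id_eq (e.gen.symm_apply_apply x).symm
  · intro X Y Z f g
    obtain ⟨x, rfl⟩ := e.gen.surjective X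
    obtain ⟨y, rfl⟩ := e.gen.surjective Y
    obtain ⟨z, rfl⟩ := e.gen.surjective Z
    obtain ⟨f, rfl⟩ := e.hom.surjective f
    obtain ⟨g, rfl⟩ := e.hom.surjective g
    apply arrow_inj
    rw [← e.hom_comp]
    exact (key₂ _ _ rfl rfl (F.comp f g)).trans
      (F.arrow_comp_eq (key₂ _ _ rfl rfl f) (key₂ _ _ rfl rfl g)).symm

theorem CoprodHom.mk_injective {I : Type} {F : I → BurnsideDiagram P} {i : I} {x y : (F i).Gen}
    {f g : (F i).Hom x y} (h : (CoprodHom.mk f : CoprodHom F ⟨i, x⟩ ⟨i, y⟩) = .mk g) : f = g := by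
  cases h
  rfl

theorem CoprodHom.exists_mk {I : Type} {F : I → BurnsideDiagram P} {i : I} {x y : (F i).Gen}
    (f : CoprodHom F ⟨i, x⟩ ⟨i, y⟩) : ∃ g, CoprodHom.mk g = f := by
  cases f
  exact ⟨_, rfl⟩

/-- No element of a disjoint union connects two different summands, so factorizations of elements of
a summand stay inside it. In the end this is what makes the annular functors 2-functors. -/
theorem IsTwoFunctor.of_coprod {I : Type} {F : I → BurnsideDiagram P}
    (hF : (coprod F).IsTwoFunctor) (i : I) : (F i).IsTwoFunctor := by
  refine IsTwoFunctor.of_factor (fun v => ?_) ?_ ?_ ?_ ?_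
  · have := hF.1 v
    refine Finite.of_injective (fun x : {x : (F i).Gen // (F i).vert x = v} =>
      (⟨⟨i, x.1⟩, x.2⟩ : {x : (coprod F).Gen // (coprod F).vert x = v})) fun x y h => ?_
    have := congrArg Subtype.val h
    exact Subtype.ext (eq_of_heq (Sigma.mk.inj this).2)
  · intro x y
    have : Finite (CoprodHom F ⟨i, x⟩ ⟨i, y⟩) := hF.2.1 ⟨i, x⟩ ⟨i, y⟩
    exact Finite.of_injective (fun f => (.mk f : CoprodHom F ⟨i, x⟩ ⟨i, y⟩))
      fun f g => CoprodHom.mk_injective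
  · intro x y f hv
    have h := hF.2.2.1 ⟨i, x⟩ ⟨i, y⟩ (.mk f) hv
    have h₁ : (⟨i, y⟩ : Σ i, (F i).Gen) = ⟨i, x⟩ :=
      congrArg (fun a : (coprod F).Arrow => a.2.1) h
    obtain rfl : y = x := eq_of_heq (Sigma.mk.inj h₁).2
    rw [CoprodHom.mk_injective (arrow_inj h : CoprodHom.mk f = .mk ((F i).id y))]
  · intro x z f v hz hx
    obtain ⟨⟨k, y⟩, g, h, hy, e⟩ := hF.exists_factor (x := ⟨i, x⟩) (z := ⟨i, z⟩) (.mk f) hz hx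
    have g' : CoprodHom F ⟨i, x⟩ ⟨k, y⟩ := g
    obtain rfl : i = k := by cases g'; rfl
    obtain ⟨g, rfl⟩ := CoprodHom.exists_mk (F := F) (i := i) (x := x) (y := y) g
    obtain ⟨h, rfl⟩ := CoprodHom.exists_mk (F := F) (i := i) (x := y) (y := z) h
    exact ⟨y, g, h, hy, CoprodHom.mk_injective e⟩
  · intro x y y' z g h g' h' hv e
    have := hF.factor_unique (x := ⟨i, x⟩) (y := ⟨i, y⟩) (y' := ⟨i, y'⟩) (z := ⟨i, z⟩)
      (g := .mk g) (h := .mk h) (g' := .mk g') (h' := .mk h') hv (congrArg CoprodHom.mk e)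
    have h₁ : (⟨i, y⟩ : Σ i, (F i).Gen) = ⟨i, y'⟩ := congrArg Sigma.fst this
    obtain rfl : y = y' := eq_of_heq (Sigma.mk.inj h₁).2
    have h₂ := Prod.mk.inj (eq_of_heq (Sigma.mk.inj this).2)
    rw [CoprodHom.mk_injective h₂.1, CoprodHom.mk_injective h₂.2]

end BurnsideDiagram
-- Recognizing a disjoint union of functors by its edges and faces
namespace BurnsideDiagram

/-- The edge of a cube from `v` to `w` in the direction `c`. -/
def CubeEdge {ι : Type} (c : ι) (v w : ι → Bool) : Prop :=
  v c = true ∧ w c = false ∧ ∀ k, k ≠ c → w k = v k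

theorem CubeEdge.unique {ι : Type} {c : ι} {v w w' : ι → Bool} (h : CubeEdge c v w)
    (h' : CubeEdge c v w') : w = w' := by
  funext k
  by_cases hk : k = c
  · subst hk; rw [h.2.1, h'.2.1]
  · rw [h.2.2 k hk, h'.2.2 k hk]

theorem CubeEdge.le {ι : Type} {c : ι} {v w : ι → Bool} (h : CubeEdge c v w) : w ≤ v := by
  intro k
  by_cases hk : k = c
  · subst hk; rw [h.2.1]; exact Bool.false_le _
  · rw [h.2.2 k hk]

/-- A functor `G` on the cube is presented by a family of cube data if its sets and edge
correspondences are the disjoint unions of those of the data, and if the faces of the data are those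
of `G`. -/
structure Presentation {ι I : Type} (A : I → CubeData ι) (G : BurnsideDiagram (ι → Bool)) where
  gen : (Σ p, (A p).Gen) ≃ G.Gen
  vert_gen : ∀ p x, G.vert (gen ⟨p, x⟩) = (A p).vert x
  subsingleton : ∀ c X Y, CubeEdge c (G.vert X) (G.vert Y) → Subsingleton (G.Hom X Y)
  nonempty : ∀ {c p x y}, (A p).Step c x y → Nonempty (G.Hom (gen ⟨p, x⟩) (gen ⟨p, y⟩))
  step : ∀ {c p x Y}, CubeEdge c (G.vert (gen ⟨p, x⟩)) (G.vert Y) → G.Hom (gen ⟨p, x⟩) Y →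
    ∃ y, Y = gen ⟨p, y⟩ ∧ (A p).Step c x y
  face : ∀ {c d p x y y' z} (f : G.Hom (gen ⟨p, x⟩) (gen ⟨p, y⟩))
    (g : G.Hom (gen ⟨p, y⟩) (gen ⟨p, z⟩)) (f' : G.Hom (gen ⟨p, x⟩) (gen ⟨p, y'⟩))
    (g' : G.Hom (gen ⟨p, y'⟩) (gen ⟨p, z⟩)), (A p).Step c x y → (A p).Step d y z →
    (A p).Step d x y' → (A p).Step c y' z → G.comp f g = G.comp f' g' →
    (A p).Face c d x y y' z
  face_unique : ∀ {c d p x y₁ y₂ y' z}, (A p).Step c x y₁ → (A p).Step d y₁ z →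
    (A p).Step c x y₂ → (A p).Step d y₂ z → (A p).Step d x y' → (A p).Step c y' z →
    (A p).Face c d x y₁ y' z → (A p).Face c d x y₂ y' z → y₁ = y₂

namespace Presentation

open CubeData

variable {ι I : Type} {A : I → CubeData ι} {G : BurnsideDiagram (ι → Bool)}
  (R : Presentation A G)

theorem cubeEdge {c : ι} {p : I} {x y : (A p).Gen} (h : (A p).Step c x y) :
    CubeEdge c (G.vert (R.gen ⟨p, x⟩)) (G.vert (R.gen ⟨p, y⟩)) := by
  rw [R.vert_gen, R.vert_gen]
  exact (A p).vert_of_step h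

/-- The edge of `G` corresponding to an edge of the data. -/
noncomputable def edge {c : ι} {p : I} {x y : (A p).Gen} (h : (A p).Step c x y) :
    G.Hom (R.gen ⟨p, x⟩) (R.gen ⟨p, y⟩) := (R.nonempty h).some

/-- The element of `G` given by a sequence of edges. -/
noncomputable def eval {p : I} : ∀ {x y : (A p).Gen}, (A p).Path x y →
    G.Hom (R.gen ⟨p, x⟩) (R.gen ⟨p, y⟩)
  | _, _, .nil x => G.id _
  | _, _, .cons _ h q => G.comp (R.edge h) (eval q)

theorem eval_append {p : I} {x y z : (A p).Gen} (q : (A p).Path x y) (r : (A p).Path y z) :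
    R.eval (q.append r) = G.comp (R.eval q) (R.eval r) := by
  induction q with
  | nil => exact (G.id_comp _).symm
  | cons c h q ih =>
    change G.comp (R.edge h) (R.eval (q.append r)) = _
    rw [ih, ← G.assoc]
    rfl

/-- An element of `G` over a square factors through the other corner, and by `step` both halves are
edges of the data. Thus the 2-functor `G` provides the faces that the data are not assumed to have.
-/
theorem exists_face (hG : G.IsTwoFunctor) {c d : ι} {p : I} {x y z : (A p).Gen}
    (f : G.Hom (R.gen ⟨p, x⟩) (R.gen ⟨p, z⟩)) (h₁ : (A p).Step c x y) (h₂ : (A p).Step d y z) :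
    ∃ (y' : (A p).Gen) (k₁ : (A p).Step d x y') (k₂ : (A p).Step c y' z),
      G.comp (R.edge k₁) (R.edge k₂) = f := by
  classical
  have hcd := ne_of_steps h₁ h₂
  obtain ⟨a₁, a₂, a₃⟩ := (A p).vert_of_step h₁
  obtain ⟨b₁, b₂, b₃⟩ := (A p).vert_of_step h₂
  have e₁ : CubeEdge d ((A p).vert x) (Function.update ((A p).vert x) d false) := by
    refine ⟨?_, by simp, fun k hk => by simp [hk]⟩
    rw [← a₃ d hcd.symm, b₁]
  have e₂ : CubeEdge c (Function.update ((A p).vert x) d false) ((A p).vert z) := by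
    refine ⟨by simp [hcd, a₁], by rw [b₃ c hcd, a₂], fun k hk => ?_⟩
    by_cases hkd : k = d
    · subst hkd; simp [b₂]
    · simp [hkd, b₃ k hkd, a₃ k hk]
  rw [← R.vert_gen] at e₁ e₂
  rw [← R.vert_gen] at e₂
  obtain ⟨Y, g, h, hY, rfl⟩ := hG.exists_factor f e₂.le e₁.le
  rw [← hY] at e₁ e₂
  obtain ⟨y', rfl, k₁⟩ := R.step e₁ g
  obtain ⟨z', hz, k₂⟩ := R.step e₂ h
  obtain rfl : z = z' := eq_of_heq (Sigma.mk.inj (R.gen.injective hz)).2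
  refine ⟨y', k₁, k₂, ?_⟩
  rw [(R.subsingleton d _ _ e₁).elim (R.edge k₁) g, (R.subsingleton c _ _ e₂).elim (R.edge k₂) h]

theorem eval_eq_of_faceRel (hG : G.IsTwoFunctor) {p : I} {x y : (A p).Gen}
    {q r : (A p).Path x y} (h : FaceRel q r) : R.eval q = R.eval r := by
  induction h with
  | @face x y y' z w c d h₁ h₂ k₁ k₂ hf q =>
    change G.comp _ (G.comp _ _) = G.comp _ (G.comp _ _)
    rw [← G.assoc, ← G.assoc]
    congr 1
    -- The face of `G` carries the second chain to some chain over the same edges as the first. By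
    -- `face` this is a face of the data, and `face_unique` identifies the chain with the first one.
    obtain ⟨y'', l₁, l₂, e⟩ := R.exists_face hG (G.comp (R.edge k₁) (R.edge k₂)) k₁ k₂
    have hf' := R.face _ _ _ _ l₁ l₂ k₁ k₂ e
    obtain rfl := R.face_unique h₁ h₂ l₁ l₂ k₁ k₂ hf hf'
    exact e
  | cons h _ ih => exact congrArg (G.comp (R.edge h)) ih

/-- The comparison map from the disjoint union of the functors given by the data to `G`. -/
noncomputable def compare (hG : G.IsTwoFunctor) : ∀ {X Y : Σ p, (A p).Gen},
    CoprodHom (fun p => (A p).toDiagram) X Y → G.Hom (R.gen X) (R.gen Y)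
  | _, _, .mk f => Quot.lift R.eval (fun _ _ h => R.eval_eq_of_faceRel hG h) f

theorem compare_comp (hG : G.IsTwoFunctor) {X Y Z : Σ p, (A p).Gen}
    (f : CoprodHom (fun p => (A p).toDiagram) X Y) (g : CoprodHom (fun p => (A p).toDiagram) Y Z) :
    R.compare hG (f.comp g) = G.comp (R.compare hG f) (R.compare hG g) := by
  obtain ⟨⟨f⟩⟩ := f
  obtain ⟨⟨g⟩⟩ := g
  exact R.eval_append f g

theorem compare_surjective [Finite ι] (hG : G.IsTwoFunctor) {X Z : Σ p, (A p).Gen}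
    (f : G.Hom (R.gen X) (R.gen Z)) : ∃ q, R.compare hG (X := X) (Y := Z) q = f := by
  classical
  have := Fintype.ofFinite ι
  -- Induction on the number of coordinates that fall: one edge is split off by factoring through
  -- the vertex where a single coordinate has fallen.
  obtain ⟨n, hn⟩ : ∃ n, (Finset.univ.filter fun c : ι =>
    G.vert (R.gen X) c = true ∧ G.vert (R.gen Z) c = false).card = n := ⟨_, rfl⟩
  induction n generalizing X with
  | zero =>
    have hv : G.vert (R.gen X) = G.vert (R.gen Z) := by
      refine le_antisymm (fun c => ?_) (G.le_of_hom f)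
      rw [Finset.card_eq_zero, Finset.filter_eq_empty_iff] at hn
      have := hn (Finset.mem_univ c)
      cases hx : G.vert (R.gen X) c with
      | false => exact Bool.false_le _
      | true =>
        cases hz : G.vert (R.gen Z) c with
        | false => exact absurd ⟨hx, hz⟩ this
        | true => exact le_rfl
    have h := hG.2.2.1 _ _ f hv
    obtain rfl : Z = X := R.gen.injective (congrArg (fun a : G.Arrow => a.2.1) h)
    obtain rfl := arrow_inj h
    exact ⟨(coprod fun p => (A p).toDiagram).id Z, rfl⟩
  | succ n ih =>
    have hne : (Finset.univ.filter fun c : ι =>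
      G.vert (R.gen X) c = true ∧ G.vert (R.gen Z) c = false).Nonempty := by
      rw [← Finset.card_pos, hn]; omega
    obtain ⟨c, hc⟩ := hne
    have hc' := hc
    simp only [Finset.mem_filter, Finset.mem_univ, true_and] at hc'
    have e : CubeEdge c (G.vert (R.gen X)) (Function.update (G.vert (R.gen X)) c false) :=
      ⟨hc'.1, by simp, fun k hk => by simp [hk]⟩
    obtain ⟨Y, g, h, hY, rfl⟩ := hG.exists_factor f (v := Function.update (G.vert (R.gen X)) c false)
      (fun k => by
        by_cases hk : k = c
        · subst hk; rw [hc'.2]; exact Bool.false_le _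
        · simp only [Function.update_of_ne hk]; exact G.le_of_hom f k) e.le
    rw [← hY] at e
    obtain ⟨p, x⟩ := X
    obtain ⟨y, rfl, k⟩ := R.step e g
    obtain ⟨q, rfl⟩ := ih h (by
      rw [hY, ← Nat.add_right_cancel_iff (n := 1), ← hn, ← Finset.card_erase_add_one hc]
      congr 2
      ext a
      by_cases ha : a = c
      · subst ha; simp
      · simp [ha])
    refine ⟨(CoprodHom.mk (Quot.mk _ (.cons c k (.nil y)))).comp q, ?_⟩
    refine (R.compare_comp hG (Y := ⟨p, y⟩) (CoprodHom.mk (Quot.mk _ (.cons c k (.nil y)))) q).trans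
      (congrArg (fun g => G.comp g _) ?_)
    exact (R.subsingleton c _ _ e).elim _ _

/-- By means of faces, any direction of a sequence can be moved to its front without a change of the
class. -/
theorem exists_cons (R : Presentation A G) (hG : G.IsTwoFunctor) {p : I} {c : ι} {x z : (A p).Gen} (q : (A p).Path x z)
    (hc : c ∈ q.dirs) : ∃ (y : (A p).Gen) (h : (A p).Step c x y) (r : (A p).Path y z),
      (Quot.mk _ (.cons c h r) : Quot (@FaceRel ι (A p) x z)) = Quot.mk _ q := by
  induction q with
  | nil => simp [Path.dirs] at hc
  | @cons x y z d h q ih =>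
    by_cases hcd : c = d
    · subst hcd; exact ⟨y, h, q, rfl⟩
    · obtain ⟨y₁, k, r, e⟩ := ih ((List.mem_cons.1 hc).resolve_left hcd)
      obtain ⟨y₂, l₁, l₂, e'⟩ := R.exists_face hG (G.comp (R.edge h) (R.edge k)) h k
      refine ⟨y₂, l₁, .cons d l₂ r, ?_⟩
      rw [← mk_cons h e]
      exact Quot.sound (FaceRel.face l₁ l₂ h k (R.face _ _ _ _ l₁ l₂ h k e') r)

/-- The second sequence is rearranged so that it starts in the same direction as the first. Unique
factorization in `G` then identifies the middle elements and the values of the two remainders, and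
the induction goes on. -/
theorem mk_eq_of_eval_eq (hG : G.IsTwoFunctor) {p : I} {x z : (A p).Gen} (q : (A p).Path x z) :
    ∀ r : (A p).Path x z, R.eval q = R.eval r →
      (Quot.mk _ q : Quot (@FaceRel ι (A p) x z)) = Quot.mk _ r := by
  induction q with
  | nil x =>
    intro r _
    cases r with
    | nil => rfl
    | cons c h r =>
      have h₁ := ((Path.cons c h r).mem_dirs c).1 (List.mem_cons_self ..)
      rw [h₁.1] at h₁
      exact absurd h₁.2 (by decide)
  | @cons x y z c h q ih =>
    intro r hr
    have hc : c ∈ r.dirs := (r.mem_dirs c).2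
      (((Path.cons c h q).mem_dirs c).1 (List.mem_cons_self ..))
    obtain ⟨y', h', r', e⟩ := R.exists_cons hG r hc
    have e₁ : R.eval (.cons c h' r') = R.eval r :=
      congrArg (Quot.lift R.eval (fun _ _ h => R.eval_eq_of_faceRel hG h)) e
    rw [← e₁] at hr
    have hv := (R.cubeEdge h).unique (R.cubeEdge h')
    have h₂ := hG.factor_unique hv hr
    have h₃ : R.gen ⟨p, y⟩ = R.gen ⟨p, y'⟩ := congrArg Sigma.fst h₂
    obtain rfl : y = y' := eq_of_heq (Sigma.mk.inj (R.gen.injective h₃)).2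
    have h₄ : R.eval q = R.eval r' := (Prod.mk.inj (eq_of_heq (Sigma.mk.inj h₂).2)).2
    rw [← e]
    exact mk_cons h (ih r' h₄)

theorem compare_injective (hG : G.IsTwoFunctor) {X Z : Σ p, (A p).Gen} :
    Function.Injective (R.compare hG (X := X) (Y := Z)) := by
  rintro f g h
  obtain ⟨⟨f⟩⟩ := f
  obtain ⟨⟨g⟩, rfl⟩ := g.exists_mk
  exact congrArg CoprodHom.mk (R.mk_eq_of_eval_eq hG f g h)

/-- A functor is isomorphic to the disjoint union of the functors given by a presentation. -/
theorem nonempty_iso [Finite ι] (R : Presentation A G) (hG : G.IsTwoFunctor) :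
    Nonempty ((coprod fun p => (A p).toDiagram).Iso G) :=
  ⟨{ gen := R.gen
     vert_gen := fun x => R.vert_gen x.1 x.2
     hom := Equiv.ofBijective (R.compare hG)
      ⟨R.compare_injective hG, fun f => R.compare_surjective hG f⟩
     hom_id := fun _ => rfl
     hom_comp := fun f g => R.compare_comp hG f g }⟩

end Presentation
end BurnsideDiagram
-- Cycles of a permutation multiplied with a transposition
section Perm
open Equiv Equiv.Perm
variable {α : Type*} [DecidableEq α]

/-- The two permutations move a point along the same orbit as long as this orbit does not enter `a`
or `b`. -/
theorem swap_mul_pow_eq (σ : Perm α) (a b e : α) (n : ℕ)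
    (h : ∀ t, t < n → (σ ^ (t + 1)) e ≠ a ∧ (σ ^ (t + 1)) e ≠ b) :
    ((swap a b * σ) ^ n) e = (σ ^ n) e := by
  induction n with
  | zero => rfl
  | succ n ih =>
    rw [pow_succ', Perm.mul_apply, ih fun t ht => h t (ht.trans (Nat.lt_succ_self n)),
      Perm.mul_apply, ← Perm.mul_apply σ, ← pow_succ']
    exact swap_apply_of_ne_of_ne (h n (Nat.lt_succ_self n)).1 (h n (Nat.lt_succ_self n)).2

/-- The joining of the cycles of `a` and `b`. -/
def JoinRel (σ : Perm α) (a b e f : α) : Prop :=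
  σ.SameCycle e f ∨ ((σ.SameCycle e a ∨ σ.SameCycle e b) ∧ (σ.SameCycle f a ∨ σ.SameCycle f b))

theorem joinRel_of_sameCycle_swap_mul [Finite α] (σ : Perm α) (a b : α) {e f : α}
    (h : (swap a b * σ).SameCycle e f) : JoinRel σ a b e f := by
  obtain ⟨n, -, rfl⟩ := h.exists_pow_eq'
  clear h
  induction n with
  | zero => exact Or.inl (SameCycle.refl _ _)
  | succ n ih =>
    rw [pow_succ', Perm.mul_apply]
    generalize ((swap a b * σ) ^ n) e = g at ih
    rw [Perm.mul_apply]
    have hg : σ.SameCycle g (σ g) := ⟨1, rfl⟩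
    have h₁ : JoinRel σ a b e (σ g) := by
      rcases ih with h | ⟨h₁, h₂⟩
      · exact Or.inl (h.trans hg)
      · exact Or.inr ⟨h₁, h₂.imp hg.symm.trans hg.symm.trans⟩
    have key : (σ g = a ∨ σ g = b) → σ.SameCycle e a ∨ σ.SameCycle e b := by
      rintro h
      rcases h₁ with h' | ⟨h', -⟩
      · rcases h with h | h <;> rw [h] at h'
        · exact Or.inl h'
        · exact Or.inr h'
      · exact h'
    by_cases ha : σ g = a
    · rw [ha, swap_apply_left]
      exact Or.inr ⟨key (Or.inl ha), Or.inr (SameCycle.refl _ _)⟩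
    · by_cases hb : σ g = b
      · rw [hb, swap_apply_right]
        exact Or.inr ⟨key (Or.inr hb), Or.inl (SameCycle.refl _ _)⟩
      · rwa [swap_apply_of_ne_of_ne ha hb]

/-- Up to the first arrival at `a` the orbit of `e` does not change, since it cannot meet `b`; the
transposition diverts this arrival to `b`. -/
theorem sameCycle_swap_mul_of_sameCycle [Finite α] (σ : Perm α) {a b e : α}
    (hab : ¬ σ.SameCycle a b) (h : σ.SameCycle e a) : (swap a b * σ).SameCycle e b := by
  obtain ⟨n, hn, -, h'⟩ := h.exists_pow_eq''
  have hex : ∃ n, (σ ^ (n + 1)) e = a := ⟨n - 1, by rwa [Nat.sub_add_cancel hn]⟩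
  classical
  refine ⟨(Nat.find hex + 1 : ℕ), ?_⟩
  rw [zpow_natCast, pow_succ', Perm.mul_apply, swap_mul_pow_eq, Perm.mul_apply,
    ← Perm.mul_apply σ, ← pow_succ', Nat.find_spec hex, swap_apply_left]
  intro t ht
  refine ⟨Nat.find_min hex ht, fun hb => hab ?_⟩
  have : σ.SameCycle e b := ⟨(t + 1 : ℕ), by rw [zpow_natCast]; exact hb⟩
  exact h.symm.trans this

/-- Multiplication with a transposition of elements of different cycles joins the two cycles. -/
theorem sameCycle_swap_mul_iff [Finite α] (σ : Perm α) {a b : α} (hab : ¬ σ.SameCycle a b)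
    (e f : α) : (swap a b * σ).SameCycle e f ↔ JoinRel σ a b e f := by
  refine ⟨joinRel_of_sameCycle_swap_mul σ a b, fun h => ?_⟩
  have h₁ : ∀ e, σ.SameCycle e a → (swap a b * σ).SameCycle e b :=
    fun e => sameCycle_swap_mul_of_sameCycle σ hab
  have h₂ : ∀ e, σ.SameCycle e b → (swap a b * σ).SameCycle e a := fun e he => by
    rw [swap_comm]
    exact sameCycle_swap_mul_of_sameCycle σ (fun h => hab h.symm) he
  have h₃ : ∀ e, (σ.SameCycle e a ∨ σ.SameCycle e b) → (swap a b * σ).SameCycle e a := by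
    rintro e (he | he)
    · exact (h₁ e he).trans (h₂ b (SameCycle.refl _ _))
    · exact h₂ e he
  by_cases he : σ.SameCycle e a ∨ σ.SameCycle e b
  · refine (h₃ e he).trans (h₃ f ?_).symm
    rcases h with h | ⟨-, h⟩
    · exact he.imp h.symm.trans h.symm.trans
    · exact h
  · obtain ⟨n, -, rfl⟩ := (h.resolve_right fun h => he h.1).exists_pow_eq'
    refine ⟨(n : ℕ), ?_⟩
    rw [zpow_natCast]
    refine swap_mul_pow_eq σ a b e n fun t _ => ⟨fun h => he ?_, fun h => he ?_⟩
    · exact Or.inl ⟨(t + 1 : ℕ), by rw [zpow_natCast]; exact h⟩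
    · exact Or.inr ⟨(t + 1 : ℕ), by rw [zpow_natCast]; exact h⟩

/-- Multiplication with a transposition of elements of the same cycle separates them. -/
theorem not_sameCycle_swap_mul [Finite α] (σ : Perm α) {a b : α} (hne : a ≠ b)
    (hab : σ.SameCycle a b) : ¬ (swap a b * σ).SameCycle a b := by
  classical
  obtain ⟨n, hn, -, h'⟩ := hab.exists_pow_eq''
  have hex : ∃ n, (σ ^ (n + 1)) a = b := ⟨n - 1, by rwa [Nat.sub_add_cancel hn]⟩
  -- `m + 1` is the first time at which the orbit of `a` reaches `b`. The new permutation is back at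
  -- `a` at this time, so that its cycle through `a` consists of earlier points only and misses `b`.
  obtain ⟨m, hm, hmin⟩ : ∃ m, (σ ^ (m + 1)) a = b ∧ ∀ t < m, (σ ^ (t + 1)) a ≠ b :=
    ⟨Nat.find hex, Nat.find_spec hex, fun t ht => Nat.find_min hex ht⟩
  have ha : ∀ t < m, (σ ^ (t + 1)) a ≠ a := by
    intro t ht h
    apply hmin (m - t - 1) (by omega)
    have e : σ ^ (m + 1) = σ ^ (m - t - 1 + 1) * σ ^ (t + 1) := by
      rw [← pow_add]; congr 1; omega
    rw [← hm, e, Perm.mul_apply, h]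
  have hp : ∀ t ≤ m, ((swap a b * σ) ^ t) a = (σ ^ t) a := fun t ht =>
    swap_mul_pow_eq σ a b a t fun s hs => ⟨ha s (by omega), hmin s (by omega)⟩
  have hper : ((swap a b * σ) ^ (m + 1)) a = a := by
    rw [pow_succ', Perm.mul_apply, hp m le_rfl, Perm.mul_apply, ← Perm.mul_apply σ, ← pow_succ',
      hm, swap_apply_right]
  intro h
  obtain ⟨k, -, hk⟩ := h.exists_pow_eq'
  have hmul : ∀ q, ((swap a b * σ) ^ ((m + 1) * q)) a = a := by
    intro q
    induction q with
    | zero => rfl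
    | succ q ih => rw [Nat.mul_succ, pow_add, Perm.mul_apply, hper, ih]
  rw [← Nat.mod_add_div k (m + 1), pow_add, Perm.mul_apply, hmul,
    hp _ (by have := Nat.mod_lt k (show 0 < m + 1 by omega); omega)] at hk
  rcases Nat.eq_zero_or_pos (k % (m + 1)) with h0 | h0
  · rw [h0] at hk; exact hne hk
  · refine hmin (k % (m + 1) - 1) (by have := Nat.mod_lt k (show 0 < m + 1 by omega); omega) ?_
    rwa [Nat.sub_add_cancel h0]

end Perm

/-! ### Circles as cycles of a permutation; surgery merges or splits -/

namespace LinkDiagram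

variable (D : LinkDiagram)

theorem vtx_rot (h : D.Dart) : D.vtx (D.rot h) = D.vtx h :=
  (Quot.sound (r := fun a b : D.Dart => b = D.rot a) rfl).symm

theorem vtx_rot_symm (h : D.Dart) : D.vtx (D.rot.symm h) = D.vtx h := by
  rw [← D.vtx_rot, Equiv.apply_symm_apply]

theorem rot_symm_eq (h : D.Dart) : D.rot.symm h = D.rot (D.rot (D.rot h)) := by
  rw [Equiv.symm_apply_eq, D.rot_four]

theorem isOver_rot_symm (h : D.Dart) : D.isOver (D.rot.symm h) = !D.isOver h := by
  have := D.isOver_rot (D.rot.symm h)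
  rw [Equiv.apply_symm_apply] at this
  rw [this, Bool.not_not]

theorem isOver_rot_rot (h : D.Dart) : D.isOver (D.rot (D.rot h)) = D.isOver h := by
  rw [D.isOver_rot, D.isOver_rot, Bool.not_not]

theorem eq_of_vtx_eq {a b : D.Dart} (h : D.vtx b = D.vtx a) :
    b = a ∨ b = D.rot a ∨ b = D.rot (D.rot a) ∨ b = D.rot (D.rot (D.rot a)) := by
  have h₁ := Quot.eqvGen_exact h
  clear h
  induction h₁ with
  | rel x y h =>
    subst h
    exact Or.inr (Or.inr (Or.inr (D.rot_four x).symm))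
  | refl x => exact Or.inl rfl
  | symm x y _ ih =>
    rcases ih with h | h | h | h
    · exact Or.inl h.symm
    · exact Or.inr (Or.inr (Or.inr (by rw [h, D.rot_four])))
    · exact Or.inr (Or.inr (Or.inl (by rw [h, D.rot_four])))
    · exact Or.inr (Or.inl (by rw [h, D.rot_four]))
  | trans x y z _ _ ih₁ ih₂ =>
    rcases ih₁ with rfl | rfl | rfl | rfl <;> rcases ih₂ with rfl | rfl | rfl | rfl <;>
      simp [D.rot_four]

theorem vtx_smooth (v : D.State) (h : D.Dart) : D.vtx (D.smooth v h) = D.vtx h := by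
  unfold smooth
  split
  · exact D.vtx_rot h
  · exact D.vtx_rot_symm h

theorem isOver_smooth (v : D.State) (h : D.Dart) : D.isOver (D.smooth v h) = !D.isOver h := by
  unfold smooth
  split
  · exact D.isOver_rot h
  · exact D.isOver_rot_symm h

theorem smooth_smooth (v : D.State) (h : D.Dart) : D.smooth v (D.smooth v h) = h := by
  rw [smooth, D.isOver_smooth, D.vtx_smooth]
  unfold smooth
  by_cases hv : D.isOver h = v (D.vtx h)
  · rw [if_pos hv, hv, if_neg (by simp), Equiv.symm_apply_apply]
  · rw [if_neg hv, if_pos (by revert hv; cases D.isOver h <;> cases v (D.vtx h) <;> simp),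
      Equiv.apply_symm_apply]

theorem smooth_rot_rot (v : D.State) (h : D.Dart) :
    D.smooth v (D.rot (D.rot h)) = D.rot (D.rot (D.smooth v h)) := by
  unfold smooth
  rw [D.isOver_rot_rot, D.vtx_rot, D.vtx_rot]
  split
  · rfl
  · rw [Equiv.symm_apply_apply, Equiv.apply_symm_apply]

/-- Two darts lie on the same circle of a resolution. -/
def Conn (v : D.State) (a b : D.Dart) : Prop := D.circ v a = D.circ v b

variable {D}

theorem Conn.refl (v : D.State) (a : D.Dart) : D.Conn v a a := rfl

theorem Conn.symm {v : D.State} {a b : D.Dart} (h : D.Conn v a b) : D.Conn v b a := Eq.symm h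

theorem Conn.trans {v : D.State} {a b c : D.Dart} (h : D.Conn v a b) (h' : D.Conn v b c) :
    D.Conn v a c := Eq.trans h h'

theorem conn_edge (v : D.State) (a : D.Dart) : D.Conn v a (D.edge a) := Quot.sound (Or.inl rfl)

theorem conn_smooth (v : D.State) (a : D.Dart) : D.Conn v a (D.smooth v a) :=
  Quot.sound (Or.inr rfl)

theorem Conn.lift {v : D.State} {α : Sort*} (f : D.Dart → α) (he : ∀ a, f (D.edge a) = f a)
    (hs : ∀ a, f (D.smooth v a) = f a) {a b : D.Dart} (h : D.Conn v a b) : f a = f b :=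
  congrArg (Quot.lift f (by rintro a _ (rfl | rfl); exacts [(he a).symm, (hs a).symm])) h

theorem KhGen.label_conn (x : D.KhGen) {a b : D.Dart} (h : D.Conn x.state a b) :
    x.label a = x.label b :=
  h.lift x.label x.label_edge x.label_smooth

variable (D)

/-- A checkerboard colouring of the regions; `col h` tells whether the region to the left of `h` is
black. -/
structure Coloring where
  col : D.Dart → Bool
  col_edge : ∀ h, col (D.edge h) = !col h
  col_rot : ∀ h, col (D.rot h) = !col h

variable {D} (κ : D.Coloring)

namespace Coloring

theorem col_rot_rot (h : D.Dart) : κ.col (D.rot (D.rot h)) = κ.col h := by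
  rw [κ.col_rot, κ.col_rot, Bool.not_not]

theorem col_rot_symm (h : D.Dart) : κ.col (D.rot.symm h) = !κ.col h := by
  have := κ.col_rot (D.rot.symm h)
  rw [Equiv.apply_symm_apply] at this
  rw [this, Bool.not_not]

theorem col_smooth (v : D.State) (h : D.Dart) : κ.col (D.smooth v h) = !κ.col h := by
  unfold smooth
  split
  · exact κ.col_rot h
  · exact κ.col_rot_symm h

/-- The darts which have a black region to their left: those which point in the direction of the
circles, if these are oriented as the boundary of the black regions. -/
abbrev Out : Type := {h : D.Dart // κ.col h = true}

/-- The next dart along a circle. -/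
def next (v : D.State) : Equiv.Perm κ.Out where
  toFun h := ⟨D.smooth v (D.edge h.1), by rw [κ.col_smooth, κ.col_edge, Bool.not_not, h.2]⟩
  invFun h := ⟨D.edge (D.smooth v h.1), by rw [κ.col_edge, κ.col_smooth, Bool.not_not, h.2]⟩
  left_inv h := Subtype.ext (by simp only [D.smooth_smooth, D.edge_edge])
  right_inv h := Subtype.ext (by simp only [D.smooth_smooth, D.edge_edge])

/-- The dart on the same edge which has a black region to its left. -/
def outRep (h : D.Dart) : κ.Out :=
  if hc : κ.col h = true then ⟨h, hc⟩
  else ⟨D.edge h, by rw [κ.col_edge]; simpa using hc⟩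

theorem outRep_out (h : κ.Out) : κ.outRep h.1 = h := by
  simp [outRep, h.2]

theorem outRep_edge (h : D.Dart) : κ.outRep (D.edge h) = κ.outRep h := by
  unfold outRep
  by_cases hc : κ.col h = true
  · have : ¬ κ.col (D.edge h) = true := by rw [κ.col_edge, hc]; decide
    simp only [dif_neg this, dif_pos hc, D.edge_edge]
  · have : κ.col (D.edge h) = true := by rw [κ.col_edge]; simpa using hc
    simp only [dif_pos this, dif_neg hc]

theorem conn_outRep (v : D.State) (h : D.Dart) : D.Conn v h (κ.outRep h).1 := by
  unfold outRep
  split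
  · exact Conn.refl v h
  · exact conn_edge v h

theorem conn_next (v : D.State) (h : κ.Out) : D.Conn v h.1 (κ.next v h).1 :=
  (conn_edge v h.1).trans (conn_smooth v _)

/-- Each edge has exactly one dart with a black region on its left, and `next` runs through these
darts along the circles, oriented as boundaries of the black regions. -/
theorem conn_iff_sameCycle (v : D.State) (a b : D.Dart) :
    D.Conn v a b ↔ (κ.next v).SameCycle (κ.outRep a) (κ.outRep b) := by
  constructor
  · intro h
    have h₁ := h.lift (fun a => (Quotient.mk (Equiv.Perm.SameCycle.setoid (κ.next v)) (κ.outRep a)))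
      (fun a => by rw [outRep_edge]) (fun a => by
        apply Quotient.sound
        change (κ.next v).SameCycle _ _
        by_cases hc : κ.col a = true
        · have h₁ : κ.outRep a = ⟨a, hc⟩ := κ.outRep_out ⟨a, hc⟩
          have h₂ : κ.outRep (D.smooth v a) = κ.outRep (D.edge (D.smooth v a)) :=
            (κ.outRep_edge _).symm
          have h₃ : κ.col (D.edge (D.smooth v a)) = true := by
            rw [κ.col_edge, κ.col_smooth, Bool.not_not, hc]
          rw [h₁, h₂, κ.outRep_out ⟨_, h₃⟩]
          refine ⟨1, Subtype.ext ?_⟩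
          simp only [zpow_one, next, Equiv.coe_fn_mk, D.edge_edge, D.smooth_smooth]
        · have hc' : κ.col a = false := by simpa using hc
          have h₁ : κ.col (D.smooth v a) = true := by rw [κ.col_smooth, hc']; rfl
          have h₂ : κ.col (D.edge a) = true := by rw [κ.col_edge, hc']; rfl
          rw [← κ.outRep_edge a, κ.outRep_out ⟨_, h₁⟩, κ.outRep_out ⟨_, h₂⟩]
          refine Equiv.Perm.SameCycle.symm ⟨1, Subtype.ext ?_⟩
          simp only [zpow_one, next, Equiv.coe_fn_mk, D.edge_edge])
    exact Quotient.exact h₁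
  · intro h
    have := D.finite_dart
    have : Finite κ.Out := Subtype.finite
    obtain ⟨n, -, h⟩ := h.exists_pow_eq'
    have key : ∀ (n : ℕ) (e : κ.Out), D.Conn v e.1 ((κ.next v ^ n) e).1 := by
      intro n
      induction n with
      | zero => intro e; exact Conn.refl v _
      | succ n ih =>
        intro e
        rw [pow_succ', Equiv.Perm.mul_apply]
        exact (ih e).trans (κ.conn_next v _)
    refine (κ.conn_outRep v a).trans ((key n _).trans ?_)
    rw [h]
    exact (κ.conn_outRep v b).symm

end Coloring

/-- `v` and `w` differ exactly at `c`. -/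
def Flip (c : D.Vertex) (v w : D.State) : Prop := w c = !v c ∧ ∀ k, k ≠ c → w k = v k

theorem Flip.symm {c : D.Vertex} {v w : D.State} (h : Flip c v w) : Flip c w v :=
  ⟨by rw [h.1, Bool.not_not], fun k hk => (h.2 k hk).symm⟩

theorem Drop.flip {c : D.Vertex} {v w : D.State} (h : D.Drop c v w) : Flip c v w :=
  ⟨by rw [h.1, h.2.1]; rfl, h.2.2⟩

theorem smooth_flip_of_ne {c : D.Vertex} {v w : D.State} (h : Flip c v w) {a : D.Dart}
    (ha : D.vtx a ≠ c) : D.smooth w a = D.smooth v a := by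
  unfold smooth
  rw [h.2 _ ha]

theorem smooth_flip {c : D.Vertex} {v w : D.State} (h : Flip c v w) {a : D.Dart}
    (ha : D.vtx a = c) : D.smooth w a = D.rot (D.rot (D.smooth v a)) := by
  unfold smooth
  rw [ha, h.1]
  cases D.isOver a <;> cases v c <;> simp [D.rot_symm_eq, D.rot_four]

/-- The circle of `e` passes through the strands of `a` or of `rot (rot a)`. -/
def Touch (D : LinkDiagram) (v : D.State) (a e : D.Dart) : Prop :=
  D.Conn v e a ∨ D.Conn v e (D.rot (D.rot a))

open Classical in
-- Two strands of the resolution leave the crossing, along `a` and along `rot (rot a)`. The other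
-- resolution exchanges the darts along which they leave.
theorem Coloring.next_flip {c : D.Vertex} {v w : D.State} (h : Flip c v w) {a : κ.Out}
    (ha : D.vtx a.1 = c) :
    κ.next w = Equiv.swap a ⟨D.rot (D.rot a.1), by rw [κ.col_rot_rot, a.2]⟩ * κ.next v := by
  ext e
  rw [Equiv.Perm.mul_apply]
  by_cases he : D.vtx (D.edge e.1) = c
  · have h₁ : (κ.next w e).1 = D.rot (D.rot (κ.next v e).1) := smooth_flip h he
    have h₂ : D.vtx (κ.next v e).1 = D.vtx a.1 := by
      rw [ha, ← he]; exact D.vtx_smooth v _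
    have h₃ : κ.next v e = a ∨ κ.next v e = ⟨D.rot (D.rot a.1), by rw [κ.col_rot_rot, a.2]⟩ := by
      have hc := (κ.next v e).2
      rcases D.eq_of_vtx_eq h₂ with h | h | h | h
      · exact Or.inl (Subtype.ext h)
      · rw [h, κ.col_rot, a.2] at hc; exact absurd hc (by decide)
      · exact Or.inr (Subtype.ext h)
      · rw [h, κ.col_rot, κ.col_rot_rot, a.2] at hc; exact absurd hc (by decide)
    rcases h₃ with h₃ | h₃
    · rw [h₁, h₃, Equiv.swap_apply_left]
    · rw [h₁, h₃, Equiv.swap_apply_right, D.rot_four]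
  · have h₁ : κ.next w e = κ.next v e := Subtype.ext (smooth_flip_of_ne h he)
    have h₂ : D.vtx (κ.next v e).1 ≠ c := by
      rw [← show D.vtx (κ.next v e).1 = D.vtx (D.edge e.1) from D.vtx_smooth v _] at he
      exact he
    rw [h₁, Equiv.swap_apply_of_ne_of_ne]
    · intro h'; rw [h'] at h₂; exact h₂ ha
    · intro h'; rw [h'] at h₂; exact h₂ (by rw [D.vtx_rot, D.vtx_rot, ha])

/-- A dart can be replaced with the one joined to it, which has the other colour. With
`touch_smooth_iff` this reduces statements about a crossing to its black darts. -/
theorem conn_smooth_iff (v : D.State) (a : D.Dart) :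
    D.Conn v a (D.rot (D.rot a)) ↔
      D.Conn v (D.smooth v a) (D.rot (D.rot (D.smooth v a))) := by
  have h₁ := conn_smooth v a
  have h₂ := conn_smooth v (D.rot (D.rot a))
  rw [D.smooth_rot_rot] at h₂
  exact ⟨fun h => h₁.symm.trans (h.trans h₂), fun h => h₁.trans (h.trans h₂.symm)⟩

theorem touch_smooth_iff (v : D.State) (a e : D.Dart) :
    D.Touch v a e ↔ D.Touch v (D.smooth v a) e := by
  have h₁ := conn_smooth v a
  have h₂ := conn_smooth v (D.rot (D.rot a))
  rw [D.smooth_rot_rot] at h₂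
  exact or_congr ⟨fun h => h.trans h₁, fun h => h.trans h₁.symm⟩
    ⟨fun h => h.trans h₂, fun h => h.trans h₂.symm⟩

theorem conn_flip_merge_aux (κ : D.Coloring) {c : D.Vertex} {v w : D.State} (h : Flip c v w) {a : D.Dart}
    (ha : D.vtx a = c) (hcol : κ.col a = true) (hv : ¬ D.Conn v a (D.rot (D.rot a)))
    (e f : D.Dart) :
    D.Conn w e f ↔ D.Conn v e f ∨ (D.Touch v a e ∧ D.Touch v a f) := by
  classical
  have := D.finite_dart
  have : Finite κ.Out := Subtype.finite
  have h₁ := κ.next_flip h (a := ⟨a, hcol⟩) ha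
  have ha' : κ.outRep a = ⟨a, hcol⟩ := κ.outRep_out ⟨a, hcol⟩
  have hcol' : κ.col (D.rot (D.rot a)) = true := by rw [κ.col_rot_rot, hcol]
  have ha'' : κ.outRep (D.rot (D.rot a)) = ⟨_, hcol'⟩ := κ.outRep_out ⟨_, hcol'⟩
  unfold Touch
  rw [κ.conn_iff_sameCycle, ha', ha''] at hv
  simp only [κ.conn_iff_sameCycle, ha', ha'']
  rw [h₁, sameCycle_swap_mul_iff _ hv]
  rfl

theorem conn_flip_split_aux (κ : D.Coloring) {c : D.Vertex} {v w : D.State} (h : Flip c v w) {a : D.Dart}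
    (ha : D.vtx a = c) (hcol : κ.col a = true) (hne : D.rot (D.rot a) ≠ a)
    (hv : D.Conn v a (D.rot (D.rot a))) : ¬ D.Conn w a (D.rot (D.rot a)) := by
  classical
  have := D.finite_dart
  have : Finite κ.Out := Subtype.finite
  have h₁ := κ.next_flip h (a := ⟨a, hcol⟩) ha
  have ha' : κ.outRep a = ⟨a, hcol⟩ := κ.outRep_out ⟨a, hcol⟩
  have hcol' : κ.col (D.rot (D.rot a)) = true := by rw [κ.col_rot_rot, hcol]
  have ha'' : κ.outRep (D.rot (D.rot a)) = ⟨_, hcol'⟩ := κ.outRep_out ⟨_, hcol'⟩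
  rw [κ.conn_iff_sameCycle, ha', ha''] at hv
  rw [κ.conn_iff_sameCycle, ha', ha'', h₁]
  exact not_sameCycle_swap_mul _ (fun h => hne (congrArg Subtype.val h).symm) hv

/-- Surgery along an arc joining two circles merges them. -/
theorem conn_flip_merge (κ : D.Coloring) {c : D.Vertex} {v w : D.State} (h : Flip c v w) {a : D.Dart}
    (ha : D.vtx a = c) (hv : ¬ D.Conn v a (D.rot (D.rot a))) (e f : D.Dart) :
    D.Conn w e f ↔ D.Conn v e f ∨ (D.Touch v a e ∧ D.Touch v a f) := by
  by_cases hcol : κ.col a = true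
  · exact conn_flip_merge_aux κ h ha hcol hv e f
  · rw [touch_smooth_iff v a e, touch_smooth_iff v a f]
    rw [conn_smooth_iff] at hv
    exact conn_flip_merge_aux κ h (by rw [D.vtx_smooth, ha])
      (by rw [κ.col_smooth]; simpa using hcol) hv e f

/-- Surgery along an arc with both ends on the same circle splits it. -/
theorem conn_flip_split (κ : D.Coloring) {c : D.Vertex} {v w : D.State} (h : Flip c v w) {a : D.Dart}
    (ha : D.vtx a = c) (hne : D.rot (D.rot a) ≠ a) (hv : D.Conn v a (D.rot (D.rot a))) :
    ¬ D.Conn w a (D.rot (D.rot a)) := by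
  by_cases hcol : κ.col a = true
  · exact conn_flip_split_aux κ h ha hcol hne hv
  · rw [conn_smooth_iff] at hv ⊢
    rw [smooth_flip h ha, D.rot_four]
    have := conn_flip_split_aux κ h (a := D.smooth v a) (by rw [D.vtx_smooth, ha])
      (by rw [κ.col_smooth]; simpa using hcol) (by
        rw [← D.smooth_rot_rot]
        exact fun h => hne (by rw [← D.smooth_smooth v (D.rot (D.rot a)), h, D.smooth_smooth])) hv
    exact fun h => this h.symm

end LinkDiagram
-- Surgery on labelled partitions
variable {δ β0 β1 β2 β3 : Type}

/-- The partition `c'` (into the fibres) is obtained from `c` by merging the blocks of `a`, `a'`. -/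
def Joins {β γ : Type} (c : δ → β) (c' : δ → γ) (a a' : δ) : Prop :=
  c a ≠ c a' ∧ ∀ e f, c' e = c' f ↔
    c e = c f ∨ ((c e = c a ∨ c e = c a') ∧ (c f = c a ∨ c f = c a'))

/-- A labelling of the blocks of a partition by `0` and `1`. -/
def IsLabelling {β : Type} (c : δ → β) (f : δ → ℤ) : Prop :=
  (∀ e g, c e = c g → f e = f g) ∧ ∀ e, f e = 0 ∨ f e = 1

/-- The labelling `f'` occurs in the image of `f` under the map of the surgery that merges the blocks
of `a`, `a'`, or splits the block of `a` into those of `a`, `a'`. -/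
def Pants {β γ : Type} (c : δ → β) (c' : δ → γ) (a a' : δ) (f f' : δ → ℤ) : Prop :=
  (Joins c c' a a' ∧ f' a = f a + f a' ∧ ∀ h, c h ≠ c a → c h ≠ c a' → f' h = f h) ∨
  (Joins c' c a a' ∧ f' a + f' a' = f a + 1 ∧ ∀ h, c' h ≠ c' a → c' h ≠ c' a' → f' h = f h)

/-- The finitely many instances of the merge condition that a face involves, in a form suited to
`grind`. -/
theorem Joins.pairs {β γ : Type} {c : δ → β} {c' : δ → γ} {a a' : δ} (h : Joins c c' a a')
   (b b' : δ) : c a ≠ c a' ∧ c' a = c' a' ∧ 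
    (c' a = c' b ↔ c a = c b ∨ c a' = c b) ∧ (c' a = c' b' ↔ c a = c b' ∨ c a' = c b') ∧
    (c' b = c' b' ↔ c b = c b' ∨ ((c b = c a ∨ c b = c a') ∧ (c b' = c a ∨ c b' = c a'))) := by
  have := h.2
  refine ⟨h.1, ?_, ?_, ?_, ?_⟩ <;> grind

/-- When the other order begins with a merge, the middle labelling is forced: the merged block
carries the sum of the two labels. That this sum is at most one (`hv`), and that the result fits the
remaining surgery, is a finite check over the types of the surgeries. -/
theorem Pants.exists_swap_merge {c0 : δ → β0} {ci : δ → β1} {cj : δ → β2} {cij : δ → β3} {a a' b b' : δ}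
   {f0 fi fij : δ → ℤ} (h0 : IsLabelling c0 f0) (hi : IsLabelling ci fi)
   (hij : IsLabelling cij fij) (Pi : Pants c0 ci a a' f0 fi) (Pj : Pants ci cij b b' fi fij)
   (Jj : Joins c0 cj b b') (Jij : Joins cj cij a a' ∨ Joins cij cj a a') :
   ∃ fj, IsLabelling cj fj ∧ Pants c0 cj b b' f0 fj ∧ Pants cj cij a a' fj fij := by
  classical
  obtain ⟨f0c, f0v⟩ := h0
  obtain ⟨fic, fiv⟩ := hi
  obtain ⟨fijc, fijv⟩ := hij
  have hv : f0 b + f0 b' = 0 ∨ f0 b + f0 b' = 1 := by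
    have e3 := Jj.pairs a a'
    have := f0v b
    have := f0v b'
    have := fiv b
    have := fiv b'
    have := fijv b
    have := fiv a
    have := fiv a'
    rcases Pi with ⟨J1, s1, o1⟩ | ⟨J1, s1, o1⟩ <;> rcases Pj with ⟨J2, s2, o2⟩ | ⟨J2, s2, o2⟩ <;>
    · have e1 := J1.pairs b b'
      have e2 := J2.pairs a a'
      have := o1 b
      have := o1 b'
      grind
  let fj : δ → ℤ := fun h => if c0 h = c0 b ∨ c0 h = c0 b' then f0 b + f0 b' else f0 h
  have fjt : ∀ h, (c0 h = c0 b ∨ c0 h = c0 b') → fj h = f0 b + f0 b' := fun h hh => if_pos hh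
  have fjo : ∀ h, ¬ (c0 h = c0 b ∨ c0 h = c0 b') → fj h = f0 h := fun h hh => if_neg hh
  clear_value fj
  have hl : IsLabelling cj fj := by
    refine ⟨fun e g h => ?_, fun e => ?_⟩
    · rw [Jj.2] at h
      rcases h with h | ⟨h₁, h₂⟩
      · by_cases hh : c0 e = c0 b ∨ c0 e = c0 b'
        · rw [fjt e hh, fjt g (by rwa [← h])]
        · rw [fjo e hh, fjo g (by rwa [← h]), f0c e g h]
      · rw [fjt e h₁, fjt g h₂]
    · have := f0v e
      have := fjt e
      have := fjo e
      clear fjt fjo f0c f0v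
      grind
  refine ⟨fj, hl, Or.inl ⟨Jj, fjt b (Or.inl rfl), fun h h₁ h₂ => fjo h (by tauto)⟩, ?_⟩
  have e3 := Jj.pairs a a'
  have := fjt a
  have := fjt a'
  have := fjo a
  have := fjo a'
  have e8 : ∀ h, (cj h = cj a ↔ _) := fun h => Jj.2 h a
  have e9 : ∀ h, (cj h = cj a' ↔ _) := fun h => Jj.2 h a'
  have oo : (∀ h, cj h ≠ cj a → cj h ≠ cj a' → fij h = fj h) := by
    intro h h₁ h₂
    have := fjt h
    have := fjo h
    have := e8 h
    have := e9 h
    clear e8 e9 fjo fjt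
    rcases Pi with ⟨J1, s1, o1⟩ | ⟨J1, s1, o1⟩ <;> rcases Pj with ⟨J2, s2, o2⟩ | ⟨J2, s2, o2⟩ <;>
    · have e1 := J1.pairs b b'
      have e2 := J2.pairs a a'
      have := o1 b
      have := o1 b'
      have := o1 h
      have := o2 a
      have := o2 a'
      have := o2 h
      have := J1.pairs b h
      have := J2.pairs a h
      have := J1.2 b' h
      have := J2.2 a' h
      grind
  clear e8 e9
  rcases Jij with Jij | Jij
  · refine Or.inl ⟨Jij, ?_, oo⟩
    have e4 := Jij.pairs b b'
    rcases Pi with ⟨J1, s1, o1⟩ | ⟨J1, s1, o1⟩ <;> rcases Pj with ⟨J2, s2, o2⟩ | ⟨J2, s2, o2⟩ <;>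
    · have e1 := J1.pairs b b'
      have e2 := J2.pairs a a'
      have := o1 b
      have := o1 b'
      have := o2 a
      have := o2 a'
      grind
  · refine Or.inr ⟨Jij, ?_, ?_⟩
    · have e4 := Jij.pairs b b'
      rcases Pi with ⟨J1, s1, o1⟩ | ⟨J1, s1, o1⟩ <;> rcases Pj with ⟨J2, s2, o2⟩ | ⟨J2, s2, o2⟩ <;>
      · have e1 := J1.pairs b b'
        have e2 := J2.pairs a a'
        have := o1 b
        have := o1 b'
        have := o2 a
        have := o2 a'
        grind
    · intro h h₁ h₂
      refine oo h ?_ ?_ <;>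
      · rw [ne_eq, Jij.2]; grind

theorem IsLabelling.dual {β : Type} {c : δ → β} {f : δ → ℤ} (h : IsLabelling c f) :
    IsLabelling c (fun e => 1 - f e) :=
  ⟨fun e g he => by dsimp only; rw [h.1 e g he], fun e => by have := h.2 e; dsimp only; omega⟩

/-- Self-duality of the Frobenius algebra: exchanging `1` with `X` and reversing the surgery turns
the product into the coproduct. -/
theorem Pants.dual {β γ : Type} {c : δ → β} {c' : δ → γ} {a a' : δ} {f f' : δ → ℤ}
    (h : Pants c c' a a' f f') : Pants c' c a a' (fun e => 1 - f' e) (fun e => 1 - f e) := by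
  rcases h with ⟨h₁, h₂, h₃⟩ | ⟨h₁, h₂, h₃⟩
  · exact Or.inr ⟨h₁, by dsimp only; omega, fun h k l => by dsimp only; rw [h₃ h k l]⟩
  · exact Or.inl ⟨h₁, by dsimp only; omega, fun h k l => by dsimp only; rw [h₃ h k l]⟩

/-- The four darts are on the same circle, before as well as after both surgeries. -/
def Lady {β γ : Type} (c : δ → β) (c' : δ → γ) (a a' b b' : δ) : Prop :=
  c a = c a' ∧ c b = c b' ∧ c a = c b ∧ c' a = c' a' ∧ c' b = c' b' ∧ c' a = c' b

/-- The given order merges at `a` and then has to split at `b`, while the other order splits first.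
The labels of the halves are recovered from the final labelling. As `c0 a ≠ c0 a'`, at most one of
the blocks of `a`, `a'` is affected by the split, and a half containing one of them later merges
with the untouched block of the other, whose label must be subtracted. -/
theorem Pants.exists_swap_split {c0 : δ → β0} {ci : δ → β1} {cj : δ → β2} {cij : δ → β3}
    {a a' b b' : δ} {f0 fi fij : δ → ℤ} (h0 : IsLabelling c0 f0) (hi : IsLabelling ci fi)
    (hij : IsLabelling cij fij) (Ji : Joins c0 ci a a') (si : fi a = f0 a + f0 a')
    (oi : ∀ h, c0 h ≠ c0 a → c0 h ≠ c0 a' → fi h = f0 h)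
    (Pj : Pants ci cij b b' fi fij) (Jj : Joins cj c0 b b') (Jij : Joins cj cij a a') :
    ∃ fj, IsLabelling cj fj ∧ Pants c0 cj b b' f0 fj ∧ Pants cj cij a a' fj fij := by
  classical
  obtain ⟨f0c, f0v⟩ := h0
  obtain ⟨fic, fiv⟩ := hi
  obtain ⟨fijc, fijv⟩ := hij
  have e0 := Ji.pairs b b'
  have e1 := Jj.pairs a a'
  have e2 := Jij.pairs b b'
  have hP : Joins cij ci b b' ∧ fij b + fij b' = fi b + 1 ∧
      ∀ h, cij h ≠ cij b → cij h ≠ cij b' → fij h = fi h := by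
    rcases Pj with ⟨J, -⟩ | h
    · exfalso
      have := J.1
      grind
    · exact h
  obtain ⟨Jk, sk, ok⟩ := hP
  have e3 := Jk.pairs a a'
  let fj : δ → ℤ := fun h => if cj h = cj b ∨ cj h = cj b' then
    (if cj h = cj a then fij h - f0 a' else if cj h = cj a' then fij h - f0 a else fij h) else f0 h
  have f1 : ∀ h, (cj h = cj b ∨ cj h = cj b') → cj h = cj a → fj h = fij h - f0 a' :=
    fun h h₁ h₂ => by simp only [fj]; rw [if_pos h₁, if_pos h₂]
  have f2 : ∀ h, (cj h = cj b ∨ cj h = cj b') → cj h ≠ cj a → cj h = cj a' →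
      fj h = fij h - f0 a :=
    fun h h₁ h₂ h₃ => by simp only [fj]; rw [if_pos h₁, if_neg h₂, if_pos h₃]
  have f3 : ∀ h, (cj h = cj b ∨ cj h = cj b') → cj h ≠ cj a → cj h ≠ cj a' →
      fj h = fij h :=
    fun h h₁ h₂ h₃ => by simp only [fj]; rw [if_pos h₁, if_neg h₂, if_neg h₃]
  have f4 : ∀ h, cj h ≠ cj b → cj h ≠ cj b' → fj h = f0 h :=
    fun h h₁ h₂ => by simp only [fj]; rw [if_neg]; tauto
  have fjc : ∀ e g, cj e = cj g → fj e = fj g := by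
    intro e g h
    have h₁ : fij e = fij g := fijc e g ((Jij.2 e g).2 (Or.inl h))
    have h₂ : f0 e = f0 g := f0c e g ((Jj.2 e g).2 (Or.inl h))
    simp only [fj, h, h₁, h₂]
  clear_value fj
  have hl : IsLabelling cj fj := by
    refine ⟨fjc, fun e => ?_⟩
    have q : fj b = 0 ∨ fj b = 1 := by
      have := f1 b
      have := f2 b
      have := f3 b
      have := f0c b a
      have := f0c b a'
      have := fic b a
      have := oi b
      have := ok a
      have := ok a'
      have := fiv a
      have := fiv b
      have := f0v b
      have := f0v a
      have := f0v a'
      have := fijv b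
      have := fijv b'
      have := fijc b b'
      have := fijc b a
      clear f1 f2 f3 f4 f0c fic fijc oi ok fiv f0v fijv
      grind
    have q' : fj b' = 0 ∨ fj b' = 1 := by
      have := f1 b'
      have := f2 b'
      have := f3 b'
      have := f0c b' a
      have := f0c b' a'
      have := fic b' a
      have := f0c b b'
      have := fic b b'
      have := oi b
      have := ok a
      have := ok a'
      have := fiv a
      have := fiv b
      have := f0v b
      have := f0v a
      have := f0v a'
      have := fijv b
      have := fijv b'
      have := fijc b b'
      have := fijc b a
      clear f1 f2 f3 f4 f0c fic fijc oi ok fiv f0v fijv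
      grind
    by_cases hb : cj e = cj b
    · rwa [fjc e b hb]
    · by_cases hb' : cj e = cj b'
      · rwa [fjc e b' hb']
      · rw [f4 e hb hb']; exact f0v e
  refine ⟨fj, hl, Or.inr ⟨Jj, ?_, fun h h₁ h₂ => f4 h h₁ h₂⟩, Or.inl ⟨Jij, ?_, ?_⟩⟩
  · have := f1 b
    have := f2 b
    have := f3 b
    have := f1 b'
    have := f2 b'
    have := f3 b'
    have := f0c b a
    have := f0c b a'
    have := fic b a
    have := f0c b b'
    have := fic b b'
    have := oi b
    clear f1 f2 f3 f4 f0c fic fijc oi ok fiv f0v fijv fjc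
    grind
  · have := f1 a
    have := f2 a
    have := f3 a
    have := f4 a
    have := f1 a'
    have := f2 a'
    have := f3 a'
    have := f4 a'
    have := fijc a a'
    have := ok a
    have := f0c b a
    have := f0c b a'
    have := fic b a
    clear f1 f2 f3 f4 f0c fic fijc oi ok fiv f0v fijv fjc
    grind
  · intro h h₁ h₂
    have := f3 h
    have := f4 h
    have := Jj.2 h a
    have := Jj.2 h a'
    have := Jij.2 h b
    have := Jij.2 h b'
    have := oi h
    have := ok h
    clear f1 f2 f3 f4 f0c fic fijc oi ok fiv f0v fijv fjc
    grind

/-- Both orders split and then merge, which forces the label `1` before and `X` after (`hs`). The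
two halves carry one `X` between them, and either of them may carry it; `t` prescribes the choice.
-/
theorem Pants.exists_swap_lady {c0 : δ → β0} {ci : δ → β1} {cj : δ → β2} {cij : δ → β3}
    {a a' b b' : δ} {f0 fi fij : δ → ℤ} (h0 : IsLabelling c0 f0) (hi : IsLabelling ci fi)
    (hij : IsLabelling cij fij) (Ji : Joins ci c0 a a') (si : fi a + fi a' = f0 a + 1)
    (oi : ∀ h, ci h ≠ ci a → ci h ≠ ci a' → fi h = f0 h)
    (Pj : Pants ci cij b b' fi fij) (Jj : Joins cj c0 b b') (Jij : Joins cj cij a a')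
    (t : ℤ) (ht : t = 0 ∨ t = 1) :
    ∃ fj, IsLabelling cj fj ∧ Pants c0 cj b b' f0 fj ∧ Pants cj cij a a' fj fij ∧ fj a = t := by
  classical
  obtain ⟨f0c, f0v⟩ := h0
  obtain ⟨fic, fiv⟩ := hi
  obtain ⟨fijc, fijv⟩ := hij
  have e0 := Ji.pairs b b'
  have e1 := Jj.pairs a a'
  have e2 := Jij.pairs b b'
  have hP : Joins ci cij b b' ∧ fij b = fi b + fi b' ∧
      ∀ h, ci h ≠ ci b → ci h ≠ ci b' → fij h = fi h := by
    rcases Pj with h | ⟨J, -⟩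
    · exact h
    · exfalso
      have := J.1
      grind
  obtain ⟨Jk, sk, ok⟩ := hP
  have e3 := Jk.pairs a a'
  have hs : f0 a = 0 ∧ fij a = 1 := by
    have := fic a b
    have := fic a b'
    have := fic a' b
    have := fic a' b'
    have := f0v a
    have := fijv a
    have := fijc a b
    clear f0c fic fijc oi ok fiv f0v fijv
    grind
  let fj : δ → ℤ := fun h => if cj h = cj a then t else if cj h = cj a' then 1 - t else f0 h
  have f1 : ∀ h, cj h = cj a → fj h = t := fun h h₁ => if_pos h₁
  have f2 : ∀ h, cj h ≠ cj a → cj h = cj a' → fj h = 1 - t := fun h h₁ h₂ => by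
    simp only [fj]; rw [if_neg h₁, if_pos h₂]
  have f3 : ∀ h, cj h ≠ cj a → cj h ≠ cj a' → fj h = f0 h := fun h h₁ h₂ => by
    simp only [fj]; rw [if_neg h₁, if_neg h₂]
  have fjc : ∀ e g, cj e = cj g → fj e = fj g := by
    intro e g h
    have h₂ : f0 e = f0 g := f0c e g ((Jj.2 e g).2 (Or.inl h))
    simp only [fj, h, h₂]
  clear_value fj
  have hl : IsLabelling cj fj := by
    refine ⟨fjc, fun e => ?_⟩
    have := f0v e
    by_cases ha : cj e = cj a
    · rw [f1 e ha]; exact ht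
    · by_cases ha' : cj e = cj a'
      · rw [f2 e ha ha']; rcases ht with rfl | rfl <;> simp
      · rwa [f3 e ha ha']
  refine ⟨fj, hl, Or.inr ⟨Jj, ?_, fun h h₁ h₂ => f3 h ?_ ?_⟩, Or.inl ⟨Jij, ?_, ?_⟩, f1 a rfl⟩
  · have := f1 b
    have := f2 b
    have := f1 b'
    have := f2 b'
    have := f0c b a
    clear f1 f2 f3 f0c fic fijc oi ok fiv f0v fijv fjc
    grind
  · grind
  · grind
  · have := f1 a
    have := f2 a'
    clear f1 f2 f3 f0c fic fijc oi ok fiv f0v fijv fjc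
    grind
  · intro h h₁ h₂
    rw [f3 h h₁ h₂]
    have k₁ : (cj b = cj a ∧ cj b' = cj a') ∨ (cj b = cj a' ∧ cj b' = cj a) := by
      clear f1 f2 f3 f0c fic fijc oi ok fiv f0v fijv fjc
      grind
    have k₂ : c0 h ≠ c0 a := by
      rw [ne_eq, Jj.2]
      clear f1 f2 f3 f0c fic fijc oi ok fiv f0v fijv fjc
      grind
    rw [ne_eq, Ji.2] at k₂
    have k₃ : (ci b = ci a ∨ ci b = ci a') ∧ (ci b' = ci a ∨ ci b' = ci a') := by
      clear f1 f2 f3 f0c fic fijc oi ok fiv f0v fijv fjc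
      grind
    rw [ok, oi] <;>
    · clear f1 f2 f3 f0c fic fijc oi ok fiv f0v fijv fjc
      grind

/-- Beginning with a merge and ending with a split are dual to each other. In the remaining case of
a split followed by a merge, the type of the first given surgery decides between a forced labelling
and the free choice `t`. -/
theorem Pants.exists_swap {c0 : δ → β0} {ci : δ → β1} {cj : δ → β2} {cij : δ → β3} {a a' b b' : δ}
    {f0 fi fij : δ → ℤ} (h0 : IsLabelling c0 f0) (hi : IsLabelling ci fi)
    (hij : IsLabelling cij fij) (Pi : Pants c0 ci a a' f0 fi) (Pj : Pants ci cij b b' fi fij)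
    (Jj : Joins c0 cj b b' ∨ Joins cj c0 b b') (Jij : Joins cj cij a a' ∨ Joins cij cj a a')
    (t : ℤ) (ht : t = 0 ∨ t = 1) :
    ∃ fj, IsLabelling cj fj ∧ Pants c0 cj b b' f0 fj ∧ Pants cj cij a a' fj fij ∧
      (Lady c0 cij a a' b b' → fj a = t) := by
  rcases Jj with Jj | Jj
  · obtain ⟨fj, h₁, h₂, h₃⟩ := Pants.exists_swap_merge h0 hi hij Pi Pj Jj Jij
    exact ⟨fj, h₁, h₂, h₃, fun h => absurd h.2.1 Jj.1⟩
  rcases Jij with Jij | Jij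
  · rcases Pi with ⟨J, s, o⟩ | ⟨J, s, o⟩
    · obtain ⟨fj, h₁, h₂, h₃⟩ := Pants.exists_swap_split h0 hi hij J s o Pj Jj Jij
      exact ⟨fj, h₁, h₂, h₃, fun h => absurd h.1 J.1⟩
    · obtain ⟨fj, h₁, h₂, h₃, h₄⟩ := Pants.exists_swap_lady h0 hi hij J s o Pj Jj Jij t ht
      exact ⟨fj, h₁, h₂, h₃, fun _ => h₄⟩
  · obtain ⟨fj, h₁, h₂, h₃⟩ := Pants.exists_swap_merge hij.dual hi.dual h0.dual Pj.dual Pi.dual Jij (Or.inl Jj)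
    refine ⟨fun e => 1 - fj e, h₁.dual, ?_, ?_, fun h => absurd h.2.2.2.1 Jij.1⟩
    · simpa using h₃.dual
    · simpa using h₂.dual

/-- A first merge determines the middle labelling from the source, a last split from the target. So
an ambiguity requires a split at `b` followed by a merge at `a`, and it survives the merge only if
both halves take part in it. -/
theorem Pants.lady_of_ne {c0 : δ → β0} {cj : δ → β2} {cij : δ → β3} {a a' b b' : δ}
    {f0 fj gj fij : δ → ℤ} (hj : IsLabelling cj fj) (hj' : IsLabelling cj gj)
    (P : Pants c0 cj b b' f0 fj) (P' : Pants cj cij a a' fj fij)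
    (Q : Pants c0 cj b b' f0 gj) (Q' : Pants cj cij a a' gj fij) (hne : fj ≠ gj) :
    Joins cj c0 b b' ∧ Joins cj cij a a' ∧ Lady c0 cij a a' b b' ∧ fj a ≠ gj a := by
  obtain ⟨h, hh⟩ := Function.ne_iff.1 hne
  have d1 := hj.1 h
  have d2 := hj'.1 h
  rcases P with ⟨J1, s1, o1⟩ | ⟨J1, s1, o1⟩
  · exfalso
    rcases Q with ⟨J2, s2, o2⟩ | ⟨J2, s2, o2⟩
    · have := o1 h
      have := o2 h
      have := J1.2 h b
      have := d1 b
      have := d2 b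
      grind
    · have := J1.1
      have := J2.pairs a a'
      have := J1.pairs a a'
      grind
  rcases P' with ⟨J3, s3, o3⟩ | ⟨J3, s3, o3⟩
  swap
  · exfalso
    rcases Q' with ⟨J2, s2, o2⟩ | ⟨J2, s2, o2⟩
    · have := J3.1
      have := J2.pairs b b'
      have := J3.pairs b b'
      grind
    · have := o3 h
      have := o2 h
      have := J3.2 h a
      have := d1 a
      have := d2 a
      grind
  have e1 := J1.pairs a a'
  have e3 := J3.pairs b b'
  rcases Q with ⟨J2, s2, o2⟩ | ⟨J2, s2, o2⟩
  · exact absurd e1.2.1 J2.1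
  rcases Q' with ⟨J4, s4, o4⟩ | ⟨J4, s4, o4⟩
  swap
  · exact absurd e3.2.1 J4.1
  have hb : fj b ≠ gj b := by
    intro hb
    have hb' : fj b' = gj b' := by omega
    apply hh
    by_cases k : cj h = cj b
    · rw [d1 b k, d2 b k, hb]
    · by_cases k' : cj h = cj b'
      · rw [d1 b' k', d2 b' k', hb']
      · rw [o1 h k k', o2 h k k']
  have hb' : fj b' ≠ gj b' := by omega
  have k₁ : cj b = cj a ∨ cj b = cj a' := by
    by_contra hc
    push Not at hc
    exact hb (by rw [← o3 b hc.1 hc.2, ← o4 b hc.1 hc.2])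
  have k₂ : cj b' = cj a ∨ cj b' = cj a' := by
    by_contra hc
    push Not at hc
    exact hb' (by rw [← o3 b' hc.1 hc.2, ← o4 b' hc.1 hc.2])
  have h₁ := hj.1 b a
  have h₂ := hj.1 b' a
  have h₃ := hj'.1 b a
  have h₄ := hj'.1 b' a
  clear d1 d2 o1 o2 o3 o4 hj hj'
  unfold Lady
  refine ⟨J1, J3, ?_, ?_⟩
  · clear h₁ h₂ h₃ h₄ hb hb' hh hne s1 s2 s3 s4
    grind
  · clear hh hne
    grind
variable {δ β0 β1 β2 β3 : Type}

/-- The ends of the arc at `b` lie on one block, but on two after the surgery at `a`. So this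
surgery splits the block between them, which means that the arcs have alternating ends. -/
theorem Lady.of_joins {c0 : δ → β0} {ci : δ → β1} {cij : δ → β3} {a a' b b' : δ}
    (Ji : Joins c0 ci a a' ∨ Joins ci c0 a a') (h : c0 b = c0 b') (Jij : Joins ci cij b b') :
    Lady c0 cij a a' b b' := by
  have e1 := Jij.pairs a a'
  rcases Ji with J | J
  · have e2 := J.pairs b b'
    grind
  · have e2 := J.pairs b b'
    unfold Lady
    grind

/-- A nonzero product with a factor `X` is `X`, and `X` splits into `X ⊗ X`; so a dart labelled `X`
keeps its label. -/
theorem Pants.mono {β γ : Type} {c : δ → β} {c' : δ → γ} {a a' : δ} {f f' : δ → ℤ}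
    (P : Pants c c' a a' f f') (h : IsLabelling c f) (h' : IsLabelling c' f') {e : δ}
    (he : f e = 1) : f' e = 1 := by
  have k1 := h.1 e a
  have k2 := h.1 e a'
  have k3 := h'.1 e a
  have k4 := h'.1 e a'
  have k5 := h'.2 a
  have k6 := h'.2 a'
  have k7 := h.2 a
  have k8 := h.2 a'
  rcases P with ⟨J, s, o⟩ | ⟨J, s, o⟩
  · have := J.2 e a
    have := o e
    clear o h h'
    grind
  · have := J.2 e a
    have := o e
    clear o h h'
    grind

/-- Only the coproduct of `1` has more than one term. -/
theorem Pants.two_targets {β γ : Type} {c : δ → β} {c' : δ → γ} {a a' : δ} {f f' g' : δ → ℤ}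
    (P : Pants c c' a a' f f') (Q : Pants c c' a a' f g') (hf : IsLabelling c' f')
    (hg : IsLabelling c' g') (hne : f' ≠ g') :
    Joins c' c a a' ∧ f a = 0 ∧ f' a + f' a' = 1 ∧ g' a + g' a' = 1 ∧ f' a ≠ g' a := by
  obtain ⟨h, hh⟩ := Function.ne_iff.1 hne
  rcases P with ⟨J, s, o⟩ | ⟨J, s, o⟩ <;> rcases Q with ⟨K, t, q⟩ | ⟨K, t, q⟩
  · exfalso
    by_cases k : c h = c a ∨ c h = c a'
    · have : c' h = c' a := (J.2 h a).2 (Or.inr ⟨k, Or.inl rfl⟩)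
      rw [hf.1 h a this, hg.1 h a this] at hh
      omega
    · push Not at k
      exact hh ((o h k.1 k.2).trans (q h k.1 k.2).symm)
  · exact absurd ((K.2 a a').2 (Or.inr ⟨Or.inl rfl, Or.inr rfl⟩)) J.1
  · exact absurd ((J.2 a a').2 (Or.inr ⟨Or.inl rfl, Or.inr rfl⟩)) K.1
  · refine ⟨J, ?_⟩
    by_cases k : c' h = c' a
    · rw [hf.1 h a k, hg.1 h a k] at hh
      have := hf.2 a
      have := hf.2 a'
      have := hg.2 a
      have := hg.2 a'
      omega
    · by_cases k' : c' h = c' a'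
      · rw [hf.1 h a' k', hg.1 h a' k'] at hh
        have := hf.2 a
        have := hf.2 a'
        have := hg.2 a
        have := hg.2 a'
        omega
      · exact absurd ((o h k k').trans (q h k k').symm) hh

/-- Dual to `Pants.two_targets`: among the surgeries, only a merge with result `X` can come from
different labellings. -/
theorem Pants.two_sources {β γ : Type} {c : δ → β} {c' : δ → γ} {a a' : δ} {f g f' : δ → ℤ}
    (P : Pants c c' a a' f f') (Q : Pants c c' a a' g f') (hf : IsLabelling c f)
    (hg : IsLabelling c g) (hne : f ≠ g) :
    Joins c c' a a' ∧ f' a = 1 ∧ f a + f a' = 1 ∧ g a + g a' = 1 ∧ f a ≠ g a := by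
  have := P.dual.two_targets Q.dual hf.dual hg.dual (fun h => hne (by
    funext e; have := congrFun h e; omega))
  obtain ⟨h₁, h₂, h₃, h₄, h₅⟩ := this
  exact ⟨h₁, by omega, by omega, by omega, by omega⟩

theorem Pants.swap {β γ : Type} {c : δ → β} {c' : δ → γ} {a a' : δ} {f f' : δ → ℤ}
    (P : Pants c c' a a' f f') (h : IsLabelling c f) (h' : IsLabelling c' f') :
    Pants c c' a' a f f' := by
  rcases P with ⟨J, s, o⟩ | ⟨J, s, o⟩
  · refine Or.inl ⟨⟨J.1.symm, fun e g => ?_⟩, ?_, fun e h₁ h₂ => o e h₂ h₁⟩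
    · rw [J.2]; tauto
    · rw [← h'.1 a a' ((J.pairs a a').2.1), s, add_comm]
  · refine Or.inr ⟨⟨J.1.symm, fun e g => ?_⟩, ?_, fun e h₁ h₂ => o e h₂ h₁⟩
    · rw [J.2]; tauto
    · rw [← h.1 a a' ((J.pairs a a').2.1), ← s, add_comm]

/-! ### Saddles in terms of the degrees of the labels -/

namespace Label

/-- The degree of a label. -/
def deg : Label → ℤ
  | one => 0
  | X => 1

theorem deg_injective : Function.Injective deg := by
  rintro (_ | _) (_ | _) h <;> first | rfl | exact absurd h (by decide)

theorem deg_eq (l : Label) : l.deg = 0 ∨ l.deg = 1 := by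
  cases l
  · exact Or.inl rfl
  · exact Or.inr rfl

theorem mul_eq_some_iff (a b c : Label) : mul a b = some c ↔ c.deg = a.deg + b.deg := by
  cases a <;> cases b <;> cases c <;> simp [mul, deg]

theorem mem_comul_iff (a b c : Label) : (b, c) ∈ comul a ↔ b.deg + c.deg = a.deg + 1 := by
  cases a <;> cases b <;> cases c <;> simp [comul, deg]

instance : Finite Label := Finite.of_injective (fun l : Label => l.deg = 0) (by
  rintro (_ | _) (_ | _) h <;> simp_all [deg])

end Label

namespace LinkDiagram

variable {D : LinkDiagram}

theorem eq_or_smooth_of_vtx_eq (v : D.State) {a b : D.Dart} (h : D.vtx b = D.vtx a) :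
    b = a ∨ b = D.rot (D.rot a) ∨ b = D.smooth v a ∨ b = D.rot (D.rot (D.smooth v a)) := by
  unfold smooth
  rcases D.eq_of_vtx_eq h with h | h | h | h
  · exact Or.inl h
  · split
    · exact Or.inr (Or.inr (Or.inl h))
    · exact Or.inr (Or.inr (Or.inr (by rw [h, D.rot_symm_eq, D.rot_four])))
  · exact Or.inr (Or.inl h)
  · split
    · exact Or.inr (Or.inr (Or.inr h))
    · exact Or.inr (Or.inr (Or.inl (by rw [h, D.rot_symm_eq])))

theorem touch_of_vtx_eq (v : D.State) {a b : D.Dart} (h : D.vtx b = D.vtx a) : D.Touch v a b := by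
  have h₁ := conn_smooth v a
  have h₂ := conn_smooth v (D.rot (D.rot a))
  rw [D.smooth_rot_rot] at h₂
  rcases eq_or_smooth_of_vtx_eq v h with rfl | rfl | rfl | rfl
  · exact Or.inl rfl
  · exact Or.inr rfl
  · exact Or.inl h₁.symm
  · exact Or.inr h₂.symm

/-- The degrees of the labels. -/
def KhGen.deg (x : D.KhGen) (h : D.Dart) : ℤ := (x.label h).deg

theorem KhGen.isLabelling (x : D.KhGen) : IsLabelling (D.circ x.state) x.deg :=
  ⟨fun _ _ h => congrArg Label.deg (x.label_conn h), fun e => (x.label e).deg_eq⟩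

theorem KhGen.ext_deg {x y : D.KhGen} (h : x.state = y.state) (h' : x.deg = y.deg) : x = y :=
  KhGen.ext h (funext fun e => Label.deg_injective (congrFun h' e))

theorem KhGen.exists_of_isLabelling {v : D.State} {f : D.Dart → ℤ}
    (h : IsLabelling (D.circ v) f) : ∃ x : D.KhGen, x.state = v ∧ x.deg = f := by
  refine ⟨⟨v, fun e => if f e = 0 then .one else .X, fun e => ?_, fun e => ?_⟩, rfl, ?_⟩
  · rw [h.1 _ _ (conn_edge v e)]
  · rw [h.1 _ _ (conn_smooth v e)]
  · funext e
    simp only [KhGen.deg]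
    rcases h.2 e with he | he <;> simp [he, Label.deg]

instance : Finite D.KhGen := by
  have := D.finite_dart
  have : Finite D.Vertex := Finite.of_surjective D.vtx Quot.mk_surjective
  exact Finite.of_injective (fun x : D.KhGen => (x.state, x.label)) fun x y h =>
    KhGen.ext (congrArg Prod.fst h) (congrArg Prod.snd h)

theorem joins_of_flip (κ : D.Coloring) {c : D.Vertex} {v w : D.State} (h : Flip c v w)
    {a : D.Dart} (ha : D.vtx a = c) (hv : ¬ D.Conn v a (D.rot (D.rot a))) :
    Joins (D.circ v) (D.circ w) a (D.rot (D.rot a)) :=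
  ⟨hv, fun e f => conn_flip_merge κ h ha hv e f⟩

theorem joins_or_joins (κ : D.Coloring) {c : D.Vertex} {v w : D.State} (h : Flip c v w)
    {a : D.Dart} (ha : D.vtx a = c) (hne : D.rot (D.rot a) ≠ a) :
    Joins (D.circ v) (D.circ w) a (D.rot (D.rot a)) ∨
      Joins (D.circ w) (D.circ v) a (D.rot (D.rot a)) := by
  by_cases hv : D.Conn v a (D.rot (D.rot a))
  · exact Or.inr (joins_of_flip κ h.symm ha (conn_flip_split κ h ha hne hv))
  · exact Or.inl (joins_of_flip κ h ha hv)

/-- A saddle in terms of degrees, as seen from a dart at the crossing. -/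
def SaddleAt (a : D.Dart) (x y : D.KhGen) : Prop :=
  Pants (D.circ x.state) (D.circ y.state) a (D.rot (D.rot a)) x.deg y.deg

theorem SaddleAt.rot_rot {a : D.Dart} {x y : D.KhGen} (h : SaddleAt a x y) :
    SaddleAt (D.rot (D.rot a)) x y := by
  unfold SaddleAt
  rw [D.rot_four]
  exact Pants.swap h x.isLabelling y.isLabelling

/-- The resolution joins `a` to a neighbouring dart, so the neighbour and its opposite describe the
same two strands. On the side of `y` they appear in the opposite order, which does not matter
because all conditions are symmetric. -/
theorem SaddleAt.of_vtx_eq {c : D.Vertex} {a b : D.Dart} {x y : D.KhGen} (h : SaddleAt a x y)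
    (hd : Flip c x.state y.state) (ha : D.vtx a = c) (hb : D.vtx b = c) : SaddleAt b x y := by
  have h₁ := conn_smooth x.state a
  have h₂ := conn_smooth x.state (D.rot (D.rot a))
  have h₃ := conn_smooth y.state a
  have h₄ := conn_smooth y.state (D.rot (D.rot a))
  rw [D.smooth_rot_rot] at h₂ h₄
  rw [smooth_flip hd ha] at h₃ h₄
  rw [D.rot_four] at h₄
  have key : SaddleAt (D.smooth x.state a) x y := by
    unfold SaddleAt Pants Joins Conn at *
    have i₁ := x.isLabelling.1 _ _ h₁
    have i₂ := x.isLabelling.1 _ _ h₂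
    have i₃ := y.isLabelling.1 _ _ h₃
    have i₄ := y.isLabelling.1 _ _ h₄
    rw [← h₁, ← h₂, ← h₃, ← h₄, ← i₁, ← i₂, ← i₃, ← i₄]
    rcases h with ⟨⟨j₁, j₂⟩, s, o⟩ | ⟨⟨j₁, j₂⟩, s, o⟩
    · refine Or.inl ⟨⟨j₁, j₂⟩, ?_, o⟩
      rw [← s]
      exact y.isLabelling.1 _ _ ((j₂ _ _).2 (Or.inr ⟨Or.inr rfl, Or.inl rfl⟩))
    · refine Or.inr ⟨⟨j₁.symm, fun e f => ?_⟩, ?_, fun e k l => o e l k⟩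
      · rw [j₂]; tauto
      · rw [← s, add_comm]
  rcases eq_or_smooth_of_vtx_eq x.state (hb.trans ha.symm) with rfl | rfl | rfl | rfl
  · exact h
  · exact h.rot_rot
  · exact key
  · exact key.rot_rot

/-- `Saddle` compares only the circles of two opposite darts. That the whole partition changes by a
merge or a split is supplied by the colouring. -/
theorem saddleAt_iff (κ : D.Coloring) {c : D.Vertex} {x y : D.KhGen} (h : D.Drop c x.state y.state)
    {a : D.Dart} (ha : D.vtx a = c) :
    SaddleAt a x y ↔ (∀ h, (∀ a, D.vtx a = c → D.circ x.state a ≠ D.circ x.state h) →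
      y.label h = x.label h) ∧ ((D.circ x.state a ≠ D.circ x.state (D.rot (D.rot a)) ∧
      D.circ y.state a = D.circ y.state (D.rot (D.rot a)) ∧
      Label.mul (x.label a) (x.label (D.rot (D.rot a))) = some (y.label a)) ∨
     (D.circ x.state a = D.circ x.state (D.rot (D.rot a)) ∧
      D.circ y.state a ≠ D.circ y.state (D.rot (D.rot a)) ∧
      (y.label a, y.label (D.rot (D.rot a))) ∈ Label.comul (x.label a))) := by
  have ho : ∀ e, (∀ a, D.vtx a = c → D.circ x.state a ≠ D.circ x.state e) ↔
      (D.circ x.state e ≠ D.circ x.state a ∧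
        D.circ x.state e ≠ D.circ x.state (D.rot (D.rot a))) := by
    intro e
    constructor
    · intro hh
      exact ⟨(hh a ha).symm, (hh _ (by rw [D.vtx_rot, D.vtx_rot, ha])).symm⟩
    · rintro ⟨h₁, h₂⟩ b hb hbe
      rcases touch_of_vtx_eq x.state (hb.trans ha.symm) with hh | hh
      · exact h₁ (hbe.symm.trans hh)
      · exact h₂ (hbe.symm.trans hh)
  simp only [ho, Label.mul_eq_some_iff, Label.mem_comul_iff]
  have hl : ∀ e, y.label e = x.label e ↔ y.deg e = x.deg e :=
    fun e => Label.deg_injective.eq_iff.symm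
  simp only [hl]
  unfold SaddleAt Pants
  constructor
  · rintro (⟨J, s, o⟩ | ⟨J, s, o⟩)
    · exact ⟨fun e he => o e he.1 he.2, Or.inl ⟨J.1, (J.pairs a a).2.1, s⟩⟩
    · refine ⟨fun e he => o e ?_ ?_, Or.inr ⟨(J.pairs a a).2.1, J.1, s⟩⟩
      · exact fun h => he.1 ((J.2 _ _).2 (Or.inl h))
      · exact fun h => he.2 ((J.2 _ _).2 (Or.inl h))
  · rintro ⟨o, ⟨h₁, -, s⟩ | ⟨h₁, h₂, s⟩⟩
    · exact Or.inl ⟨joins_of_flip κ h.flip ha h₁, s, fun e k l => o e ⟨k, l⟩⟩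
    · have J := joins_of_flip κ h.flip.symm ha h₂
      refine Or.inr ⟨J, s, fun e k l => o e ?_⟩
      rw [ne_eq, ne_eq, J.2, J.2]
      tauto

theorem Saddle.rot_rot_ne {c : D.Vertex} {x y : D.KhGen} (h : D.Saddle c x y) {a : D.Dart}
    (ha : D.vtx a = c) : D.rot (D.rot a) ≠ a := by
  obtain ⟨-, -, b, hb, h⟩ := h
  have : D.rot (D.rot b) ≠ b := by
    intro he
    rw [he] at h
    rcases h with h | h
    · exact h.1 rfl
    · exact h.2.1 rfl
  intro he
  rcases D.eq_of_vtx_eq (hb.trans ha.symm) with h | h | h | h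
  · rw [h] at this; exact this he
  · rw [h, he] at this; exact this rfl
  · rw [h, he] at this; exact this he
  · rw [h, he, he] at this; exact this rfl

theorem Saddle.isCrossing {c : D.Vertex} {x y : D.KhGen} (h : D.Saddle c x y) : D.IsCrossing c :=
  fun _ => h.rot_rot_ne

theorem saddle_iff (κ : D.Coloring) {c : D.Vertex} {x y : D.KhGen}
    {a : D.Dart} (ha : D.vtx a = c) :
    D.Saddle c x y ↔ D.Drop c x.state y.state ∧ D.rot (D.rot a) ≠ a ∧ SaddleAt a x y := by
  constructor
  · intro h
    obtain ⟨hd, ho, b, hb, hs⟩ := id h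
    exact ⟨hd, h.rot_rot_ne ha,
      ((saddleAt_iff κ hd hb).2 ⟨ho, hs⟩).of_vtx_eq hd.flip hb ha⟩
  · rintro ⟨hd, hne, h⟩
    obtain ⟨ho, hs⟩ := (saddleAt_iff κ hd ha).1 h
    exact ⟨hd, ho, a, ha, hs⟩

theorem Saddle.at (κ : D.Coloring) {c : D.Vertex} {x y : D.KhGen} (h : D.Saddle c x y)
    {a : D.Dart} (ha : D.vtx a = c) : SaddleAt a x y := ((saddle_iff κ ha).1 h).2.2

theorem exists_under (c : D.Vertex) : ∃ a, D.vtx a = c ∧ D.isOver a = false := by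
  obtain ⟨a, ha⟩ : ∃ a, D.vtx a = c := Quot.exists_rep c
  by_cases h : D.isOver a = true
  · exact ⟨D.rot a, by rw [D.vtx_rot, ha], by rw [D.isOver_rot, h]; rfl⟩
  · exact ⟨a, ha, by simpa using h⟩

theorem eq_or_rot_rot {a b : D.Dart} (h : D.vtx a = D.vtx b) (ho : D.isOver a = D.isOver b) :
    a = b ∨ a = D.rot (D.rot b) := by
  rcases D.eq_of_vtx_eq h with h | h | h | h
  · exact Or.inl h
  · rw [h, D.isOver_rot] at ho; simp at ho
  · exact Or.inr h
  · rw [h, D.isOver_rot, D.isOver_rot_rot] at ho; simp at ho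

/-- Every circle that meets a crossing passes through one of two given opposite darts, so one pair
of darts at each crossing suffices. -/
theorem isLadybug_iff {i j : D.Vertex} {u w : D.State} {a b : D.Dart} (ha : D.vtx a = i)
    (hb : D.vtx b = j) :
    D.IsLadybug i j u w ↔ D.IsCrossing i ∧ D.IsCrossing j ∧
      Lady (D.circ u) (D.circ w) a (D.rot (D.rot a)) b (D.rot (D.rot b)) := by
  have ha' : D.vtx (D.rot (D.rot a)) = i := by rw [D.vtx_rot, D.vtx_rot, ha]
  have hb' : D.vtx (D.rot (D.rot b)) = j := by rw [D.vtx_rot, D.vtx_rot, hb]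
  unfold IsLadybug Lady
  refine and_congr_right fun _ => and_congr_right fun _ => ⟨fun h => ?_, ?_⟩
  · exact ⟨(h a _ (Or.inl ha) (Or.inl ha')).1, (h b _ (Or.inr hb) (Or.inr hb')).1,
      (h a b (Or.inl ha) (Or.inr hb)).1, (h a _ (Or.inl ha) (Or.inl ha')).2,
      (h b _ (Or.inr hb) (Or.inr hb')).2, (h a b (Or.inl ha) (Or.inr hb)).2⟩
  · rintro ⟨h₁, h₂, h₃, h₄, h₅, h₆⟩
    have key : ∀ e, (D.vtx e = i ∨ D.vtx e = j) → D.circ u e = D.circ u a ∧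
        D.circ w e = D.circ w a := by
      rintro e (he | he)
      · refine ⟨?_, ?_⟩
        · rcases touch_of_vtx_eq u (he.trans ha.symm) with h | h
          · exact h
          · exact Eq.trans h h₁.symm
        · rcases touch_of_vtx_eq w (he.trans ha.symm) with h | h
          · exact h
          · exact Eq.trans h h₄.symm
      · refine ⟨?_, ?_⟩
        · rcases touch_of_vtx_eq u (he.trans hb.symm) with h | h
          · exact Eq.trans h h₃.symm
          · exact Eq.trans h (h₂.symm.trans h₃.symm)
        · rcases touch_of_vtx_eq w (he.trans hb.symm) with h | h
          · exact Eq.trans h h₆.symm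
          · exact Eq.trans h (h₅.symm.trans h₆.symm)
    exact fun e f he hf => ⟨(key e he).1.trans (key f hf).1.symm,
      (key e he).2.trans (key f hf).2.symm⟩

theorem IsLadybug.symm {i j : D.Vertex} {u w : D.State} (h : D.IsLadybug i j u w) :
    D.IsLadybug j i u w :=
  ⟨h.2.1, h.1, fun a b ha hb => h.2.2 a b ha.symm hb.symm⟩

end LinkDiagram
-- Sums over circles and the quantum grading
section Sum
variable {δ β γ : Type}

/-- The blocks that are not merged correspond bijectively and cancel. -/
theorem Joins.sum_eq [Fintype β] [Fintype γ] {c : δ → β} {c' : δ → γ} {a a' : δ}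
    (J : Joins c c' a a') (hc : Function.Surjective c) (hc' : Function.Surjective c')
    (φ : β → ℤ) (ψ : γ → ℤ) (h : ∀ e, c e ≠ c a → c e ≠ c a' → ψ (c' e) = φ (c e)) :
    ∑ C, ψ C + φ (c a) + φ (c a') = ∑ B, φ B + ψ (c' a) := by
  classical
  have h₁ : ∑ C, ψ C = ψ (c' a) + ∑ C ∈ Finset.univ.erase (c' a), ψ C :=
    (Finset.add_sum_erase _ _ (Finset.mem_univ _)).symm
  have h₂ : ∑ B, φ B = φ (c a) + ∑ B ∈ Finset.univ.erase (c a), φ B :=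
    (Finset.add_sum_erase _ _ (Finset.mem_univ _)).symm
  have h₃ : ∑ B ∈ Finset.univ.erase (c a), φ B =
      φ (c a') + ∑ B ∈ (Finset.univ.erase (c a)).erase (c a'), φ B :=
    (Finset.add_sum_erase _ _ (by simpa using J.1.symm)).symm
  have h₄ : ∑ B ∈ (Finset.univ.erase (c a)).erase (c a'), φ B =
      ∑ C ∈ Finset.univ.erase (c' a), ψ C := by
    have k : ∀ B, c (Function.surjInv hc B) = B := Function.surjInv_eq hc
    have hJ := J.2
    refine Finset.sum_bij (fun B _ => c' (Function.surjInv hc B)) ?_ ?_ ?_ ?_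
    · intro B hB
      simp only [Finset.mem_erase, Finset.mem_univ, and_true, ne_eq] at hB ⊢
      rw [hJ, k]
      tauto
    · intro B hB B' hB' hBB
      simp only [Finset.mem_erase, Finset.mem_univ, and_true, ne_eq] at hB hB'
      rw [hJ, k, k] at hBB
      tauto
    · intro C hC
      obtain ⟨e, rfl⟩ := hc' C
      simp only [Finset.mem_erase, Finset.mem_univ, and_true, ne_eq] at hC
      rw [hJ] at hC
      refine ⟨c e, ?_, ?_⟩
      · simp only [Finset.mem_erase, Finset.mem_univ, and_true, ne_eq]
        tauto
      · rw [hJ, k]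
        exact Or.inl rfl
    · intro B hB
      simp only [Finset.mem_erase, Finset.mem_univ, and_true, ne_eq] at hB
      have := h (Function.surjInv hc B)
      rw [k] at this
      exact (this hB.2 hB.1).symm
  linarith

theorem natCard_subtype_eq_sum [Fintype β] (p : β → Prop) [DecidablePred p] :
    (Nat.card {b // p b} : ℤ) = ∑ b, if p b then 1 else 0 := by
  rw [Nat.card_eq_fintype_card, Fintype.card_subtype, Finset.card_filter]
  push_cast
  rfl

end Sum

namespace LinkDiagram

variable {D : LinkDiagram}

noncomputable instance (v : D.State) : Fintype (D.Circle v) := by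
  have := D.finite_dart
  have : Finite (D.Circle v) := Finite.of_surjective (D.circ v) Quot.mk_surjective
  exact Fintype.ofFinite _

theorem circ_surjective (v : D.State) : Function.Surjective (D.circ v) := Quot.mk_surjective

/-- The label of a circle. -/
def KhGen.circLabel (x : D.KhGen) : D.Circle x.state → Label :=
  Quot.lift x.label (by rintro a _ (rfl | rfl); exacts [(x.label_edge a).symm, (x.label_smooth a).symm])

theorem exists_circ_label_iff (x : D.KhGen) (l : Label) (C : D.Circle x.state) :
    (∃ h, D.circ x.state h = C ∧ x.label h = l) ↔ x.circLabel C = l := by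
  obtain ⟨a, rfl⟩ := circ_surjective _ C
  constructor
  · rintro ⟨h, h₁, h₂⟩
    rw [← h₁]
    exact h₂
  · exact fun h => ⟨a, rfl, h⟩

theorem numLabel_sub (x : D.KhGen) :
    (D.numLabel x .X : ℤ) - D.numLabel x .one = ∑ C, (2 * (x.circLabel C).deg - 1) := by
  classical
  unfold numLabel
  simp only [exists_circ_label_iff]
  have e : ∀ l, (Nat.card {C // x.circLabel C = l} : ℤ) =
      ∑ C, if (x.circLabel C).deg = l.deg then 1 else 0 := by
    intro l
    rw [← natCard_subtype_eq_sum]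
    simp only [Label.deg_injective.eq_iff]
  rw [e, e, ← Finset.sum_sub_distrib]
  refine Finset.sum_congr rfl fun C _ => ?_
  rcases (x.circLabel C).deg_eq with h | h <;> rw [h] <;> simp [Label.deg]

theorem weight_drop {c : D.Vertex} {v w : D.State} (h : D.Drop c v w) (hc : D.IsCrossing c) :
    (D.weight v : ℤ) = D.weight w + 1 := by
  classical
  have := D.finite_dart
  have : Finite D.Vertex := Finite.of_surjective D.vtx Quot.mk_surjective
  have := Fintype.ofFinite D.Vertex
  unfold weight
  rw [natCard_subtype_eq_sum, natCard_subtype_eq_sum,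
    ← Finset.add_sum_erase _ _ (Finset.mem_univ c),
    ← Finset.add_sum_erase (a := c) _ (fun b => if D.IsCrossing b ∧ w b = true then (1 : ℤ) else 0)
      (Finset.mem_univ c)]
  rw [if_pos ⟨hc, h.1⟩, if_neg (by rw [h.2.1]; simp), zero_add, add_comm]
  congr 1
  refine Finset.sum_congr rfl fun b hb => ?_
  rw [h.2.2 b (Finset.mem_erase.1 hb).1]

theorem SaddleAt.sum_eq {a : D.Dart} {x y : D.KhGen} (h : SaddleAt a x y) :
    ∑ C, (2 * (y.circLabel C).deg - 1) = ∑ C, (2 * (x.circLabel C).deg - 1) + 1 := by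
  have ex : ∀ e, (x.circLabel (D.circ x.state e)).deg = x.deg e := fun _ => rfl
  have ey : ∀ e, (y.circLabel (D.circ y.state e)).deg = y.deg e := fun _ => rfl
  rcases h with ⟨J, s, o⟩ | ⟨J, s, o⟩
  · have := J.sum_eq (circ_surjective _) (circ_surjective _)
      (fun C => 2 * (x.circLabel C).deg - 1) (fun C => 2 * (y.circLabel C).deg - 1)
      (fun e h₁ h₂ => by rw [ex, ey, o e h₁ h₂])
    simp only [ex, ey] at this
    linarith
  · have := J.sum_eq (circ_surjective _) (circ_surjective _)
      (fun C => 2 * (y.circLabel C).deg - 1) (fun C => 2 * (x.circLabel C).deg - 1)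
      (fun e h₁ h₂ => by rw [ex, ey, o e h₁ h₂])
    simp only [ex, ey] at this
    linarith

/-- `#{X} - #{1}` is the sum of `2 deg - 1` over the circles. A saddle raises it by one, whether it
merges or splits, and lowers `|v|` by one. -/
theorem Saddle.quantum_eq (κ : D.Coloring) {c : D.Vertex} {x y : D.KhGen} (h : D.Saddle c x y)
    (o : D.Orientation) : D.quantum o y = D.quantum o x := by
  obtain ⟨a, ha⟩ : ∃ a, D.vtx a = c := Quot.exists_rep c
  have h₁ := (h.at κ ha).sum_eq
  have h₂ := weight_drop h.1 h.isCrossing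
  rw [← numLabel_sub, ← numLabel_sub] at h₁
  unfold quantum
  linarith

theorem SaddleAt.mono {a : D.Dart} {x y : D.KhGen} (h : SaddleAt a x y) {e : D.Dart}
    (he : x.deg e = 1) : y.deg e = 1 := Pants.mono h x.isLabelling y.isLabelling he

theorem SaddleAt.two_targets {a : D.Dart} {x y z : D.KhGen} (hs : y.state = z.state)
    (h : SaddleAt a x y) (k : SaddleAt a x z) (hne : y ≠ z) :
    Joins (D.circ y.state) (D.circ x.state) a (D.rot (D.rot a)) ∧ x.deg a = 0 ∧
      y.deg a + y.deg (D.rot (D.rot a)) = 1 ∧ z.deg a + z.deg (D.rot (D.rot a)) = 1 ∧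
      y.deg a ≠ z.deg a := by
  have hd : y.deg ≠ z.deg := fun h => hne (KhGen.ext_deg hs h)
  have hy := y.isLabelling
  have hz := z.isLabelling
  unfold SaddleAt at h k
  rw [← hs] at k hz
  exact Pants.two_targets h k hy hz hd

theorem SaddleAt.two_sources {a : D.Dart} {x y z : D.KhGen} (hs : x.state = y.state)
    (h : SaddleAt a x z) (k : SaddleAt a y z) (hne : x ≠ y) :
    Joins (D.circ x.state) (D.circ z.state) a (D.rot (D.rot a)) ∧ z.deg a = 1 ∧
      x.deg a + x.deg (D.rot (D.rot a)) = 1 ∧ y.deg a + y.deg (D.rot (D.rot a)) = 1 ∧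
      x.deg a ≠ y.deg a := by
  have hd : x.deg ≠ y.deg := fun h => hne (KhGen.ext_deg hs h)
  have hx := x.isLabelling
  have hy := y.isLabelling
  unfold SaddleAt at h k
  rw [← hs] at k hy
  exact Pants.two_sources h k hx hy hd

theorem SaddleAt.lady_of_ne {a b : D.Dart} {x y y' z : D.KhGen} (hs : y.state = y'.state)
    (h : SaddleAt b x y) (k : SaddleAt a y z) (h' : SaddleAt b x y') (k' : SaddleAt a y' z)
    (hne : y ≠ y') :
    Joins (D.circ y.state) (D.circ x.state) b (D.rot (D.rot b)) ∧
      Joins (D.circ y.state) (D.circ z.state) a (D.rot (D.rot a)) ∧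
      Lady (D.circ x.state) (D.circ z.state) a (D.rot (D.rot a)) b (D.rot (D.rot b)) ∧
      y.deg a ≠ y'.deg a := by
  have hd : y.deg ≠ y'.deg := fun h => hne (KhGen.ext_deg hs h)
  have hx := y.isLabelling
  have hy := y'.isLabelling
  unfold SaddleAt at h k h' k'
  rw [← hs] at h' k' hy
  exact Pants.lady_of_ne hx hy h k h' k' hd

theorem drop_unique {i : D.Vertex} {u v v' : D.State} (h₁ : D.Drop i u v) (h₂ : D.Drop i u v') :
    v = v' := by
  funext c
  by_cases hi : c = i
  · subst hi; rw [h₁.2.1, h₂.2.1]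
  · rw [h₁.2.2 c hi, h₂.2.2 c hi]

theorem ne_of_drop {i j : D.Vertex} {u v w : D.State} (h₁ : D.Drop i u v) (h₂ : D.Drop j v w) :
    i ≠ j := by
  rintro rfl
  have := h₁.2.1
  rw [h₂.1] at this
  exact absurd this (by decide)

/-- The intermediate vertex on the other side of a face. -/
theorem exists_drop_swap {i j : D.Vertex} {u v w : D.State} (h₁ : D.Drop i u v)
    (h₂ : D.Drop j v w) : ∃ v', D.Drop j u v' ∧ D.Drop i v' w := by
  classical
  have hij := ne_of_drop h₁ h₂
  refine ⟨Function.update u j false, ⟨?_, by simp, fun k hk => by simp [hk]⟩, ?_, ?_, ?_⟩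
  · rw [← h₁.2.2 j hij.symm, h₂.1]
  · rw [Function.update_of_ne hij, h₁.1]
  · rw [h₂.2.2 i hij, h₁.2.1]
  · intro k hk
    by_cases hj : k = j
    · subst hj; simp [h₂.2.1]
    · rw [Function.update_of_ne hj, h₂.2.2 k hj, h₁.2.2 k hk]

/-- A chain of two saddles can be replaced with a chain in the other order. -/
theorem Saddle.exists_swap (κ : D.Coloring) {i j : D.Vertex} {x y z : D.KhGen}
    (h₁ : D.Saddle i x y) (h₂ : D.Saddle j y z) :
    ∃ y', D.Saddle j x y' ∧ D.Saddle i y' z ∧ D.FaceMatch i j x y y' z := by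
  obtain ⟨a, ha, hao⟩ := exists_under i
  obtain ⟨b, hb⟩ : ∃ b, D.vtx b = j := Quot.exists_rep j
  obtain ⟨v', hd₁, hd₂⟩ := exists_drop_swap h₁.1 h₂.1
  -- The free parameter is set to the label of `y` at an end `a` of the understrand of `i`, as the
  -- ladybug matching demands.
  obtain ⟨f, hf, hP, hQ, hl⟩ := Pants.exists_swap x.isLabelling y.isLabelling z.isLabelling
    (h₁.at κ ha) (h₂.at κ hb) (joins_or_joins κ hd₁.flip hb (h₂.rot_rot_ne hb))
    (joins_or_joins κ hd₂.flip ha (h₁.rot_rot_ne ha)) (y.deg a) (y.label a).deg_eq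
  obtain ⟨y', rfl, rfl⟩ := KhGen.exists_of_isLabelling hf
  have k₁ : D.Saddle j x y' := (saddle_iff κ hb).2 ⟨hd₁, h₂.rot_rot_ne hb, hP⟩
  have k₂ : D.Saddle i y' z := (saddle_iff κ ha).2 ⟨hd₂, h₁.rot_rot_ne ha, hQ⟩
  refine ⟨y', k₁, k₂, ?_⟩
  intro hlady h hh ho
  have hL := ((isLadybug_iff ha hb).1 hlady).2.2
  have key : y'.deg a = y.deg a := hl hL
  apply Label.deg_injective
  change y.deg h = y'.deg h
  rcases eq_or_rot_rot (hh.trans ha.symm) (ho.trans hao.symm) with rfl | rfl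
  · exact key.symm
  · rcases h₁.at κ ha with ⟨J, -⟩ | ⟨J, s, -⟩
    · exact absurd hL.1 J.1
    rcases k₂.at κ ha with ⟨J', s', -⟩ | ⟨J', -⟩
    swap
    · exact absurd hL.2.2.2.1 J'.1
    -- both sums are determined
    rcases h₂.at κ hb with ⟨J₂, s₂, -⟩ | ⟨J₂, -⟩
    swap
    · exact absurd hL.2.2.2.2.1 J₂.1
    have e₁ := z.isLabelling.1 _ _ hL.2.2.2.2.2
    have e₂ := J.pairs b (D.rot (D.rot b))
    have e₃ := y.isLabelling.1 b a
    have e₄ := y.isLabelling.1 b (D.rot (D.rot a))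
    have e₅ := y.isLabelling.1 (D.rot (D.rot b)) a
    have e₆ := y.isLabelling.1 (D.rot (D.rot b)) (D.rot (D.rot a))
    have e₇ : y.deg b + y.deg (D.rot (D.rot b)) =
        y.deg a + y.deg (D.rot (D.rot a)) := by
      have := J₂.1
      obtain ⟨l₁, l₂, l₃, l₄, l₅, l₆⟩ := hL
      clear hl hQ hP
      grind
    linarith

end LinkDiagram
-- Symmetry and uniqueness of the ladybug matching, and cubes
namespace LinkDiagram

variable {D : LinkDiagram}

theorem Coloring.conn_pow_next (κ : D.Coloring) {u v : D.State} (h : κ.Out) {n : ℕ}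
    (hn : ∀ m < n, v (D.vtx (D.edge ((κ.next u ^ m) h).1)) = u (D.vtx (D.edge ((κ.next u ^ m) h).1))) :
    (κ.next v ^ n) h = (κ.next u ^ n) h := by
  induction n with
  | zero => rfl
  | succ n ih =>
    rw [pow_succ', pow_succ', Equiv.Perm.mul_apply, Equiv.Perm.mul_apply,
      ih fun m hm => hn m (hm.trans (Nat.lt_succ_self n))]
    apply Subtype.ext
    change D.smooth v _ = D.smooth u _
    unfold smooth
    rw [hn n (Nat.lt_succ_self n)]

theorem Coloring.conn_pow (κ : D.Coloring) (v : D.State) (h : κ.Out) (n : ℕ) :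
    D.Conn v h.1 ((κ.next v ^ n) h).1 := by
  induction n with
  | zero => exact Conn.refl v _
  | succ n ih =>
    rw [pow_succ', Equiv.Perm.mul_apply]
    exact ih.trans (κ.conn_next v _)

theorem Coloring.exists_pow_of_conn (κ : D.Coloring) {v : D.State} (h : κ.Out) {g : D.Dart}
    (hg : κ.col g = false) (hc : D.Conn v h.1 g) : ∃ n, ((κ.next v ^ n) h).1 = D.edge g := by
  have := D.finite_dart
  have : Finite κ.Out := Subtype.finite
  rw [κ.conn_iff_sameCycle, κ.outRep_out] at hc
  obtain ⟨n, -, hn⟩ := hc.exists_pow_eq'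
  refine ⟨n, ?_⟩
  rw [hn, ← κ.outRep_edge]
  have : κ.col (D.edge g) = true := by rw [κ.col_edge, hg]; rfl
  rw [κ.outRep_out ⟨_, this⟩]

/-- Follow the circle from `h` until it first arrives at `i` or `j`. An arrival at `i` would close
up a circle that misses `j`, either at `u` or at `vi`, against `hu` or `hv`. So the arrival is at
`j`, along an arc that neither surgery touches. Its last dart has the colour of `g₀`, hence belongs
to the understrand like `g₀`. -/
theorem exists_conn_both_aux (κ : D.Coloring) {i j : D.Vertex} {u vi vj : D.State}
    (hi : Flip i u vi) (hj : Flip j u vj) (hij : i ≠ j) {h g₀ : D.Dart} (hh : D.vtx h = i)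
    (hg₀ : D.vtx g₀ = j) (hgo : D.isOver g₀ = false)
    (hcol : κ.col h = true) (hcol' : κ.col g₀ = false) (hu : D.Conn u h g₀)
    (hv : D.Conn vi h g₀ ∨ D.Conn vi h (D.rot (D.rot g₀))) :
    ∃ g, D.vtx g = j ∧ D.isOver g = false ∧ D.Conn vi h g ∧ D.Conn vj h g := by
  classical
  have hex : ∃ n, D.vtx (D.edge ((κ.next u ^ n) ⟨h, hcol⟩).1) = i ∨
      D.vtx (D.edge ((κ.next u ^ n) ⟨h, hcol⟩).1) = j := by
    obtain ⟨n, hn⟩ := κ.exists_pow_of_conn ⟨h, hcol⟩ hcol' hu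
    exact ⟨n, Or.inr (by rw [hn, D.edge_edge, hg₀])⟩
  obtain ⟨n, hn, hmin⟩ : ∃ n, (D.vtx (D.edge ((κ.next u ^ n) ⟨h, hcol⟩).1) = i ∨
      D.vtx (D.edge ((κ.next u ^ n) ⟨h, hcol⟩).1) = j) ∧
      ∀ m < n, ¬ (D.vtx (D.edge ((κ.next u ^ m) ⟨h, hcol⟩).1) = i ∨
      D.vtx (D.edge ((κ.next u ^ m) ⟨h, hcol⟩).1) = j) :=
    ⟨Nat.find hex, Nat.find_spec hex, fun m hm => Nat.find_min hex hm⟩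
  have hpow : ∀ v : D.State, (∀ c, c ≠ i → c ≠ j → v c = u c) → ∀ m ≤ n,
      (κ.next v ^ m) ⟨h, hcol⟩ = (κ.next u ^ m) ⟨h, hcol⟩ := by
    intro v hvu m hm
    refine κ.conn_pow_next _ fun l hl => hvu _ ?_ ?_
    · exact fun he => hmin l (by omega) (Or.inl he)
    · exact fun he => hmin l (by omega) (Or.inr he)
  have hvi : ∀ c, c ≠ i → c ≠ j → vi c = u c := fun c h₁ _ => hi.2 c h₁
  have hvj : ∀ c, c ≠ i → c ≠ j → vj c = u c := fun c _ h₂ => hj.2 c h₂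
  rcases hn with hn | hn
  · exfalso
    -- the arc returns to the first crossing, so that it closes up without passing the second one
    set b := D.edge ((κ.next u ^ n) ⟨h, hcol⟩).1 with hb
    have hbc : κ.col b = false := by rw [hb, κ.col_edge, ((κ.next u ^ n) ⟨h, hcol⟩).2]; rfl
    have hclose : ∀ v : D.State, (∀ c, c ≠ i → c ≠ j → v c = u c) → D.smooth v b = h →
        ∀ g, D.vtx g = j → κ.col g = false → ¬ D.Conn v h g := by
      intro v hvu hs g hg hgc hcon
      obtain ⟨k, hk⟩ := κ.exists_pow_of_conn ⟨h, hcol⟩ hgc hcon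
      have hper : (κ.next v ^ (n + 1)) ⟨h, hcol⟩ = ⟨h, hcol⟩ := by
        rw [pow_succ', Equiv.Perm.mul_apply, hpow v hvu n le_rfl]
        exact Subtype.ext hs
      have hmul : ∀ q, (κ.next v ^ ((n + 1) * q)) ⟨h, hcol⟩ = ⟨h, hcol⟩ := by
        intro q
        induction q with
        | zero => rfl
        | succ q ih => rw [Nat.mul_succ, pow_add, Equiv.Perm.mul_apply, hper, ih]
      have hlt := Nat.mod_lt k (show 0 < n + 1 by omega)
      rw [← Nat.mod_add_div k (n + 1), pow_add, Equiv.Perm.mul_apply, hmul,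
        hpow v hvu _ (by omega)] at hk
      have hvt : D.vtx (D.edge ((κ.next u ^ (k % (n + 1))) ⟨h, hcol⟩).1) = j := by
        rw [hk, D.edge_edge, hg]
      rcases Nat.lt_or_ge (k % (n + 1)) n with hl | hl
      · exact hmin _ hl (Or.inr hvt)
      · have : k % (n + 1) = n := by omega
        rw [this] at hvt
        exact hij (hn.symm.trans hvt)
    have hbo : D.smooth u b = h ∨ D.smooth u b = D.rot (D.rot h) := by
      have h₁ : D.vtx (D.smooth u b) = D.vtx h := by rw [D.vtx_smooth, hn, hh]
      have h₂ : κ.col (D.smooth u b) = true := by rw [κ.col_smooth, hbc]; rfl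
      rcases D.eq_of_vtx_eq h₁ with h₃ | h₃ | h₃ | h₃
      · exact Or.inl h₃
      · rw [h₃, κ.col_rot, hcol] at h₂; exact absurd h₂ (by decide)
      · exact Or.inr h₃
      · rw [h₃, κ.col_rot, κ.col_rot_rot, hcol] at h₂; exact absurd h₂ (by decide)
    rcases hbo with hbo | hbo
    · exact hclose u (fun _ _ _ => rfl) hbo g₀ hg₀ hcol' hu
    · have hs : D.smooth vi b = h := by rw [smooth_flip hi hn, hbo, D.rot_four]
      rcases hv with hv | hv
      · exact hclose vi hvi hs g₀ hg₀ hcol' hv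
      · exact hclose vi hvi hs _ (by rw [D.vtx_rot, D.vtx_rot, hg₀])
          (by rw [κ.col_rot_rot, hcol']) hv
  · refine ⟨_, hn, ?_, ?_, ?_⟩
    · set b := D.edge ((κ.next u ^ n) ⟨h, hcol⟩).1 with hb
      have hbc : κ.col b = false := by rw [hb, κ.col_edge, ((κ.next u ^ n) ⟨h, hcol⟩).2]; rfl
      rcases D.eq_of_vtx_eq (hn.trans hg₀.symm) with h₃ | h₃ | h₃ | h₃
      · rw [h₃, hgo]
      · rw [h₃, κ.col_rot, hcol'] at hbc; exact absurd hbc (by decide)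
      · rw [h₃, D.isOver_rot_rot, hgo]
      · rw [h₃, κ.col_rot, κ.col_rot_rot, hcol'] at hbc; exact absurd hbc (by decide)
    · have := κ.conn_pow vi ⟨h, hcol⟩ n
      rw [hpow vi hvi n le_rfl] at this
      exact this.trans (conn_edge _ _)
    · have := κ.conn_pow vj ⟨h, hcol⟩ n
      rw [hpow vj hvj n le_rfl] at this
      exact this.trans (conn_edge _ _)

/-- In a ladybug, a segment of the right pair belongs to corresponding circles. -/
theorem exists_conn_both (κ : D.Coloring) {i j : D.Vertex} {u vi vj : D.State}
    (hi : Flip i u vi) (hj : Flip j u vj) (hij : i ≠ j)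
    (hκ : ∀ a b, D.vtx a = i → D.vtx b = j → D.isOver a = D.isOver b → κ.col a ≠ κ.col b)
    (hu : ∀ a b, D.vtx a = i → D.vtx b = j → D.Conn u a b)
    (hvi : ∀ a b, D.vtx a = i → D.vtx b = j → D.Conn vi a b ∨ D.Conn vi a (D.rot (D.rot b)))
    (hvj : ∀ a b, D.vtx a = i → D.vtx b = j → D.Conn vj b a ∨ D.Conn vj b (D.rot (D.rot a))) :
    ∃ a b, D.vtx a = i ∧ D.vtx b = j ∧ D.isOver a = false ∧ D.isOver b = false ∧
      D.Conn vi a b ∧ D.Conn vj a b := by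
  obtain ⟨a, ha, hao⟩ := exists_under i
  obtain ⟨b, hb, hbo⟩ := exists_under j
  have hab := hκ a b ha hb (hao.trans hbo.symm)
  by_cases hc : κ.col a = true
  · obtain ⟨g, h₁, h₂, h₃, h₄⟩ := exists_conn_both_aux κ hi hj hij ha hb hbo hc
      (by rw [hc] at hab; simpa using hab.symm) (hu a b ha hb) (hvi a b ha hb)
    exact ⟨a, g, ha, h₁, hao, h₂, h₃, h₄⟩
  · have hc' : κ.col a = false := by simpa using hc
    obtain ⟨g, h₁, h₂, h₃, h₄⟩ := exists_conn_both_aux κ hj hi hij.symm hb ha hao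
      (by rw [hc'] at hab; simpa using hab.symm) hc' (hu a b ha hb).symm (hvj a b ha hb)
    exact ⟨g, b, h₁, hb, h₂, hbo, h₄.symm, h₃.symm⟩

/-- The crossings of a ladybug have different colours. -/
def Coloring.SeparatesLadybugs (κ : D.Coloring) : Prop :=
  ∀ i j u v w, D.Drop i u v → D.Drop j v w → D.IsLadybug i j u w →
    ∀ a b, D.vtx a = i → D.vtx b = j → D.isOver a = D.isOver b → κ.col a ≠ κ.col b

/-- The labels in the middle of a ladybug. -/
theorem lady_sums {a b : D.Dart} {x y z : D.KhGen} (h : SaddleAt a x y) (k : SaddleAt b y z)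
    (hL : Lady (D.circ x.state) (D.circ z.state) a (D.rot (D.rot a)) b (D.rot (D.rot b))) :
    x.deg a = 0 ∧ z.deg a = 1 ∧ y.deg a + y.deg (D.rot (D.rot a)) = 1 ∧
    y.deg b + y.deg (D.rot (D.rot b)) = 1 ∧ (D.Conn y.state a b ∨
      D.Conn y.state a (D.rot (D.rot b))) ∧
    ¬ D.Conn y.state a (D.rot (D.rot a)) ∧ ¬ D.Conn y.state b (D.rot (D.rot b)) := by
  rcases h with ⟨J, -⟩ | ⟨J, s, -⟩
  · exact absurd hL.1 J.1
  rcases k with ⟨J₂, s₂, -⟩ | ⟨J₂, -⟩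
  swap
  · exact absurd hL.2.2.2.2.1 J₂.1
  have e₂ := J.pairs b (D.rot (D.rot b))
  have e₃ := y.isLabelling.1 b a
  have e₄ := y.isLabelling.1 b (D.rot (D.rot a))
  have e₅ := y.isLabelling.1 (D.rot (D.rot b)) a
  have e₆ := y.isLabelling.1 (D.rot (D.rot b)) (D.rot (D.rot a))
  have e₇ := z.isLabelling.1 _ _ hL.2.2.2.2.2
  have e₈ := z.isLabelling.2 a
  have e₉ := x.isLabelling.2 a
  have e₁₀ := J₂.1
  have e₁₁ := J.1
  obtain ⟨l₁, l₂, l₃, l₄, l₅, l₆⟩ := hL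
  unfold Conn
  have k₁ : (D.circ y.state b = D.circ y.state a ∧
      D.circ y.state (D.rot (D.rot b)) = D.circ y.state (D.rot (D.rot a))) ∨
      (D.circ y.state b = D.circ y.state (D.rot (D.rot a)) ∧
      D.circ y.state (D.rot (D.rot b)) = D.circ y.state a) := by
    clear s s₂ e₃ e₄ e₅ e₆ e₇ e₈ e₉
    grind
  rcases k₁ with ⟨k₁, k₂⟩ | ⟨k₁, k₂⟩
  · have := e₃ k₁
    have := e₆ k₂
    exact ⟨by omega, by omega, by omega, by omega, Or.inl k₁.symm, e₁₁, e₁₀⟩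
  · have := e₄ k₁
    have := e₅ k₂
    exact ⟨by omega, by omega, by omega, by omega, Or.inr k₂.symm, e₁₁, e₁₀⟩

/-- The matching is defined by labels at the understrand of `i`. An arc from an understrand end of
`i` to one of `j` that lies on circles of both middle resolutions transfers the equality of labels
to `j`. The opposite end of `j` follows, since on each side the two labels add up to one. -/
theorem FaceMatch.symm (κ : D.Coloring) (hκ : κ.SeparatesLadybugs) {i j : D.Vertex}
    {x y y' z : D.KhGen} (h₁ : D.Saddle i x y) (h₂ : D.Saddle j y z) (h₃ : D.Saddle j x y')
    (h₄ : D.Saddle i y' z) (h : D.FaceMatch i j x y y' z) : D.FaceMatch j i x y' y z := by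
  intro hl g₀ hg₀ hgo
  have hL : ∀ a b, D.vtx a = i → D.vtx b = j →
      Lady (D.circ x.state) (D.circ z.state) a (D.rot (D.rot a)) b (D.rot (D.rot b)) :=
    fun a b ha hb => ((isLadybug_iff ha hb).1 hl.symm).2.2
  have hL' : ∀ a b, D.vtx a = i → D.vtx b = j →
      Lady (D.circ x.state) (D.circ z.state) b (D.rot (D.rot b)) a (D.rot (D.rot a)) :=
    fun a b ha hb => ((isLadybug_iff hb ha).1 hl).2.2
  obtain ⟨a, b, ha, hb, hao, hbo, c₁, c₂⟩ := exists_conn_both κ h₁.1.flip h₃.1.flip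
    (ne_of_drop h₁.1 h₂.1) (hκ _ _ _ _ _ h₁.1 h₂.1 hl.symm) (fun a b ha hb => (hL a b ha hb).2.2.1)
    (fun a b ha hb => (lady_sums (h₁.at κ ha) (h₂.at κ hb) (hL a b ha hb)).2.2.2.2.1)
    (fun a b ha hb => (lady_sums (h₃.at κ hb) (h₄.at κ ha) (hL' a b ha hb)).2.2.2.2.1)
  have e₁ := h hl.symm a ha hao
  rw [y.label_conn c₁, y'.label_conn c₂] at e₁
  have s₁ := (lady_sums (h₁.at κ ha) (h₂.at κ hb) (hL a b ha hb)).2.2.2.1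
  have s₂ := (lady_sums (h₃.at κ hb) (h₄.at κ ha) (hL' a b ha hb)).2.2.1
  rcases eq_or_rot_rot (hg₀.trans hb.symm) (hgo.trans hbo.symm) with rfl | rfl
  · exact e₁.symm
  · apply Label.deg_injective
    change y'.deg _ = y.deg _
    have e₂ : y.deg b = y'.deg b := congrArg Label.deg e₁
    linarith

/-- Two chains over the same two edges differ only in the middle of a ladybug. -/
theorem eq_of_not_ladybug (κ : D.Coloring) {i j : D.Vertex} {x y y' z : D.KhGen}
    (h₁ : D.Saddle i x y) (h₂ : D.Saddle j y z) (h₃ : D.Saddle i x y') (h₄ : D.Saddle j y' z)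
    (hl : ¬ D.IsLadybug i j x.state z.state) : y = y' := by
  by_contra hne
  obtain ⟨a, ha⟩ : ∃ a, D.vtx a = i := Quot.exists_rep i
  obtain ⟨b, hb⟩ : ∃ b, D.vtx b = j := Quot.exists_rep j
  obtain ⟨-, -, hL, -⟩ := SaddleAt.lady_of_ne (drop_unique h₁.1 h₃.1) (h₁.at κ ha) (h₂.at κ hb)
    (h₃.at κ ha) (h₄.at κ hb) hne
  exact hl (((isLadybug_iff hb ha).2 ⟨h₂.isCrossing, h₁.isCrossing, hL⟩).symm)

/-- Two different middle generators occur only in a ladybug and differ at `a`, but there the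
matching prescribes the label. -/
theorem FaceMatch.unique (κ : D.Coloring) {i j : D.Vertex} {x y z y₁ y₂ : D.KhGen}
    (h₁ : D.Saddle j x y₁) (k₁ : D.Saddle i y₁ z) (h₂ : D.Saddle j x y₂) (k₂ : D.Saddle i y₂ z)
    (f₁ : D.FaceMatch i j x y y₁ z) (f₂ : D.FaceMatch i j x y y₂ z) : y₁ = y₂ := by
  by_contra hne
  obtain ⟨a, ha, hao⟩ := exists_under i
  obtain ⟨b, hb⟩ : ∃ b, D.vtx b = j := Quot.exists_rep j
  obtain ⟨-, -, hL, hd⟩ := SaddleAt.lady_of_ne (drop_unique h₁.1 h₂.1) (h₁.at κ hb) (k₁.at κ ha)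
    (h₂.at κ hb) (k₂.at κ ha) hne
  have hl : D.IsLadybug i j x.state z.state :=
    (isLadybug_iff ha hb).2 ⟨k₁.isCrossing, h₁.isCrossing, hL⟩
  exact hd (congrArg Label.deg ((f₁ hl a ha hao).symm.trans (f₂ hl a ha hao)))

/-- A crossing which splits at first, but merges after another surgery, is part of a ladybug. -/
theorem isLadybug_of_split (κ : D.Coloring) {i j : D.Vertex} {u v w : D.State}
    (h₁ : D.Drop i u v) (h₂ : D.Drop j v w) (hi : D.IsCrossing i) (hj : D.IsCrossing j)
    {b : D.Dart} (hb : D.vtx b = j) (hs : D.Conn u b (D.rot (D.rot b)))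
    (hm : ¬ D.Conn v b (D.rot (D.rot b))) : D.IsLadybug i j u w := by
  obtain ⟨a, ha⟩ : ∃ a, D.vtx a = i := Quot.exists_rep i
  exact (isLadybug_iff ha hb).2 ⟨hi, hj,
    Lady.of_joins (joins_or_joins κ h₁.flip ha (hi a ha)) hs (joins_of_flip κ h₂.flip hb hm)⟩

/-- Following the labels at a crossing along one side of a cube. -/
theorem hexagon_route (κ : D.Coloring) (hκ : κ.SeparatesLadybugs) {i j k : D.Vertex}
    {x y z w s t : D.KhGen} (h₁ : D.Saddle i x y) (h₂ : D.Saddle j y z) (h₃ : D.Saddle k z w)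
    (h₄ : D.Saddle k y s) (h₅ : D.Saddle j s w) (h₆ : D.Saddle k x t) (h₇ : D.Saddle i t s)
    (f₁ : D.FaceMatch j k y z s w) (f₂ : D.FaceMatch i k x y t s)
    {h : D.Dart} (hh : D.vtx h = k) (ho : D.isOver h = false)
    (hs : D.Conn x.state h (D.rot (D.rot h))) (hm : ¬ D.Conn z.state h (D.rot (D.rot h)))
    (ht : t.deg h + t.deg (D.rot (D.rot h)) = 1) (hz : z.deg h + z.deg (D.rot (D.rot h)) = 1) :
    t.deg h = z.deg h := by
  obtain ⟨a, ha⟩ : ∃ a, D.vtx a = i := Quot.exists_rep i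
  obtain ⟨b, hb⟩ : ∃ b, D.vtx b = j := Quot.exists_rep j
  have bd : ∀ (g : D.KhGen) e, g.deg e = 0 ∨ g.deg e = 1 := fun g e => g.isLabelling.2 e
  by_cases hy : D.Conn y.state h (D.rot (D.rot h))
  · -- ladybug in the directions `j`, `k` from `y`
    have hl := isLadybug_of_split κ h₂.1 h₃.1 h₂.isCrossing h₃.isCrossing hh hy hm
    have e : s.deg h = z.deg h := congrArg Label.deg ((f₁.symm κ hκ h₂ h₃ h₄ h₅) hl.symm h hh ho)
    have hL := ((isLadybug_iff hh hb).1 hl.symm).2.2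
    have s₁ := (lady_sums (h₄.at κ hh) (h₅.at κ hb) hL).2.2.1
    -- Labels `X` persist from `t` to `s`, and in both generators exactly one of the two opposite
    -- darts carries `X`; so it is the same dart.
    have m₁ := fun e => (h₇.at κ ha).mono (e := e)
    have := m₁ h
    have := m₁ (D.rot (D.rot h))
    have := bd t h
    have := bd t (D.rot (D.rot h))
    omega
  -- Here the surgery in direction `i` already separates the strands at `k`. The ladybug has the
  -- directions `i`, `k` and starts at `x`, and the label found at `y` persists to `z`.
  · have hl := isLadybug_of_split κ h₁.1 h₄.1 h₁.isCrossing h₄.isCrossing hh hs hy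
    have e : t.deg h = y.deg h := congrArg Label.deg ((f₂.symm κ hκ h₁ h₄ h₆ h₇) hl.symm h hh ho)
    have hL := ((isLadybug_iff ha hh).1 hl).2.2
    have s₁ := (lady_sums (h₁.at κ ha) (h₄.at κ hh) hL).2.2.2.1
    have m₁ := fun e => (h₂.at κ hb).mono (e := e)
    have := m₁ h
    have := m₁ (D.rot (D.rot h))
    have := bd y h
    have := bd y (D.rot (D.rot h))
    omega

/-- The six faces of a cube are compatible, if two of the crossings do not form ladybugs. -/
theorem hexagon_core (κ : D.Coloring) (hκ : κ.SeparatesLadybugs) {i j k : D.Vertex}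
    (hij : ∀ u v w, D.Drop i u v → D.Drop j v w → ¬ D.IsLadybug i j u w) {x y z w y' s t s' t' s₁ y₁ z₁ : D.KhGen}
    (h₁ : D.Saddle i x y) (h₂ : D.Saddle j y z) (h₃ : D.Saddle k z w)
    (h₄ : D.Saddle j x y') (h₅ : D.Saddle i y' z)
    (h₆ : D.Saddle k y s) (h₇ : D.Saddle j s w) (f₂ : D.FaceMatch j k y z s w)
    (h₈ : D.Saddle k x t) (h₉ : D.Saddle i t s) (f₃ : D.FaceMatch i k x y t s)
    (h₁₀ : D.Saddle k y' s') (h₁₁ : D.Saddle i s' w) (f₄ : D.FaceMatch i k y' z s' w)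
    (h₁₂ : D.Saddle k x t') (h₁₃ : D.Saddle j t' s') (f₅ : D.FaceMatch j k x y' t' s')
    (h₁₄ : D.Saddle j t s₁) (h₁₅ : D.Saddle i s₁ w)
    (h₁₆ : D.Saddle j x y₁) (h₁₇ : D.Saddle k y₁ s₁) (f₇ : D.FaceMatch k j x t y₁ s₁)
    (h₁₈ : D.Saddle i y₁ z₁) (h₁₉ : D.Saddle k z₁ w) (f₈ : D.FaceMatch k i y₁ s₁ z₁ w) :
    y₁ = y' ∧ z₁ = z := by
  have hji : ∀ u v w, D.Drop j u v → D.Drop i v w → ¬ D.IsLadybug j i u w := by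
    intro u v w d₁ d₂ h
    obtain ⟨v', d₃, d₄⟩ := exists_drop_swap d₁ d₂
    exact hij u v' w d₃ d₄ h.symm
  by_cases hz : z₁ = z
  · subst hz
    exact ⟨eq_of_not_ladybug κ h₁₆ h₁₈ h₄ h₅ (hji _ _ _ h₁₆.1 h₁₈.1), rfl⟩
  by_cases ht : t = t'
  · subst ht
    have hs : s₁ = s' := eq_of_not_ladybug κ h₁₄ h₁₅ h₁₃ h₁₁ (hji _ _ _ h₁₄.1 h₁₅.1)
    subst hs
    have hy : y₁ = y' := f₇.unique κ h₁₆ h₁₇ h₄ h₁₀ (f₅.symm κ hκ h₄ h₁₀ h₁₂ h₁₃)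
    subst hy
    exact ⟨rfl, f₈.unique κ h₁₈ h₁₉ h₅ h₃ (f₄.symm κ hκ h₅ h₃ h₁₀ h₁₁)⟩
  -- If the ends of the two routes differ, at `t` as well as at `z`, then `k` splits a circle at `x`
  -- and merges two circles at `z`. In this situation `hexagon_route` computes the labels of both
  -- `t` and `t'` at `h` from the label of `z`, so they agree.
  exfalso
  obtain ⟨h, hh, ho⟩ := exists_under k
  obtain ⟨J, -, m₁, m₂, hne⟩ := SaddleAt.two_targets (drop_unique h₈.1 h₁₂.1) (h₈.at κ hh)
    (h₁₂.at κ hh) ht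
  have e : z₁.state = z.state := drop_unique h₁₈.1 (drop_unique h₁₆.1 h₄.1 ▸ h₅.1)
  obtain ⟨J', -, -, m₃, -⟩ := SaddleAt.two_sources e (h₁₉.at κ hh) (h₃.at κ hh) hz
  have hm : ¬ D.Conn z.state h (D.rot (D.rot h)) := by
    rw [← e]
    exact J'.1
  have hs : D.Conn x.state h (D.rot (D.rot h)) := (J.pairs h h).2.1
  apply hne
  rw [hexagon_route κ hκ h₁ h₂ h₃ h₆ h₇ h₈ h₉ f₂ f₃ hh ho hs hm m₁ m₃,
    hexagon_route κ hκ h₄ h₅ h₃ h₁₀ h₁₁ h₁₂ h₁₃ f₄ f₅ hh ho hs hm m₂ m₃]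

end LinkDiagram
-- The hexagon relation from pairs of directions without ladybugs
namespace CubeData
variable {ι : Type} {A : CubeData ι}

/-- Sequences of three edges. -/
structure Chain (A : CubeData ι) (x w : A.Gen) where
  (i j k : ι)
  (y z : A.Gen)
  fst : A.Step i x y
  snd : A.Step j y z
  trd : A.Step k z w

/-- The hexagon condition follows from its special case for sequences of edges the first two of
which have a certain property, if among any three directions there are two with this property. -/
theorem hexagon_of_good
    (hex : ∀ {i j x y z}, A.Step i x y → A.Step j y z →
      ∃ y', A.Step j x y' ∧ A.Step i y' z ∧ A.Face i j x y y' z)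
    (huniq : ∀ {i j x y z y₁ y₂}, A.Step i x y → A.Step j y z →
      A.Step j x y₁ → A.Step i y₁ z → A.Face i j x y y₁ z →
      A.Step j x y₂ → A.Step i y₂ z → A.Face i j x y y₂ z → y₁ = y₂)
    (hsymm : ∀ {i j x y y' z}, A.Step i x y → A.Step j y z → A.Step j x y' → A.Step i y' z →
      A.Face i j x y y' z → A.Face j i x y' y z)
    (good : ι → ι → Prop) (hgood : ∀ i j k, good i j ∨ good i k ∨ good j k)
    (hcore : ∀ {i j k x y z w y' s t s' t' s₁ y₁ z₁}, good i j →
      A.Step i x y → A.Step j y z → A.Step k z w →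
      A.Step j x y' → A.Step i y' z →
      A.Step k y s → A.Step j s w → A.Face j k y z s w →
      A.Step k x t → A.Step i t s → A.Face i k x y t s →
      A.Step k y' s' → A.Step i s' w → A.Face i k y' z s' w →
      A.Step k x t' → A.Step j t' s' → A.Face j k x y' t' s' →
      A.Step j t s₁ → A.Step i s₁ w → A.Face i j t s s₁ w → A.Face i j x y y' z →
      A.Step j x y₁ → A.Step k y₁ s₁ → A.Face k j x t y₁ s₁ →
      A.Step i y₁ z₁ → A.Step k z₁ w → A.Face k i y₁ s₁ z₁ w → y₁ = y' ∧ z₁ = z)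
    {i j k x y z w y' s t s' t'} (h₁ : A.Step i x y) (h₂ : A.Step j y z) (h₃ : A.Step k z w)
    (h₄ : A.Step j x y') (h₅ : A.Step i y' z) (f₁ : A.Face i j x y y' z)
    (h₆ : A.Step k y s) (h₇ : A.Step j s w) (f₂ : A.Face j k y z s w)
    (h₈ : A.Step k x t) (h₉ : A.Step i t s) (f₃ : A.Face i k x y t s)
    (h₁₀ : A.Step k y' s') (h₁₁ : A.Step i s' w) (f₄ : A.Face i k y' z s' w)
    (h₁₂ : A.Step k x t') (h₁₃ : A.Step j t' s') (f₅ : A.Face j k x y' t' s') :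
    t = t' ∧ A.Face i j t s s' w := by
  classical
  -- the two involutions which exchange the first two or the last two edges
  have hA : ∀ C : A.Chain x w, ∃ C' : A.Chain x w, C'.i = C.j ∧ C'.j = C.i ∧ C'.k = C.k ∧
      C'.z = C.z ∧ A.Face C.i C.j x C.y C'.y C.z := by
    intro C
    obtain ⟨y', k₁, k₂, f⟩ := hex C.fst C.snd
    exact ⟨⟨C.j, C.i, C.k, y', C.z, k₁, k₂, C.trd⟩, rfl, rfl, rfl, rfl, f⟩
  have hB : ∀ C : A.Chain x w, ∃ C' : A.Chain x w, C'.i = C.i ∧ C'.j = C.k ∧ C'.k = C.j ∧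
      C'.y = C.y ∧ A.Face C.j C.k C.y C.z C'.z w := by
    intro C
    obtain ⟨z', k₁, k₂, f⟩ := hex C.snd C.trd
    exact ⟨⟨C.i, C.k, C.j, C.y, z', C.fst, k₁, k₂⟩, rfl, rfl, rfl, rfl, f⟩
  choose a ha using hA
  choose b hb using hB
  have ha' : ∀ {i j k y z y'} (k₁ : A.Step i x y) (k₂ : A.Step j y z) (k₃ : A.Step k z w)
      (k₄ : A.Step j x y') (k₅ : A.Step i y' z), A.Face i j x y y' z →
      a ⟨i, j, k, y, z, k₁, k₂, k₃⟩ = ⟨j, i, k, y', z, k₄, k₅, k₃⟩ := by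
    intro i j k y z y' k₁ k₂ k₃ k₄ k₅ f
    obtain ⟨e₁, e₂, e₃, e₄, e₅⟩ := ha ⟨i, j, k, y, z, k₁, k₂, k₃⟩
    generalize a ⟨i, j, k, y, z, k₁, k₂, k₃⟩ = C at *
    obtain ⟨i₁, j₁, k₁', y₁, z₁, l₁, l₂, l₃⟩ := C
    dsimp only at *
    subst e₁ e₂ e₃ e₄
    have := huniq k₁ k₂ l₁ l₂ e₅ k₄ k₅ f
    subst this
    rfl
  have hb' : ∀ {i j k y z z'} (k₁ : A.Step i x y) (k₂ : A.Step j y z) (k₃ : A.Step k z w)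
      (k₄ : A.Step k y z') (k₅ : A.Step j z' w), A.Face j k y z z' w →
      b ⟨i, j, k, y, z, k₁, k₂, k₃⟩ = ⟨i, k, j, y, z', k₁, k₄, k₅⟩ := by
    intro i j k y z y' k₁ k₂ k₃ k₄ k₅ f
    obtain ⟨e₁, e₂, e₃, e₄, e₅⟩ := hb ⟨i, j, k, y, z, k₁, k₂, k₃⟩
    generalize b ⟨i, j, k, y, z, k₁, k₂, k₃⟩ = C at *
    obtain ⟨i₁, j₁, k₁', y₁, z₁, l₁, l₂, l₃⟩ := C
    dsimp only at *
    subst e₁ e₂ e₃ e₄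
    have := huniq k₂ k₃ l₂ l₃ e₅ k₄ k₅ f
    subst this
    rfl
  have haa : ∀ C, a (a C) = C := by
    rintro ⟨i, j, k, y, z, k₁, k₂, k₃⟩
    obtain ⟨y', k₄, k₅, f⟩ := hex k₁ k₂
    rw [ha' k₁ k₂ k₃ k₄ k₅ f, ha' k₄ k₅ k₃ k₁ k₂ (hsymm k₁ k₂ k₄ k₅ f)]
  have hbb : ∀ C, b (b C) = C := by
    rintro ⟨i, j, k, y, z, k₁, k₂, k₃⟩
    obtain ⟨y', k₄, k₅, f⟩ := hex k₂ k₃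
    rw [hb' k₁ k₂ k₃ k₄ k₅ f, hb' k₁ k₄ k₅ k₂ k₃ (hsymm k₂ k₃ k₄ k₅ f)]
  -- In terms of the involutions `a` and `b` of the chains over a cube, the hexagon is the relation
  -- `(a b)³ = 1`. For a good first pair of directions it is `hcore`.
  have hgoodC : ∀ C : A.Chain x w, good C.i C.j → b (a (b (a (b C)))) = a C := by
    rintro ⟨i, j, k, y, z, k₁, k₂, k₃⟩ hg
    obtain ⟨y', k₄, k₅, g₁⟩ := hex k₁ k₂
    obtain ⟨s, k₆, k₇, g₂⟩ := hex k₂ k₃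
    obtain ⟨t, k₈, k₉, g₃⟩ := hex k₁ k₆
    obtain ⟨s', k₁₀, k₁₁, g₄⟩ := hex k₅ k₃
    obtain ⟨t', k₁₂, k₁₃, g₅⟩ := hex k₄ k₁₀
    obtain ⟨s₁, k₁₄, k₁₅, g₆⟩ := hex k₉ k₇
    obtain ⟨y₁, k₁₆, k₁₇, g₇⟩ := hex k₈ k₁₄
    obtain ⟨z₁, k₁₈, k₁₉, g₈⟩ := hex k₁₇ k₁₅
    rw [ha' k₁ k₂ k₃ k₄ k₅ g₁, hb' k₁ k₂ k₃ k₆ k₇ g₂, ha' k₁ k₆ k₇ k₈ k₉ g₃,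
      hb' k₈ k₉ k₇ k₁₄ k₁₅ g₆, ha' k₈ k₁₄ k₁₅ k₁₆ k₁₇ g₇, hb' k₁₆ k₁₇ k₁₅ k₁₈ k₁₉ g₈]
    obtain ⟨rfl, rfl⟩ := hcore hg k₁ k₂ k₃ k₄ k₅ k₆ k₇ g₂ k₈ k₉ g₃ k₁₀ k₁₁ g₄ k₁₂ k₁₃ g₅
      k₁₄ k₁₅ g₆ g₁ k₁₆ k₁₇ g₇ k₁₈ k₁₉ g₈
    rfl
  -- The relation `(a b)³ = 1` may be verified at any chain of the orbit. Passing from `C` to `b C`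
  -- or `b (a C)` changes the pair of directions that comes first, so one of these three chains has
  -- a good first pair.
  have key : ∀ C : A.Chain x w, b (a (b (a (b C)))) = a C := by
    intro C
    rcases hgood C.i C.j C.k with hg | hg | hg
    · exact hgoodC C hg
    · have h := hgoodC (b C) (by rw [(hb C).1, (hb C).2.1]; exact hg)
      rw [hbb] at h
      -- `b a b a C = a b C`
      have h' := congrArg b (congrArg a (congrArg b h))
      rw [hbb, haa, hbb] at h'
      exact h'.symm
    · have h := hgoodC (b (a C)) (by
        rw [(hb (a C)).1, (hb (a C)).2.1, (ha C).1, (ha C).2.2.1]; exact hg)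
      rw [hbb, haa] at h
      -- `b a b C = a b a C`
      rw [h, haa, hbb]
  have h := key ⟨i, j, k, y, z, h₁, h₂, h₃⟩
  obtain ⟨s₁, k₁₄, k₁₅, g₆⟩ := hex h₉ h₇
  have h' := congrArg a (congrArg b h)
  rw [hbb, haa] at h'
  rw [ha' h₁ h₂ h₃ h₄ h₅ f₁, hb' h₄ h₅ h₃ h₁₀ h₁₁ f₄, ha' h₄ h₁₀ h₁₁ h₁₂ h₁₃ f₅,
    hb' h₁ h₂ h₃ h₆ h₇ f₂, ha' h₁ h₆ h₇ h₈ h₉ f₃, hb' h₈ h₉ h₇ k₁₄ k₁₅ g₆] at h'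
  simp only [Chain.mk.injEq] at h'
  obtain ⟨-, -, -, rfl, rfl⟩ := h'
  exact ⟨rfl, g₆⟩

end CubeData

namespace LinkDiagram

variable {D : LinkDiagram}

/-- Each crossing gets the colour of its understrand ends. Crossings of equal colour form no
ladybug, and among three crossings two have equal colour, so the hexagon relation only has to be
checked for such a pair. -/
theorem khovanovData_coherent (κ : D.Coloring) (hκ : κ.SeparatesLadybugs) (o : D.Orientation)
    (q : ℤ) : (D.khovanovData o q).Coherent := by
  have hex : ∀ {i j} {x y z : (D.khovanovData o q).Gen}, (D.khovanovData o q).Step i x y →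
      (D.khovanovData o q).Step j y z →
      ∃ y', (D.khovanovData o q).Step j x y' ∧ (D.khovanovData o q).Step i y' z ∧
        (D.khovanovData o q).Face i j x y y' z := by
    intro i j x y z h₁ h₂
    obtain ⟨y', h₃, h₄, f⟩ := Saddle.exists_swap κ h₁ h₂
    exact ⟨⟨y', (h₃.quantum_eq κ o).trans x.2⟩, h₃, h₄, f⟩
  have huniq : ∀ {i j} {x y z y₁ y₂ : (D.khovanovData o q).Gen}, (D.khovanovData o q).Step i x y →
      (D.khovanovData o q).Step j y z →
      (D.khovanovData o q).Step j x y₁ → (D.khovanovData o q).Step i y₁ z →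
      (D.khovanovData o q).Face i j x y y₁ z →
      (D.khovanovData o q).Step j x y₂ → (D.khovanovData o q).Step i y₂ z →
      (D.khovanovData o q).Face i j x y y₂ z → y₁ = y₂ :=
    fun _ _ h₁ k₁ f₁ h₂ k₂ f₂ => Subtype.ext (FaceMatch.unique κ h₁ k₁ h₂ k₂ f₁ f₂)
  have hsymm : ∀ {i j} {x y y' z : (D.khovanovData o q).Gen}, (D.khovanovData o q).Step i x y →
      (D.khovanovData o q).Step j y z → (D.khovanovData o q).Step j x y' →
      (D.khovanovData o q).Step i y' z →
      (D.khovanovData o q).Face i j x y y' z → (D.khovanovData o q).Face j i x y' y z :=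
    fun h₁ h₂ h₃ h₄ f => FaceMatch.symm κ hκ h₁ h₂ h₃ h₄ f
  have hcol : ∀ c : D.Vertex, ∃ e : Bool, ∀ a, D.vtx a = c → D.isOver a = false → κ.col a = e := by
    intro c
    obtain ⟨a, ha, hao⟩ := exists_under c
    refine ⟨κ.col a, fun b hb hbo => ?_⟩
    rcases eq_or_rot_rot (hb.trans ha.symm) (hbo.trans hao.symm) with rfl | rfl
    · rfl
    · exact κ.col_rot_rot a
  choose e he using hcol
  have := D.finite_dart
  have hG : Finite D.KhGen := inferInstance
  refine ⟨Finite.of_surjective D.vtx Quot.mk_surjective, Subtype.finite, hex, huniq, hsymm, ?_⟩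
  intro i j k x y z w y' s t s' t' h₁ h₂ h₃ h₄ h₅ f₁ h₆ h₇ f₂ h₈ h₉ f₃ h₁₀ h₁₁ f₄ h₁₂ h₁₃ f₅
  refine CubeData.hexagon_of_good hex huniq hsymm (fun i j => e i = e j) ?_ ?_ h₁ h₂ h₃ h₄ h₅ f₁
    h₆ h₇ f₂ h₈ h₉ f₃ h₁₀ h₁₁ f₄ h₁₂ h₁₃ f₅
  · intro i j k
    cases e i <;> cases e j <;> cases e k <;> simp
  · intro i j k x y z w y' s t s' t' s₁ y₁ z₁ hg k₁ k₂ k₃ k₄ k₅ k₆ k₇ g₂ k₈ k₉ g₃ k₁₀ k₁₁ g₄ k₁₂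
      k₁₃ g₅ k₁₄ k₁₅ _ _ k₁₆ k₁₇ g₇ k₁₈ k₁₉ g₈
    obtain ⟨a, ha, hao⟩ := exists_under i
    obtain ⟨b, hb, hbo⟩ := exists_under j
    have hn : ∀ {u v w}, D.Drop i u v → D.Drop j v w → ¬ D.IsLadybug i j u w := by
      intro u v w d₁ d₂ hl
      refine hκ _ _ _ _ _ d₁ d₂ hl a b ha hb (hao.trans hbo.symm) ?_
      rw [he i a ha hao, he j b hb hbo]
      exact hg
    have := hexagon_core κ hκ (fun _ _ _ => hn) k₁ k₂ k₃ k₄ k₅ k₆ k₇ g₂ k₈ k₉ g₃ k₁₀ k₁₁ g₄ k₁₂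
      k₁₃ g₅ k₁₄ k₁₅ k₁₆ k₁₇ g₇ k₁₈ k₁₉ g₈
    exact ⟨Subtype.ext this.1, Subtype.ext this.2⟩

end LinkDiagram
-- Planarity: cycles bound, and ladybugs join crossings of opposite colours
namespace LinkDiagram

variable (D : LinkDiagram)

/-- A connected diagram on the sphere, all of whose vertices are crossings. -/
structure IsPlanar : Prop where
  four_valent : ∀ h, D.rot (D.rot h) ≠ h
  connected : ∀ p : D.Dart → ZMod 2, (∀ h, p (D.edge h) = p h) → (∀ h, p (D.rot h) = p h) →
    ∀ a b, p a = p b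
  euler : Nat.card D.Vertex + Nat.card D.Region = Nat.card D.Edge + 2

variable {D}

theorem left_edge (h : D.Dart) : D.left (D.edge h) = D.left (D.rot.symm h) := by
  have : D.left (D.edge h) = D.left (D.rot.symm (D.edge (D.edge h))) := Quot.sound rfl
  rwa [D.edge_edge] at this

theorem left_edge_rot (h : D.Dart) : D.left (D.edge (D.rot h)) = D.left h := by
  rw [left_edge, Equiv.symm_apply_apply]

theorem edge_class_eq {a b : D.Dart}
    (h : (Quot.mk _ b : D.Edge) = Quot.mk (fun a b => b = D.edge a) a) :
    b = a ∨ b = D.edge a := by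
  have h₁ := Quot.eqvGen_exact h
  clear h
  induction h₁ with
  | rel x y h => subst h; exact Or.inr (D.edge_edge x).symm
  | refl x => exact Or.inl rfl
  | symm x y _ ih =>
    rcases ih with h | h
    · exact Or.inl h.symm
    · exact Or.inr (by rw [h, D.edge_edge])
  | trans x y z _ _ ih₁ ih₂ =>
    rcases ih₁ with rfl | rfl <;> rcases ih₂ with rfl | rfl <;> simp [D.edge_edge]

open Classical in
theorem sum_vertex [Fintype D.Dart] (hD : D.IsPlanar) (f : D.Dart → ZMod 2) (a : D.Dart) :
    ∑ h, (if D.vtx h = D.vtx a then f h else 0) =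
      f a + f (D.rot a) + f (D.rot (D.rot a)) + f (D.rot (D.rot (D.rot a))) := by
  rw [← Finset.sum_filter]
  have h₁ : ∀ b : D.Dart, D.rot b ≠ b := fun b h => by
    have := D.isOver_rot b
    rw [h] at this
    simp at this
  have h₂ := hD.four_valent
  have h₃ : ∀ b : D.Dart, D.rot (D.rot (D.rot b)) ≠ b := fun b h => by
    have := D.isOver_rot b
    rw [← D.isOver_rot_rot, h] at this
    simp at this
  have : (Finset.univ.filter fun h => D.vtx h = D.vtx a) =
      {a, D.rot a, D.rot (D.rot a), D.rot (D.rot (D.rot a))} := by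
    ext b
    simp only [Finset.mem_filter, Finset.mem_univ, true_and, Finset.mem_insert,
      Finset.mem_singleton]
    refine ⟨fun h => D.eq_of_vtx_eq h, ?_⟩
    rintro (rfl | rfl | rfl | rfl) <;> simp only [D.vtx_rot]
  rw [this, Finset.sum_insert, Finset.sum_insert, Finset.sum_insert, Finset.sum_singleton]
  · ring
  · simpa using (h₁ _).symm
  · simp only [Finset.mem_insert, Finset.mem_singleton, not_or]
    exact ⟨(h₁ _).symm, (h₂ _).symm⟩
  · simp only [Finset.mem_insert, Finset.mem_singleton, not_or]
    exact ⟨(h₁ _).symm, (h₂ _).symm, (h₃ _).symm⟩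

open Classical in
theorem sum_edge [Fintype D.Dart] (f : D.Dart → ZMod 2) (a : D.Dart) :
    ∑ h, (if (Quot.mk _ h : D.Edge) = Quot.mk (fun a b => b = D.edge a) a then f h else 0) =
      f a + f (D.edge a) := by
  rw [← Finset.sum_filter]
  have : (Finset.univ.filter fun h => (Quot.mk _ h : D.Edge) = Quot.mk (fun a b => b = D.edge a) a) =
      {a, D.edge a} := by
    ext b
    simp only [Finset.mem_filter, Finset.mem_univ, true_and, Finset.mem_insert,
      Finset.mem_singleton]
    refine ⟨fun h => edge_class_eq h, ?_⟩
    rintro (rfl | rfl)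
    · rfl
    · exact (Quot.sound (r := fun a b : D.Dart => b = D.edge a) rfl).symm
  rw [this, Finset.sum_insert (by simpa using (D.edge_ne a).symm), Finset.sum_singleton]

theorem finrank_le_one_of_const {W ι : Type} [Fintype ι] [AddCommGroup W] [Module (ZMod 2) W]
    (T : (ι → ZMod 2) →ₗ[ZMod 2] W) (h : ∀ p, T p = 0 → ∀ a b, p a = p b) :
    Module.finrank (ZMod 2) (LinearMap.ker T) ≤ 1 := by
  refine (Submodule.finrank_mono (t := Submodule.span (ZMod 2) {fun _ : ι => (1 : ZMod 2)})
    fun p hp => ?_).trans 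
    ((finrank_span_le_card ({_} : Set (ι → ZMod 2))).trans (by simp))
  rw [Submodule.mem_span_singleton]
  by_cases hι : Nonempty ι
  · obtain ⟨i⟩ := hι
    refine ⟨p i, ?_⟩
    funext k
    simp [h p hp i k]
  · exact ⟨0, funext fun k => absurd ⟨k⟩ hι⟩

open Classical in
/-- On the sphere, every cycle with coefficients in `ℤ/2` is a boundary. -/
theorem IsPlanar.exists_boundary (hD : D.IsPlanar) (f : D.Dart → ZMod 2)
    (he : ∀ h, f (D.edge h) = f h)
    (hv : ∀ h, f h + f (D.rot h) + f (D.rot (D.rot h)) + f (D.rot (D.rot (D.rot h))) = 0) :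
    ∃ χ : D.Region → ZMod 2, ∀ h, f h = χ (D.left h) + χ (D.left (D.edge h)) := by
  have := D.finite_dart
  have := Fintype.ofFinite D.Dart
  have : Finite D.Vertex := Finite.of_surjective D.vtx Quot.mk_surjective
  have : Finite D.Region := Finite.of_surjective D.left Quot.mk_surjective
  have : Finite D.Edge := Finite.of_surjective (Quot.mk _ : D.Dart → D.Edge) Quot.mk_surjective
  have := Fintype.ofFinite D.Vertex
  have := Fintype.ofFinite D.Region
  have := Fintype.ofFinite D.Edge
  let cls : D.Dart → D.Edge := Quot.mk _
  have hcls : ∀ h, cls (D.edge h) = cls h := fun h =>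
    (Quot.sound (r := fun a b : D.Dart => b = D.edge a) rfl).symm
  -- the coboundary of functions on the regions
  let δ : (D.Region → ZMod 2) →ₗ[ZMod 2] (D.Edge → ZMod 2) :=
    { toFun := fun χ => Quot.lift (fun h => χ (D.left h) + χ (D.left (D.edge h)))
        (by rintro a _ rfl; rw [D.edge_edge, add_comm])
      map_add' := fun χ χ' => by
        funext e
        obtain ⟨h, rfl⟩ := Quot.exists_rep e
        change _ = (χ _ + χ _) + (χ' _ + χ' _)
        simp only [Pi.add_apply]
        ring
      map_smul' := fun c χ => by
        funext e
        obtain ⟨h, rfl⟩ := Quot.exists_rep e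
        change _ = c * (χ _ + χ _)
        simp only [Pi.smul_apply, smul_eq_mul]
        ring }
  have hδ : ∀ χ h, δ χ (cls h) = χ (D.left h) + χ (D.left (D.edge h)) := fun _ _ => rfl
  -- the incidence matrix
  let M : Matrix D.Vertex D.Edge (ZMod 2) := fun v e =>
    ∑ h, if D.vtx h = v ∧ cls h = e then 1 else 0
  have hMd : ∀ v e, M v e = ∑ h, if D.vtx h = v ∧ cls h = e then 1 else 0 := fun _ _ => rfl
  have hM : ∀ (g : D.Edge → ZMod 2) v, (M.mulVec g) v = ∑ h, if D.vtx h = v then g (cls h) else 0 := by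
    intro g v
    change ∑ e, M v e * g e = _
    simp only [hMd, Finset.sum_mul]
    rw [Finset.sum_comm]
    refine Finset.sum_congr rfl fun h _ => ?_
    simp [ite_and, ite_mul]
  have hMt : ∀ (g : D.Vertex → ZMod 2) a,
      (M.transpose.mulVec g) (cls a) = g (D.vtx a) + g (D.vtx (D.edge a)) := by
    intro g a
    rw [← sum_edge (fun h => g (D.vtx h))]
    change ∑ v, M v (cls a) * g v = _
    simp only [hMd, Finset.sum_mul]
    rw [Finset.sum_comm]
    refine Finset.sum_congr rfl fun h _ => ?_
    simp only [and_comm (b := cls h = cls a), ite_and, ite_mul, zero_mul, one_mul]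
    by_cases hc : cls h = cls a
    · have hc' : (Quot.mk _ h : D.Edge) = Quot.mk (fun a b => b = D.edge a) a := hc
      rw [if_pos hc']
      simp [hc]
    · have hc' : ¬ (Quot.mk _ h : D.Edge) = Quot.mk (fun a b => b = D.edge a) a := hc
      simp [hc, hc']
  have k₁ : Module.finrank (ZMod 2) (LinearMap.ker δ) ≤ 1 := by
    refine finrank_le_one_of_const _ fun p hp => ?_
    have hp' : ∀ h, p (D.left h) = p (D.left (D.edge h)) := fun h => by
      have := congrFun hp (cls h)
      rw [hδ] at this
      exact CharTwo.add_eq_zero.1 this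
    have := hD.connected (fun h => p (D.left h)) (fun h => (hp' h).symm)
      (fun h => by rw [hp', left_edge_rot])
    rintro ⟨a⟩ ⟨b⟩
    exact this a b
  have k₂ : Module.finrank (ZMod 2) (LinearMap.ker M.transpose.mulVecLin) ≤ 1 := by
    refine finrank_le_one_of_const _ fun p hp => ?_
    have hp' : ∀ h, p (D.vtx h) = p (D.vtx (D.edge h)) := fun h => by
      have := congrFun hp (cls h)
      rw [Matrix.mulVecLin_apply, hMt] at this
      exact CharTwo.add_eq_zero.1 this
    have := hD.connected (fun h => p (D.vtx h)) (fun h => (hp' h).symm) (fun h => by rw [D.vtx_rot])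
    rintro ⟨a⟩ ⟨b⟩
    exact this a b
  have r₁ := LinearMap.finrank_range_add_finrank_ker δ
  have r₂ := LinearMap.finrank_range_add_finrank_ker M.transpose.mulVecLin
  have r₃ := LinearMap.finrank_range_add_finrank_ker M.mulVecLin
  have r₄ : Module.finrank (ZMod 2) (LinearMap.range M.transpose.mulVecLin) =
    Module.finrank (ZMod 2) (LinearMap.range M.mulVecLin) := M.rank_transpose
  have r₅ := hD.euler
  rw [Module.finrank_fintype_fun_eq_card] at r₁ r₂ r₃
  simp only [Nat.card_eq_fintype_card] at r₅
  have hle : LinearMap.range δ ≤ LinearMap.ker M.mulVecLin := by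
    rintro _ ⟨χ, rfl⟩
    rw [LinearMap.mem_ker, Matrix.mulVecLin_apply]
    funext c
    obtain ⟨a, rfl⟩ := Quot.exists_rep c
    change (M.mulVec (δ χ)) (D.vtx a) = 0
    rw [hM]
    simp only [hδ]
    rw [sum_vertex hD, left_edge a, D.rot_symm_eq]
    simp only [left_edge_rot]
    ring_nf
    simp [show (2 : ZMod 2) = 0 from rfl]
  -- With `V`, `E`, `F` the numbers of vertices, edges and regions, the range of `δ` has dimension
  -- at least `F - 1` and the kernel of `M` at most `E - V + 1`. By Euler's formula these two bounds
  -- coincide.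
  have heq : LinearMap.range δ = LinearMap.ker M.mulVecLin := by
    apply Submodule.eq_of_le_of_finrank_le hle
    omega
  let g : D.Edge → ZMod 2 := Quot.lift f (by rintro a _ rfl; exact (he a).symm)
  have hg : g ∈ LinearMap.ker M.mulVecLin := by
    rw [LinearMap.mem_ker, Matrix.mulVecLin_apply]
    funext c
    obtain ⟨a, rfl⟩ := Quot.exists_rep c
    change (M.mulVec g) (D.vtx a) = 0
    rw [hM]
    change ∑ h, (if D.vtx h = D.vtx a then f h else 0) = 0
    rw [sum_vertex hD, hv]
  rw [← heq] at hg
  obtain ⟨χ, hχ⟩ := hg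
  exact ⟨χ, fun h => by rw [← hδ, hχ]⟩

theorem IsPlanar.exists_bool_boundary (hD : D.IsPlanar) (f : D.Dart → Bool)
    (he : ∀ h, f (D.edge h) = f h)
    (hv : ∀ h, (f h ^^ f (D.rot h) ^^ f (D.rot (D.rot h)) ^^ f (D.rot (D.rot (D.rot h)))) = false) :
    ∃ χ : D.Region → Bool, ∀ h, f h = (χ (D.left h) ^^ χ (D.left (D.edge h))) := by
  obtain ⟨χ, hχ⟩ := hD.exists_boundary (fun h => if f h then 1 else 0) (fun h => by rw [he])
    (fun h => by
      have := hv h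
      revert this
      generalize f h = p
      generalize f (D.rot h) = q
      generalize f (D.rot (D.rot h)) = r
      generalize f (D.rot (D.rot (D.rot h))) = s
      revert p q r s
      decide)
  refine ⟨fun r => decide (χ r = 1), fun h => ?_⟩
  have := hχ h
  dsimp only at this ⊢
  revert this
  generalize f h = p
  generalize χ (D.left h) = q
  generalize χ (D.left (D.edge h)) = r
  revert p q r
  decide

/-- All vertices have even valency, so the sum of all edges is a cycle modulo 2; a set of regions
bounded by it is a colouring. -/
theorem IsPlanar.exists_coloring (hD : D.IsPlanar) :
    ∃ κ : D.Coloring, ∀ a b, D.left a = D.left b → κ.col a = κ.col b := by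
  obtain ⟨χ, hχ⟩ := hD.exists_bool_boundary (fun _ => true) (fun _ => rfl) (fun _ => rfl)
  have he : ∀ h, χ (D.left (D.edge h)) = !χ (D.left h) := by
    intro h
    have := hχ h
    revert this
    generalize χ (D.left h) = q
    generalize χ (D.left (D.edge h)) = r
    revert q r
    decide
  refine ⟨⟨fun h => χ (D.left h), he, fun h => ?_⟩, fun a b h => congrArg χ h⟩
  rw [← left_edge_rot h, he, Bool.not_not]

open Classical in
/-- A circle is the boundary of a set of regions. -/
theorem IsPlanar.exists_circle_boundary (hD : D.IsPlanar) (v : D.State) (a : D.Dart) :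
    ∃ χ : D.Region → Bool, ∀ h, D.Conn v h a ↔ χ (D.left h) ≠ χ (D.left (D.edge h)) := by
  obtain ⟨χ, hχ⟩ := hD.exists_bool_boundary (fun h => decide (D.Conn v h a))
    (fun h => by
      have := conn_edge v h
      exact decide_eq_decide.2 ⟨fun h => this.trans h, fun h => this.symm.trans h⟩)
    (fun h => by
      -- The smoothing joins the four darts at a vertex in pairs, so an even number of them lies on
      -- the given circle.
      have h₁ := conn_smooth v h
      have h₂ := conn_smooth v (D.rot (D.rot h))
      rw [D.smooth_rot_rot] at h₂
      have e₁ : decide (D.Conn v (D.smooth v h) a) = decide (D.Conn v h a) :=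
        decide_eq_decide.2 ⟨fun h => h₁.trans h, fun h => h₁.symm.trans h⟩
      have e₂ : decide (D.Conn v (D.rot (D.rot (D.smooth v h))) a) =
          decide (D.Conn v (D.rot (D.rot h)) a) :=
        decide_eq_decide.2 ⟨fun h => h₂.trans h, fun h => h₂.symm.trans h⟩
      unfold smooth at e₁ e₂
      split at e₁
      · rename_i hs
        rw [if_pos hs] at e₂
        rw [e₁, e₂]
        cases decide (D.Conn v h a) <;> cases decide (D.Conn v (D.rot (D.rot h)) a) <;> rfl
      · rename_i hs
        rw [if_neg hs, D.rot_symm_eq, D.rot_four] at e₂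
        rw [D.rot_symm_eq] at e₁
        rw [e₁, e₂]
        cases decide (D.Conn v h a) <;> cases decide (D.Conn v (D.rot (D.rot h)) a) <;> rfl)
  refine ⟨χ, fun h => ?_⟩
  have := hχ h
  rw [← decide_eq_true_iff (p := D.Conn v h a), this]
  simp

/-- The colour of the corner between a dart and the dart joined to it. -/
def Coloring.corner (κ : D.Coloring) (v : D.State) (h : D.Dart) : Bool :=
  (D.isOver h ^^ v (D.vtx h)) ^^ κ.col h

/-- Two crossings whose surgery arcs join the same two circles: the corners next to one of the
circles have the same colour. -/
theorem corner_eq (hD : D.IsPlanar) (κ : D.Coloring) {v : D.State} {h g : D.Dart}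
    (hg : D.Conn v h g) (hg' : D.Conn v (D.rot (D.rot h)) (D.rot (D.rot g)))
    (hne : ¬ D.Conn v h (D.rot (D.rot h))) : κ.corner v h = κ.corner v g := by
  classical
  obtain ⟨χ, hχ⟩ := hD.exists_circle_boundary v h
  -- the value on the black side of the darts of the first circle
  have h₁ : ∀ e, D.Conn v h e → (if κ.col e then χ (D.left e) else χ (D.left (D.edge e))) =
      (if κ.col h then χ (D.left h) else χ (D.left (D.edge h))) := by
    intro e he
    have := he.lift (fun e => if D.Conn v e h then
      (if κ.col e then χ (D.left e) else χ (D.left (D.edge e))) else false) (fun e => by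
        have c := conn_edge v e
        by_cases hc : D.Conn v e h
        · rw [if_pos hc, if_pos (c.symm.trans hc), κ.col_edge, D.edge_edge]
          cases κ.col e <;> rfl
        · rw [if_neg hc, if_neg (fun h => hc (c.trans h))]) (fun e => by
        have c := conn_smooth v e
        by_cases hc : D.Conn v e h
        · have hc' := c.symm.trans hc
          rw [if_pos hc, if_pos hc', κ.col_smooth]
          have b₁ := (hχ _).1 hc
          have b₂ := (hχ _).1 hc'
          unfold smooth at b₂ ⊢
          by_cases hs : D.isOver e = v (D.vtx e)
          · rw [if_pos hs] at b₂ ⊢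
            rw [left_edge_rot] at b₂ ⊢
            revert b₁ b₂
            generalize κ.col e = p
            generalize χ (D.left e) = q
            generalize χ (D.left (D.edge e)) = r
            generalize χ (D.left (D.rot e)) = s
            revert p q r s
            decide
          · rw [if_neg hs] at b₂ ⊢
            rw [left_edge e] at b₁ ⊢
            revert b₁ b₂
            generalize κ.col e = p
            generalize χ (D.left e) = q
            generalize χ (D.left (D.edge _)) = r
            generalize χ (D.left (D.rot.symm e)) = s
            revert p q r s
            decide
        · rw [if_neg hc, if_neg (fun h => hc (c.trans h))])
    rw [if_pos (Conn.refl v h), if_pos he.symm] at this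
    exact this.symm
  -- the value near the second circle
  have h₂ : ∀ e, D.Conn v (D.rot (D.rot h)) e → χ (D.left e) = χ (D.left (D.rot (D.rot h))) := by
    intro e he
    have hz : ∀ e, D.Conn v e (D.rot (D.rot h)) → χ (D.left e) = χ (D.left (D.edge e)) := by
      intro e he
      by_contra hc
      exact hne (((hχ e).2 hc).symm.trans he)
    have := he.lift (fun e => if D.Conn v e (D.rot (D.rot h)) then χ (D.left e) else false) (fun e => by
        have c := conn_edge v e
        by_cases hc : D.Conn v e (D.rot (D.rot h))
        · rw [if_pos hc, if_pos (c.symm.trans hc), ← hz e hc]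
        · rw [if_neg hc, if_neg (fun h => hc (c.trans h))]) (fun e => by
        have c := conn_smooth v e
        by_cases hc : D.Conn v e (D.rot (D.rot h))
        · have hc' := c.symm.trans hc
          rw [if_pos hc, if_pos hc']
          have b₁ := hz _ hc
          have b₂ := hz _ hc'
          unfold smooth at b₂ ⊢
          split
          · rename_i hs
            rw [if_pos hs] at b₂
            rw [b₂, left_edge_rot]
          · rw [b₁, left_edge]
        · rw [if_neg hc, if_neg (fun h => hc (c.trans h))])
    rw [if_pos (Conn.refl v _), if_pos he.symm] at this
    exact this.symm
  -- The region in the corner at `e` and the second circle lie on different sides of the first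
  -- circle. So the corner is black exactly when `χ` on the black side of the first circle differs
  -- from `χ` near the second one, and by `h₁` and `h₂` neither value depends on `e`.
  have h₃ : ∀ e, D.Conn v h e → D.Conn v (D.rot (D.rot h)) (D.rot (D.rot e)) →
      (κ.corner v e = ((if κ.col e then χ (D.left e) else χ (D.left (D.edge e))) ^^
        χ (D.left (D.rot (D.rot h))))) := by
    intro e he he'
    have b₁ := (hχ e).1 he.symm
    have c := conn_smooth v (D.rot (D.rot e))
    have b₂ := h₂ _ he'
    have b₃ := h₂ _ (he'.trans c)
    have b₄ := mt (hχ (D.rot (D.rot e))).2 (fun h => hne (h.symm.trans he'.symm))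
    have b₅ := (hχ _).1 ((conn_smooth v e).symm.trans he.symm)
    have b₆ := mt (hχ (D.smooth v (D.rot (D.rot e)))).2
      (fun h => hne ((c.trans h).symm.trans he'.symm))
    rw [D.smooth_rot_rot] at b₃ b₆
    push Not at b₄ b₆
    unfold Coloring.corner
    rw [left_edge e, D.rot_symm_eq] at b₁ ⊢
    rw [left_edge_rot] at b₄
    unfold smooth at b₃ b₅ b₆
    split at b₅
    · rename_i hs
      rw [if_pos hs] at b₃ b₆
      rw [hs]
      rw [left_edge_rot] at b₅ b₆
      revert b₁ b₂ b₃ b₄ b₅ b₆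
      generalize v (D.vtx e) = o
      generalize κ.col e = p
      generalize χ (D.left e) = q
      generalize χ (D.left (D.rot e)) = r
      generalize χ (D.left (D.rot (D.rot e))) = s
      generalize χ (D.left (D.rot (D.rot (D.rot e)))) = t
      generalize χ (D.left (D.rot (D.rot h))) = u
      revert o p q r s t u
      decide
    · rename_i hs
      rw [if_neg hs, D.rot_symm_eq, D.rot_four] at b₃ b₆
      rw [D.rot_symm_eq, left_edge_rot] at b₅
      rw [left_edge, D.rot_symm_eq, D.rot_four] at b₆
      revert b₁ b₂ b₃ b₄ b₅ b₆ hs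
      generalize v (D.vtx e) = o
      generalize D.isOver e = o'
      generalize κ.col e = p
      generalize χ (D.left e) = q
      generalize χ (D.left (D.rot e)) = r
      generalize χ (D.left (D.rot (D.rot e))) = s
      generalize χ (D.left (D.rot (D.rot (D.rot e)))) = t
      generalize χ (D.left (D.rot (D.rot h))) = u
      revert o o' p q r s t u
      decide
  rw [h₃ h (Conn.refl v h) (Conn.refl v _), h₃ g hg hg', h₁ g hg]

theorem Coloring.corner_rot_rot (κ : D.Coloring) (v : D.State) (h : D.Dart) :
    κ.corner v (D.rot (D.rot h)) = κ.corner v h := by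
  unfold corner
  rw [D.isOver_rot_rot, D.vtx_rot, D.vtx_rot, κ.col_rot_rot]

/-- In the middle of a ladybug there are two circles, and the arcs of both crossings join them, so
by `corner_eq` the corners have the same colour. The state there is `0` at `i` and `1` at `j`, so
equal corners mean opposite colours of the corresponding darts. -/
theorem IsPlanar.separatesLadybugs (hD : D.IsPlanar) (κ : D.Coloring) : κ.SeparatesLadybugs := by
  intro i j u v w h₁ h₂ hl a b ha hb ho hcol
  have ne : ∀ a, D.rot (D.rot a) ≠ a := hD.four_valent
  obtain ⟨-, -, l₁, l₂, l₃, l₄, l₅, l₆⟩ := (isLadybug_iff ha hb).1 hl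
  have J := (joins_or_joins κ h₁.flip ha (ne a)).resolve_left fun J => J.1 l₁
  have J' := (joins_or_joins κ h₂.flip hb (ne b)).resolve_right fun J => J.1 l₅
  have e₁ := J.1
  have e₂ := J'.1
  have e₃ := J.pairs b (D.rot (D.rot b))
  have key : κ.corner v a = κ.corner v b := by
    by_cases hc : D.Conn v a b
    · refine corner_eq hD κ hc ?_ e₁
      unfold Conn at *
      clear J J'
      grind
    · rw [← κ.corner_rot_rot v b]
      refine corner_eq hD κ ?_ ?_ e₁
      · unfold Conn at *
        clear J J'
        grind
      · rw [D.rot_four]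
        unfold Conn at *
        clear J J'
        grind
  unfold Coloring.corner at key
  rw [ha, hb, h₁.2.1, h₂.1, hcol, ho] at key
  revert key
  cases D.isOver b <;> cases κ.col b <;> decide

end LinkDiagram
-- The essential circles of the quotient
/-- An involution of a set has a fundamental domain, up to its fixed points. -/
theorem exists_halves {α : Type} [Finite α] (t : α → α) (ht : ∀ x, t (t x) = x) :
    ∃ s : α → ZMod 2, ∀ x, t x ≠ x → s (t x) = s x + 1 := by
  classical
  obtain ⟨n, ⟨e⟩⟩ := Finite.exists_equiv_fin α
  refine ⟨fun x => if e x < e (t x) then 0 else 1, fun x hx => ?_⟩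
  have hne : e x ≠ e (t x) := fun h => hx (e.injective h).symm
  dsimp only
  rw [ht]
  rcases lt_or_gt_of_ne hne with h | h
  · rw [if_pos h, if_neg h.not_gt]; rfl
  · rw [if_pos h, if_neg h.not_gt]; rfl

/-- Along a cycle of a permutation which is invariant under an involution that exchanges the values
`0`, `1` of a function, there is an odd number of changes from `0` to `1`. -/
theorem sum_changes_eq_one {α : Type} [Fintype α] [DecidableEq α] (f : Equiv.Perm α) (t : α → α)
    (ht : ∀ x, t (t x) = x) (hf : ∀ x, f (t x) = t (f x)) (H : α → ZMod 2)
    (hH : ∀ x, H (t x) = H x + 1) {a : α} (ha : f.SameCycle a (t a)) :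
    ∑ x, (if f.SameCycle a x then (1 + H x) * H (f x) else 0) = 1 := by
  have hpow : ∀ (k : ℕ) x, (f ^ k) (t x) = t ((f ^ k) x) := by
    intro k
    induction k with
    | zero => intro x; rfl
    | succ k ih => intro x; rw [pow_succ', Equiv.Perm.mul_apply, Equiv.Perm.mul_apply, ih, hf]
  have hne : t a ≠ a := fun h => by
    have := hH a
    rw [h] at this
    simp at this
  have hex : ∃ n, 0 < n ∧ (f ^ n) a = a := ⟨orderOf f, orderOf_pos f, by rw [pow_orderOf_eq_one]; rfl⟩
  obtain ⟨n, ⟨hn, hna⟩, hmin⟩ : ∃ n, (0 < n ∧ (f ^ n) a = a) ∧ ∀ m < n, ¬ (0 < m ∧ (f ^ m) a = a) :=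
    ⟨Nat.find hex, Nat.find_spec hex, fun m hm => Nat.find_min hex hm⟩
  have hmod : ∀ k, (f ^ (k % n)) a = (f ^ k) a := by
    intro k
    have hq : ∀ q, (f ^ (n * q)) a = a := by
      intro q
      induction q with
      | zero => rfl
      | succ q ih => rw [Nat.mul_succ, pow_add, Equiv.Perm.mul_apply, hna, ih]
    conv_rhs => rw [← Nat.mod_add_div k n, pow_add, Equiv.Perm.mul_apply, hq]
  have hinj : ∀ k l, k < n → l < n → (f ^ k) a = (f ^ l) a → k = l := by
    have key : ∀ k l, k < n → l < n → (f ^ k) a = (f ^ l) a → k ≤ l := by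
      intro k l hk hl h
      by_contra hlt
      refine hmin (k - l) (by omega) ⟨by omega, ?_⟩
      apply (f ^ l).injective
      rw [← Equiv.Perm.mul_apply, ← pow_add, ← h]
      congr 2
      omega
    exact fun k l hk hl h => le_antisymm (key k l hk hl h) (key l k hl hk h.symm)
  obtain ⟨k₀, -, hk₀⟩ := ha.exists_pow_eq'
  set m := k₀ % n with hm
  have hma : (f ^ m) a = t a := by rw [hmod, hk₀]
  have hmn : m < n := Nat.mod_lt _ hn
  have hm0 : 0 < m := by
    rcases Nat.eq_zero_or_pos m with h | h
    · rw [h] at hma; exact absurd hma.symm hne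
    · exact h
  -- The involution commutes with `f` and maps the cycle to itself without fixed points, so it acts
  -- on it as a half turn.
  have hn2 : n = 2 * m := by
    have h2 : (f ^ (2 * m)) a = a := by
      rw [two_mul, pow_add, Equiv.Perm.mul_apply, hma, hpow, hma, ht]
    rw [← hmod] at h2
    have h3 := hinj _ 0 (Nat.mod_lt _ hn) hn h2
    rcases Nat.lt_or_ge (2 * m) n with h | h
    · rw [Nat.mod_eq_of_lt h] at h3; omega
    · rw [Nat.mod_eq_sub_mod h, Nat.mod_eq_of_lt (by omega)] at h3
      omega
  have hs : ∑ x, (if f.SameCycle a x then (1 + H x) * H (f x) else 0) =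
      ∑ k ∈ Finset.range n, (1 + H ((f ^ k) a)) * H ((f ^ (k + 1)) a) := by
    rw [← Finset.sum_filter]
    symm
    refine Finset.sum_bij (fun k _ => (f ^ k) a) ?_ ?_ ?_ ?_
    · intro k _
      rw [Finset.mem_filter]
      exact ⟨Finset.mem_univ _, ⟨k, by rw [zpow_natCast]⟩⟩
    · intro k hk l hl h
      exact hinj k l (Finset.mem_range.1 hk) (Finset.mem_range.1 hl) h
    · intro x hx
      obtain ⟨k, -, hk⟩ := (Finset.mem_filter.1 hx).2.exists_pow_eq'
      exact ⟨k % n, Finset.mem_range.2 (Nat.mod_lt _ hn), by rw [hmod, hk]⟩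
    · intro k _
      rw [pow_succ', Equiv.Perm.mul_apply]
  have hHm : ∀ k, H ((f ^ (m + k)) a) = H ((f ^ k) a) + 1 := by
    intro k
    rw [add_comm, pow_add, Equiv.Perm.mul_apply, hma, hpow, hH]
  rw [hs, hn2, two_mul, Finset.sum_range_add]
  simp only [add_assoc, hHm]
  rw [← Finset.sum_add_distrib]
  -- Modulo 2, the terms for `k` and `m + k` add up to the change of `H` between `k` and `k + 1`.
  -- The sum over half of the cycle telescopes to the difference between `H (t a)` and `H a`.
  have htel : ∀ m, ∑ k ∈ Finset.range m, (H ((f ^ (k + 1)) a) - H ((f ^ k) a)) =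
      H ((f ^ m) a) - H ((f ^ 0) a) := fun m => Finset.sum_range_sub (fun k => H ((f ^ k) a)) m
  have h1 : ∑ k ∈ Finset.range m, (H ((f ^ (k + 1)) a) - H ((f ^ k) a)) = 1 := by
    rw [htel, hma, hH]
    simp
  refine Eq.trans ?_ h1
  refine Finset.sum_congr rfl fun k _ => ?_
  generalize H ((f ^ k) a) = p
  generalize H ((f ^ (k + 1)) a) = q
  revert p q
  decide

namespace IntravergentDiagram

open LinkDiagram

variable (K : IntravergentDiagram)

theorem isPlanar : K.toLinkDiagram.IsPlanar where
  four_valent := K.four_valent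
  connected p he hr a b := by
    have hs := K.knot
    have key := hs.elim (Quot.mk _ a) (Quot.mk _ b)
    exact congrArg (Quot.lift p (by
      rintro a _ (rfl | rfl)
      · exact (he a).symm
      · rw [hr, hr])) key
  euler := K.planar

theorem exists_center_dart (ε : Bool) : ∃ a, K.vtx a = K.center ∧ K.isOver a = ε := by
  obtain ⟨a, ha, ho⟩ := exists_under K.center
  cases ε
  · exact ⟨a, ha, ho⟩
  · exact ⟨K.rot a, by rw [LinkDiagram.vtx_rot, ha], by rw [K.isOver_rot, ho]; rfl⟩

/-- A function on the darts which changes by a constant is determined by one value. -/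
theorem const_of_edge_rot (p : K.Dart → Bool) (he : ∀ h, p (K.edge h) = p h)
    (hr : ∀ h, p (K.rot h) = p h) (a b : K.Dart) : p a = p b := by
  have := K.isPlanar.connected (fun h => if p h then 1 else 0) (fun h => by rw [he])
    (fun h => by rw [hr]) a b
  revert this
  generalize p a = x
  generalize p b = y
  revert x y
  decide

/-- The colourings `κ.col` and `κ.col ∘ tau` differ by a constant because the diagram is connected.
At the center `tau` is `rot ∘ rot`, which preserves colours, so the constant is zero. -/
theorem col_tau (κ : K.toLinkDiagram.Coloring) (h : K.Dart) : κ.col (K.tau h) = κ.col h := by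
  obtain ⟨c, hc, -⟩ := K.exists_center_dart true
  have := K.const_of_edge_rot (fun h => κ.col (K.tau h) ^^ κ.col h)
    (fun h => by rw [K.tau_edge, κ.col_edge, κ.col_edge]; simp)
    (fun h => by rw [K.tau_rot, κ.col_rot, κ.col_rot]; simp) h c
  rw [K.tau_center c hc, κ.col_rot_rot] at this
  simpa using this

/-- The action of the rotation on the regions. -/
def tauRegion : K.Region → K.Region :=
  Quot.lift (fun a => K.left (K.tau a)) (by
    rintro a _ rfl
    rw [K.tau_rot_symm, K.tau_edge]
    exact Quot.sound rfl)

theorem tauRegion_left (a : K.Dart) : K.tauRegion (K.left a) = K.left (K.tau a) := rfl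

theorem tauRegion_tauRegion (r : K.Region) : K.tauRegion (K.tauRegion r) = r := by
  obtain ⟨a, rfl⟩ := Quot.exists_rep r
  change K.left (K.tau (K.tau a)) = K.left a
  rw [K.tau_tau]

theorem tauRegion_eq_iff (r : K.Region) : K.tauRegion r = r ↔ r = K.outer := by
  obtain ⟨a, rfl⟩ := Quot.exists_rep r
  exact K.outer_iff a

theorem tauRegion_outer : K.tauRegion K.outer = K.outer := (K.tauRegion_eq_iff _).2 rfl

/-! ### The quotient -/

theorem projDart_surjective : Function.Surjective K.projDart := Quot.mk_surjective

theorem vtx_projDart (a : K.Dart) : K.quotientDiagram.vtx (K.projDart a) = K.projVertex (K.vtx a) := rfl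

theorem isOver_projDart (a : K.Dart) : K.quotientDiagram.isOver (K.projDart a) = K.isOver a := rfl

theorem projVertex_eq_iff {c d : K.Vertex} :
    K.projVertex c = K.projVertex d ↔ d = c ∨ d = K.tauVertex c := by
  constructor
  · intro h
    have hf : ∀ e, (fun e => e = c ∨ e = K.tauVertex c) (K.tauVertex e) =
        (fun e => e = c ∨ e = K.tauVertex c) e := by
      intro e
      refine propext ⟨?_, ?_⟩
      · rintro (h | h)
        · exact Or.inr (by rw [← h, tauVertex_tauVertex])
        · exact Or.inl (K.tauVertex.injective h)
      · rintro (rfl | rfl)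
        · exact Or.inr rfl
        · exact Or.inl (K.tauVertex_tauVertex _)
    have h₁ := K.descend_projVertex (fun e => e = c ∨ e = K.tauVertex c) hf d
    rw [← h, K.descend_projVertex] at h₁
    exact h₁.mp (Or.inl rfl)
  · rintro (rfl | rfl)
    · rfl
    · exact (K.projVertex_tau c).symm

/-- The state of `K` given by a state of the quotient. -/
def liftState (w : K.quotientDiagram.State) : K.State := w ∘ K.projVertex

theorem liftState_tau (w : K.quotientDiagram.State) : K.liftState w ∘ K.tauVertex = K.liftState w :=
  funext fun c => congrArg w (K.projVertex_tau c)

theorem smooth_projDart (w : K.quotientDiagram.State) (a : K.Dart) :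
    K.quotientDiagram.smooth w (K.projDart a) = K.projDart (K.smooth (K.liftState w) a) := by
  unfold smooth
  rw [isOver_projDart, vtx_projDart]
  change (if K.isOver a = K.liftState w (K.vtx a) then _ else _) = _
  split <;> rfl

theorem conn_tau {w : K.quotientDiagram.State} {a b : K.Dart} :
    K.Conn (K.liftState w) (K.tau a) (K.tau b) ↔ K.Conn (K.liftState w) a b := by
  have := K.circ_tau_iff (K.liftState w) a b
  rw [liftState_tau] at this
  exact this.symm

theorem smooth_liftState_tau (w : K.quotientDiagram.State) (a : K.Dart) :
    K.smooth (K.liftState w) (K.tau a) = K.tau (K.smooth (K.liftState w) a) := by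
  rw [K.smooth_tau, liftState_tau]

theorem conn_projDart (w : K.quotientDiagram.State) (a b : K.Dart) :
    K.quotientDiagram.Conn w (K.projDart a) (K.projDart b) ↔
      K.Conn (K.liftState w) a b ∨ K.Conn (K.liftState w) a (K.tau b) := by
  constructor
  · intro h
    have key := h.lift (Quot.lift (fun b => K.Conn (K.liftState w) a b ∨ K.Conn (K.liftState w) a (K.tau b))
      (by
        rintro b _ rfl
        rw [K.tau_tau, or_comm])) (by
        rintro ⟨b⟩
        have h₁ := conn_edge (K.liftState w) b
        have h₂ := conn_edge (K.liftState w) (K.tau b)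
        change (K.Conn _ a (K.edge b) ∨ K.Conn _ a (K.tau (K.edge b))) = (K.Conn _ a b ∨ K.Conn _ a (K.tau b))
        rw [K.tau_edge]
        exact propext (or_congr ⟨fun h => h.trans h₁.symm, fun h => h.trans h₁⟩
          ⟨fun h => h.trans h₂.symm, fun h => h.trans h₂⟩)) (by
        rintro ⟨b⟩
        have h₁ := conn_smooth (K.liftState w) b
        have h₂ := conn_smooth (K.liftState w) (K.tau b)
        rw [smooth_liftState_tau] at h₂
        have e : K.quotientDiagram.smooth w (Quot.mk _ b) = K.projDart (K.smooth (K.liftState w) b) :=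
          K.smooth_projDart w b
        rw [e]
        change (K.Conn _ a (K.smooth _ b) ∨ K.Conn _ a (K.tau (K.smooth _ b))) =
          (K.Conn _ a b ∨ K.Conn _ a (K.tau b))
        exact propext (or_congr ⟨fun h => h.trans h₁.symm, fun h => h.trans h₁⟩
          ⟨fun h => h.trans h₂.symm, fun h => h.trans h₂⟩))
    exact key.mp (Or.inl (Conn.refl _ a))
  · have key : ∀ b, K.Conn (K.liftState w) a b → K.quotientDiagram.Conn w (K.projDart a) (K.projDart b) := by
      intro b h
      have := h.lift (fun b => K.quotientDiagram.circ w (K.projDart b))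
        (fun b => (conn_edge w (K.projDart b)).symm)
        (fun b => by
          have := conn_smooth w (K.projDart b)
          rw [smooth_projDart] at this
          exact this.symm)
      exact this
    rintro (h | h)
    · exact key b h
    · rw [← K.projDart_tau b]; exact key _ h

/-- The colouring of the quotient. -/
def quotientColoring (κ : K.toLinkDiagram.Coloring) : K.quotientDiagram.Coloring where
  col := Quot.lift κ.col (by rintro a _ rfl; exact (K.col_tau κ a).symm)
  col_edge := by rintro ⟨a⟩; exact κ.col_edge a
  col_rot := by rintro ⟨a⟩; exact κ.col_rot a

theorem tauVertex_eq_center_iff (c : K.Vertex) : K.tauVertex c = K.center ↔ c = K.center := by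
  constructor
  · intro h
    have := congrArg K.tauVertex h
    rwa [tauVertex_tauVertex, tauVertex_center] at this
  · rintro rfl
    exact K.tauVertex_center

theorem tauVertex_eq_self_iff (c : K.Vertex) : K.tauVertex c = c ↔ c = K.center := by
  obtain ⟨a, rfl⟩ := Quot.exists_rep c
  refine ⟨fun h => K.center_of_tau a h, fun h => ?_⟩
  rw [h]
  exact K.tauVertex_center

end IntravergentDiagram
namespace IntravergentDiagram

open LinkDiagram

variable (K : IntravergentDiagram)

theorem region_const (q : K.Region → Bool) (hq : ∀ h, q (K.left h) = q (K.left (K.edge h)))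
    (r s : K.Region) : q r = q s := by
  obtain ⟨a, rfl⟩ := Quot.exists_rep r
  obtain ⟨b, rfl⟩ := Quot.exists_rep s
  exact K.const_of_edge_rot (fun h => q (K.left h)) (fun h => (hq h).symm)
    (fun h => by rw [hq, left_edge_rot]) a b

theorem isAxisRegion_iff (ε : Bool) (r : K.quotient.Region) : K.quotient.IsAxisRegion ε r ↔
    ∃ h, K.vtx h = K.center ∧ K.isOver h = !ε ∧ K.projRegion (K.left h) = r := by
  constructor
  · rintro ⟨h, h₁, h₂, h₃⟩
    obtain ⟨a, rfl⟩ := K.projDart_surjective h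
    exact ⟨a, K.eq_center_of_projVertex h₁, h₂, h₃⟩
  · rintro ⟨h, h₁, h₂, h₃⟩
    exact ⟨K.projDart h, congrArg K.projVertex h₁, h₂, h₃⟩

/-- Otherwise the preimage consists of two circles exchanged by the rotation. If `χ` bounds one of
them, `χ + χ ∘ tauRegion` bounds both and agrees with the preimage of `inside` up to a constant. It
vanishes at `outer`, which is fixed by the rotation, and also at the axis, since the two exchanged
regions there are joined by the resolution of the center and have the same `χ`. So `inside` does not
separate the axis from infinity. -/
theorem conn_tau_self_of_isEssential {w : K.quotientDiagram.State} {a : K.Dart}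
    (h : K.quotient.IsEssential w (K.quotientDiagram.circ w (K.projDart a))) :
    K.Conn (K.liftState w) a (K.tau a) := by
  classical
  by_contra hne
  obtain ⟨inside, hin, r, hr, hr'⟩ := h
  obtain ⟨h, hc, ho, rfl⟩ := (K.isAxisRegion_iff _ _).1 hr
  obtain ⟨χ, hχ⟩ := K.isPlanar.exists_circle_boundary (K.liftState w) a
  have hI : ∀ h, ¬ (inside (K.projRegion (K.left h)) ↔ inside (K.projRegion (K.left (K.edge h)))) ↔
      K.Conn (K.liftState w) h a ∨ K.Conn (K.liftState w) (K.tau h) a := by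
    intro h
    rw [← K.conn_tau (a := K.tau h), K.tau_tau, ← K.conn_projDart]
    exact hin (K.projDart h)
  have key := K.region_const
    (fun r => decide (inside (K.projRegion r)) ^^ χ r ^^ χ (K.tauRegion r)) (fun h => by
      have h₁ := hχ h
      have h₂ := hχ (K.tau h)
      have h₃ := hI h
      rw [h₁, h₂] at h₃
      have h₄ : ¬ (K.Conn (K.liftState w) h a ∧ K.Conn (K.liftState w) (K.tau h) a) := by
        rintro ⟨h₄, h₅⟩
        rw [← K.conn_tau, K.tau_tau] at h₅
        exact hne (h₄.symm.trans h₅)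
      rw [h₁, h₂] at h₄
      rw [tauRegion_left, tauRegion_left, K.tau_edge]
      clear h₁ h₂
      by_cases i₁ : inside (K.projRegion (K.left h)) <;>
        by_cases i₂ : inside (K.projRegion (K.left (K.edge h))) <;>
        simp only [i₁, i₂] at h₃ ⊢ <;>
      · revert h₃ h₄
        generalize χ (K.left h) = p
        generalize χ (K.left (K.edge h)) = q
        generalize χ (K.left (K.tau h)) = r
        generalize χ (K.left (K.edge (K.tau h))) = s
        revert p q r s
        decide) (K.left h) K.outer
  rw [tauRegion_outer, tauRegion_left, K.tau_center h hc] at key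
  have hs : K.smooth (K.liftState w) h = K.rot.symm h := by
    unfold smooth
    rw [if_neg]
    rw [hc, ho]
    change ¬ (!w K.quotient.point) = w K.quotient.point
    cases w K.quotient.point <;> decide
  have hs' : K.smooth (K.liftState w) (K.rot (K.rot h)) = K.rot h := by
    rw [K.smooth_rot_rot, hs, K.rot_symm_eq, K.rot_four]
  have hc₂ := conn_smooth (K.liftState w) (K.rot (K.rot h))
  rw [hs'] at hc₂
  have e₁ := hχ (K.rot (K.rot h))
  have e₂ := hχ (K.rot h)
  rw [left_edge_rot] at e₁ e₂
  have e₃ : K.Conn (K.liftState w) (K.rot (K.rot h)) a ↔ K.Conn (K.liftState w) (K.rot h) a :=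
    ⟨fun h => hc₂.symm.trans h, fun h => hc₂.trans h⟩
  rw [e₁, e₂] at e₃
  have hr'' : ¬ (inside (K.projRegion (K.left h)) ↔ inside (K.projRegion K.outer)) := hr'
  by_cases i₁ : inside (K.projRegion (K.left h)) <;>
    by_cases i₂ : inside (K.projRegion K.outer) <;> simp only [i₁, i₂] at key hr'' <;>
  · revert key e₃ hr''
    generalize χ (K.left h) = p
    generalize χ (K.left (K.rot h)) = q
    generalize χ (K.left (K.rot (K.rot h))) = r
    generalize χ K.outer = s
    revert p q r s
    decide

/-- The rotation as a permutation of the darts. -/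
def tauPerm : Equiv.Perm K.Dart := ⟨K.tau, K.tau, K.tau_tau, K.tau_tau⟩

/-- A function on the darts that jumps along a line through the center. -/
theorem exists_cut (w : K.quotientDiagram.State) {h₀ : K.Dart} (hc : K.vtx h₀ = K.center) :
    ∃ H : K.Dart → ZMod 2, (∀ h, H (K.tau h) = H h + 1) ∧
      (∀ h, K.vtx h ≠ K.center → H (K.rot h) = H h) ∧
      ∀ h, H (K.smooth (K.liftState w) h) = H h := by
  classical
  have := K.finite_dart
  have : Finite K.Vertex := Finite.of_surjective K.vtx Quot.mk_surjective
  obtain ⟨s, hs⟩ := exists_halves K.tauVertex K.tauVertex_tauVertex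
  set v := K.liftState w with hv
  -- `H` distinguishes the two vertices of each orbit. The center is its own orbit and is divided
  -- between the two strands of its resolution, which the rotation exchanges.
  let H : K.Dart → ZMod 2 := fun h => if K.vtx h = K.center then
    (if h = h₀ ∨ h = K.smooth v h₀ then 0 else 1) else s (K.vtx h)
  have H₁ : ∀ h, K.vtx h = K.center → H h = if h = h₀ ∨ h = K.smooth v h₀ then 0 else 1 :=
    fun h hh => if_pos hh
  have H₂ : ∀ h, K.vtx h ≠ K.center → H h = s (K.vtx h) := fun h hh => if_neg hh
  have n₁ : ∀ h : K.Dart, K.rot (K.rot h) ≠ h := K.four_valent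
  have n₂ : ∀ h, K.smooth v h ≠ h := fun h hh => by
    have := K.isOver_smooth v h
    rw [hh] at this
    simp at this
  have n₃ : ∀ h, K.rot (K.rot (K.smooth v h)) ≠ h := fun h hh => by
    have := K.isOver_smooth v h
    rw [← K.isOver_rot_rot, hh] at this
    simp at this
  have cs : ∀ h, K.vtx h = K.center → h = h₀ ∨ h = K.rot (K.rot h₀) ∨ h = K.smooth v h₀ ∨
      h = K.rot (K.rot (K.smooth v h₀)) := fun h hh => eq_or_smooth_of_vtx_eq v (hh.trans hc.symm)
  have m₁ : H h₀ = 0 := by rw [H₁ h₀ hc, if_pos (Or.inl rfl)]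
  have m₂ : H (K.rot (K.rot h₀)) = 1 := by
    rw [H₁ _ (by rw [LinkDiagram.vtx_rot, LinkDiagram.vtx_rot, hc]), if_neg]
    rintro (h | h)
    · exact n₁ _ h
    · have := n₃ h₀
      rw [← h, K.rot_four] at this
      exact this rfl
  have m₃ : H (K.smooth v h₀) = 0 := by
    rw [H₁ _ (by rw [K.vtx_smooth, hc]), if_pos (Or.inr rfl)]
  have m₄ : H (K.rot (K.rot (K.smooth v h₀))) = 1 := by
    rw [H₁ _ (by rw [LinkDiagram.vtx_rot, LinkDiagram.vtx_rot, K.vtx_smooth, hc]), if_neg]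
    rintro (h | h)
    · exact n₃ _ h
    · exact n₁ _ h
  refine ⟨H, fun h => ?_, fun h hh => ?_, fun h => ?_⟩
  · by_cases hh : K.vtx h = K.center
    · rw [K.tau_center h hh]
      rcases cs h hh with rfl | rfl | rfl | rfl
      · rw [m₁, m₂]; rfl
      · rw [K.rot_four, m₁, m₂]; rfl
      · rw [m₃, m₄]; rfl
      · rw [K.rot_four, m₃, m₄]; rfl
    · have hh' : K.vtx (K.tau h) ≠ K.center := fun h' => hh (by
        rw [← tauVertex_vtx, tauVertex_eq_center_iff] at h'; exact h')
      rw [H₂ h hh, H₂ _ hh', ← tauVertex_vtx]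
      exact hs _ (by rw [ne_eq, tauVertex_eq_self_iff]; exact hh)
  · rw [H₂ h hh, H₂ _ (by rwa [LinkDiagram.vtx_rot]), LinkDiagram.vtx_rot]
  · by_cases hh : K.vtx h = K.center
    · rcases cs h hh with rfl | rfl | rfl | rfl
      · rw [m₁, m₃]
      · rw [K.smooth_rot_rot, m₂, m₄]
      · rw [K.smooth_smooth, m₁, m₃]
      · rw [K.smooth_rot_rot, K.smooth_smooth, m₂, m₄]
    · rw [H₂ h hh, H₂ _ (by rwa [K.vtx_smooth]), K.vtx_smooth]

/-- Folding by the rotation turns the sum into one over half of the regions, with `H h + H (edge h)`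
in place of the product. Around each region, `edge h` may be replaced with `rot h`. Since `H` is
constant around all vertices except the center, only the two darts at the center with the axis on
their left contribute. -/
theorem sum_cut_eq [Fintype K.Dart] {w : K.quotientDiagram.State} {h₀ : K.Dart}
    (hc : K.vtx h₀ = K.center) (ho : K.isOver h₀ = !w K.quotient.point) {H : K.Dart → ZMod 2}
    (H₁ : ∀ h, H (K.tau h) = H h + 1) (H₂ : ∀ h, K.vtx h ≠ K.center → H (K.rot h) = H h)
    (H₃ : ∀ h, H (K.smooth (K.liftState w) h) = H h) (X : K.Region → ZMod 2)
    (hX : ∀ r, X (K.tauRegion r) = X r) (hXo : X K.outer = 0) :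
    ∑ h, (1 + H h) * H (K.edge h) * X (K.left h) = X (K.left h₀) := by
  classical
  have : Finite K.Region := Finite.of_surjective K.left Quot.mk_surjective
  obtain ⟨s, hs⟩ := exists_halves K.tauRegion K.tauRegion_tauRegion
  have hsm : K.smooth (K.liftState w) h₀ = K.rot.symm h₀ := by
    unfold smooth
    rw [if_neg]
    rw [hc, ho]
    change ¬ (!w K.quotient.point) = w K.quotient.point
    cases w K.quotient.point <;> decide
  have h₁ : ∀ h, (1 + H h) * H (K.edge h) * X (K.left h) =
      s (K.left h) * ((1 + H h) * H (K.edge h)) * X (K.left h) +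
      (1 + s (K.left h)) * ((1 + H h) * H (K.edge h)) * X (K.left h) := by
    intro h
    generalize s (K.left h) = p
    generalize H h = q
    generalize H (K.edge h) = r
    generalize X (K.left h) = t
    revert p q r t
    decide
  have h₂ : ∑ h, (1 + s (K.left h)) * ((1 + H h) * H (K.edge h)) * X (K.left h) =
      ∑ h, s (K.left h) * (H h * (1 + H (K.edge h))) * X (K.left h) := by
    rw [← Equiv.sum_comp K.tauPerm]
    refine Finset.sum_congr rfl fun h _ => ?_
    change (1 + s (K.left (K.tau h))) * ((1 + H (K.tau h)) * H (K.edge (K.tau h))) *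
      X (K.left (K.tau h)) = _
    rw [← K.tau_edge, H₁, H₁, ← tauRegion_left, hX]
    -- The fundamental domain says nothing about the fixed region `outer`, but `X` vanishes there.
    by_cases hr : K.tauRegion (K.left h) = K.left h
    · rw [(K.tauRegion_eq_iff _).1 hr, hXo, mul_zero, mul_zero]
    · rw [hs _ hr]
      generalize s (K.left h) = p
      generalize H h = q
      generalize H (K.edge h) = r
      generalize X (K.left h) = t
      revert p q r t
      decide
  have h₃ : ∑ h, s (K.left h) * H (K.edge h) * X (K.left h) =
      ∑ h, s (K.left h) * H (K.rot h) * X (K.left h) := by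
    rw [← Equiv.sum_comp (K.edge.trans K.rot.symm)
      (fun h => s (K.left h) * H (K.rot h) * X (K.left h))]
    refine Finset.sum_congr rfl fun h _ => ?_
    have e₁ : K.left ((K.edge.trans K.rot.symm) h) = K.left h := (Quot.sound rfl : K.left h = _).symm
    have e₂ : K.rot ((K.edge.trans K.rot.symm) h) = K.edge h := K.rot.apply_symm_apply _
    rw [e₁, e₂]
  have h₄ : ∑ h, (1 + H h) * H (K.edge h) * X (K.left h) =
      ∑ h, s (K.left h) * (H h + H (K.rot h)) * X (K.left h) := by
    simp only [h₁]
    rw [Finset.sum_add_distrib, h₂, ← Finset.sum_add_distrib]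
    have : ∀ h, s (K.left h) * ((1 + H h) * H (K.edge h)) * X (K.left h) +
        s (K.left h) * (H h * (1 + H (K.edge h))) * X (K.left h) =
        s (K.left h) * H h * X (K.left h) + s (K.left h) * H (K.edge h) * X (K.left h) := by
      intro h
      generalize s (K.left h) = p
      generalize H h = q
      generalize H (K.edge h) = r
      generalize X (K.left h) = t
      revert p q r t
      decide
    simp only [this]
    rw [Finset.sum_add_distrib, h₃, ← Finset.sum_add_distrib]
    refine Finset.sum_congr rfl fun h _ => ?_
    ring
  have htau : K.tau h₀ = K.rot (K.rot h₀) := K.tau_center h₀ hc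
  have e₁ : H (K.rot h₀) = H h₀ + 1 := by
    have := H₃ (K.rot (K.rot h₀))
    rw [K.smooth_rot_rot, hsm, K.rot_symm_eq, K.rot_four] at this
    rw [this, ← htau, H₁]
  have e₂ : H (K.rot (K.rot (K.rot h₀))) = H (K.rot (K.rot h₀)) + 1 := by
    have := H₃ h₀
    rw [hsm, K.rot_symm_eq] at this
    rw [this, ← htau, H₁, add_assoc]
    generalize H h₀ = p
    revert p
    decide
  rw [h₄, Finset.sum_eq_add h₀ (K.rot (K.rot h₀)) (K.four_valent h₀).symm]
  · rw [e₁, e₂, ← htau, ← tauRegion_left, hX]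
    by_cases hr : K.tauRegion (K.left h₀) = K.left h₀
    · rw [(K.tauRegion_eq_iff _).1 hr, hXo]
      simp
    · rw [hs _ hr]
      generalize s (K.left h₀) = p
      generalize H h₀ = q
      generalize H (K.tau h₀) = r
      generalize X (K.left h₀) = t
      revert p q r t
      decide
  · rintro h - ⟨hh₁, hh₂⟩
    have : H (K.rot h) = H h := by
      by_cases hv : K.vtx h = K.center
      · rcases K.eq_of_vtx_eq (hv.trans hc.symm) with rfl | rfl | rfl | rfl
        · exact absurd rfl hh₁
        · rw [e₁, ← htau, H₁]
        · exact absurd rfl hh₂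
        · rw [K.rot_four, e₂, ← htau, H₁]
          generalize H h₀ = p
          revert p
          decide
      · exact H₂ h hv
    rw [this]
    generalize H h = p
    rw [show p + p = 0 from by revert p; decide]
    simp
  · exact fun h => absurd (Finset.mem_univ _) h
  · exact fun h => absurd (Finset.mem_univ _) h

/-- The sum of `sum_cut_eq` is now evaluated along the circle. The terms of `h` and `tau (edge h)`
have the same factor in `H`, and the values of `χ` add up to the indicator function of the circle.
The remaining sum over black darts counts the changes of `H` from `0` to `1` along an invariant
circle, an odd number. -/
theorem sum_cut_eq_one [Fintype K.Dart] (κ : K.toLinkDiagram.Coloring) {w : K.quotientDiagram.State}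
    {a : K.Dart} (ha : K.Conn (K.liftState w) a (K.tau a)) {H : K.Dart → ZMod 2}
    (H₁ : ∀ h, H (K.tau h) = H h + 1)
    (H₃ : ∀ h, H (K.smooth (K.liftState w) h) = H h) {χ : K.Region → Bool}
    (hχ : ∀ h, K.Conn (K.liftState w) h a ↔ χ (K.left h) ≠ χ (K.left (K.edge h)))
    (hτ : ∀ r, χ (K.tauRegion r) = χ r) :
    ∑ h, (1 + H h) * H (K.edge h) * (if χ (K.left h) then 1 else 0) = 1 := by
  classical
  have hcol : ∀ h, κ.col (K.tau h) = κ.col h := K.col_tau κ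
  let t : κ.Out → κ.Out := fun x => ⟨K.tau x.1, by rw [hcol, x.2]⟩
  have hout : ∀ h, κ.outRep (K.tau h) = t (κ.outRep h) := by
    intro h
    apply Subtype.ext
    unfold Coloring.outRep
    by_cases hc : κ.col h = true
    · rw [dif_pos hc, dif_pos ((hcol h).trans hc)]
    · rw [dif_neg hc, dif_neg (by rwa [hcol])]
      exact (K.tau_edge h).symm
  have key := sum_changes_eq_one (κ.next (K.liftState w)) t (fun x => Subtype.ext (K.tau_tau x.1))
    (fun x => Subtype.ext (by
      change K.smooth _ (K.edge (K.tau x.1)) = K.tau (K.smooth _ (K.edge x.1))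
      rw [← K.tau_edge, smooth_liftState_tau])) (fun x => H x.1) (fun x => H₁ x.1)
    (a := κ.outRep a) (by rw [← hout, ← κ.conn_iff_sameCycle]; exact ha)
  have e₁ : ∀ x : κ.Out, (if (κ.next (K.liftState w)).SameCycle (κ.outRep a) x then
      (1 + H x.1) * H (κ.next (K.liftState w) x).1 else 0) =
      if K.Conn (K.liftState w) x.1 a then (1 + H x.1) * H (K.edge x.1) else 0 := by
    intro x
    have h₁ : H (κ.next (K.liftState w) x).1 = H (K.edge x.1) := H₃ _
    have h₂ : (κ.next (K.liftState w)).SameCycle (κ.outRep a) x ↔ K.Conn (K.liftState w) x.1 a := by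
      rw [κ.conn_iff_sameCycle, κ.outRep_out]
      exact Equiv.Perm.sameCycle_comm
    rw [h₁]
    simp only [h₂]
  simp only [e₁] at key
  have e₂ : ∑ x : κ.Out, (if K.Conn (K.liftState w) x.1 a then (1 + H x.1) * H (K.edge x.1) else 0) =
      ∑ h, if κ.col h = true then
        (if K.Conn (K.liftState w) h a then (1 + H h) * H (K.edge h) else 0) else 0 := by
    rw [← Finset.sum_filter (fun h => κ.col h = true)]
    exact (Finset.sum_subtype (p := fun h => κ.col h = true) _
      (fun h => by rw [Finset.mem_filter]; exact and_iff_right (Finset.mem_univ _))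
      (fun h => if K.Conn (K.liftState w) h a then (1 + H h) * H (K.edge h) else 0)).symm
  rw [e₂] at key
  have e₃ : ∀ h, (1 + H h) * H (K.edge h) * (if χ (K.left h) then 1 else 0) =
      (if κ.col h = true then (1 + H h) * H (K.edge h) * (if χ (K.left h) then 1 else 0) else 0) +
      (if κ.col h = true then 0 else (1 + H h) * H (K.edge h) * (if χ (K.left h) then 1 else 0)) := by
    intro h
    by_cases hc : κ.col h = true
    · rw [if_pos hc, if_pos hc, add_zero]
    · rw [if_neg hc, if_neg hc, zero_add]
  rw [Finset.sum_congr rfl fun h _ => e₃ h, Finset.sum_add_distrib,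
    ← Equiv.sum_comp (K.edge.trans K.tauPerm) (fun h => if κ.col h = true then 0 else _),
    ← Finset.sum_add_distrib]
  refine Eq.trans ?_ key
  refine Finset.sum_congr rfl fun h _ => ?_
  change _ + (if κ.col (K.tau (K.edge h)) = true then 0 else
    (1 + H (K.tau (K.edge h))) * H (K.edge (K.tau (K.edge h))) *
      (if χ (K.left (K.tau (K.edge h))) = true then 1 else 0)) = _
  have e₄ : K.edge (K.tau (K.edge h)) = K.tau h := by rw [← K.tau_edge, K.edge_edge]
  rw [e₄, H₁, H₁, hcol, κ.col_edge, ← tauRegion_left, hτ]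
  by_cases hc : κ.col h = true
  · simp only [hc, if_true, hχ, Bool.not_true, Bool.false_eq_true, if_false]
    generalize χ (K.left h) = p
    generalize χ (K.left (K.edge h)) = q
    generalize H h = r
    generalize H (K.edge h) = s
    revert p q r s
    decide
  · rw [if_neg hc, if_neg hc, if_pos (by simpa using hc), add_zero]

/-- The essential circles of the quotient are those with a connected preimage. -/
theorem isEssential_iff (w : K.quotientDiagram.State) (a : K.Dart) :
    K.quotient.IsEssential w (K.quotientDiagram.circ w (K.projDart a)) ↔
      K.Conn (K.liftState w) a (K.tau a) := by
  classical
  refine ⟨K.conn_tau_self_of_isEssential, fun ha => ?_⟩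
  have := K.finite_dart
  have := Fintype.ofFinite K.Dart
  obtain ⟨κ, -⟩ := K.isPlanar.exists_coloring
  obtain ⟨χ', hχ'⟩ := K.isPlanar.exists_circle_boundary (K.liftState w) a
  obtain ⟨χ, hχ, hχo⟩ : ∃ χ : K.Region → Bool,
      (∀ h, K.Conn (K.liftState w) h a ↔ χ (K.left h) ≠ χ (K.left (K.edge h))) ∧
      χ K.outer = false := by
    refine ⟨fun r => χ' r ^^ χ' K.outer, fun h => ?_, by simp⟩
    rw [hχ']
    simp
  have hτ : ∀ r, χ (K.tauRegion r) = χ r := by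
    intro r
    have := K.region_const (fun r => χ (K.tauRegion r) ^^ χ r) (fun h => by
      have h₁ := hχ h
      have h₂ := hχ (K.tau h)
      have h₃ : K.Conn (K.liftState w) (K.tau h) a ↔ K.Conn (K.liftState w) h a := by
        rw [← K.conn_tau, K.tau_tau]
        exact ⟨fun h => h.trans ha.symm, fun h => h.trans ha⟩
      rw [h₁, h₂] at h₃
      rw [tauRegion_left, tauRegion_left, K.tau_edge]
      clear h₁ h₂
      revert h₃
      generalize χ (K.left h) = p
      generalize χ (K.left (K.edge h)) = q
      generalize χ (K.left (K.tau h)) = r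
      generalize χ (K.left (K.edge (K.tau h))) = s
      revert p q r s
      decide) r K.outer
    rw [tauRegion_outer, hχo] at this
    simpa using this
  obtain ⟨h₀, hc, ho⟩ := K.exists_center_dart (!w K.quotient.point)
  obtain ⟨H, H₁, H₂, H₃⟩ := K.exists_cut w hc
  -- Comparing the two evaluations shows that `χ` is `true` at the axis, whereas it is `false` at
  -- infinity.
  have t₁ := K.sum_cut_eq_one κ ha H₁ H₃ hχ hτ
  have t₂ := K.sum_cut_eq hc ho H₁ H₂ H₃ (fun r => if χ r then 1 else 0) (fun r => by rw [hτ])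
    (by rw [hχo]; rfl)
  rw [t₁] at t₂
  have hin : χ (K.left h₀) = true := by
    by_contra hf
    rw [if_neg hf] at t₂
    exact absurd t₂ (by decide)
  let I : K.quotient.Region → Prop := Quot.lift (Quot.lift (fun h => χ (K.left h) = true) (by
    rintro a _ rfl
    rw [← tauRegion_left, hτ])) (by
    rintro ⟨a⟩ _ rfl
    have h : K.left a = K.left (K.rot.symm (K.edge a)) := Quot.sound rfl
    exact congrArg (fun r => χ r = true) h)
  have hI : ∀ h, I (K.quotientDiagram.left (K.projDart h)) = (χ (K.left h) = true) := fun _ => rfl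
  refine ⟨I, fun h => ?_, K.projRegion (K.left h₀), (K.isAxisRegion_iff _ _).2 ⟨h₀, hc, ho, rfl⟩, ?_⟩
  · obtain ⟨h, rfl⟩ := K.projDart_surjective h
    change ¬ ((χ (K.left h) = true) ↔ (χ (K.left (K.edge h)) = true)) ↔
      K.quotientDiagram.Conn w (K.projDart h) (K.projDart a)
    rw [K.conn_projDart]
    have : (K.Conn (K.liftState w) h a ∨ K.Conn (K.liftState w) h (K.tau a)) ↔
        K.Conn (K.liftState w) h a := ⟨fun h => h.elim id fun h => h.trans ha.symm, Or.inl⟩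
    rw [this, hχ]
    generalize χ (K.left h) = p
    generalize χ (K.left (K.edge h)) = q
    revert p q
    decide
  · obtain ⟨b, hb⟩ : ∃ b, K.left b = K.outer := Quot.exists_rep K.outer
    change ¬ ((χ (K.left h₀) = true) ↔ I (K.projRegion K.outer))
    rw [← hb]
    change ¬ ((χ (K.left h₀) = true) ↔ χ (K.left b) = true)
    rw [hb, hχo, hin]
    decide

end IntravergentDiagram
-- Gradings of the equivariant generators
-- The fibres of `p` are the orbits of `t`, with two points, or one over the values in `fix`. This
-- is used for the circles and for the crossings.
theorem sum_comp_two_fibres {X Y : Type} [Fintype X] [Fintype Y] (p : X → Y)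
    (hs : Function.Surjective p) (t : X → X) (hp : ∀ x x', p x = p x' ↔ x' = x ∨ x' = t x)
    (fix : Y → Prop) [DecidablePred fix] (hfix : ∀ x, fix (p x) ↔ t x = x) (φ : Y → ℤ) :
    ∑ x, φ (p x) + ∑ y, (if fix y then φ y else 0) = 2 * ∑ y, φ y := by
  classical
  rw [← Finset.sum_fiberwise Finset.univ p, ← Finset.sum_add_distrib, Finset.mul_sum]
  refine Finset.sum_congr rfl fun y _ => ?_
  obtain ⟨x, rfl⟩ := hs y
  have h₁ : (Finset.univ.filter fun x' => p x' = p x) = {x, t x} := by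
    ext x'
    rw [Finset.mem_filter, Finset.mem_insert, Finset.mem_singleton, ← hp, eq_comm]
    simp
  have h₂ : ∑ x' with p x' = p x, φ (p x') = ∑ x' with p x' = p x, φ (p x) :=
    Finset.sum_congr rfl fun x' hx' => by rw [(Finset.mem_filter.1 hx').2]
  rw [h₂, h₁, Finset.sum_const]
  by_cases h : t x = x
  · rw [if_pos ((hfix x).2 h), h]
    simp
    ring
  · rw [if_neg (fun h' => h ((hfix x).1 h')), Finset.card_pair (fun h' => h h'.symm)]
    simp

namespace AxisDiagram

open LinkDiagram

variable (L : AxisDiagram)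

theorem isCrossing_iff (c : L.Vertex) : L.IsCrossing c ↔ c ≠ L.point := by
  obtain ⟨a, rfl⟩ := Quot.exists_rep c
  constructor
  · intro h h'
    exact h a rfl ((L.point_iff a).2 h')
  · intro h b hb hb'
    exact h (by rw [← hb]; exact (L.point_iff b).1 hb')

open Classical in
theorem winding_eq (x : L.KhGen) : L.winding x =
    - ∑ C, if L.IsEssential x.state C then 2 * (x.circLabel C).deg - 1 else 0 := by
  unfold winding numEssential
  simp only [exists_circ_label_iff]
  have e : ∀ l, (Nat.card {C // L.IsEssential x.state C ∧ x.circLabel C = l} : ℤ) =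
      ∑ C, if L.IsEssential x.state C ∧ (x.circLabel C).deg = l.deg then 1 else 0 := by
    intro l
    rw [← natCard_subtype_eq_sum]
    simp only [Label.deg_injective.eq_iff]
  rw [e, e, ← Finset.sum_sub_distrib, ← Finset.sum_neg_distrib]
  refine Finset.sum_congr rfl fun C _ => ?_
  by_cases hC : L.IsEssential x.state C
  · rcases (x.circLabel C).deg_eq with h | h <;> rw [h] <;> simp [Label.deg, hC]
  · simp [hC]

end AxisDiagram

namespace IntravergentDiagram

open LinkDiagram

variable (K : IntravergentDiagram)

/-- The equivariant generator given by a generator of the quotient. -/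
def liftGen (x : K.quotientDiagram.KhGen) : K.KhGen where
  state := K.liftState x.state
  label := x.label ∘ K.projDart
  label_edge h := x.label_edge (K.projDart h)
  label_smooth h := by
    simp only [Function.comp_apply]
    rw [← K.smooth_projDart, x.label_smooth]

theorem tauGen_liftGen (x : K.quotientDiagram.KhGen) : K.tauGen (K.liftGen x) = K.liftGen x := by
  apply KhGen.ext
  · exact K.liftState_tau x.state
  · funext h
    exact congrArg x.label (K.projDart_tau h)

theorem liftState_injective {v w : K.quotientDiagram.State} (h : K.liftState v = K.liftState w) :
    v = w := by
  funext c
  obtain ⟨c, rfl⟩ := K.projVertex_surjective c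
  exact congrFun h c

theorem liftGen_injective {x y : K.quotientDiagram.KhGen} (h : K.liftGen x = K.liftGen y) :
    x = y := by
  apply KhGen.ext
  · exact K.liftState_injective (congrArg KhGen.state h)
  · funext a
    obtain ⟨a, rfl⟩ := K.projDart_surjective a
    exact congrFun (congrArg KhGen.label h) a

theorem exists_liftGen {X : K.KhGen} (h : K.tauGen X = X) : ∃ x, K.liftGen x = X := by
  have hs : ∀ c, X.state (K.tauVertex c) = X.state c := fun c => congrFun (congrArg KhGen.state h) c
  have hl : ∀ a, X.label (K.tau a) = X.label a := fun a => congrFun (congrArg KhGen.label h) a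
  have e : K.liftState (K.descend X.state hs) = X.state := by
    funext c
    exact K.descend_projVertex X.state hs c
  refine ⟨⟨K.descend X.state hs, Quot.lift X.label (by rintro a _ rfl; exact (hl a).symm), ?_, ?_⟩, ?_⟩
  · rintro ⟨a⟩
    exact X.label_edge a
  · rintro ⟨a⟩
    have e' : K.quotientDiagram.smooth (K.descend X.state hs) (Quot.mk _ a) =
        K.projDart (K.smooth X.state a) :=
      (K.smooth_projDart _ a).trans (by rw [e])
    rw [e']
    exact X.label_smooth a
  · exact KhGen.ext e rfl

/-- The image of a circle. -/
def projCircle (w : K.quotientDiagram.State) : K.Circle (K.liftState w) → K.quotientDiagram.Circle w :=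
  Quot.lift (fun a => K.quotientDiagram.circ w (K.projDart a)) (by
    intro a b h
    refine (K.conn_projDart w a b).2 (Or.inl ?_)
    exact Quot.sound h)

/-- The action of the rotation on the circles of an equivariant resolution. -/
def tauCircle (w : K.quotientDiagram.State) : K.Circle (K.liftState w) → K.Circle (K.liftState w) :=
  Quot.lift (fun a => K.circ (K.liftState w) (K.tau a)) (by
    intro a b h
    exact K.conn_tau.2 (Quot.sound h))

theorem projCircle_eq_iff (w : K.quotientDiagram.State) (C C' : K.Circle (K.liftState w)) :
    K.projCircle w C = K.projCircle w C' ↔ C' = C ∨ C' = K.tauCircle w C := by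
  obtain ⟨a, rfl⟩ := circ_surjective _ C
  obtain ⟨b, rfl⟩ := circ_surjective _ C'
  refine (K.conn_projDart w a b).trans (or_congr ⟨Eq.symm, Eq.symm⟩ ?_)
  rw [← K.conn_tau, K.tau_tau]
  exact ⟨Eq.symm, Eq.symm⟩

theorem projCircle_surjective (w : K.quotientDiagram.State) : Function.Surjective (K.projCircle w) := by
  intro C
  obtain ⟨a, rfl⟩ := circ_surjective _ C
  obtain ⟨a, rfl⟩ := K.projDart_surjective a
  exact ⟨K.circ _ a, rfl⟩

theorem isEssential_projCircle_iff (w : K.quotientDiagram.State) (C : K.Circle (K.liftState w)) :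
    K.quotient.IsEssential w (K.projCircle w C) ↔ K.tauCircle w C = C := by
  obtain ⟨a, rfl⟩ := circ_surjective _ C
  refine (K.isEssential_iff w a).trans ⟨Eq.symm, Eq.symm⟩

/-- The gradings of a generator of the quotient and of its preimage. -/
theorem quantum_liftGen (o : K.Orientation) (o' : K.quotient.Orientation)
    (x : K.quotient.KhGen) : K.quantum o (K.liftGen x) =
      2 * K.quotient.quantum o' x + K.quotient.annular x + 1 - 3 * K.shift o o' := by
  classical
  have := K.finite_dart
  have : Finite K.Vertex := Finite.of_surjective K.vtx Quot.mk_surjective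
  have := Fintype.ofFinite K.Vertex
  have : Finite K.quotientDiagram.Vertex := Finite.of_surjective K.projVertex K.projVertex_surjective
  have : Fintype K.quotient.Vertex := Fintype.ofFinite K.quotientDiagram.Vertex
  -- circles
  have h₁ := sum_comp_two_fibres (Y := K.quotient.Circle x.state) (K.projCircle x.state) (K.projCircle_surjective _)
    (K.tauCircle x.state) (K.projCircle_eq_iff _) (K.quotient.IsEssential x.state)
    (K.isEssential_projCircle_iff _) (fun C => 2 * (x.circLabel C).deg - 1)
  have e₁ : ∑ C, (2 * ((K.liftGen x).circLabel C).deg - 1) =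
      ∑ C, (2 * (x.circLabel (K.projCircle x.state C)).deg - 1) := by
    refine Finset.sum_congr rfl fun C _ => ?_
    obtain ⟨a, rfl⟩ := circ_surjective _ C
    rfl
  have e₂ := K.quotient.winding_eq x
  have e₃ := numLabel_sub (K.liftGen x)
  have e₄ := numLabel_sub (D := K.quotient.toLinkDiagram) x
  -- crossings
  have hv := fun φ => sum_comp_two_fibres (Y := K.quotient.Vertex) K.projVertex K.projVertex_surjective K.tauVertex
    (fun c d => K.projVertex_eq_iff) (fun c => c = K.quotient.point) (fun c => by
      rw [K.tauVertex_eq_self_iff]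
      exact ⟨K.eq_center_of_projVertex, fun h => by rw [h]; rfl⟩) φ
  have h₂ := hv fun _ => 1
  have h₃ := hv fun c => if x.state c = true then 1 else 0
  have n₁ : (K.numCrossings : ℤ) = ∑ c : K.Vertex, 1 := by
    unfold numCrossings
    rw [natCard_subtype_eq_sum]
    exact Finset.sum_congr rfl fun c _ => if_pos (K.isCrossing c)
  have n₂ : (K.quotient.numCrossings : ℤ) = (∑ c : K.quotient.Vertex, (1 : ℤ)) -
      ∑ c : K.quotient.Vertex, if c = K.quotient.point then 1 else 0 := by
    unfold numCrossings
    rw [natCard_subtype_eq_sum, ← Finset.sum_sub_distrib]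
    refine Finset.sum_congr rfl fun c _ => ?_
    rw [K.quotient.isCrossing_iff]
    by_cases hc : c = K.quotient.point <;> simp [hc]
  have n₃ : (K.weight (K.liftState x.state) : ℤ) =
      ∑ c : K.Vertex, if x.state (K.projVertex c) = true then 1 else 0 := by
    unfold weight
    rw [natCard_subtype_eq_sum]
    refine Finset.sum_congr rfl fun c _ => ?_
    simp only [K.isCrossing c, true_and]
    rfl
  have n₄ : (K.quotient.weight x.state : ℤ) =
      (∑ c : K.quotient.Vertex, if x.state c = true then (1 : ℤ) else 0) -
      ∑ c : K.quotient.Vertex, if c = K.quotient.point then (if x.state c = true then 1 else 0) else 0 := by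
    unfold weight
    rw [natCard_subtype_eq_sum, ← Finset.sum_sub_distrib]
    refine Finset.sum_congr rfl fun c _ => ?_
    rw [K.quotient.isCrossing_iff]
    by_cases hc : c = K.quotient.point <;> simp [hc]
  have s₁ : (∑ c : K.quotient.Vertex, if c = K.quotient.point then (1 : ℤ) else 0) = 1 := by
    rw [Finset.sum_ite_eq' Finset.univ K.quotient.point (fun _ => (1 : ℤ)), if_pos (Finset.mem_univ _)]
  have s₂ : (∑ c : K.quotient.Vertex, if c = K.quotient.point then
      (if x.state c = true then (1 : ℤ) else 0) else 0) =
      if x.state K.quotient.point = true then 1 else 0 := by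
    rw [Finset.sum_ite_eq' Finset.univ K.quotient.point
      (fun c => if x.state c = true then (1 : ℤ) else 0), if_pos (Finset.mem_univ _)]
  change ∑ c : K.Vertex, (1 : ℤ) + (∑ c : K.quotient.Vertex, if c = K.quotient.point then (1 : ℤ) else 0) =
    2 * ∑ c : K.quotient.Vertex, (1 : ℤ) at h₂
  change (∑ c : K.Vertex, if x.state (K.projVertex c) = true then (1 : ℤ) else 0) +
    (∑ c : K.quotient.Vertex, if c = K.quotient.point then
      (if x.state c = true then (1 : ℤ) else 0) else 0) =
    2 * ∑ c : K.quotient.Vertex, if x.state c = true then (1 : ℤ) else 0 at h₃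
  change ∑ C : K.Circle (K.liftState x.state), (2 * (x.circLabel (K.projCircle x.state C)).deg - 1) +
    (∑ C : K.quotient.Circle x.state, if K.quotient.IsEssential x.state C then
      2 * (x.circLabel C).deg - 1 else 0) =
    2 * ∑ C : K.quotient.Circle x.state, (2 * (x.circLabel C).deg - 1) at h₁
  change _ = ∑ C : K.Circle (K.liftState x.state), (2 * ((K.liftGen x).circLabel C).deg - 1) at e₃
  unfold quantum AxisDiagram.annular shift
  change _ + (K.weight (K.liftState x.state) : ℤ) + _ - _ = _
  replace e₃ := e₃.trans e₁
  -- Upstairs there are `2 N̄ + 1` crossings, `|v|` is twice the weight in the quotient plus the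
  -- value at the point, and `#{X} - #{1}` is twice its value in the quotient plus the winding
  -- number.
  rw [s₁] at h₂ n₂
  rw [s₂] at h₃ n₄
  linarith

end IntravergentDiagram
-- Pairs of surgeries exchanged by an involution
section Orbit
variable {δ β0 β1 β2 γ0 γ2 : Type}

/-- The partition `d` is the quotient of the invariant partition `c` by the involution `t`. -/
def IsOrbitPartition {β γ : Type} (t : δ → δ) (c : δ → β) (d : δ → γ) : Prop :=
  (∀ e f, c (t e) = c (t f) ↔ c e = c f) ∧ ∀ e f, d e = d f ↔ c e = c f ∨ c e = c (t f)

open Classical in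
/-- The contribution of the block of `a` to the winding number, up to sign. -/
noncomputable def windAt {β : Type} (t : δ → δ) (c : δ → β) (f : δ → ℤ) (a : δ) : ℤ :=
  if c a = c (t a) then 2 * f a - 1 else 0

theorem windAt_pos {β : Type} {t : δ → δ} {c : δ → β} {f : δ → ℤ} {a : δ} (h : c a = c (t a)) :
    windAt t c f a = 2 * f a - 1 := if_pos h

theorem windAt_neg {β : Type} {t : δ → δ} {c : δ → β} {f : δ → ℤ} {a : δ} (h : c a ≠ c (t a)) :
    windAt t c f a = 0 := if_neg h

theorem windAt_dual {β : Type} (t : δ → δ) (c : δ → β) (f : δ → ℤ) (a : δ) :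
    windAt t c (fun e => 1 - f e) a = - windAt t c f a := by
  by_cases h : c a = c (t a)
  · rw [windAt_pos h, windAt_pos h]; ring
  · rw [windAt_neg h, windAt_neg h]; rfl

/-- Blocks fixed by `t` stand for essential circles. If two essential circles merge in the quotient,
the second surgery upstairs splits and the result is inessential. Otherwise both surgeries merge,
and the result is essential exactly when one of the two circles is. -/
theorem orbit_merge_types {t : δ → δ} (ht : ∀ e, t (t e) = e) {c0 : δ → β0} {c1 : δ → β1}
    {c2 : δ → β2} {d0 : δ → γ0} {d2 : δ → γ2} (h0 : IsOrbitPartition t c0 d0)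
    (h2 : IsOrbitPartition t c2 d2) {a a' : δ} (J₁ : Joins c0 c1 a a' ∨ Joins c1 c0 a a')
    (J₂ : Joins c1 c2 (t a) (t a') ∨ Joins c2 c1 (t a) (t a')) (Jd : Joins d0 d2 a a') :
    Joins c0 c1 a a' ∧ c0 a ≠ c0 a' ∧ c0 a ≠ c0 (t a') ∧ c0 (t a) ≠ c0 a' ∧ c0 (t a) ≠ c0 (t a') ∧
    ((c0 a = c0 (t a) ∧ c0 a' = c0 (t a') ∧ Joins c2 c1 (t a) (t a') ∧ c2 a ≠ c2 (t a)) ∨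
      (¬ (c0 a = c0 (t a) ∧ c0 a' = c0 (t a')) ∧ Joins c1 c2 (t a) (t a') ∧
        (c2 a = c2 (t a) ↔ (c0 a = c0 (t a) ∨ c0 a' = c0 (t a'))))) := by
  obtain ⟨i0, q0⟩ := h0
  obtain ⟨i2, q2⟩ := h2
  have n : ¬ (c0 a = c0 a' ∨ c0 a = c0 (t a')) := by rw [← q0]; exact Jd.1
  rw [not_or] at n
  obtain ⟨n₁, n₂⟩ := n
  have n₃ : c0 (t a) ≠ c0 a' := by rw [← ht a', ne_eq, i0]; exact n₂
  have n₄ : c0 (t a) ≠ c0 (t a') := by rw [ne_eq, i0]; exact n₁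
  have J : Joins c0 c1 a a' := J₁.resolve_right fun h => n₁ (by rw [h.2]; right; simp)
  refine ⟨J, n₁, n₂, n₃, n₄, ?_⟩
  have e : c2 a = c2 a' ∨ c2 a = c2 (t a') := by rw [← q2, Jd.2]; right; simp
  have e' : c2 a = c2 a' ↔ c2 (t a) = c2 (t a') := (i2 _ _).symm
  have e'' : c2 a = c2 (t a') ↔ c2 (t a) = c2 a' := by rw [← i2 a (t a'), ht]
  have p₁ := J.pairs (t a) (t a')
  rcases J₂ with J₂ | J₂
  · have p₂ := J₂.pairs a a'
    right
    refine ⟨by grind, J₂, by grind⟩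
  · have p₂ := J₂.pairs a a'
    left
    refine ⟨by grind, by grind, J₂, by grind⟩

/-- For two fixed blocks, the product is followed by a coproduct with two equal labels, which forces
exactly one of the blocks to carry `X`. If one block is fixed, both copies of the other are merged
into it, so that the latter must carry `1`. If neither is fixed, there is no condition. In each case
this is what preservation of the winding number demands. -/
theorem orbit_merge_iff {t : δ → δ} (ht : ∀ e, t (t e) = e) {c0 : δ → β0} {c1 : δ → β1}
    {c2 : δ → β2} {d0 : δ → γ0} {d2 : δ → γ2} (h0 : IsOrbitPartition t c0 d0)
    (h2 : IsOrbitPartition t c2 d2) {a a' : δ} (J₁ : Joins c0 c1 a a' ∨ Joins c1 c0 a a')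
    (J₂ : Joins c1 c2 (t a) (t a') ∨ Joins c2 c1 (t a) (t a')) (Jd : Joins d0 d2 a a')
    {f0 f2 : δ → ℤ} (l0 : IsLabelling c0 f0) (l2 : IsLabelling c2 f2) (t0 : ∀ e, f0 (t e) = f0 e)
    (t2 : ∀ e, f2 (t e) = f2 e) :
    (∃ f1, IsLabelling c1 f1 ∧ Pants c0 c1 a a' f0 f1 ∧ Pants c1 c2 (t a) (t a') f1 f2) ↔
      Pants d0 d2 a a' f0 f2 ∧ windAt t c2 f2 a = windAt t c0 f0 a + windAt t c0 f0 a' := by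
  obtain ⟨J, n₁, n₂, n₃, n₄, hJ⟩ := orbit_merge_types ht h0 h2 J₁ J₂ Jd
  obtain ⟨i0, q0⟩ := h0
  obtain ⟨i2, q2⟩ := h2
  obtain ⟨u0, v0⟩ := l0
  obtain ⟨u2, v2⟩ := l2
  have p₁ := J.pairs (t a) (t a')
  have w₁ := v0 a
  have w₂ := v0 a'
  have w₃ := v2 a
  have w₄ := t0 a
  have w₅ := t0 a'
  have w₆ := t2 a
  have w₇ := t2 a'
  constructor
  · rintro ⟨f1, ⟨u1, v1⟩, P, Q⟩
    have w₈ := v1 (t a)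
    have w₉ := v1 (t a')
    have P' : f1 a = f0 a + f0 a' ∧ ∀ h, c0 h ≠ c0 a → c0 h ≠ c0 a' → f1 h = f0 h := by
      rcases P with P | P
      · exact P.2
      · exact absurd ((P.1.2 _ _).2 (Or.inr (by simp))) n₁
    obtain ⟨P₁, P₂⟩ := P'
    have x₁ := P₂ (t a)
    have x₂ := P₂ (t a')
    have x₃ := u1 a (t a)
    have x₄ := u1 a (t a')
    have off : ∀ h, d0 h ≠ d0 a → d0 h ≠ d0 a' → f2 h = f0 h := by
      intro h k₁ k₂
      rw [ne_eq, q0] at k₁ k₂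
      rw [not_or] at k₁ k₂
      have y : ∀ g, c0 h ≠ c0 g → c1 h ≠ c1 g := by
        intro g hg
        rw [ne_eq, J.2]
        rintro (h' | h')
        · exact hg h'
        · exact h'.1.elim k₁.1 k₂.1
      rw [← P₂ h k₁.1 k₂.1]
      rcases Q with Q | Q
      · exact Q.2.2 h (y _ k₁.2) (y _ k₂.2)
      · refine Q.2.2 h (fun e => y _ k₁.2 ?_) (fun e => y _ k₂.2 ?_) <;> rw [Q.1.2] <;>
          exact Or.inl e
    rcases hJ with ⟨k₁, k₂, k₃, k₄⟩ | ⟨k₁, k₂, k₃⟩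
    · have Q' : f2 (t a) + f2 (t a') = f1 (t a) + 1 := by
        rcases Q with Q | Q
        · exact absurd ((Q.1.2 _ _).2 (Or.inr (by simp))) k₃.1
        · exact Q.2.1
      have e : f2 a = f2 a' := by
        have : c2 a = c2 a' ∨ c2 a = c2 (t a') := by rw [← q2, Jd.2]; right; simp
        rcases this with h | h
        · exact u2 _ _ h
        · rw [u2 _ _ h, t2]
      have x : f2 a = f0 a + f0 a' ∧ f0 a + f0 a' = 1 := by
        have := x₃ ((J.2 _ _).2 (Or.inl k₁))
        omega
      refine ⟨Or.inl ⟨Jd, x.1, off⟩, ?_⟩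
      rw [windAt_pos k₁, windAt_pos k₂, windAt_neg k₄]
      omega
    · have Q' : f2 (t a) = f1 (t a) + f1 (t a') := by
        rcases Q with Q | Q
        · exact Q.2.1
        · exact absurd ((Q.1.2 _ _).2 (Or.inr (by simp))) k₂.1
      have x₅ := P₂ (t a)
      have x₆ := P₂ (t a')
      have x : f2 a = f0 a + f0 a' ∧ (c0 a = c0 (t a) → f0 a' = 0) ∧
          (c0 a' = c0 (t a') → f0 a = 0) := by
        have y₁ : c0 a = c0 (t a) → f1 (t a) = f0 a + f0 a' := fun h => by
          rw [← x₃ ((J.2 _ _).2 (Or.inl h)), P₁]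
        have y₂ : c0 a' = c0 (t a') → f1 (t a') = f0 a + f0 a' := fun h => by
          rw [← x₄ ((J.2 _ _).2 (Or.inr ⟨Or.inl rfl, Or.inr h.symm⟩)), P₁]
        have y₃ : c0 a ≠ c0 (t a) → f1 (t a) = f0 a := fun h => by
          rw [x₅ (Ne.symm h) n₃, t0]
        have y₄ : c0 a' ≠ c0 (t a') → f1 (t a') = f0 a' := fun h => by
          rw [x₆ n₂.symm (Ne.symm h), t0]
        clear off P₂ u0 u1 u2
        by_cases b₁ : c0 a = c0 (t a)
        · have b₂ : c0 a' ≠ c0 (t a') := fun h => k₁ ⟨b₁, h⟩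
          have := y₁ b₁
          have := y₄ b₂
          exact ⟨by omega, fun _ => by omega, fun h => absurd h b₂⟩
        · have := y₃ b₁
          by_cases b₂ : c0 a' = c0 (t a')
          · have := y₂ b₂
            exact ⟨by omega, fun h => absurd h b₁, fun h => by omega⟩
          · have := y₄ b₂
            exact ⟨by omega, fun h => absurd h b₁, fun h => absurd h b₂⟩
      refine ⟨Or.inl ⟨Jd, x.1, off⟩, ?_⟩
      clear off P₂
      by_cases b₁ : c0 a = c0 (t a)
      · have b₂ : c0 a' ≠ c0 (t a') := fun h => k₁ ⟨b₁, h⟩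
        rw [windAt_pos b₁, windAt_neg b₂, windAt_pos (k₃.2 (Or.inl b₁))]
        have := x.2.1 b₁
        omega
      · by_cases b₂ : c0 a' = c0 (t a')
        · rw [windAt_neg b₁, windAt_pos b₂, windAt_pos (k₃.2 (Or.inr b₂))]
          have := x.2.2 b₂
          omega
        · rw [windAt_neg b₁, windAt_neg b₂, windAt_neg (fun h => (k₃.1 h).elim b₁ b₂)]
          rfl
  · rintro ⟨P, W⟩
    have P' : f2 a = f0 a + f0 a' ∧ ∀ h, d0 h ≠ d0 a → d0 h ≠ d0 a' → f2 h = f0 h := by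
      rcases P with P | P
      · exact P.2
      · exact absurd ((P.1.2 _ _).2 (Or.inr (by simp))) Jd.1
    obtain ⟨P₁, P₂⟩ := P'
    classical
    let f1 : δ → ℤ := fun h => if c0 h = c0 a ∨ c0 h = c0 a' then f0 a + f0 a' else f0 h
    have ft : ∀ h, (c0 h = c0 a ∨ c0 h = c0 a') → f1 h = f0 a + f0 a' := fun h hh => if_pos hh
    have fo : ∀ h, ¬ (c0 h = c0 a ∨ c0 h = c0 a') → f1 h = f0 h := fun h hh => if_neg hh
    clear_value f1
    refine ⟨f1, ⟨fun e g h => ?_, fun e => ?_⟩, Or.inl ⟨J, ft a (Or.inl rfl), fun h k l => fo h (by tauto)⟩, ?_⟩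
    · rw [J.2] at h
      rcases h with h | ⟨h₁, h₂⟩
      · by_cases hh : c0 e = c0 a ∨ c0 e = c0 a'
        · rw [ft e hh, ft g (by rwa [← h])]
        · rw [fo e hh, fo g (by rwa [← h]), u0 e g h]
      · rw [ft e h₁, ft g h₂]
    · by_cases hh : c0 e = c0 a ∨ c0 e = c0 a'
      · rw [ft e hh]; omega
      · rw [fo e hh]; exact v0 e
    have y₁ := ft (t a)
    have y₂ := fo (t a)
    have y₃ := ft (t a')
    have y₄ := fo (t a')
    have off : ∀ h, c1 h ≠ c1 (t a) → c1 h ≠ c1 (t a') → f2 h = f1 h := by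
      intro h k₁ k₂
      by_cases hh : c0 h = c0 a ∨ c0 h = c0 a'
      · rw [ft h hh, ← P₁]
        have e := (J.2 h a).2 (Or.inr ⟨hh, Or.inl rfl⟩)
        rcases hJ with ⟨l₁, l₂, l₃, l₄⟩ | ⟨l₁, l₂, l₃⟩
        · exact absurd ((J.2 h (t a)).2 (Or.inr ⟨hh, Or.inl l₁.symm⟩)) k₁
        · exact u2 _ _ ((l₂.2 h a).2 (Or.inl e))
      · rw [fo h hh]
        rw [not_or] at hh
        refine P₂ h ?_ ?_ <;> rw [ne_eq, q0, not_or]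
        · exact ⟨hh.1, fun e => k₁ ((J.2 _ _).2 (Or.inl e))⟩
        · exact ⟨hh.2, fun e => k₂ ((J.2 _ _).2 (Or.inl e))⟩
    rcases hJ with ⟨k₁, k₂, k₃, k₄⟩ | ⟨k₁, k₂, k₃⟩
    · refine Or.inr ⟨k₃, ?_, ?_⟩
      · rw [windAt_pos k₁, windAt_pos k₂, windAt_neg k₄] at W
        rw [ft (t a) (Or.inl k₁.symm), t2, t2]
        have : c2 a = c2 a' ∨ c2 a = c2 (t a') := by rw [← q2, Jd.2]; right; simp
        have e : f2 a = f2 a' := by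
          rcases this with h | h
          · exact u2 _ _ h
          · rw [u2 _ _ h, t2]
        omega
      · intro h l₁ l₂
        have : c1 h ≠ c1 (t a) := by
          rw [ne_eq, k₃.2]
          rintro (e | ⟨e | e, -⟩)
          exacts [l₁ e, l₁ e, l₂ e]
        refine off h this ?_
        rw [← (k₃.pairs a a').2.1]
        exact this
    · refine Or.inl ⟨k₂, ?_, off⟩
      clear off P₂ ft fo
      rw [t2, P₁]
      by_cases b₁ : c0 a = c0 (t a)
      · have b₂ : c0 a' ≠ c0 (t a') := fun h => k₁ ⟨b₁, h⟩
        rw [windAt_pos b₁, windAt_neg b₂, windAt_pos (k₃.2 (Or.inl b₁))] at W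
        rw [y₁ (Or.inl b₁.symm), y₄ (by rintro (h | h); exacts [n₂ h.symm, b₂ h.symm])]
        omega
      · by_cases b₂ : c0 a' = c0 (t a')
        · rw [windAt_neg b₁, windAt_pos b₂, windAt_pos (k₃.2 (Or.inr b₂))] at W
          rw [y₃ (Or.inr b₂.symm), y₂ (by rintro (h | h); exacts [b₁ h.symm, n₃ h])]
          omega
        · rw [y₂ (by rintro (h | h); exacts [b₁ h.symm, n₃ h]),
            y₄ (by rintro (h | h); exacts [n₂ h.symm, b₂ h.symm]), w₄, w₅]

theorem Pants.dual_iff {β γ : Type} {c : δ → β} {c' : δ → γ} {a a' : δ} {f f' : δ → ℤ} :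
    Pants c' c a a' (fun e => 1 - f' e) (fun e => 1 - f e) ↔ Pants c c' a a' f f' := by
  refine ⟨fun h => ?_, Pants.dual⟩
  have := h.dual
  simpa using this

theorem windAt_invol {β : Type} {t : δ → δ} (ht : ∀ e, t (t e) = e) {c : δ → β} {f : δ → ℤ}
    (hf : ∀ e, f (t e) = f e) (a : δ) : windAt t c f (t a) = windAt t c f a := by
  by_cases h : c a = c (t a)
  · rw [windAt_pos h, windAt_pos (by rw [ht]; exact h.symm), hf]
  · rw [windAt_neg h, windAt_neg (by rw [ht]; exact Ne.symm h)]

/-- The surgeries are read backwards with dual labels: a split becomes a merge, and the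
contributions to the winding number change sign. -/
theorem orbit_split_iff {t : δ → δ} (ht : ∀ e, t (t e) = e) {c0 : δ → β0} {c1 : δ → β1}
    {c2 : δ → β2} {d0 : δ → γ0} {d2 : δ → γ2} (h0 : IsOrbitPartition t c0 d0)
    (h2 : IsOrbitPartition t c2 d2) {a a' : δ} (J₁ : Joins c0 c1 a a' ∨ Joins c1 c0 a a')
    (J₂ : Joins c1 c2 (t a) (t a') ∨ Joins c2 c1 (t a) (t a')) (Jd : Joins d2 d0 a a')
    {f0 f2 : δ → ℤ} (l0 : IsLabelling c0 f0) (l2 : IsLabelling c2 f2) (t0 : ∀ e, f0 (t e) = f0 e)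
    (t2 : ∀ e, f2 (t e) = f2 e) :
    (∃ f1, IsLabelling c1 f1 ∧ Pants c0 c1 a a' f0 f1 ∧ Pants c1 c2 (t a) (t a') f1 f2) ↔
      Pants d0 d2 a a' f0 f2 ∧ windAt t c0 f0 a = windAt t c2 f2 a + windAt t c2 f2 a' := by
  have e0 : ∀ e, d0 (t e) = d0 e := fun e => by rw [h0.2]; exact Or.inr rfl
  have e2 : ∀ e, d2 (t e) = d2 e := fun e => by rw [h2.2]; exact Or.inr rfl
  have Jd' : Joins d2 d0 (t a) (t a') := by
    unfold Joins at Jd ⊢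
    simpa only [e2] using Jd
  have key := orbit_merge_iff ht h2 h0 (a := t a) (a' := t a') J₂.symm
    (by rw [ht, ht]; exact J₁.symm) Jd' l2.dual l0.dual (fun e => by rw [t2])
    (fun e => by rw [t0])
  have hw : ∀ e, windAt t c0 (fun e => 1 - f0 e) (t e) = - windAt t c0 f0 e := fun e => by
    rw [windAt_dual, windAt_invol ht t0]
  have hw' : ∀ e, windAt t c2 (fun e => 1 - f2 e) (t e) = - windAt t c2 f2 e := fun e => by
    rw [windAt_dual, windAt_invol ht t2]
  rw [hw, hw', hw', ht, ht] at key
  have hP : Pants d2 d0 (t a) (t a') (fun e => 1 - f2 e) (fun e => 1 - f0 e) ↔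
      Pants d0 d2 a a' f0 f2 := by
    rw [Pants.dual_iff]
    unfold Pants Joins
    simp only [e0, e2, t0, t2]
  rw [hP] at key
  have hx : (windAt t c0 f0 a = windAt t c2 f2 a + windAt t c2 f2 a') ↔
      (- windAt t c0 f0 a = - windAt t c2 f2 a + - windAt t c2 f2 a') := by
    constructor <;> intro h <;> linarith
  rw [hx, ← key]
  constructor
  · rintro ⟨f1, l, P, Q⟩
    exact ⟨_, l.dual, Q.dual, P.dual⟩
  · rintro ⟨f1, l, P, Q⟩
    refine ⟨_, l.dual, Pants.dual_iff.1 ?_, Pants.dual_iff.1 ?_⟩ <;> simpa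

end Orbit
-- Edges away from the center: saddles of the quotient
section Pullback
variable {δ ε β γ : Type}

theorem Joins.comp_iff {p : ε → δ} (hp : Function.Surjective p) {c : δ → β} {c' : δ → γ}
    {a a' : ε} : Joins (c ∘ p) (c' ∘ p) a a' ↔ Joins c c' (p a) (p a') := by
  unfold Joins
  simp only [Function.comp_apply, ← hp.forall (p := fun e => ∀ f, c' e = c' (p f) ↔
    c e = c (p f) ∨ ((c e = c (p a) ∨ c e = c (p a')) ∧ (c (p f) = c (p a) ∨ c (p f) = c (p a'))))]
  refine and_congr_right fun _ => forall_congr' fun e => ?_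
  exact (hp.forall (p := fun f => c' e = c' f ↔
    c e = c f ∨ ((c e = c (p a) ∨ c e = c (p a')) ∧ (c f = c (p a) ∨ c f = c (p a'))))).symm

theorem Pants.comp_iff {p : ε → δ} (hp : Function.Surjective p) {c : δ → β} {c' : δ → γ}
    {a a' : ε} {f f' : δ → ℤ} :
    Pants (c ∘ p) (c' ∘ p) a a' (f ∘ p) (f' ∘ p) ↔ Pants c c' (p a) (p a') f f' := by
  unfold Pants
  rw [Joins.comp_iff hp, Joins.comp_iff hp]
  have h₁ := hp.forall (p := fun h => c h ≠ c (p a) → c h ≠ c (p a') → f' h = f h)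
  have h₂ := hp.forall (p := fun h => c' h ≠ c' (p a) → c' h ≠ c' (p a') → f' h = f h)
  rw [h₁, h₂]
  rfl

theorem eq_iff_of_off {c : δ → β} {c' : δ → γ} {a a' : δ} (J : Joins c c' a a' ∨ Joins c' c a a')
    {e : δ} (h : c e ≠ c a) (h' : c e ≠ c a') (f : δ) : c' e = c' f ↔ c e = c f := by
  rcases J with J | J
  · rw [J.2]
    tauto
  · have h₁ := J.2 e f
    have h₂ := J.2 e a
    have h₃ := J.2 e a'
    rw [h₁]
    tauto

theorem eq_iff_of_off_orbit {β0 β1 β2 γ0 : Type} {t : δ → δ} {c0 : δ → β0} {c1 : δ → β1}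
    {c2 : δ → β2} {d0 : δ → γ0} (h0 : IsOrbitPartition t c0 d0) {a a' : δ}
    (J₁ : Joins c0 c1 a a' ∨ Joins c1 c0 a a')
    (J₂ : Joins c1 c2 (t a) (t a') ∨ Joins c2 c1 (t a) (t a'))
    {e : δ} (h : d0 e ≠ d0 a) (h' : d0 e ≠ d0 a') (f : δ) : c2 e = c2 f ↔ c0 e = c0 f := by
  rw [ne_eq, h0.2, not_or] at h h'
  have k := eq_iff_of_off J₁ h.1 h'.1
  rw [eq_iff_of_off J₂ (by rw [ne_eq, k]; exact h.2) (by rw [ne_eq, k]; exact h'.2), k]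

theorem windAt_congr {t : δ → δ} {c : δ → β} {c' : δ → γ} {f f' : δ → ℤ} {e : δ}
    (h : c' e = c' (t e) ↔ c e = c (t e)) (hf : f' e = f e) : windAt t c' f' e = windAt t c f e := by
  by_cases k : c e = c (t e)
  · rw [windAt_pos k, windAt_pos (h.2 k), hf]
  · rw [windAt_neg k, windAt_neg (fun e => k (h.1 e))]

end Pullback

namespace IntravergentDiagram

open LinkDiagram

variable (K : IntravergentDiagram)

/-- The partition of the darts into the circles of the quotient. -/
def projCirc (w : K.quotient.State) (a : K.Dart) : K.quotient.Circle w :=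
  K.quotientDiagram.circ w (K.projDart a)

theorem isOrbitPartition (w : K.quotientDiagram.State) :
    IsOrbitPartition K.tau (K.circ (K.liftState w)) (K.projCirc w) :=
  ⟨fun _ _ => K.conn_tau, fun a b => K.conn_projDart w a b⟩

theorem projCirc_surjective (w : K.quotientDiagram.State) : Function.Surjective (K.projCirc w) :=
  (circ_surjective w).comp K.projDart_surjective

theorem liftGen_deg (x : K.quotientDiagram.KhGen) : (K.liftGen x).deg = x.deg ∘ K.projDart := rfl

theorem liftGen_deg_tau (x : K.quotientDiagram.KhGen) (a : K.Dart) :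
    (K.liftGen x).deg (K.tau a) = (K.liftGen x).deg a := by
  rw [liftGen_deg, Function.comp_apply, K.projDart_tau]
  rfl

open Classical in
theorem windAt_eq (x : K.quotient.KhGen) (a : K.Dart) :
    (if K.quotient.IsEssential x.state (K.projCirc x.state a) then
      2 * (x.circLabel (K.projCirc x.state a)).deg - 1 else 0) =
    windAt K.tau (K.circ (K.liftState x.state)) (K.liftGen x).deg a := by
  unfold windAt
  refine if_congr (K.isEssential_iff x.state a) rfl rfl

/-- Circles away from the surgery contribute equally on both sides, so the change of the winding
number is local. -/
theorem winding_of_joins {x y : K.quotient.KhGen} {a a' : K.Dart}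
    (J : Joins (K.projCirc x.state) (K.projCirc y.state) a a')
    (h : ∀ e, K.projCirc x.state e ≠ K.projCirc x.state a →
      K.projCirc x.state e ≠ K.projCirc x.state a' →
      windAt K.tau (K.circ (K.liftState y.state)) (K.liftGen y).deg e =
        windAt K.tau (K.circ (K.liftState x.state)) (K.liftGen x).deg e) :
    K.quotient.winding y - K.quotient.winding x =
      windAt K.tau (K.circ (K.liftState x.state)) (K.liftGen x).deg a +
      windAt K.tau (K.circ (K.liftState x.state)) (K.liftGen x).deg a' -
      windAt K.tau (K.circ (K.liftState y.state)) (K.liftGen y).deg a := by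
  classical
  have key := Joins.sum_eq J (K.projCirc_surjective _) (K.projCirc_surjective _)
    (fun C => if K.quotient.IsEssential x.state C then 2 * (x.circLabel C).deg - 1 else 0)
    (fun C => if K.quotient.IsEssential y.state C then 2 * (y.circLabel C).deg - 1 else 0)
    (by
      intro e h₁ h₂
      have := h e h₁ h₂
      rwa [← K.windAt_eq, ← K.windAt_eq] at this)
  beta_reduce at key
  rw [K.windAt_eq, K.windAt_eq, K.windAt_eq] at key
  have e₁ := K.quotient.winding_eq x
  have e₂ := K.quotient.winding_eq y
  linarith

theorem drop_projVertex {c : K.Vertex} {v w : K.quotientDiagram.State}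
    {u : K.State} (h₁ : K.Drop c (K.liftState v) u) (h₂ : K.Drop (K.tauVertex c) u (K.liftState w)) :
    K.quotientDiagram.Drop (K.projVertex c) v w := by
  refine ⟨h₁.1, ?_, fun k hk => ?_⟩
  · have := h₂.2.1
    change w (K.projVertex (K.tauVertex c)) = false at this
    rwa [K.projVertex_tau] at this
  · obtain ⟨k, rfl⟩ := K.projVertex_surjective k
    have n₁ : k ≠ c := fun h => hk (by rw [h])
    have n₂ : k ≠ K.tauVertex c := fun h => hk (by rw [h, K.projVertex_tau])
    exact (h₂.2.2 k n₂).trans (h₁.2.2 k n₁)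

theorem exists_drop_of_projVertex {c : K.Vertex} (hc : c ≠ K.center) {v w : K.quotientDiagram.State}
    (h : K.quotientDiagram.Drop (K.projVertex c) v w) :
    ∃ u, K.Drop c (K.liftState v) u ∧ K.Drop (K.tauVertex c) u (K.liftState w) := by
  classical
  have hne : K.tauVertex c ≠ c := fun h => hc ((K.tauVertex_eq_self_iff c).1 h)
  refine ⟨Function.update (K.liftState v) c false, ⟨h.1, by simp, fun k hk => by simp [hk]⟩,
    ?_, ?_, ?_⟩
  · rw [Function.update_of_ne hne]
    change v (K.projVertex (K.tauVertex c)) = true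
    rw [K.projVertex_tau]
    exact h.1
  · change w (K.projVertex (K.tauVertex c)) = false
    rw [K.projVertex_tau]
    exact h.2.1
  · intro k hk
    by_cases hkc : k = c
    · subst hkc
      rw [Function.update_self]
      exact h.2.1
    · rw [Function.update_of_ne hkc]
      refine h.2.2 _ fun e => ?_
      rcases K.projVertex_eq_iff.1 e with e | e
      · exact hkc e.symm
      · exact hk (by rw [e, K.tauVertex_tauVertex])

theorem rot_rot_projDart_ne {a : K.Dart} (h : K.vtx a ≠ K.center) :
    K.quotientDiagram.rot (K.quotientDiagram.rot (K.projDart a)) ≠ K.projDart a := by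
  intro e
  have e' := (K.quotient.point_iff (K.projDart a)).1 e
  exact h (K.eq_center_of_projVertex ((K.vtx_projDart a).symm.trans e'))

theorem saddleAt_projDart_iff {x y : K.quotientDiagram.KhGen} {a : K.Dart} :
    SaddleAt (K.projDart a) x y ↔ Pants (K.projCirc x.state) (K.projCirc y.state) a
      (K.rot (K.rot a)) (K.liftGen x).deg (K.liftGen y).deg :=
  (Pants.comp_iff K.projDart_surjective (a := a) (a' := K.rot (K.rot a))).symm

/-- Saddles of the quotient that preserve the winding number correspond to pairs of saddles
exchanged by the rotation. -/
theorem exists_middle_iff {x y : K.quotientDiagram.KhGen} {c : K.Vertex} (hc : c ≠ K.center) :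
    (∃ m, K.Saddle c (K.liftGen x) m ∧ K.Saddle (K.tauVertex c) m (K.liftGen y)) ↔
      K.quotientDiagram.Saddle (K.projVertex c) x y ∧
        K.quotient.winding x = K.quotient.winding y := by
  obtain ⟨κ, -⟩ := K.isPlanar.exists_coloring
  obtain ⟨a, rfl⟩ := Quot.exists_rep c
  change K.vtx a ≠ K.center at hc
  change (∃ m, K.Saddle (K.vtx a) (K.liftGen x) m ∧ K.Saddle (K.tauVertex (K.vtx a)) m (K.liftGen y)) ↔
    K.quotientDiagram.Saddle (K.projVertex (K.vtx a)) x y ∧ _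
  have hp := K.vtx_projDart a
  by_cases hd : K.quotientDiagram.Drop (K.projVertex (K.vtx a)) x.state y.state
  swap
  · constructor
    · rintro ⟨m, h₁, h₂⟩
      exact absurd (K.drop_projVertex h₁.1 h₂.1) hd
    · rintro ⟨h, -⟩
      exact absurd h.1 hd
  obtain ⟨u, d₁, d₂⟩ := K.exists_drop_of_projVertex hc hd
  have J₁ := joins_or_joins κ d₁.flip rfl (K.four_valent a)
  have J₂ := joins_or_joins κ d₂.flip (K.tauVertex_vtx a).symm (K.four_valent (K.tau a))
  have Jd := joins_or_joins (K.quotientColoring κ) hd.flip hp (K.rot_rot_projDart_ne hc)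
  rw [← K.tau_rot, ← K.tau_rot] at J₂
  have Jd' : Joins (K.projCirc x.state) (K.projCirc y.state) a (K.rot (K.rot a)) ∨
      Joins (K.projCirc y.state) (K.projCirc x.state) a (K.rot (K.rot a)) :=
    Jd.imp (Joins.comp_iff K.projDart_surjective (a := a) (a' := K.rot (K.rot a))).2
      (Joins.comp_iff K.projDart_surjective (a := a) (a' := K.rot (K.rot a))).2
  -- Both sides are rewritten in terms of labelled partitions of the darts of `K`, where
  -- `orbit_merge_iff` and `orbit_split_iff` apply.
  have L : (∃ m, K.Saddle (K.vtx a) (K.liftGen x) m ∧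
      K.Saddle (K.tauVertex (K.vtx a)) m (K.liftGen y)) ↔
      ∃ f, IsLabelling (K.circ u) f ∧
        Pants (K.circ (K.liftState x.state)) (K.circ u) a (K.rot (K.rot a)) (K.liftGen x).deg f ∧
        Pants (K.circ u) (K.circ (K.liftState y.state)) (K.tau a) (K.tau (K.rot (K.rot a))) f
          (K.liftGen y).deg := by
    constructor
    · rintro ⟨m, h₁, h₂⟩
      obtain rfl : m.state = u := drop_unique h₁.1 d₁
      have h₃ := h₂.at κ (K.tauVertex_vtx a).symm
      unfold SaddleAt at h₃
      rw [← K.tau_rot, ← K.tau_rot] at h₃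
      exact ⟨m.deg, m.isLabelling, h₁.at κ rfl, h₃⟩
    · rintro ⟨f, l, h₁, h₂⟩
      obtain ⟨m, rfl, rfl⟩ := KhGen.exists_of_isLabelling l
      refine ⟨m, (saddle_iff κ rfl).2 ⟨d₁, K.four_valent a, h₁⟩,
        (saddle_iff κ (K.tauVertex_vtx a).symm).2 ⟨d₂, K.four_valent _, ?_⟩⟩
      unfold SaddleAt
      rw [← K.tau_rot, ← K.tau_rot]
      exact h₂
  have R : K.quotientDiagram.Saddle (K.projVertex (K.vtx a)) x y ↔
      Pants (K.projCirc x.state) (K.projCirc y.state) a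
        (K.rot (K.rot a)) (K.liftGen x).deg (K.liftGen y).deg := by
    rw [saddle_iff (K.quotientColoring κ) hp, K.saddleAt_projDart_iff]
    exact ⟨fun h => h.2.2, fun h => ⟨hd, K.rot_rot_projDart_ne hc, h⟩⟩
  rw [L, R]
  have O₀ := K.isOrbitPartition x.state
  have O₂ := K.isOrbitPartition y.state
  rcases Jd' with Jd' | Jd'
  · rw [orbit_merge_iff K.tau_tau O₀ O₂ J₁ J₂ Jd' (K.liftGen x).isLabelling (K.liftGen y).isLabelling
      (K.liftGen_deg_tau x) (K.liftGen_deg_tau y)]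
    refine and_congr_right fun P => ?_
    have key := K.winding_of_joins Jd' fun e h₁ h₂ =>
      windAt_congr (eq_iff_of_off_orbit O₀ J₁ J₂ h₁ h₂ _) (by
        rcases P with P | P
        · exact P.2.2 e h₁ h₂
        · exact absurd Jd'.1 (not_not.2 ((P.1.2 _ _).2 (Or.inr (by simp)))))
    constructor <;> intro h <;> linarith
  · rw [orbit_split_iff K.tau_tau O₀ O₂ J₁ J₂ Jd' (K.liftGen x).isLabelling (K.liftGen y).isLabelling
      (K.liftGen_deg_tau x) (K.liftGen_deg_tau y)]
    refine and_congr_right fun P => ?_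
    have ht : ∀ e, K.projCirc y.state (K.tau e) = K.projCirc y.state e := fun e => by
      unfold projCirc
      rw [K.projDart_tau]
    have key := K.winding_of_joins Jd' fun e h₁ h₂ =>
      windAt_congr (eq_iff_of_off_orbit O₂ J₂.symm (by rw [K.tau_tau, K.tau_tau]; exact J₁.symm)
        (by rw [ht]; exact h₁) (by rw [ht]; exact h₂) _) (by
        rcases P with P | P
        · exact absurd Jd'.1 (not_not.2 ((P.1.2 _ _).2 (Or.inr (by simp))))
        · exact (P.2.2 e h₁ h₂).symm)
    constructor <;> intro h <;> linarith

end IntravergentDiagram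
-- The edge of the center: the axis-moving map
section Relabel
variable {δ β γ : Type}

theorem sum_eq_of_partition_eq [Fintype β] [Fintype γ] {c : δ → β} {c' : δ → γ}
    (hc : Function.Surjective c) (hc' : Function.Surjective c')
    (h : ∀ e f, c' e = c' f ↔ c e = c f) (φ : β → ℤ) (ψ : γ → ℤ) (a : δ)
    (hφ : ∀ e, c e ≠ c a → ψ (c' e) = φ (c e)) :
    ∑ C, ψ C + φ (c a) = ∑ B, φ B + ψ (c' a) := by
  classical
  have h₁ : ∑ C, ψ C = ψ (c' a) + ∑ C ∈ Finset.univ.erase (c' a), ψ C :=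
    (Finset.add_sum_erase _ _ (Finset.mem_univ _)).symm
  have h₂ : ∑ B, φ B = φ (c a) + ∑ B ∈ Finset.univ.erase (c a), φ B :=
    (Finset.add_sum_erase _ _ (Finset.mem_univ _)).symm
  have h₃ : ∑ B ∈ Finset.univ.erase (c a), φ B = ∑ C ∈ Finset.univ.erase (c' a), ψ C := by
    have k : ∀ B, c (Function.surjInv hc B) = B := Function.surjInv_eq hc
    refine Finset.sum_bij (fun B _ => c' (Function.surjInv hc B)) ?_ ?_ ?_ ?_
    · intro B hB
      simpa [h, k] using hB
    · intro B _ B' _ hB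
      rwa [h, k, k] at hB
    · intro C hC
      obtain ⟨e, rfl⟩ := hc' C
      refine ⟨c e, by simpa [h] using hC, ?_⟩
      rw [h, k]
    · intro B hB
      have := hφ (Function.surjInv hc B)
      rw [k] at this
      exact (this (by simpa using hB)).symm
  linarith

end Relabel

namespace AxisDiagram

open LinkDiagram

variable (L : AxisDiagram)

/-- At a two-valent vertex `rot` is its own inverse, so both resolutions join the same darts. Moving
the point across the axis leaves the circles as they are and changes only which of them are
essential. -/
theorem smooth_of_drop_point {v w : L.State} (h : L.Drop L.point v w) (a : L.Dart) :
    L.smooth w a = L.smooth v a := by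
  by_cases ha : L.vtx a = L.point
  · have e : L.rot.symm a = L.rot a := by
      rw [L.rot_symm_eq]
      exact congrArg L.rot ((L.point_iff a).2 ha)
    unfold smooth
    rw [e, ite_self, ite_self]
  · exact smooth_flip_of_ne (Drop.flip h) ha

theorem conn_of_drop_point {v w : L.State} (h : L.Drop L.point v w) (a b : L.Dart) :
    L.Conn w a b ↔ L.Conn v a b := by
  constructor
  · refine fun hc => Conn.lift (L.circ v) (fun a => (conn_edge v a).symm) (fun a => ?_) hc
    rw [L.smooth_of_drop_point h]
    exact (conn_smooth v a).symm
  · refine fun hc => Conn.lift (L.circ w) (fun a => (conn_edge w a).symm) (fun a => ?_) hc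
    rw [← L.smooth_of_drop_point h]
    exact (conn_smooth w a).symm

/-- Multiplication with `1` keeps the label, so the only restriction is the one on the winding
number. -/
theorem axisMove_iff (x y : L.KhGen) : L.AxisMove x y ↔
    L.Drop L.point x.state y.state ∧ y.label = x.label ∧ L.winding y = L.winding x + 1 := by
  have hm : ∀ l l' : Label, Label.mul .one l = some l' ↔ l' = l := fun l l' => by
    cases l <;> cases l' <;> simp [Label.mul]
  unfold AxisMove
  simp only [hm]
  refine and_congr_right fun d => ?_
  rw [← and_assoc]
  refine and_congr_left fun _ => ?_
  constructor
  · rintro ⟨h₁, h₂⟩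
    funext h
    by_cases hh : ∀ a, L.vtx a = L.point → L.circ x.state a ≠ L.circ x.state h
    · exact h₁ h hh
    · push Not at hh
      obtain ⟨a, ha, e⟩ := hh
      rw [← y.label_conn ((L.conn_of_drop_point d a h).2 e), h₂ a ha]
      exact x.label_conn e
  · intro h
    exact ⟨fun e _ => by rw [h], fun e _ => by rw [h]⟩

end AxisDiagram

namespace IntravergentDiagram

open LinkDiagram

variable (K : IntravergentDiagram)

/-- In a ladybug the opposite darts at `c` would be on one circle at the start and at the end, hence
also in the quotient. There, however, the surgery at the image of `c` merges two circles or splits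
one. -/
theorem not_isLadybug_orbit {c : K.Vertex} (hc : c ≠ K.center) {v w : K.quotientDiagram.State}
    {u : K.State} (h₁ : K.Drop c (K.liftState v) u) (h₂ : K.Drop (K.tauVertex c) u (K.liftState w)) :
    ¬ K.IsLadybug c (K.tauVertex c) (K.liftState v) (K.liftState w) := by
  rintro ⟨-, -, h⟩
  obtain ⟨κ, -⟩ := K.isPlanar.exists_coloring
  obtain ⟨a, rfl⟩ := Quot.exists_rep c
  have hd := K.drop_projVertex h₁ h₂
  have Jd := joins_or_joins (K.quotientColoring κ) hd.flip (K.vtx_projDart a)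
    (K.rot_rot_projDart_ne hc)
  have hr : K.vtx (K.rot (K.rot a)) = K.vtx a := by rw [K.vtx_rot, K.vtx_rot]
  have k := h a (K.rot (K.rot a)) (Or.inl rfl) (Or.inl hr)
  have k₁ : K.quotientDiagram.Conn v (K.projDart a) (K.projDart (K.rot (K.rot a))) :=
    (K.conn_projDart _ _ _).2 (Or.inl k.1)
  have k₂ : K.quotientDiagram.Conn w (K.projDart a) (K.projDart (K.rot (K.rot a))) :=
    (K.conn_projDart _ _ _).2 (Or.inl k.2)
  exact Jd.elim (fun J => J.1 k₁) (fun J => J.1 k₂)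

theorem drop_center_iff {v w : K.quotientDiagram.State} :
    K.Drop K.center (K.liftState v) (K.liftState w) ↔
      K.quotientDiagram.Drop K.quotient.point v w := by
  refine and_congr_right fun _ => and_congr_right fun _ => ?_
  constructor
  · intro h k hk
    obtain ⟨k, rfl⟩ := K.projVertex_surjective k
    exact h k fun e => hk (by rw [e]; rfl)
  · intro h k hk
    exact h _ fun e => hk (K.eq_center_of_projVertex e)

/-- Saddles at the center correspond to axis moves of the quotient. -/
theorem saddle_center_iff {x y : K.quotient.KhGen} :
    K.Saddle K.center (K.liftGen x) (K.liftGen y) ↔ K.quotient.AxisMove x y := by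
  obtain ⟨κ, -⟩ := K.isPlanar.exists_coloring
  obtain ⟨a, ha⟩ := Quot.exists_rep K.center
  change K.vtx a = K.center at ha
  rw [K.quotient.axisMove_iff, saddle_iff κ ha]
  refine Iff.trans (and_congr_left' (K.drop_center_iff (v := x.state) (w := y.state)))
    (and_congr_right fun d => ?_)
  have d' := K.drop_center_iff.2 d
  have ht := K.tau_center a ha
  have J := joins_or_joins κ d'.flip ha (K.four_valent a)
  unfold SaddleAt
  rw [← ht] at J ⊢
  have O₀ := K.isOrbitPartition x.state
  have O₂ := K.isOrbitPartition y.state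
  have hA : (K.liftGen x).deg (K.tau a) = (K.liftGen x).deg a := K.liftGen_deg_tau x a
  have hB : (K.liftGen y).deg (K.tau a) = (K.liftGen y).deg a := K.liftGen_deg_tau y a
  have hpart : ∀ e f, K.projCirc y.state e = K.projCirc y.state f ↔
      K.projCirc x.state e = K.projCirc x.state f :=
    fun e f => K.quotient.conn_of_drop_point d (K.projDart e) (K.projDart f)
  have hl : y.label = x.label ↔ ∀ e, (K.liftGen y).deg e = (K.liftGen x).deg e := by
    constructor
    · intro h e
      change (y.label _).deg = (x.label _).deg
      rw [h]
    · intro h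
      funext e
      obtain ⟨e, rfl⟩ := K.projDart_surjective e
      exact Label.deg_injective (h e)
  have hoff : ∀ e, K.projCirc x.state e ≠ K.projCirc x.state a →
      (K.liftGen y).deg e = (K.liftGen x).deg e →
      windAt K.tau (K.circ (K.liftState y.state)) (K.liftGen y).deg e =
        windAt K.tau (K.circ (K.liftState x.state)) (K.liftGen x).deg e := by
    intro e he hd
    rw [ne_eq, O₀.2, not_or] at he
    exact windAt_congr (eq_iff_of_off J he.1 he.2 _) hd
  have hw : (∀ e, (K.liftGen y).deg e = (K.liftGen x).deg e) →
      K.quotient.winding y - K.quotient.winding x =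
        windAt K.tau (K.circ (K.liftState x.state)) (K.liftGen x).deg a -
        windAt K.tau (K.circ (K.liftState y.state)) (K.liftGen y).deg a := by
    classical
    intro hd
    have key := sum_eq_of_partition_eq (K.projCirc_surjective x.state)
      (K.projCirc_surjective y.state) hpart
      (fun C => if K.quotient.IsEssential x.state C then 2 * (x.circLabel C).deg - 1 else 0)
      (fun C => if K.quotient.IsEssential y.state C then 2 * (y.circLabel C).deg - 1 else 0) a
      (by
        intro e he
        have := hoff e he (hd e)
        rwa [← K.windAt_eq, ← K.windAt_eq] at this)
    beta_reduce at key
    rw [K.windAt_eq, K.windAt_eq] at key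
    have e₁ := K.quotient.winding_eq x
    have e₂ := K.quotient.winding_eq y
    linarith
  have hx := (K.liftGen x).isLabelling
  have hy := (K.liftGen y).isLabelling
  have v₁ := hx.2 a
  have v₂ := hy.2 a
  rw [hl]
  constructor
  · rintro ⟨-, P⟩
    have P' : (K.liftGen y).deg a = (K.liftGen x).deg a ∧
        ∀ e, K.circ (K.liftGen x).state e ≠ K.circ (K.liftGen x).state a →
          K.circ (K.liftGen x).state e ≠ K.circ (K.liftGen x).state (K.tau a) →
          (K.liftGen y).deg e = (K.liftGen x).deg e := by
      -- The two darts are exchanged by the rotation and have equal labels. So a merge can only be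
      -- `1 · 1 = 1` and a split only `X ↦ X ⊗ X`, and no label changes.
      rcases P with ⟨J', s, o⟩ | ⟨J', s, o⟩
      · exact ⟨by omega, o⟩
      · refine ⟨by omega, fun e h₁ h₂ => o e ?_ ?_⟩
        · exact fun h => h₁ ((J'.2 _ _).2 (Or.inl h))
        · exact fun h => h₂ ((J'.2 _ _).2 (Or.inl h))
    have hd : ∀ e, (K.liftGen y).deg e = (K.liftGen x).deg e := by
      intro e
      by_cases he : K.projCirc x.state e = K.projCirc x.state a
      · have k₁ := (O₀.2 _ _).1 he
        have k₂ := (O₂.2 _ _).1 ((hpart _ _).2 he)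
        have l₁ : (K.liftGen x).deg e = (K.liftGen x).deg a :=
          k₁.elim (hx.1 _ _) fun k => (hx.1 _ _ k).trans hA
        have l₂ : (K.liftGen y).deg e = (K.liftGen y).deg a :=
          k₂.elim (hy.1 _ _) fun k => (hy.1 _ _ k).trans hB
        rw [l₁, l₂, P'.1]
      · rw [O₀.2, not_or] at he
        exact P'.2 e he.1 he.2
    refine ⟨hd, ?_⟩
    have := hw hd
    -- In a merge, an inessential circle labelled `1` becomes essential; in a split, an essential
    -- circle labelled `X` becomes inessential. Both raise the winding number by one.
    rcases P with ⟨J', s, o⟩ | ⟨J', s, o⟩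
    · have z₁ : windAt K.tau (K.circ (K.liftState x.state)) (K.liftGen x).deg a = 0 :=
        windAt_neg J'.1
      have z₂ : windAt K.tau (K.circ (K.liftState y.state)) (K.liftGen y).deg a = _ :=
        windAt_pos (J'.pairs a a).2.1
      rw [z₁, z₂] at this
      omega
    · have z₁ : windAt K.tau (K.circ (K.liftState y.state)) (K.liftGen y).deg a = 0 :=
        windAt_neg J'.1
      have z₂ : windAt K.tau (K.circ (K.liftState x.state)) (K.liftGen x).deg a = _ :=
        windAt_pos (J'.pairs a a).2.1
      rw [z₁, z₂] at this
      omega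
  · rintro ⟨hd, h⟩
    have key := hw hd
    have := hd a
    refine ⟨K.tau_ne a, ?_⟩
    rcases J with J' | J'
    · have z₁ : windAt K.tau (K.circ (K.liftState x.state)) (K.liftGen x).deg a = 0 :=
        windAt_neg J'.1
      have z₂ : windAt K.tau (K.circ (K.liftState y.state)) (K.liftGen y).deg a = _ :=
        windAt_pos (J'.pairs a a).2.1
      rw [z₁, z₂] at key
      exact Or.inl ⟨J', by omega, fun e _ _ => hd e⟩
    · have z₁ : windAt K.tau (K.circ (K.liftState y.state)) (K.liftGen y).deg a = 0 :=
        windAt_neg J'.1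
      have z₂ : windAt K.tau (K.circ (K.liftState x.state)) (K.liftGen x).deg a = _ :=
        windAt_pos (J'.pairs a a).2.1
      rw [z₁, z₂] at key
      exact Or.inr ⟨J', by omega, fun e _ _ => hd e⟩

end IntravergentDiagram
-- Ladybugs of the quotient
namespace LinkDiagram

variable {D : LinkDiagram}

theorem SaddleAt.split {a : D.Dart} {x y : D.KhGen} (h : SaddleAt a x y)
    (hc : D.Conn x.state a (D.rot (D.rot a))) :
    y.deg a + y.deg (D.rot (D.rot a)) = x.deg a + 1 := by
  rcases h with h | h
  · exact absurd hc h.1.1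
  · exact h.2.1

theorem SaddleAt.merge {a : D.Dart} {x y : D.KhGen} (h : SaddleAt a x y)
    (hc : ¬ D.Conn x.state a (D.rot (D.rot a))) :
    Joins (D.circ x.state) (D.circ y.state) a (D.rot (D.rot a)) ∧
      y.deg a = x.deg a + x.deg (D.rot (D.rot a)) := by
  rcases h with h | h
  · exact ⟨h.1, h.2.1⟩
  · exact absurd ((h.1.2 _ _).2 (Or.inr (by simp))) hc

theorem SaddleAt.joins {a : D.Dart} {x y : D.KhGen} (h : SaddleAt a x y) :
    Joins (D.circ x.state) (D.circ y.state) a (D.rot (D.rot a)) ∨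
      Joins (D.circ y.state) (D.circ x.state) a (D.rot (D.rot a)) :=
  h.imp And.left And.left

theorem SaddleAt.deg_off {a e : D.Dart} {x y : D.KhGen} (h : SaddleAt a x y)
    (h₁ : ¬ D.Conn x.state e a) (h₂ : ¬ D.Conn x.state e (D.rot (D.rot a))) :
    y.deg e = x.deg e := by
  rcases h with h | h
  · exact h.2.2 e h₁ h₂
  · exact h.2.2 e (fun k => h₁ ((h.1.2 _ _).2 (Or.inl k))) (fun k => h₂ ((h.1.2 _ _).2 (Or.inl k)))

theorem SaddleAt.conn_off {a e : D.Dart} {x y : D.KhGen} (h : SaddleAt a x y)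
    (h₁ : ¬ D.Conn x.state e a) (h₂ : ¬ D.Conn x.state e (D.rot (D.rot a))) (f : D.Dart) :
    D.Conn y.state e f ↔ D.Conn x.state e f :=
  eq_iff_of_off h.joins h₁ h₂ f

theorem KhGen.deg_conn (x : D.KhGen) {a b : D.Dart} (h : D.Conn x.state a b) : x.deg a = x.deg b :=
  x.isLabelling.1 _ _ h

end LinkDiagram

namespace IntravergentDiagram

open LinkDiagram

variable (K : IntravergentDiagram)

/-- The composite of saddles at `i`, `tau i`, `j`, `tau j` is rearranged by faces upstairs. The
hypotheses on labels say that the generators `y` and `y'` reached on the two sides would be matched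
wrongly in a ladybug of the quotient. In every configuration of the circles at `x`, either one of
the faces is a ladybug whose matching contradicts this, or a circle is untouched by a surgery and
its label is carried to a contradiction. -/
theorem saddle_faces_absurd {x y y' : K.quotientDiagram.KhGen} {i j : K.Vertex}
    {m n p m' q : K.KhGen}
    (s₁ : K.Saddle i (K.liftGen x) m) (s₂ : K.Saddle (K.tauVertex i) m (K.liftGen y))
    (s₃ : K.Saddle j (K.liftGen y) n)
    (s₅ : K.Saddle j m p)
    (f₂ : K.FaceMatch (K.tauVertex i) j m (K.liftGen y) p n)
    (s₇ : K.Saddle j (K.liftGen x) m') (s₈ : K.Saddle i m' p)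
    (f₁ : K.FaceMatch i j (K.liftGen x) m m' p)
    (s₁₁ : K.Saddle (K.tauVertex j) m' (K.liftGen y')) (s₁₂ : K.Saddle i (K.liftGen y') q)
    (f₄ : K.FaceMatch i (K.tauVertex j) m' p (K.liftGen y') q)
    (hx : ∀ a b, (K.vtx a = i ∨ K.vtx a = j) → (K.vtx b = i ∨ K.vtx b = j) →
      K.Conn (K.liftState x.state) a b ∨ K.Conn (K.liftState x.state) a (K.tau b))
    (hy : ∀ b, K.vtx b = j → ¬ K.Conn (K.liftState y.state) b (K.rot (K.rot b)))
    {h : K.Dart} (hh : K.vtx h = i) (ho : K.isOver h = false)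
    (x₀ : (K.liftGen x).deg h = 0) (y₀ : (K.liftGen y).deg h = 0)
    (y₁ : (K.liftGen y).deg (K.rot (K.rot h)) = 1) (y₂ : (K.liftGen y').deg h = 1)
    (y₃ : (K.liftGen y').deg (K.rot (K.rot h)) = 0) : False := by
  obtain ⟨κ, -⟩ := K.isPlanar.exists_coloring
  have hr : ∀ a, K.vtx (K.rot (K.rot a)) = K.vtx a := fun a => by rw [K.vtx_rot, K.vtx_rot]
  have hh' : K.vtx (K.rot (K.rot h)) = i := (hr h).trans hh
  have ho' : K.isOver (K.rot (K.rot h)) = false := by rw [K.isOver_rot_rot, ho]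
  have v : ∀ (u : K.KhGen) e, u.deg e = 0 ∨ u.deg e = 1 := fun u e => u.isLabelling.2 e
  have mono : ∀ {c} {u w : K.KhGen}, K.Saddle c u w → ∀ e, w.deg e = 0 → u.deg e = 0 := by
    intro c u w s e he
    obtain ⟨a, ha⟩ := Quot.exists_rep c
    rcases v u e with k | k
    · exact k
    · have := (s.at κ ha).mono k
      omega
  have lab : ∀ {u w : K.KhGen} {e}, u.label e = w.label e → u.deg e = w.deg e :=
    fun k => congrArg Label.deg k
  have a₁ := s₁.at κ hh
  have a₈ := s₈.at κ hh
  -- First case: the saddle at `i` splits a circle at `x`, and only the opposite dart gets the label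
  -- `X` in `m`. Depending on whether the surgery at `j` separates the strands of `i`, the ladybug
  -- is the face from `x` in the directions `i`, `j` or the one from `m'` in the directions `i`,
  -- `tau j`.
  by_cases hc : K.Conn (K.liftState x.state) h (K.rot (K.rot h))
  · have b₁ := a₁.split hc
    have b₂ := mono s₂ h y₀
    have b₃ : m.deg (K.rot (K.rot h)) = 1 := by omega
    have b₅ := mono s₁₁ _ y₃
    by_cases hj : K.Conn m'.state h (K.rot (K.rot h))
    · have b₆ := a₈.split hj
      have b₇ := m'.deg_conn hj
      have b₈ : p.deg (K.rot (K.rot h)) = 1 := by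
        rcases v p (K.rot (K.rot h)) with k | k
        · have := mono s₅ _ k
          omega
        · exact k
      have nc : ¬ K.Conn (K.liftState y'.state) h (K.rot (K.rot h)) := fun k => by
        have := (K.liftGen y').deg_conn k
        omega
      have L := isLadybug_of_split κ s₁₁.1 s₁₂.1 (K.isCrossing _) (K.isCrossing _) hh hj nc
      have := lab (f₄ L.symm h hh ho)
      omega
    · have L := isLadybug_of_split κ s₇.1 s₈.1 (K.isCrossing _) (K.isCrossing _) hh hc hj
      have := lab (f₁ L.symm _ hh' ho')
      omega
  -- Second case: the strands of `i` lie on two circles at `x`, exchanged by the rotation. They are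
  -- merged in `m`, and since the strands at `j` are separate again at `y`, the face from `m` in the
  -- directions `tau i`, `j` is a ladybug.
  · have hd : K.Conn (K.liftState x.state) h (K.tau (K.rot (K.rot h))) :=
      (hx _ _ (Or.inl hh) (Or.inl hh')).resolve_left hc
    have hd' : K.Conn (K.liftState x.state) (K.rot (K.rot h)) (K.tau h) := by
      have := K.conn_tau.2 hd
      rw [K.tau_tau] at this
      exact this.symm
    obtain ⟨J₁, -⟩ := a₁.merge hc
    have hg : ∀ g, K.vtx g = j → K.Conn (K.liftState x.state) g h ∨
        K.Conn (K.liftState x.state) g (K.rot (K.rot h)) := by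
      intro g hg
      rcases hx g h (Or.inr hg) (Or.inl hh) with k | k
      · exact Or.inl k
      · exact Or.inr (k.trans hd'.symm)
    obtain ⟨g, hgj, hgo⟩ := exists_under j
    have hgj' : K.vtx (K.rot (K.rot g)) = j := (hr g).trans hgj
    have hmg : K.Conn m.state g (K.rot (K.rot g)) :=
      (J₁.2 _ _).2 (Or.inr ⟨hg g hgj, hg _ hgj'⟩)
    have L := isLadybug_of_split κ s₂.1 s₃.1 (K.isCrossing _) (K.isCrossing _) hgj hmg (hy g hgj)
    by_cases hgc : K.Conn (K.liftState x.state) g (K.rot (K.rot g))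
    -- The arc at `j` has both ends on one of the two circles, so the other circle is untouched by
    -- the surgery at `j`. Its label, and the labels at `p` given by the ladybug matching, exclude
    -- each other.
    · have c₂ : p.deg (K.tau h) = 0 := by
        have := lab (f₂ L (K.tau h) (by rw [← K.tauVertex_vtx, hh]) (by rw [K.isOver_tau, ho]))
        rw [← this, K.liftGen_deg_tau, y₀]
      have c₃ : p.deg (K.tau (K.rot (K.rot h))) = 1 := by
        have := lab (f₂ L (K.tau (K.rot (K.rot h))) (by rw [← K.tauVertex_vtx, hh'])
          (by rw [K.isOver_tau, ho']))
        rw [← this, K.liftGen_deg_tau, y₁]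
      have a₇ := s₇.at κ hgj
      rcases hg g hgj with k | k
      · have n₁ : ¬ K.Conn (K.liftState x.state) (K.rot (K.rot h)) g := fun e =>
          hc (e.trans k).symm
        have n₂ : ¬ K.Conn (K.liftState x.state) (K.rot (K.rot h)) (K.rot (K.rot g)) := fun e =>
          hc ((e.trans hgc.symm).trans k).symm
        have e₁ := a₇.conn_off n₁ n₂
        have e₂ := a₇.deg_off n₁ n₂
        have e₃ : ¬ K.Conn m'.state h (K.rot (K.rot h)) := fun e => hc ((e₁ h).1 e.symm).symm
        obtain ⟨J₈, e₄⟩ := a₈.merge e₃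
        have e₅ : K.Conn p.state h (K.tau h) :=
          (J₈.2 _ _).2 (Or.inr ⟨Or.inl rfl, Or.inr ((e₁ _).2 hd').symm⟩)
        have e₆ := p.deg_conn e₅
        have a₁₁ := s₁₁.at κ (a := K.tau g) (by rw [← K.tauVertex_vtx, hgj])
        have r₁ : ∀ f, K.Conn (K.liftState x.state) f (K.rot (K.rot h)) → ¬ K.Conn m'.state h f :=
          fun f hf e => e₃ (e.trans ((e₁ f).2 hf.symm).symm)
        have t₁ : K.Conn (K.liftState x.state) (K.tau g) (K.rot (K.rot h)) :=
          (K.conn_tau.2 k).trans hd'.symm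
        have t₂ : K.Conn (K.liftState x.state) (K.rot (K.rot (K.tau g))) (K.rot (K.rot h)) := by
          rw [← K.tau_rot, ← K.tau_rot]
          exact (K.conn_tau.2 hgc.symm).trans t₁
        have e₇ := a₁₁.deg_off (r₁ _ t₁) (r₁ _ t₂)
        have e₈ := (K.liftGen x).deg_conn hd'
        rw [K.liftGen_deg_tau] at e₈
        omega
      · have n₁ : ¬ K.Conn (K.liftState x.state) h g := fun e => hc (e.trans k)
        have n₂ : ¬ K.Conn (K.liftState x.state) h (K.rot (K.rot g)) := fun e =>
          hc ((e.trans hgc.symm).trans k)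
        have e₁ := a₇.conn_off n₁ n₂
        have e₂ := a₇.deg_off n₁ n₂
        have e₃ : ¬ K.Conn m'.state h (K.rot (K.rot h)) := fun e => hc ((e₁ _).1 e)
        obtain ⟨J₈, e₄⟩ := a₈.merge e₃
        have e₅ : K.Conn p.state h (K.tau (K.rot (K.rot h))) :=
          (J₈.2 _ _).2 (Or.inl ((e₁ _).2 hd))
        have e₆ := p.deg_conn e₅
        have b₅ := mono s₁₁ _ y₃
        omega
    -- The arcs at `i` and `j` both join the two circles at `x`, where both crossings have state
    -- `1`. By `corner_eq` their colours agree, and so do those of `tau i` and `j`, which therefore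
    -- cannot form a ladybug.
    · obtain ⟨g, hgj, hgo, k₁, k₂⟩ : ∃ g, K.vtx g = j ∧ K.isOver g = false ∧
          K.Conn (K.liftState x.state) h g ∧
          K.Conn (K.liftState x.state) (K.rot (K.rot h)) (K.rot (K.rot g)) := by
        rcases hg g hgj with k | k <;> rcases hg _ hgj' with k' | k'
        · exact absurd (k.trans k'.symm) hgc
        · exact ⟨g, hgj, hgo, k.symm, k'.symm⟩
        · refine ⟨_, hgj', by rw [K.isOver_rot_rot, hgo], k'.symm, ?_⟩
          rw [K.rot_four]
          exact k.symm
        · exact absurd (k.trans k'.symm) hgc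
      have hcor := corner_eq K.isPlanar κ k₁ k₂ hc
      unfold Coloring.corner at hcor
      have w₁ : K.liftState x.state i = true := s₁.1.1
      have w₂ : K.liftState x.state j = true := s₇.1.1
      rw [hh, hgj, w₁, w₂, ho, hgo] at hcor
      refine K.isPlanar.separatesLadybugs κ _ _ _ _ _ s₂.1 s₃.1 L (K.tau h) g
        (by rw [← K.tauVertex_vtx, hh]) hgj (by rw [K.isOver_tau, ho, hgo]) ?_
      rw [K.col_tau]
      simpa using hcor

end IntravergentDiagram
namespace IntravergentDiagram

open LinkDiagram

variable (K : IntravergentDiagram)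

theorem exists_dart_over {i : K.Vertex} {e : K.quotientDiagram.Dart}
    (he : K.quotientDiagram.vtx e = K.projVertex i) : ∃ h, K.vtx h = i ∧ K.projDart h = e := by
  obtain ⟨h, rfl⟩ := K.projDart_surjective e
  rw [K.vtx_projDart] at he
  rcases K.projVertex_eq_iff.1 he with k | k
  · exact ⟨h, k.symm, rfl⟩
  · exact ⟨K.tau h, k.symm, K.projDart_tau h⟩

/-- Opposite labels at `h` are excluded by `saddle_faces_absurd`. Replacing `h` with `rot (rot h)`
exchanges the two possible orders of the labels. -/
theorem faceMatch_of_saddles {x y y' z : K.quotientDiagram.KhGen} {i j : K.Vertex}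
    {m n p m' q : K.KhGen}
    (d₁ : K.quotientDiagram.Saddle (K.projVertex i) x y)
    (d₂ : K.quotientDiagram.Saddle (K.projVertex j) y z)
    (d₃ : K.quotientDiagram.Saddle (K.projVertex j) x y')
    (d₄ : K.quotientDiagram.Saddle (K.projVertex i) y' z)
    (s₁ : K.Saddle i (K.liftGen x) m) (s₂ : K.Saddle (K.tauVertex i) m (K.liftGen y))
    (s₃ : K.Saddle j (K.liftGen y) n)
    (s₅ : K.Saddle j m p)
    (f₂ : K.FaceMatch (K.tauVertex i) j m (K.liftGen y) p n)
    (s₇ : K.Saddle j (K.liftGen x) m') (s₈ : K.Saddle i m' p)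
    (f₁ : K.FaceMatch i j (K.liftGen x) m m' p)
    (s₁₁ : K.Saddle (K.tauVertex j) m' (K.liftGen y')) (s₁₂ : K.Saddle i (K.liftGen y') q)
    (f₄ : K.FaceMatch i (K.tauVertex j) m' p (K.liftGen y') q) :
    K.quotientDiagram.FaceMatch (K.projVertex i) (K.projVertex j) x y y' z := by
  obtain ⟨κ₀, -⟩ := K.isPlanar.exists_coloring
  have κ := K.quotientColoring κ₀
  intro L e he heo
  obtain ⟨h, hh, rfl⟩ := K.exists_dart_over he
  rw [K.isOver_projDart] at heo
  obtain ⟨g₀, hg₀⟩ := Quot.exists_rep j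
  change K.vtx g₀ = j at hg₀
  have hp : ∀ {b : K.Dart} {c}, K.vtx b = c → K.quotientDiagram.vtx (K.projDart b) = K.projVertex c :=
    fun {b c} hb => (K.vtx_projDart b).trans (congrArg K.projVertex hb)
  have hx : ∀ a b, (K.vtx a = i ∨ K.vtx a = j) → (K.vtx b = i ∨ K.vtx b = j) →
      K.Conn (K.liftState x.state) a b ∨ K.Conn (K.liftState x.state) a (K.tau b) := by
    intro a b ha hb
    exact (K.conn_projDart _ _ _).1 (L.2.2 _ _ (ha.imp hp hp) (hb.imp hp hp)).1
  have lady := fun b (hb : K.vtx b = j) =>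
    lady_sums (d₁.at κ he) (d₂.at κ (hp hb)) ((isLadybug_iff he (hp hb)).1 L).2.2
  have hy : ∀ b, K.vtx b = j → ¬ K.Conn (K.liftState y.state) b (K.rot (K.rot b)) := by
    intro b hb k
    obtain ⟨-, -, -, -, -, -, hn⟩ := lady b hb
    exact hn ((K.conn_projDart _ _ _).2 (Or.inl k))
  obtain ⟨l₁, -, l₃, -⟩ := lady g₀ hg₀
  obtain ⟨-, -, -, l₄, -⟩ :=
    lady_sums (d₃.at κ (hp hg₀)) (d₄.at κ he) ((isLadybug_iff (hp hg₀) he).1 L.symm).2.2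
  change (K.liftGen x).deg h = 0 at l₁
  change (K.liftGen y).deg h + (K.liftGen y).deg (K.rot (K.rot h)) = 1 at l₃
  change (K.liftGen y').deg h + (K.liftGen y').deg (K.rot (K.rot h)) = 1 at l₄
  apply Label.deg_injective
  change (K.liftGen y).deg h = (K.liftGen y').deg h
  by_contra hne
  have v₁ := (K.liftGen y).isLabelling.2 h
  have v₂ := (K.liftGen y').isLabelling.2 h
  have key := @saddle_faces_absurd K x y y' i j m n p m' q s₁ s₂ s₃ s₅ f₂ s₇ s₈ f₁ s₁₁ s₁₂ f₄ hx hy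
  rcases v₁ with v₁ | v₁
  · exact key hh heo l₁ v₁ (by omega) (by omega) (by omega)
  · have hr : K.vtx (K.rot (K.rot h)) = i := by rw [K.vtx_rot, K.vtx_rot, hh]
    have xr : (K.liftGen x).deg (K.rot (K.rot h)) = (K.liftGen x).deg h := by
      rcases hx _ _ (Or.inl hr) (Or.inl hh) with k | k
      · exact (K.liftGen x).deg_conn k
      · rw [(K.liftGen x).deg_conn k, K.liftGen_deg_tau]
    exact key hr (by rw [K.isOver_rot_rot, heo]) (by omega) (by omega)
      (by rw [K.rot_four]; omega) (by omega) (by rw [K.rot_four]; omega)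

end IntravergentDiagram
-- Edges of the fixed point functor
namespace CubeData

open BurnsideDiagram

variable {ι : Type} {A : CubeData ι}

/-- The element of the functor given by an edge. -/
def edge {i : ι} {x y : A.Gen} (h : A.Step i x y) : A.toDiagram.Hom x y :=
  Quot.mk _ (.cons i h (.nil y))

/-- Moving two edges past two other ones. -/
theorem edge_comp_swap {a b c d : ι} {x m y n z p m' q w : A.Gen} (s₁ : A.Step a x m)
    (s₂ : A.Step b m y) (s₃ : A.Step c y n) (s₄ : A.Step d n z) (s₅ : A.Step c m p)
    (s₆ : A.Step b p n) (s₇ : A.Step c x m') (s₈ : A.Step a m' p) (s₉ : A.Step d p q)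
    (s₁₀ : A.Step b q z) (s₁₁ : A.Step d m' w) (s₁₂ : A.Step a w q) (f₁ : A.Face b c m y p n)
    (f₂ : A.Face a c x m m' p) (f₃ : A.Face b d p n q z) (f₄ : A.Face a d m' p w q) :
    A.toDiagram.comp (A.toDiagram.comp (edge s₁) (edge s₂))
      (A.toDiagram.comp (edge s₃) (edge s₄)) =
    A.toDiagram.comp (A.toDiagram.comp (edge s₇) (edge s₁₁))
      (A.toDiagram.comp (edge s₁₂) (edge s₁₀)) :=
  (Quot.sound (.cons s₁ (.face s₂ s₃ s₅ s₆ f₁ (.cons d s₄ (.nil z))))).trans <|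
    (Quot.sound (.face s₁ s₅ s₇ s₈ f₂ (.cons b s₆ (.cons d s₄ (.nil z))))).trans <|
    (Quot.sound (.cons s₇ (.cons s₈ (.face s₆ s₄ s₉ s₁₀ f₃ (.nil z))))).trans <|
    Quot.sound (.cons s₇ (.face s₈ s₉ s₁₁ s₁₂ f₄ (.cons b s₁₀ (.nil z))))

/-- A single coordinate falls, so that every sequence representing `f` consists of one edge. -/
theorem exists_edge {c : ι} {x y : A.Gen} (f : A.toDiagram.Hom x y)
    (h : CubeEdge c (A.vert x) (A.vert y)) : ∃ k : A.Step c x y, f = edge k := by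
  obtain ⟨p⟩ := f
  have hd : ∀ d, d ∈ p.dirs → d = c := by
    intro d hd
    by_contra hne
    have := (p.mem_dirs d).1 hd
    rw [h.2.2 d hne, this.1] at this
    exact absurd this.2 (by decide)
  cases p with
  | nil => exact absurd (h.1.symm.trans h.2.1) (by decide)
  | cons i k q =>
    obtain rfl : i = c := hd i (by simp [Path.dirs])
    cases q with
    | nil => exact ⟨k, rfl⟩
    | cons j k' q =>
      obtain rfl : j = i := hd j (by simp [Path.dirs])
      exact absurd rfl (ne_of_steps k k')

end CubeData

namespace IntravergentDiagram

open LinkDiagram BurnsideDiagram CubeData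

variable (K : IntravergentDiagram)

theorem khovanov_isTwoFunctor (o : K.Orientation) (j : ℤ) : (K.khovanov o j).IsTwoFunctor := by
  obtain ⟨κ, -⟩ := K.isPlanar.exists_coloring
  exact (khovanovData_coherent κ (K.isPlanar.separatesLadybugs κ) o j).isTwoFunctor

theorem fixedPointFunctor_isTwoFunctor (o : K.Orientation) (j : ℤ) :
    (K.fixedPointFunctor o j).IsTwoFunctor :=
  ((K.tauAction o j).isTwoFunctor_fixed (K.khovanov_isTwoFunctor o j)).reindex K.fixedCube

/-- An equivariant generator, as an element of the fixed point functor. -/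
def fixedGen (o : K.Orientation) (j : ℤ) (x : K.quotient.KhGen)
    (hx : K.quantum o (K.liftGen x) = j) : (K.fixedPointFunctor o j).Gen :=
  ⟨⟨K.liftGen x, hx⟩, Subtype.ext (K.tauGen_liftGen x)⟩

theorem vert_fixedGen (o : K.Orientation) (j : ℤ) (x : K.quotient.KhGen)
    (hx : K.quantum o (K.liftGen x) = j) :
    (K.fixedPointFunctor o j).vert (K.fixedGen o j x hx) = x.state := by
  exact K.fixedCube.apply_symm_apply x.state

theorem exists_fixedGen {o : K.Orientation} {j : ℤ} (X : (K.fixedPointFunctor o j).Gen) :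
    ∃ x hx, K.fixedGen o j x hx = X := by
  obtain ⟨⟨X, hX⟩, ht⟩ := X
  obtain ⟨x, rfl⟩ := K.exists_liftGen (congrArg Subtype.val ht)
  exact ⟨x, hX, rfl⟩

/-- Edges away from the center of the fixed point functor. -/
theorem exists_edges {o : K.Orientation} {j : ℤ} {c : K.Vertex} (hc : c ≠ K.center)
    {x y : K.quotient.KhGen} {hx : K.quantum o (K.liftGen x) = j}
    {hy : K.quantum o (K.liftGen y) = j} (h : K.quotient.Drop (K.projVertex c) x.state y.state)
    (f : (K.khovanov o j).Hom ⟨K.liftGen x, hx⟩ ⟨K.liftGen y, hy⟩) :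
    ∃ (m : (K.khovanovData o j).Gen) (k₁ : (K.khovanovData o j).Step c ⟨K.liftGen x, hx⟩ m)
      (k₂ : (K.khovanovData o j).Step (K.tauVertex c) m ⟨K.liftGen y, hy⟩),
      f = (K.khovanov o j).comp (edge k₁) (edge k₂) := by
  obtain ⟨u, d₁, d₂⟩ := K.exists_drop_of_projVertex hc h
  have l₁ : u ≤ K.liftState x.state := CubeEdge.le d₁
  have l₂ : K.liftState y.state ≤ u := CubeEdge.le d₂
  obtain ⟨m, g₁, g₂, hm, rfl⟩ := (K.khovanov_isTwoFunctor o j).exists_factor f l₂ l₁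
  change m.1.state = u at hm
  subst hm
  obtain ⟨k₁, rfl⟩ := exists_edge (A := K.khovanovData o j) g₁ d₁
  obtain ⟨k₂, rfl⟩ := exists_edge (A := K.khovanovData o j) g₂ d₂
  exact ⟨m, k₁, k₂, rfl⟩

/-- Away from the center, an edge of the quotient cube is a face upstairs in the directions of a
crossing and its image. By `not_isLadybug_orbit` this is no ladybug, so there is only one possible
middle generator. -/
theorem subsingleton_hom_liftGen {o : K.Orientation} {j : ℤ} {c : K.Vertex} {x y : K.quotient.KhGen}
    (hx : K.quantum o (K.liftGen x) = j) (hy : K.quantum o (K.liftGen y) = j)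
    (h : K.quotient.Drop (K.projVertex c) x.state y.state) :
    Subsingleton ((K.khovanov o j).Hom ⟨K.liftGen x, hx⟩ ⟨K.liftGen y, hy⟩) := by
  constructor
  intro f f'
  by_cases hc : c = K.center
  · subst hc
    have h' := (K.drop_center_iff (v := x.state) (w := y.state)).2 h
    obtain ⟨k, rfl⟩ := exists_edge (A := K.khovanovData o j) f h'
    obtain ⟨k', rfl⟩ := exists_edge (A := K.khovanovData o j) f' h'
    rfl
  · obtain ⟨m, k₁, k₂, rfl⟩ := K.exists_edges hc h f
    obtain ⟨m', k₁', k₂', rfl⟩ := K.exists_edges hc h f'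
    obtain ⟨κ, -⟩ := K.isPlanar.exists_coloring
    obtain rfl : m = m' := Subtype.ext
      (eq_of_not_ladybug κ k₁ k₂ k₁' k₂' (K.not_isLadybug_orbit hc k₁.1 k₂.1))
    rfl

theorem arrow_eq_of_subsingleton {P : Type} [PartialOrder P] {F : BurnsideDiagram P}
    {x y x' y' : F.Gen} (f : F.Hom x y) (f' : F.Hom x' y') (hx : x' = x) (hy : y' = y)
    (h : Subsingleton (F.Hom x y)) : F.arrow f' = F.arrow f := by
  subst hx hy
  rw [h.elim f' f]

theorem subsingleton_fixed {o : K.Orientation} {j : ℤ} {c : K.quotient.Vertex} {x y : K.quotient.KhGen}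
    (hx : K.quantum o (K.liftGen x) = j) (hy : K.quantum o (K.liftGen y) = j)
    (h : K.quotient.Drop c x.state y.state) :
    Subsingleton ((K.fixedPointFunctor o j).Hom (K.fixedGen o j x hx) (K.fixedGen o j y hy)) := by
  obtain ⟨c, rfl⟩ := K.projVertex_surjective c
  have := K.subsingleton_hom_liftGen hx hy h
  exact ⟨fun f f' => Subtype.ext (this.elim f.1 f'.1)⟩

/-- An element that is alone between two fixed generators is itself fixed by the rotation. -/
theorem nonempty_fixed {o : K.Orientation} {j : ℤ} {c : K.quotient.Vertex} {x y : K.quotient.KhGen}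
    (hx : K.quantum o (K.liftGen x) = j) (hy : K.quantum o (K.liftGen y) = j)
    (h : K.quotient.Drop c x.state y.state)
    (f : (K.khovanov o j).Hom ⟨K.liftGen x, hx⟩ ⟨K.liftGen y, hy⟩) :
    Nonempty ((K.fixedPointFunctor o j).Hom (K.fixedGen o j x hx) (K.fixedGen o j y hy)) := by
  obtain ⟨c, rfl⟩ := K.projVertex_surjective c
  have := K.subsingleton_hom_liftGen hx hy h
  exact ⟨⟨f, arrow_eq_of_subsingleton _ _ (Subtype.ext (K.tauGen_liftGen x))
    (Subtype.ext (K.tauGen_liftGen y)) this⟩⟩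

end IntravergentDiagram
-- The fixed point functor is presented by the annular data
namespace IntravergentDiagram

open LinkDiagram BurnsideDiagram CubeData

variable (K : IntravergentDiagram)

/-- The bigradings that contribute to the quantum grading `j`. -/
abbrev Bigrading (o : K.Orientation) (o' : K.quotient.Orientation) (j : ℤ) : Type :=
  {p : ℤ × ℤ // 2 * p.1 + p.2 = j - 1 + 3 * K.shift o o'}

/-- The annular data in the bigradings that contribute to the quantum grading `j`. -/
noncomputable abbrev annularFamily (o : K.Orientation) (o' : K.quotient.Orientation) (j : ℤ)
    (p : K.Bigrading o o' j) : CubeData K.quotient.Vertex :=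
  K.quotient.annularData o' p.1.1 p.1.2

variable {o : K.Orientation} {o' : K.quotient.Orientation} {j : ℤ}

theorem quantum_annularFamily {p : K.Bigrading o o' j} (x : (K.annularFamily o o' j p).Gen) :
    K.quantum o (K.liftGen x.1) = j := by
  have := K.quantum_liftGen o o' x.1
  rw [x.2.1, x.2.2] at this
  have := p.2
  omega

/-- The bijection of generators. -/
noncomputable def genEquiv (o : K.Orientation) (o' : K.quotient.Orientation) (j : ℤ) :
    (Σ p, (K.annularFamily o o' j p).Gen) ≃ (K.fixedPointFunctor o j).Gen :=
  Equiv.ofBijective (fun x => K.fixedGen o j x.2.1 (K.quantum_annularFamily x.2)) (by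
    constructor
    · rintro ⟨⟨⟨q, k⟩, hp⟩, x, hq, hk⟩ ⟨⟨⟨q', k'⟩, hp'⟩, x', hq', hk'⟩ h
      dsimp only at hq hk hq' hk'
      subst hq hk hq' hk'
      have e : K.liftGen x = K.liftGen x' :=
        congrArg (fun X : (K.fixedPointFunctor o j).Gen => X.1.1) h
      obtain rfl := K.liftGen_injective e
      rfl
    · intro X
      obtain ⟨x, hx, rfl⟩ := K.exists_fixedGen X
      have := K.quantum_liftGen o o' x
      exact ⟨⟨⟨(K.quotient.quantum o' x, K.quotient.annular x), by dsimp only; omega⟩, x, rfl, rfl⟩,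
        rfl⟩)

theorem saddle_drop {p : K.Bigrading o o' j} {c : K.quotient.Vertex}
    {x y : (K.annularFamily o o' j p).Gen} (h : (K.annularFamily o o' j p).Step c x y) :
    K.quotient.Drop c x.1.state y.1.state := (K.annularFamily o o' j p).vert_of_step h

theorem ne_center_of_ne_point {c : K.Vertex} (h : K.projVertex c ≠ K.quotient.point) :
    c ≠ K.center := fun e => h (by rw [e]; rfl)

theorem annular_eq_of_hom {c : K.quotient.Vertex} {x y : K.quotient.KhGen}
    {hx : K.quantum o (K.liftGen x) = j} {hy : K.quantum o (K.liftGen y) = j}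
    (h : K.quotient.Drop c x.state y.state)
    (f : (K.khovanov o j).Hom ⟨K.liftGen x, hx⟩ ⟨K.liftGen y, hy⟩) :
    ((c ≠ K.quotient.point ∧ K.quotient.Saddle c x y ∧
      K.quotient.winding x = K.quotient.winding y) ∨
      (c = K.quotient.point ∧ K.quotient.AxisMove x y)) ∧
    K.quotient.annular y = K.quotient.annular x := by
  by_cases hc : c = K.quotient.point
  · subst hc
    obtain ⟨k, -⟩ := exists_edge (A := K.khovanovData o j) (c := K.center) f
      ((K.drop_center_iff (v := x.state) (w := y.state)).2 h)
    have hm := K.saddle_center_iff.1 k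
    refine ⟨Or.inr ⟨rfl, hm⟩, ?_⟩
    unfold AxisDiagram.annular
    -- The rise of the winding number makes up for the shift by one of the generators of `L₁`.
    rw [hm.2.2.2, if_pos h.1, if_neg (by rw [h.2.1]; decide)]
    ring
  · obtain ⟨c, rfl⟩ := K.projVertex_surjective c
    have hc' := K.ne_center_of_ne_point hc
    obtain ⟨m, k₁, k₂, -⟩ := K.exists_edges hc' h f
    obtain ⟨s, hw⟩ := (K.exists_middle_iff hc').1 ⟨m.1, k₁, k₂⟩
    refine ⟨Or.inl ⟨hc, s, hw⟩, ?_⟩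
    unfold AxisDiagram.annular
    rw [hw, h.2.2 _ (Ne.symm hc)]

theorem nonempty_hom_of_step {p : K.Bigrading o o' j} {c : K.quotient.Vertex}
    {x y : (K.annularFamily o o' j p).Gen} (h : (K.annularFamily o o' j p).Step c x y) :
    Nonempty ((K.khovanov o j).Hom ⟨K.liftGen x.1, K.quantum_annularFamily x⟩
      ⟨K.liftGen y.1, K.quantum_annularFamily y⟩) := by
  rcases h with ⟨hc, s, hw⟩ | ⟨rfl, hm⟩
  · obtain ⟨c, rfl⟩ := K.projVertex_surjective c
    obtain ⟨m, k₁, k₂⟩ := (K.exists_middle_iff (K.ne_center_of_ne_point hc)).2 ⟨s, hw⟩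
    obtain ⟨κ, -⟩ := K.isPlanar.exists_coloring
    have hq : K.quantum o m = j := (k₁.quantum_eq κ o).trans (K.quantum_annularFamily x)
    exact ⟨(K.khovanov o j).comp
      (edge (A := K.khovanovData o j) (x := ⟨K.liftGen x.1, K.quantum_annularFamily x⟩)
        (y := ⟨m, hq⟩) k₁)
      (edge (A := K.khovanovData o j) (y := ⟨K.liftGen y.1, K.quantum_annularFamily y⟩) k₂)⟩
  · exact ⟨edge (A := K.khovanovData o j) (i := K.center)
      (x := ⟨K.liftGen x.1, K.quantum_annularFamily x⟩)
      (y := ⟨K.liftGen y.1, K.quantum_annularFamily y⟩) (K.saddle_center_iff.2 hm)⟩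

theorem saddle_of_step {p : K.Bigrading o o' j} {c : K.quotient.Vertex}
    {x y : (K.annularFamily o o' j p).Gen} (h : (K.annularFamily o o' j p).Step c x y)
    (hc : c ≠ K.quotient.point) : K.quotient.Saddle c x.1 y.1 := by
  rcases h with h | h
  · exact h.2.1
  · exact absurd h.1 hc

/-- Four faces carry the composite in the directions `i`, `tau i`, `i'`, `tau i'` to one in the
directions `i'`, `tau i'`, `i`, `tau i`. By unique factorization the latter passes through `y'`, so
the equality of composites supplies the faces needed for `faceMatch_of_saddles`. -/
theorem faceMatch_of_comp_eq {i i' : K.Vertex} (hi : i ≠ K.center) (hi' : i' ≠ K.center)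
    {x y y' z : K.quotient.KhGen} {hx : K.quantum o (K.liftGen x) = j}
    {hy : K.quantum o (K.liftGen y) = j} {hy' : K.quantum o (K.liftGen y') = j}
    {hz : K.quantum o (K.liftGen z) = j}
    (f : (K.khovanov o j).Hom ⟨K.liftGen x, hx⟩ ⟨K.liftGen y, hy⟩)
    (g : (K.khovanov o j).Hom ⟨K.liftGen y, hy⟩ ⟨K.liftGen z, hz⟩)
    (f' : (K.khovanov o j).Hom ⟨K.liftGen x, hx⟩ ⟨K.liftGen y', hy'⟩)
    (g' : (K.khovanov o j).Hom ⟨K.liftGen y', hy'⟩ ⟨K.liftGen z, hz⟩)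
    (d₁ : K.quotient.Saddle (K.projVertex i) x y) (d₂ : K.quotient.Saddle (K.projVertex i') y z)
    (d₃ : K.quotient.Saddle (K.projVertex i') x y') (d₄ : K.quotient.Saddle (K.projVertex i) y' z)
    (h : (K.khovanov o j).comp f g = (K.khovanov o j).comp f' g') :
    K.quotient.FaceMatch (K.projVertex i) (K.projVertex i') x y y' z := by
  obtain ⟨κ, -⟩ := K.isPlanar.exists_coloring
  have hA := khovanovData_coherent κ (K.isPlanar.separatesLadybugs κ) o j
  obtain ⟨m, s₁, s₂, rfl⟩ := K.exists_edges hi d₁.1 f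
  obtain ⟨n, s₃, s₄, rfl⟩ := K.exists_edges hi' d₂.1 g
  obtain ⟨m₁, t₁, t₂, rfl⟩ := K.exists_edges hi' d₃.1 f'
  obtain ⟨m₂, t₃, t₄, rfl⟩ := K.exists_edges hi d₄.1 g'
  obtain ⟨p, s₅, s₆, f₂⟩ := hA.face_exists s₂ s₃
  obtain ⟨m', s₇, s₈, f₁⟩ := hA.face_exists s₁ s₅
  obtain ⟨q, s₉, s₁₀, f₃⟩ := hA.face_exists s₆ s₄
  obtain ⟨w, s₁₁, s₁₂, f₄⟩ := hA.face_exists s₈ s₉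
  have e := edge_comp_swap s₁ s₂ s₃ s₄ s₅ s₆ s₇ s₈ s₉ s₁₀ s₁₁ s₁₂ f₂ f₁ f₃ f₄
  have hv : w.1.state = K.liftState y'.state := by
    have l₁ : m'.1.state = m₁.1.state := drop_unique s₇.1 t₁.1
    have l₂ := s₁₁.1
    change K.Drop _ m'.1.state _ at l₂
    rw [l₁] at l₂
    exact drop_unique l₂ t₂.1
  have key := (K.khovanov_isTwoFunctor o j).factor_unique (y := w) (y' := ⟨K.liftGen y', hy'⟩) hv
    (e.symm.trans h)
  obtain rfl : w = ⟨K.liftGen y', hy'⟩ := congrArg Sigma.fst key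
  exact K.faceMatch_of_saddles (n := n.1) (q := q.1) d₁ d₂ d₃ d₄ s₁ s₂ s₃ s₅ f₂ s₇ s₈ f₁ s₁₁ s₁₂ f₄

/-- An axis move keeps all labels, so it determines its other end. Among crossings, only a ladybug
leaves a choice, and there the common partner `y'` fixes the label at the understrand of `c`. -/
theorem step_left_unique {p : K.Bigrading o o' j} {c d : K.quotient.Vertex}
    {x y₁ y₂ y' z : (K.annularFamily o o' j p).Gen}
    (h₁ : (K.annularFamily o o' j p).Step c x y₁) (k₁ : (K.annularFamily o o' j p).Step d y₁ z)
    (h₂ : (K.annularFamily o o' j p).Step c x y₂) (k₂ : (K.annularFamily o o' j p).Step d y₂ z)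
    (f₁ : (K.annularFamily o o' j p).Face c d x y₁ y' z)
    (f₂ : (K.annularFamily o o' j p).Face c d x y₂ y' z) : y₁ = y₂ := by
  have hs : y₁.1.state = y₂.1.state := drop_unique (K.saddle_drop h₁) (K.saddle_drop h₂)
  apply Subtype.ext
  by_cases hc : c = K.quotient.point
  · have m₁ := h₁.resolve_left (fun h => h.1 hc)
    have m₂ := h₂.resolve_left (fun h => h.1 hc)
    exact KhGen.ext hs (((K.quotient.axisMove_iff _ _).1 m₁.2).2.1.trans
      ((K.quotient.axisMove_iff _ _).1 m₂.2).2.1.symm)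
  by_cases hd : d = K.quotient.point
  · have m₁ := k₁.resolve_left (fun h => h.1 hd)
    have m₂ := k₂.resolve_left (fun h => h.1 hd)
    exact KhGen.ext hs (((K.quotient.axisMove_iff _ _).1 m₁.2).2.1.symm.trans
      ((K.quotient.axisMove_iff _ _).1 m₂.2).2.1)
  obtain ⟨κ₀, -⟩ := K.isPlanar.exists_coloring
  have κ : K.quotient.Coloring := K.quotientColoring κ₀
  by_contra hne
  have L : K.quotient.IsLadybug c d x.1.state z.1.state := by
    by_contra hl
    exact hne (eq_of_not_ladybug κ (K.saddle_of_step h₁ hc) (K.saddle_of_step k₁ hd)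
      (K.saddle_of_step h₂ hc) (K.saddle_of_step k₂ hd) hl)
  obtain ⟨a, ha, hao⟩ := exists_under c
  have ht := SaddleAt.two_targets hs ((K.saddle_of_step h₁ hc).at κ ha)
    ((K.saddle_of_step h₂ hc).at κ ha) hne
  exact ht.2.2.2.2 (congrArg Label.deg ((f₁ L a ha hao).trans (f₂ L a ha hao).symm))

/-- The fixed point functor is presented by the annular data. -/
noncomputable def presentation (o : K.Orientation) (o' : K.quotient.Orientation) (j : ℤ) :
    Presentation (K.annularFamily o o' j) (K.fixedPointFunctor o j) where
  gen := K.genEquiv o o' j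
  vert_gen p x := K.vert_fixedGen o j x.1 (K.quantum_annularFamily x)
  subsingleton c X Y h := by
    obtain ⟨x, hx, rfl⟩ := K.exists_fixedGen X
    obtain ⟨y, hy, rfl⟩ := K.exists_fixedGen Y
    rw [vert_fixedGen, vert_fixedGen] at h
    exact K.subsingleton_fixed hx hy h
  nonempty h := by
    obtain ⟨f⟩ := K.nonempty_hom_of_step h
    exact K.nonempty_fixed _ _ (K.saddle_drop h) f
  step {c p x Y} h f := by
    obtain ⟨y, hy, rfl⟩ := K.exists_fixedGen Y
    have hx := K.quantum_annularFamily x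
    have h' : K.quotient.Drop c x.1.state y.state := by
      rw [vert_fixedGen] at h
      have e : (K.fixedPointFunctor o j).vert (K.genEquiv o o' j ⟨p, x⟩) = x.1.state :=
        K.vert_fixedGen o j x.1 hx
      rw [e] at h
      exact h
    obtain ⟨hs, ha⟩ := K.annular_eq_of_hom (hx := hx) (hy := hy) h' f.1
    have ha' : K.quotient.annular y = p.1.2 := ha.trans x.2.2
    have hq : K.quotient.quantum o' y = p.1.1 := by
      have e₁ := K.quantum_liftGen o o' y
      have e₂ := p.2
      omega
    exact ⟨⟨y, hq, ha'⟩, rfl, hs⟩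
  face {c d p x y y' z} f g f' g' h₁ h₂ h₃ h₄ h := by
    by_cases hc : c = K.quotient.point
    · exact fun L => absurd hc ((K.quotient.isCrossing_iff c).1 L.1)
    by_cases hd : d = K.quotient.point
    · exact fun L => absurd hd ((K.quotient.isCrossing_iff d).1 L.2.1)
    obtain ⟨c, rfl⟩ := K.projVertex_surjective c
    obtain ⟨d, rfl⟩ := K.projVertex_surjective d
    exact K.faceMatch_of_comp_eq (K.ne_center_of_ne_point hc) (K.ne_center_of_ne_point hd)
      f.1 g.1 f'.1 g'.1 (K.saddle_of_step h₁ hc) (K.saddle_of_step h₂ hd) (K.saddle_of_step h₃ hd)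
      (K.saddle_of_step h₄ hc) (congrArg Subtype.val h)
  face_unique h₁ k₁ h₂ k₂ _ _ f₁ f₂ := K.step_left_unique h₁ k₁ h₂ k₂ f₁ f₂

end IntravergentDiagram
end Khovanov

/-! ### The lemma -/

theorem lemma4p2 (K : Khovanov.IntravergentDiagram) (o : K.Orientation)
    (o' : K.quotient.Orientation) (j : ℤ) :
    (K.khovanov o j).IsTwoFunctor ∧
    (∀ j' k : ℤ, (K.quotient.annularPair o' j' k).IsTwoFunctor) ∧
    Nonempty ((K.fixedPointFunctor o j).Iso
      (Khovanov.BurnsideDiagram.coprod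
        (fun p : {p : ℤ × ℤ // 2 * p.1 + p.2 = j - 1 + 3 * K.shift o o'} =>
          K.quotient.annularPair o' p.1.1 p.1.2))) := by
  have : Finite K.quotient.Vertex := by
    have := K.finite_dart
    have : Finite K.Vertex := Finite.of_surjective K.vtx Quot.mk_surjective
    exact Finite.of_surjective K.projVertex K.projVertex_surjective
  have iso : ∀ j, Nonempty ((K.fixedPointFunctor o j).Iso
      (Khovanov.BurnsideDiagram.coprod
        (fun p : {p : ℤ × ℤ // 2 * p.1 + p.2 = j - 1 + 3 * K.shift o o'} =>
          K.quotient.annularPair o' p.1.1 p.1.2))) := fun j => by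
    obtain ⟨e⟩ := (K.presentation o o' j).nonempty_iso (K.fixedPointFunctor_isTwoFunctor o j)
    exact e.exists_symm
  refine ⟨K.khovanov_isTwoFunctor o j, fun j' k => ?_, iso j⟩
  -- The quantum grading is chosen so that `(j', k)` is among its bigradings; the annular functor is
  -- then a summand of a 2-functor.
  obtain ⟨e⟩ := iso (2 * j' + k + 1 - 3 * K.shift o o')
  exact ((K.fixedPointFunctor_isTwoFunctor o _).of_iso e).of_coprod ⟨(j', k), by dsimp only; ring⟩
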